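/- Fix $\epsilon\in\{-1,1\}$. All functions are smooth and real-valued, equations are considered on domains (nonempty connected open sets) $\Omega$ of the $(t,x)$-plane, and an inequality $f\ne0$ means that $f$ vanishes nowhere on its domain. Consider the following classes of equations, where $A\neq0$, $B$ and $C$ are functions of $(t,x)$: $$\bar{\mathcal K}\colon u_t=Au_{xx}+Bu_x,\quad \mathcal K^\epsilon\colon u_t=\epsilon u_{xx}+Bu_x,\quad \bar{\mathcal F}\colon u_t=(Au)_{xx}+(Bu)_x,\quad \mathcal F^\epsilon\colon u_t=\epsilon u_{xx}+(Bu)_x,$$ and $\mathcal P^{\epsilon}_C\colon u_t=\epsilon u_{xx}+Cu$ (the class $\mathcal P^\epsilon$); the arbitrary-element tuple $\theta$ is $(A,B)$, $B$, $(A,B)$, $B$ and $C$, respectively. The equivalence group $G^\sim_{\mathcal L}$ of a class $\mathcal L$ consists of the point transformations of the variables $(t,x,u,\theta)$, over a domain $\Omega$ and onto those over a domain $\Omega'$, that are projectable to the space of $(t,x,u)$ and, together with their inverses, map every equation of $\mathcal L$ to an equation of $\mathcal L$. The essential point symmetry group $G^{\rm ess}_{\mathcal P^{\epsilon}_C}$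 consists of the point symmetries of $\mathcal P^{\epsilon}_C$ that are projections of elements of $G^\sim_{\mathcal P^\epsilon}$. The essential Lie invariance algebra $\mathfrak g^{\rm ess}_\theta$ of an equation consists of its Lie symmetries of the form $\tau(t,x)\partial_t+\xi(t,x)\partial_x+\zeta(t,x)u\partial_u$, and the essential kernel algebra $\mathfrak g^{\cap\rm ess}_{\mathcal L}$ is the intersection of the algebras $\mathfrak g^{\rm ess}_\theta$ of all the equations of $\mathcal L$ (on a given domain). Call a potential $C$ on a domain canonical if it is of one of the following forms there: 1. $C=C(x)$ does not depend on $t$, and it is neither of the form $\mu(x+\beta)^{-2}+\alpha(x+\beta)^2+\gamma$ with constants $\alpha,\beta,\gamma$ and $\mu\neq0$ nor of the form $\alpha x^2+\beta x+\gamma$ with constants $\alpha,\beta,\gamma$; 2. $C=\mu x^{-2}$ with a constant $\mu\ne0$ (on a domain with $x\ne0$); 3. $C=0$. Let $\mathcal L$ be one of the classes $\bar{\mathcal K}$, $\mathcal K^\epsilon$, $\bar{\mathcal F}$ and $\mathcal F^\epsilon$, and put $\breve\epsilon=1$ for $\mathcal L\in\{\bar{\mathcal K},\mathcal K^\epsilon\}$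 and $\breve\epsilon=-1$ for $\mathcal L\in\{\bar{\mathcal F},\mathcal F^\epsilon\}$. Then $\mathfrak g^{\cap\rm ess}_{\mathcal L}=\langle u\partial_u\rangle$, and a complete list of $G^\sim_{\mathcal L}$-inequivalent essential Lie-symmetry extensions of $\mathfrak g^{\cap\rm ess}_{\mathcal L}$ is given by the equations with $B=2\epsilon\breve\epsilon U_x/U$ (and with $A=\epsilon$ if $\mathcal L\in\{\bar{\mathcal K},\bar{\mathcal F}\}$), where $C$ runs through a complete set of canonical potentials that, within each of Cases 1 and 3 and within Case 2 for each $\mu$, are $G^\sim_{\mathcal P^\epsilon}$-inequivalent, and $U$ runs through a complete set of $G^{\rm ess}_{\mathcal P^{\epsilon\breve\epsilon}_{\breve\epsilon C}}$-inequivalent nonzero solutions of the equation $\mathcal P^{\epsilon\breve\epsilon}_{\breve\epsilon C}$, that is, $U_t=\epsilon\breve\epsilon U_{xx}+\breve\epsilon CU$ with $U\neq0$. In detail: for any choice of these complete sets, different pairs $(C,U)$ give $G^\sim_{\mathcal L}$-inequivalent equations of $\mathcal L$; each of these equations has an essential Lie invariance algebra wider than $\langle u\partial_u\rangle$; and for any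 equation of $\mathcal L$ on a domain $\Omega$ whose essential Lie invariance algebra is wider than $\langle u\partial_u\rangle$, every nonempty open subset of $\Omega$ contains a domain on which the equation is $G^\sim_{\mathcal L}$-equivalent to an equation from the list. Moreover, depending on $C$, basis vector fields, besides $u\partial_u$, of the essential Lie invariance algebras of the listed equations are the following: 1. $C=C(x)$: $\hat P^t_U$; 2. $C=\mu x^{-2}$: $\hat P^t_U$, $\hat D_U$, $\hat\Pi_U$; 3. $C=0$: $\hat P^t_U$, $\hat D_U$, $\hat\Pi_U$, $\hat P^x_U$, $\hat G_U$. Here $R:=\breve\epsilon U_t/U$ and $$\hat P^t_U:=\partial_t-Ru\partial_u,\qquad \hat D_U:=2t\partial_t+x\partial_x-\big(2tR+\tfrac12\epsilon xB\big)u\partial_u,$$ $$\hat\Pi_U:=4t^2\partial_t+4tx\partial_x-\big(\epsilon x^2+2t+4t^2R+2\epsilon txB\big)u\partial_u,$$ $$\hat P^x_U:=\partial_x-\tfrac12\epsilon Bu\partial_u,\qquad \hat G_U:=2t\partial_x-\epsilon(x+tB)u\partial_u.$$ -/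

import Mathlib

open scoped ContDiff Topology

namespace KolmogorovFokkerPlanck

noncomputable section

/-! ## Classes of linear evolution equations -/

/-- Points `(t, x)`. -/
abbrev TX := ℝ × ℝ

/-- Points `(t, x, u)`, written `((t, x), u)`. -/
abbrev TXU := TX × ℝ

/-- The partial derivative with respect to `t`. -/
def dt (f : TX → ℝ) (p : TX) : ℝ := fderiv ℝ f p (1, 0)

/-- The partial derivative with respect to `x`. -/
def dx (f : TX → ℝ) (p : TX) : ℝ := fderiv ℝ f p (0, 1)

/-- Domains of the independent variables: nonempty connected open sets. -/
def IsDom (Ω : Set TX) : Prop := IsOpen Ω ∧ IsConnected Ω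

/-- A class of equations `u_t = rhs θ u`, where the arbitrary-element tuple `θ` is a smooth function
of `(t, x)` that takes its values in `values`. Here `rhs θ` is a second-order differential operator
in `x`, linear in `u`. -/
structure EqClass (Θ : Type) where
  values : Set Θ
  rhs : (TX → Θ) → (TX → ℝ) → TX → ℝ

/-- The class of all Kolmogorov equations `u_t = A u_xx + B u_x`, `A ≠ 0`, with `θ = (A, B)`. -/
def Kbar : EqClass (ℝ × ℝ) where
  values := {v | v.1 ≠ 0}
  rhs θ u p := (θ p).1 * dx (dx u) p + (θ p).2 * dx u p

/-- The class of reduced Kolmogorov equations `u_t = ε u_xx + B u_x`, with `θ = B`. -/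
def Keps (ε : ℝ) : EqClass ℝ where
  values := Set.univ
  rhs B u p := ε * dx (dx u) p + B p * dx u p

/-- The class of all Fokker--Planck equations `u_t = (A u)_xx + (B u)_x`, `A ≠ 0`,
with `θ = (A, B)`. -/
def Fbar : EqClass (ℝ × ℝ) where
  values := {v | v.1 ≠ 0}
  rhs θ u p := dx (dx fun q => (θ q).1 * u q) p + dx (fun q => (θ q).2 * u q) p

/-- The class of reduced Fokker--Planck equations `u_t = ε u_xx + (B u)_x`, with `θ = B`. -/
def Feps (ε : ℝ) : EqClass ℝ where
  values := Set.univ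
  rhs B u p := ε * dx (dx u) p + dx (fun q => B q * u q) p

/-- The class of heat equations with potentials `u_t = ε u_xx + C u`, with `θ = C`. -/
def Peps (ε : ℝ) : EqClass ℝ where
  values := Set.univ
  rhs C u p := ε * dx (dx u) p + C p * u p

/-! ## Lie symmetries -/

/-- A vector field `τ ∂_t + ξ ∂_x + η ∂_u` on the space with coordinates `(t, x, u)`. -/
structure VField where
  τ : TXU → ℝ
  ξ : TXU → ℝ
  η : TXU → ℝ

/-- The characteristic `η - τ u_t - ξ u_x` of a vector field, evaluated on the function `u = f`. -/
def VField.char (Q : VField) (f : TX → ℝ) (p : TX) : ℝ :=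
  Q.η (p, f p) - Q.τ (p, f p) * dt f p - Q.ξ (p, f p) * dx f p

/-- Components `(τ, ξ, ζ)` of the vector field `τ ∂_t + ξ ∂_x + ζ u ∂_u`, where `τ`, `ξ` and `ζ` are
functions of `(t, x)`. -/
abbrev EssField := TX → ℝ × ℝ × ℝ

def EssField.toVField (Q : EssField) : VField where
  τ z := (Q z.1).1
  ξ z := (Q z.1).2.1
  η z := (Q z.1).2.2 * z.2

namespace EqClass

variable {Θ : Type} (L : EqClass Θ)

/-- The left-hand side `u_t - rhs θ u` of the equation with the value `θ`. -/
def lhs (θ : TX → Θ) (u : TX → ℝ) (p : TX) : ℝ := dt u p - L.rhs θ u p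

/-- The infinitesimal invariance criterion: the second prolongation of `Q` annihilates the
left-hand side `Δ = u_t - rhs θ u` on all the 2-jets (here, of smooth functions `f` at points `p`)
that satisfy `Δ = 0`.
Since `Δ` is linear in `u`, the prolongation formula reads
`(pr Q) Δ = Δ[Q.char] + τ D_t Δ + ξ D_x Δ`. -/
def IsLieSymmetry (Ω : Set TX) (θ : TX → Θ) (Q : VField) : Prop :=
  ContDiffOn ℝ ∞ Q.τ (Ω ×ˢ Set.univ) ∧ ContDiffOn ℝ ∞ Q.ξ (Ω ×ˢ Set.univ) ∧
  ContDiffOn ℝ ∞ Q.η (Ω ×ˢ Set.univ) ∧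
  ∀ p ∈ Ω, ∀ f : TX → ℝ, ContDiff ℝ ∞ f → L.lhs θ f p = 0 →
    L.lhs θ (Q.char f) p + Q.τ (p, f p) * dt (L.lhs θ f) p + Q.ξ (p, f p) * dx (L.lhs θ f) p = 0

/-- The essential Lie invariance algebra of the equation with the value `θ` on `Ω`: the Lie
symmetries of the form `τ(t,x) ∂_t + ξ(t,x) ∂_x + ζ(t,x) u ∂_u`. -/
def gEss (Ω : Set TX) (θ : TX → Θ) : Set EssField :=
  {Q | L.IsLieSymmetry Ω θ Q.toVField}

/-! ## Point transformations and equivalence -/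

variable [NormedAddCommGroup Θ] [NormedSpace ℝ Θ]

/-- The values of the arbitrary-element tuple on the domain `Ω`. -/
def S (Ω : Set TX) : Set (TX → Θ) :=
  {θ | ContDiffOn ℝ ∞ θ Ω ∧ ∀ p ∈ Ω, θ p ∈ L.values}

/-- The essential kernel algebra on the domain `Ω`. -/
def kernelEss (Ω : Set TX) : Set EssField := {Q | ∀ θ ∈ L.S Ω, Q ∈ L.gEss Ω θ}

end EqClass

/-- `e` is a diffeomorphism of `s` onto `s'`. -/
def IsDiffeo {E : Type} [NormedAddCommGroup E] [NormedSpace ℝ E] (e : PartialEquiv E E)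
    (s s' : Set E) : Prop :=
  e.source = s ∧ e.target = s' ∧ ContDiffOn ℝ ∞ e s ∧ ContDiffOn ℝ ∞ e.symm s'

namespace EqClass

variable {Θ : Type} (L : EqClass Θ)

/-- The point transformation `Φ`, defined over `Ω`, maps the equation with the value `θ` to the
equation with the value `θ'`: if `Φ` maps the graph of `f` near `p` to the graph of `f'`, then `f`
satisfies the first equation at `p` if and only if `f'` satisfies the second equation at the image
of `p`. -/
def MapsEq (Ω : Set TX) (Φ : PartialEquiv TXU TXU) (θ θ' : TX → Θ) : Prop :=
  ∀ p ∈ Ω, ∀ f f' : TX → ℝ, ContDiffAt ℝ ∞ f p → ContDiffAt ℝ ∞ f' (Φ (p, f p)).1 →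
    (∀ᶠ q in 𝓝 p, (Φ (q, f q)).2 = f' (Φ (q, f q)).1) →
    (L.lhs θ f p = 0 ↔ L.lhs θ' f' (Φ (p, f p)).1 = 0)

/-- The transformation `T` of the space with coordinates `((t, x, u), θ)` maps the value `θ` of the
arbitrary-element tuple on `Ω` to the value `θ'`. -/
def Pushes (Ω : Set TX) (T : PartialEquiv (TXU × Θ) (TXU × Θ)) (θ θ' : TX → Θ) : Prop :=
  ∀ p ∈ Ω, ∀ u : ℝ, (T ((p, u), θ p)).2 = θ' (T ((p, u), θ p)).1.1

variable [NormedAddCommGroup Θ] [NormedSpace ℝ Θ]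

/-- `T` is a (usual) equivalence transformation of the class `L` from `Ω` to `Ω'`, and `Φ` is its
projection to the space with coordinates `(t, x, u)`: `T` is a point transformation in the space
with coordinates `((t, x, u), θ)` that is projectable to the space with coordinates `(t, x, u)`, and
it maps any equation of the class to an equation of the class, as does its inverse. -/
def IsEquivTransf (Ω Ω' : Set TX) (Φ : PartialEquiv TXU TXU)
    (T : PartialEquiv (TXU × Θ) (TXU × Θ)) : Prop :=
  IsDiffeo Φ (Ω ×ˢ Set.univ) (Ω' ×ˢ Set.univ) ∧
  IsDiffeo T ((Ω ×ˢ Set.univ) ×ˢ L.values) ((Ω' ×ˢ Set.univ) ×ˢ L.values) ∧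
  (∀ z ∈ (Ω ×ˢ (Set.univ : Set ℝ)) ×ˢ L.values, (T z).1 = Φ z.1) ∧
  (∀ θ ∈ L.S Ω, ∃ θ' ∈ L.S Ω', Pushes Ω T θ θ' ∧ L.MapsEq Ω Φ θ θ') ∧
  (∀ θ' ∈ L.S Ω', ∃ θ ∈ L.S Ω, Pushes Ω T θ θ' ∧ L.MapsEq Ω Φ θ θ')

/-- Equivalence of equations, given on `Ω` and on `Ω'`, with respect to the equivalence group of the
class. -/
def GEquiv (Ω : Set TX) (θ : TX → Θ) (Ω' : Set TX) (θ' : TX → Θ) : Prop :=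
  ∃ Φ T, L.IsEquivTransf Ω Ω' Φ T ∧ Pushes Ω T θ θ'

/-- The essential point symmetry group of the equation with the value `θ` on `Ω`: the point
symmetries of this equation that are projections of equivalence transformations of the class. -/
def GEss (Ω : Set TX) (θ : TX → Θ) : Set (PartialEquiv TXU TXU) :=
  {Φ | L.MapsEq Ω Φ θ θ ∧ ∃ T, L.IsEquivTransf Ω Ω Φ T}

/-- Equivalence of functions on `Ω` with respect to the essential point symmetry group of the
equation with the value `θ`. -/
def GEssEquiv (Ω : Set TX) (θ : TX → Θ) (U U' : TX → ℝ) : Prop :=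
  ∃ Φ ∈ L.GEss Ω θ, ∀ p ∈ Ω, (Φ (p, U p)).2 = U' (Φ (p, U p)).1

/-- Nonvanishing smooth solutions on `Ω` of the equation with the value `θ`. -/
def nonzeroSol (Ω : Set TX) (θ : TX → Θ) : Set (TX → ℝ) :=
  {U | ContDiffOn ℝ ∞ U Ω ∧ (∀ p ∈ Ω, U p ≠ 0) ∧ ∀ p ∈ Ω, L.lhs θ U p = 0}

/-- `𝒰` is a complete set of nonvanishing solutions on `Ω` of the equation with the value `θ` that
are inequivalent with respect to its essential point symmetry group. -/
def IsSolSelection (Ω : Set TX) (θ : TX → Θ) (𝒰 : Set (TX → ℝ)) : Prop :=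
  𝒰 ⊆ L.nonzeroSol Ω θ ∧
  (∀ U ∈ L.nonzeroSol Ω θ, ∃ U' ∈ 𝒰, L.GEssEquiv Ω θ U U') ∧
  ∀ U ∈ 𝒰, ∀ U' ∈ 𝒰, L.GEssEquiv Ω θ U U' → U = U'

end EqClass

/-! ## Canonical potentials -/

/-- Labels of the canonical potentials: general `C = C(x)`, `C = μ x⁻²` and `C = 0`. -/
inductive PotCase where
  | general : PotCase
  | invSq (μ : ℝ) : PotCase
  | zero : PotCase

/-- `C` is, on `Ω`, a canonical potential with the given label. -/
def IsCanonical (Ω : Set TX) (C : TX → ℝ) : PotCase → Prop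
  | .general => (∃ c : ℝ → ℝ, ∀ p ∈ Ω, C p = c p.2) ∧
      (¬ ∃ α β γ μ : ℝ, μ ≠ 0 ∧
        ∀ p ∈ Ω, C p = μ / (p.2 + β) ^ 2 + α * (p.2 + β) ^ 2 + γ) ∧
      ¬ ∃ α β γ : ℝ, ∀ p ∈ Ω, C p = α * p.2 ^ 2 + β * p.2 + γ
  | .invSq μ => μ ≠ 0 ∧ ∀ p ∈ Ω, p.2 ≠ 0 ∧ C p = μ / p.2 ^ 2
  | .zero => ∀ p ∈ Ω, C p = 0

/-- Pairs of a domain and a potential on it. -/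
abbrev Pot := Set TX × (TX → ℝ)

/-- The canonical potentials with the label `k`, on arbitrary domains. -/
def canonicalPot (ε : ℝ) (k : PotCase) : Set Pot :=
  {P | IsDom P.1 ∧ P.2 ∈ (Peps ε).S P.1 ∧ IsCanonical P.1 P.2 k}

/-- `𝒞` is, for each label, a complete set of canonical potentials with this label that are
inequivalent with respect to the equivalence group of the class of heat equations with potentials.
(That different labels give inequivalent potentials is not built in.) -/
def IsPotSelection (ε : ℝ) (𝒞 : Set Pot) : Prop :=
  (∀ P ∈ 𝒞, ∃ k, P ∈ canonicalPot ε k) ∧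
  ∀ k, (∀ P ∈ canonicalPot ε k, ∃ P' ∈ 𝒞 ∩ canonicalPot ε k,
      (Peps ε).GEquiv P.1 P.2 P'.1 P'.2) ∧
    ∀ P ∈ 𝒞 ∩ canonicalPot ε k, ∀ P' ∈ 𝒞 ∩ canonicalPot ε k,
      (Peps ε).GEquiv P.1 P.2 P'.1 P'.2 → P = P'

/-! ## The classification -/

/-- The drift `B = 2 ε σ U_x / U`. -/
def drift (ε σ : ℝ) (U : TX → ℝ) (p : TX) : ℝ := 2 * ε * σ * dx U p / U p

/-- The function `R = σ U_t / U`. -/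
def Rfun (σ : ℝ) (U : TX → ℝ) (p : TX) : ℝ := σ * dt U p / U p

/-- `u ∂_u` -/
def fieldI : EssField := fun _ => (0, 0, 1)

/-- `∂_t - R u ∂_u` -/
def fieldPt (σ : ℝ) (U : TX → ℝ) : EssField := fun p => (1, 0, -Rfun σ U p)

/-- `2 t ∂_t + x ∂_x - (2 t R + ε x B / 2) u ∂_u` -/
def fieldD (ε σ : ℝ) (U : TX → ℝ) : EssField := fun p =>
  (2 * p.1, p.2, -(2 * p.1 * Rfun σ U p + 1 / 2 * ε * p.2 * drift ε σ U p))

/-- `4 t² ∂_t + 4 t x ∂_x - (ε x² + 2 t + 4 t² R + 2 ε t x B) u ∂_u` -/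
def fieldPi (ε σ : ℝ) (U : TX → ℝ) : EssField := fun p =>
  (4 * p.1 ^ 2, 4 * p.1 * p.2,
    -(ε * p.2 ^ 2 + 2 * p.1 + 4 * p.1 ^ 2 * Rfun σ U p + 2 * ε * p.1 * p.2 * drift ε σ U p))

/-- `∂_x - (ε B / 2) u ∂_u` -/
def fieldPx (ε σ : ℝ) (U : TX → ℝ) : EssField := fun p => (0, 1, -(1 / 2 * ε * drift ε σ U p))

/-- `2 t ∂_x - ε (x + t B) u ∂_u` -/
def fieldG (ε σ : ℝ) (U : TX → ℝ) : EssField := fun p =>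
  (0, 2 * p.1, -(ε * (p.2 + p.1 * drift ε σ U p)))

/-- The set `g` of vector fields over `Ω` is a vector space with basis `e`. -/
def IsBasisOn (Ω : Set TX) (g : Set EssField) {n : ℕ} (e : Fin n → EssField) : Prop :=
  (∀ Q : EssField, Q ∈ g ↔ ∃ a : Fin n → ℝ, ∀ p ∈ Ω, Q p = ∑ i, a i • e i p) ∧
  ∀ a : Fin n → ℝ, (∀ p ∈ Ω, ∑ i, a i • e i p = 0) → a = 0

/-- The basis of the essential Lie invariance algebra for the drift `2 ε σ U_x / U`, if the potential
has the label `k`. -/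
def HasListedBasis (ε σ : ℝ) (Ω : Set TX) (U : TX → ℝ) (g : Set EssField) : PotCase → Prop
  | .general => IsBasisOn Ω g ![fieldI, fieldPt σ U]
  | .invSq _ => IsBasisOn Ω g ![fieldI, fieldPt σ U, fieldD ε σ U, fieldPi ε σ U]
  | .zero => IsBasisOn Ω g
      ![fieldI, fieldPt σ U, fieldD ε σ U, fieldPi ε σ U, fieldPx ε σ U, fieldG ε σ U]

/-- The solution of the group classification problem for the class `L` up to the equivalence
generated by its equivalence group. Here `el B` is the value of the arbitrary-element tuple with the
drift `B` (and with `A = ε`, if `A` is in this tuple), and `σ = ±1`. -/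
structure GroupClassification {Θ : Type} [NormedAddCommGroup Θ] [NormedSpace ℝ Θ] (L : EqClass Θ)
    (ε σ : ℝ) (el : (TX → ℝ) → TX → Θ) : Prop where
  /-- The essential kernel algebra is spanned by `u ∂_u`. -/
  kernel : ∀ Ω, IsDom Ω → IsBasisOn Ω (L.kernelEss Ω) ![fieldI]
  /-- Each listed equation belongs to the class, admits an extension of the essential kernel algebra,
  and its essential Lie invariance algebra has the listed basis. -/
  bases : ∀ k, ∀ P ∈ canonicalPot ε k,
    ∀ U ∈ (Peps (ε * σ)).nonzeroSol P.1 (fun p => σ * P.2 p),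
      el (drift ε σ U) ∈ L.S P.1 ∧ L.kernelEss P.1 ⊂ L.gEss P.1 (el (drift ε σ U)) ∧
      HasListedBasis ε σ P.1 U (L.gEss P.1 (el (drift ε σ U))) k
  /-- Different listed equations are inequivalent. -/
  inequivalent : ∀ 𝒞, IsPotSelection ε 𝒞 → ∀ 𝒰 : Pot → Set (TX → ℝ),
    (∀ P ∈ 𝒞, (Peps (ε * σ)).IsSolSelection P.1 (fun p => σ * P.2 p) (𝒰 P)) →
    ∀ P ∈ 𝒞, ∀ U ∈ 𝒰 P, ∀ P' ∈ 𝒞, ∀ U' ∈ 𝒰 P',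
      L.GEquiv P.1 (el (drift ε σ U)) P'.1 (el (drift ε σ U')) → P = P' ∧ U = U'
  /-- Any equation that admits an extension of the essential kernel algebra is, locally around the
  points of a dense open subset of its domain, equivalent to a listed one. -/
  complete : ∀ 𝒞, IsPotSelection ε 𝒞 → ∀ 𝒰 : Pot → Set (TX → ℝ),
    (∀ P ∈ 𝒞, (Peps (ε * σ)).IsSolSelection P.1 (fun p => σ * P.2 p) (𝒰 P)) →
    ∀ Ω, IsDom Ω → ∀ θ ∈ L.S Ω, L.kernelEss Ω ⊂ L.gEss Ω θ →
      ∀ W ⊆ Ω, IsOpen W → W.Nonempty →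
        ∃ Ω' ⊆ W, IsDom Ω' ∧ ∃ P ∈ 𝒞, ∃ U ∈ 𝒰 P, L.GEquiv Ω' θ P.1 (el (drift ε σ U))

end

end KolmogorovFokkerPlanck

/-! Up to passing to the formal adjoint, every equation of the four classes is a Kolmogorov equation
u_t = a u_xx + b u_x. All work therefore takes place in the class `Lin` of equations u_t = a u_xx +
b u_x + c u, and the sign σ = -1 records that the adjoint is taken. A point transformation between
two linear equations necessarily has the form t̃ = T(t), x̃ = X(t,x), u = φ ũ, up to adding a
solution to ũ (`PointMap.exists_inter`). Its linear part is an `Inter`; the laws `rel_a`, `rel_b`,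
`rel_c` tell how the coefficients change. Such maps transport essential symmetries
(`Inter.pushField_mem`) and induce maps of the adjoint equations with the multiplier X_x/φ
(`Inter.adjoint`), which is why Kolmogorov and Fokker-Planck equations are handled together.

The hinge is the gauge u = U ũ by a nonvanishing solution U. It turns the heat equation with
potential satisfied by U into the Kolmogorov equation with drift 2εσ U_x/U, and it turns U into the
solution 1. Hence an equation of a class amounts, locally, to a heat equation with potential
together with a chosen solution U. A transformation acting on the whole class must keep the
zero-order coefficient equal to 0 for every constant drift, so its dualized multiplier is constant
(`KClass.inter_of_gEquiv`). Two gauged equations are then equivalent precisely when the potentials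
are equivalent by a map that carries U to U'. This gives `KClass.inequivalent` and, read backwards,
`KClass.complete`.

What remains is the classification of potentials. The determining equations for τ∂_t + ξ∂_x + ζu∂_u
close up to a holonomic linear system for (τ, τ_t, τ_tt, ξ, ξ_t), so a symmetry is determined by a
jet at one point (`IsSymm.eq_zero`); this yields the listed bases and unique continuation. A
symmetry that is not a multiple of u∂_u is straightened locally to a multiple of ∂_t or to ∂_x, up
to a term ζu∂_u, which makes the potential stationary or affine in x (`reduces_of_mem_gEss`).
Stationary potentials with further symmetries are found in `special_of_isSymm`, and a scaling of x
by a solution of y'' = -4εαy brings them to μ/x² or 0. Distinct labels are separated by the relative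
invariant C_xxx (`Inter.third_deriv`) and by the symmetry algebras. -/

namespace KolmogorovFokkerPlanck

noncomputable section

section

/-! ### Calculus of `dt` and `dx` -/

section Calculus

/-- Smoothness at a point. -/
abbrev Sm (f : TX → ℝ) (p : TX) : Prop := ContDiffAt ℝ ∞ f p

variable {f g : TX → ℝ} {p : TX}

theorem dt_congr (h : f =ᶠ[𝓝 p] g) : dt f p = dt g p := by
  unfold dt; rw [h.fderiv_eq]

theorem dx_congr (h : f =ᶠ[𝓝 p] g) : dx f p = dx g p := by
  unfold dx; rw [h.fderiv_eq]

theorem dt_eventuallyEq (h : f =ᶠ[𝓝 p] g) : dt f =ᶠ[𝓝 p] dt g :=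
  h.eventuallyEq_nhds.mono fun _ hq => dt_congr hq

theorem dx_eventuallyEq (h : f =ᶠ[𝓝 p] g) : dx f =ᶠ[𝓝 p] dx g :=
  h.eventuallyEq_nhds.mono fun _ hq => dx_congr hq

theorem eventuallyEq_of_eqOn {α : Type*} {f g : TX → α} {Ω : Set TX} (hΩ : IsOpen Ω) (hp : p ∈ Ω)
    (h : ∀ q ∈ Ω, f q = g q) : f =ᶠ[𝓝 p] g :=
  Filter.eventually_of_mem (hΩ.mem_nhds hp) h

theorem two_le_infty : (2 : WithTop ℕ∞) ≤ ∞ := 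
  WithTop.coe_le_coe.2 (le_top : (2 : ℕ∞) ≤ ⊤)

theorem Sm.dt (hf : Sm f p) : Sm (dt f) p :=
  (hf.fderiv_right (m := ∞) (by simp)).clm_apply contDiffAt_const

theorem Sm.dx (hf : Sm f p) : Sm (dx f) p :=
  (hf.fderiv_right (m := ∞) (by simp)).clm_apply contDiffAt_const

theorem Sm.mul (hf : Sm f p) (hg : Sm g p) : Sm (fun q => f q * g q) p := ContDiffAt.mul hf hg
theorem Sm.add (hf : Sm f p) (hg : Sm g p) : Sm (fun q => f q + g q) p := ContDiffAt.add hf hg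
theorem Sm.sub (hf : Sm f p) (hg : Sm g p) : Sm (fun q => f q - g q) p := ContDiffAt.sub hf hg
theorem Sm.inv (hf : Sm f p) (h : f p ≠ 0) : Sm (fun q => (f q)⁻¹) p := ContDiffAt.inv hf h
theorem Sm.div (hf : Sm f p) (hg : Sm g p) (h : g p ≠ 0) : Sm (fun q => f q / g q) p :=
  ContDiffAt.div hf hg h
theorem Sm.const (c : ℝ) : Sm (fun _ => c) p := contDiffAt_const

theorem Sm.diff (hf : Sm f p) : DifferentiableAt ℝ f p := hf.differentiableAt (by simp)

theorem Sm.eventually_diff (hf : Sm f p) : ∀ᶠ q in 𝓝 p, DifferentiableAt ℝ f q := by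
  have h1 : ContDiffAt ℝ 1 f p := hf.of_le (by exact_mod_cast le_top)
  exact (h1.eventually (by simp)).mono fun q hq => hq.differentiableAt (by simp)

theorem Sm.congr (hf : Sm f p) (h : g =ᶠ[𝓝 p] f) : Sm g p := ContDiffAt.congr_of_eventuallyEq hf h

theorem fderiv_apply_eq (p v : TX) : fderiv ℝ f p v = v.1 * dt f p + v.2 * dx f p := by
  have : v = v.1 • ((1, 0) : TX) + v.2 • ((0, 1) : TX) := by ext <;> simp
  rw [congrArg (fderiv ℝ f p) this, map_add, map_smul, map_smul]
  rfl

theorem dt_const (c : ℝ) : dt (fun _ => c) p = 0 := by simp [dt]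
theorem dx_const (c : ℝ) : dx (fun _ => c) p = 0 := by simp [dx]

theorem dt_fst : dt (fun q => q.1) p = 1 := by
  simp [dt, fderiv_fst]
theorem dx_fst : dx (fun q => q.1) p = 0 := by
  simp [dx, fderiv_fst]
theorem dt_snd : dt (fun q => q.2) p = 0 := by
  simp [dt, fderiv_snd]
theorem dx_snd : dx (fun q => q.2) p = 1 := by
  simp [dx, fderiv_snd]

theorem dt_add (hf : DifferentiableAt ℝ f p) (hg : DifferentiableAt ℝ g p) :
    dt (fun q => f q + g q) p = dt f p + dt g p := by
  unfold dt; rw [fderiv_fun_add hf hg]; rfl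
theorem dx_add (hf : DifferentiableAt ℝ f p) (hg : DifferentiableAt ℝ g p) :
    dx (fun q => f q + g q) p = dx f p + dx g p := by
  unfold dx; rw [fderiv_fun_add hf hg]; rfl
theorem dt_sub (hf : DifferentiableAt ℝ f p) (hg : DifferentiableAt ℝ g p) :
    dt (fun q => f q - g q) p = dt f p - dt g p := by
  unfold dt; rw [fderiv_fun_sub hf hg]; rfl
theorem dx_sub (hf : DifferentiableAt ℝ f p) (hg : DifferentiableAt ℝ g p) :
    dx (fun q => f q - g q) p = dx f p - dx g p := by
  unfold dx; rw [fderiv_fun_sub hf hg]; rfl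
theorem dt_mul (hf : DifferentiableAt ℝ f p) (hg : DifferentiableAt ℝ g p) :
    dt (fun q => f q * g q) p = f p * dt g p + dt f p * g p := by
  unfold dt; rw [fderiv_fun_mul hf hg]; simp [mul_comm]
theorem dx_mul (hf : DifferentiableAt ℝ f p) (hg : DifferentiableAt ℝ g p) :
    dx (fun q => f q * g q) p = f p * dx g p + dx f p * g p := by
  unfold dx; rw [fderiv_fun_mul hf hg]; simp [mul_comm]
theorem dt_const_mul (c : ℝ) (hf : DifferentiableAt ℝ f p) :
    dt (fun q => c * f q) p = c * dt f p := by
  rw [dt_mul (differentiableAt_const c) hf, dt_const]; ring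
theorem dx_const_mul (c : ℝ) (hf : DifferentiableAt ℝ f p) :
    dx (fun q => c * f q) p = c * dx f p := by
  rw [dx_mul (differentiableAt_const c) hf, dx_const]; ring

theorem dt_comp_real {F : ℝ → ℝ} (hF : DifferentiableAt ℝ F (f p)) (hf : DifferentiableAt ℝ f p) :
    dt (fun q => F (f q)) p = deriv F (f p) * dt f p := by
  have := (hF.hasDerivAt.comp_hasFDerivAt p hf.hasFDerivAt).fderiv
  unfold dt; rw [show (fun q => F (f q)) = F ∘ f from rfl, this]; simp
theorem dx_comp_real {F : ℝ → ℝ} (hF : DifferentiableAt ℝ F (f p)) (hf : DifferentiableAt ℝ f p) :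
    dx (fun q => F (f q)) p = deriv F (f p) * dx f p := by
  have := (hF.hasDerivAt.comp_hasFDerivAt p hf.hasFDerivAt).fderiv
  unfold dx; rw [show (fun q => F (f q)) = F ∘ f from rfl, this]; simp

theorem fderiv_pair {e : TX → TX} (he : DifferentiableAt ℝ e p) (v : TX) :
    fderiv ℝ e p v = (fderiv ℝ (fun q => (e q).1) p v, fderiv ℝ (fun q => (e q).2) p v) := by
  have h1 := he.hasFDerivAt.fst.fderiv
  have h2 := he.hasFDerivAt.snd.fderiv
  rw [h1, h2]; rfl

theorem dt_comp {h : TX → ℝ} {e : TX → TX} (hh : DifferentiableAt ℝ h (e p))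
    (he : DifferentiableAt ℝ e p) :
    dt (fun q => h (e q)) p =
      dt (fun q => (e q).1) p * dt h (e p) + dt (fun q => (e q).2) p * dx h (e p) := by
  have := (hh.hasFDerivAt.comp p he.hasFDerivAt).fderiv
  unfold dt; rw [show (fun q => h (e q)) = h ∘ e from rfl, this, ContinuousLinearMap.comp_apply,
    fderiv_apply_eq, fderiv_pair he]; rfl
theorem dx_comp {h : TX → ℝ} {e : TX → TX} (hh : DifferentiableAt ℝ h (e p))
    (he : DifferentiableAt ℝ e p) :
    dx (fun q => h (e q)) p =
      dx (fun q => (e q).1) p * dt h (e p) + dx (fun q => (e q).2) p * dx h (e p) := by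
  have := (hh.hasFDerivAt.comp p he.hasFDerivAt).fderiv
  unfold dx; rw [show (fun q => h (e q)) = h ∘ e from rfl, this, ContinuousLinearMap.comp_apply,
    fderiv_apply_eq, fderiv_pair he]; rfl

theorem eventually_dx_add (hf : Sm f p) (hg : Sm g p) :
    dx (fun q => f q + g q) =ᶠ[𝓝 p] fun q => dx f q + dx g q := by
  filter_upwards [hf.eventually_diff, hg.eventually_diff] with q h1 h2 using dx_add h1 h2
theorem eventually_dx_sub (hf : Sm f p) (hg : Sm g p) :
    dx (fun q => f q - g q) =ᶠ[𝓝 p] fun q => dx f q - dx g q := by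
  filter_upwards [hf.eventually_diff, hg.eventually_diff] with q h1 h2 using dx_sub h1 h2
theorem eventually_dx_mul (hf : Sm f p) (hg : Sm g p) :
    dx (fun q => f q * g q) =ᶠ[𝓝 p] fun q => f q * dx g q + dx f q * g q := by
  filter_upwards [hf.eventually_diff, hg.eventually_diff] with q h1 h2 using dx_mul h1 h2
theorem eventually_dt_dx_comm (hf : Sm f p) : ∀ᶠ q in 𝓝 p, dt (dx f) q = dx (dt f) q := by
  have h1 : ContDiffAt ℝ 2 f p := hf.of_le two_le_infty
  refine (h1.eventually (by simp)).mono fun q hq => ?_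
  have h2 : IsSymmSndFDerivAt ℝ f q := hq.isSymmSndFDerivAt (by simp)
  have hd : DifferentiableAt ℝ (fderiv ℝ f) q :=
    (hq.fderiv_right (m := 1) (by norm_num)).differentiableAt (by simp)
  have key : ∀ v w : TX, fderiv ℝ (fun q => fderiv ℝ f q v) q w = fderiv ℝ (fderiv ℝ f) q w v := by
    intro v w
    rw [fderiv_clm_apply hd (differentiableAt_const v)]
    simp
  unfold dt dx
  rw [key, key]
  exact h2 _ _

theorem dt_dx_comm (hf : Sm f p) : dt (dx f) p = dx (dt f) p :=
  (eventually_dt_dx_comm hf).self_of_nhds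

theorem dxx_add (hf : Sm f p) (hg : Sm g p) :
    dx (dx (fun q => f q + g q)) p = dx (dx f) p + dx (dx g) p := by
  rw [dx_congr (eventually_dx_add hf hg), dx_add hf.dx.diff hg.dx.diff]
theorem dxx_sub (hf : Sm f p) (hg : Sm g p) :
    dx (dx (fun q => f q - g q)) p = dx (dx f) p - dx (dx g) p := by
  rw [dx_congr (eventually_dx_sub hf hg), dx_sub hf.dx.diff hg.dx.diff]
theorem dxx_mul (hf : Sm f p) (hg : Sm g p) :
    dx (dx (fun q => f q * g q)) p =
      dx (dx f) p * g p + 2 * dx f p * dx g p + f p * dx (dx g) p := by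
  rw [dx_congr (eventually_dx_mul hf hg),
    dx_add (hf.diff.fun_mul hg.dx.diff) (hf.dx.diff.fun_mul hg.diff),
    dx_mul hf.diff hg.dx.diff, dx_mul hf.dx.diff hg.diff]
  ring
theorem dxx_const_mul (c : ℝ) (hf : Sm f p) :
    dx (dx (fun q => c * f q)) p = c * dx (dx f) p := by
  rw [dxx_mul contDiffAt_const hf, dx_const, dx_congr (g := fun _ => 0), dx_const]
  · ring
  · exact Filter.Eventually.of_forall fun q => dx_const c

end Calculus

/-! ### Quadratic test functions -/

/-- The quadratic function with the value `c` and with the given derivatives at `p`. -/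
def quad (p : TX) (c ct cx ctt ctx cxx : ℝ) (q : TX) : ℝ :=
  c + ct * (q.1 - p.1) + cx * (q.2 - p.2) + ctt / 2 * (q.1 - p.1) ^ 2 +
    ctx * ((q.1 - p.1) * (q.2 - p.2)) + cxx / 2 * (q.2 - p.2) ^ 2

section Quad
variable (p : TX) (c ct cx ctt ctx cxx : ℝ)

theorem quad_contDiff : ContDiff ℝ ∞ (quad p c ct cx ctt ctx cxx) := by
  unfold quad; fun_prop

theorem quad_self : quad p c ct cx ctt ctx cxx p = c := by simp [quad]

theorem hasFDerivAt_quad (q : TX) : HasFDerivAt (quad p c ct cx ctt ctx cxx)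
    ((ct + ctt * (q.1 - p.1) + ctx * (q.2 - p.2)) • ContinuousLinearMap.fst ℝ ℝ ℝ +
      (cx + ctx * (q.1 - p.1) + cxx * (q.2 - p.2)) • ContinuousLinearMap.snd ℝ ℝ ℝ) q := by
  have h1 : HasFDerivAt (fun q : TX => q.1 - p.1) (ContinuousLinearMap.fst ℝ ℝ ℝ) q :=
    hasFDerivAt_fst.sub_const _
  have h2 : HasFDerivAt (fun q : TX => q.2 - p.2) (ContinuousLinearMap.snd ℝ ℝ ℝ) q :=
    hasFDerivAt_snd.sub_const _
  have := (((((hasFDerivAt_const c q).add (h1.const_mul ct)).add (h2.const_mul cx)).add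
    ((h1.pow 2).const_mul (ctt / 2))).add ((h1.mul h2).const_mul ctx)).add
    ((h2.pow 2).const_mul (cxx / 2))
  refine HasFDerivAt.congr_fderiv (f := quad p c ct cx ctt ctx cxx) this ?_
  ext <;> simp <;> ring

theorem dt_quad : dt (quad p c ct cx ctt ctx cxx) = quad p ct ctt ctx 0 0 0 := by
  ext q; unfold dt; rw [(hasFDerivAt_quad p c ct cx ctt ctx cxx q).fderiv]; simp [quad]

theorem dx_quad : dx (quad p c ct cx ctt ctx cxx) = quad p cx ctx cxx 0 0 0 := by
  ext q; unfold dx; rw [(hasFDerivAt_quad p c ct cx ctt ctx cxx q).fderiv]; simp [quad]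

end Quad

end

section

/-! ### Linear second-order evolution equations and maps between them -/

/-- Coefficients `(a, b, c)` of the equation `u_t = a u_xx + b u_x + c u`. -/
abbrev Coef := TX → ℝ × ℝ × ℝ

/-- The class of all equations `u_t = a u_xx + b u_x + c u`, `a ≠ 0`. -/
def Lin : EqClass (ℝ × ℝ × ℝ) where
  values := {v | v.1 ≠ 0}
  rhs k u p := (k p).1 * dx (dx u) p + (k p).2.1 * dx u p + (k p).2.2 * u p

theorem Lin_lhs (k : Coef) (f : TX → ℝ) (p : TX) : Lin.lhs k f p =
    dt f p - ((k p).1 * dx (dx f) p + (k p).2.1 * dx f p + (k p).2.2 * f p) := rfl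

theorem Lin_lhs_congr {k : Coef} {f g : TX → ℝ} {p : TX} (h : f =ᶠ[𝓝 p] g) :
    Lin.lhs k f p = Lin.lhs k g p := by
  rw [Lin_lhs, Lin_lhs, dt_congr h, dx_congr h, dx_congr (dx_eventuallyEq h), h.eq_of_nhds]

theorem Lin_lhs_add {k : Coef} {f g : TX → ℝ} {p : TX} (hf : Sm f p) (hg : Sm g p) :
    Lin.lhs k (fun q => f q + g q) p = Lin.lhs k f p + Lin.lhs k g p := by
  simp only [Lin_lhs, dt_add hf.diff hg.diff, dx_add hf.diff hg.diff, dxx_add hf hg]; ring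

theorem Lin_lhs_sub {k : Coef} {f g : TX → ℝ} {p : TX} (hf : Sm f p) (hg : Sm g p) :
    Lin.lhs k (fun q => f q - g q) p = Lin.lhs k f p - Lin.lhs k g p := by
  simp only [Lin_lhs, dt_sub hf.diff hg.diff, dx_sub hf.diff hg.diff, dxx_sub hf hg]; ring

theorem Lin_lhs_const_mul {k : Coef} (c : ℝ) {f : TX → ℝ} {p : TX} (hf : Sm f p) :
    Lin.lhs k (fun q => c * f q) p = c * Lin.lhs k f p := by
  simp only [Lin_lhs, dt_const_mul c hf.diff, dx_const_mul c hf.diff, dxx_const_mul c hf]; ring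

/-- The function `quad` realizes an arbitrary 2-jet at `p`, so an operator identity valid for all
test functions can be read off one jet coordinate at a time. This is how the coefficient laws and
the determining equations are extracted. -/
theorem Lin_lhs_quad (k : Coef) (p : TX) (c ct cx ctt ctx cxx : ℝ) :
    Lin.lhs k (quad p c ct cx ctt ctx cxx) p =
      ct - ((k p).1 * cxx + (k p).2.1 * cx + (k p).2.2 * c) := by
  simp only [Lin_lhs, dt_quad, dx_quad, quad_self]

theorem sm_of_contDiffOn {f : TX → ℝ} {Ω : Set TX} {p : TX} (hf : ContDiffOn ℝ ∞ f Ω)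
    (hΩ : IsOpen Ω) (hp : p ∈ Ω) : Sm f p := hf.contDiffAt (hΩ.mem_nhds hp)

section Maps

variable {e : TX → TX} {p : TX}

theorem Sm.comp {h : TX → ℝ} (hh : Sm h (e p)) (he : ContDiffAt ℝ ∞ e p) :
    Sm (fun q => h (e q)) p := ContDiffAt.comp p hh he

theorem dxx_comp {h : TX → ℝ} (hh : Sm h (e p)) (he : ContDiffAt ℝ ∞ e p) :
    dx (dx (fun q => h (e q))) p =
      dx (dx fun q => (e q).1) p * dt h (e p) + dx (dx fun q => (e q).2) p * dx h (e p) +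
      dx (fun q => (e q).1) p ^ 2 * dt (dt h) (e p) +
      2 * (dx (fun q => (e q).1) p * dx (fun q => (e q).2) p) * dx (dt h) (e p) +
      dx (fun q => (e q).2) p ^ 2 * dx (dx h) (e p) := by
  have hT : Sm (fun q => (e q).1) p := contDiffAt_fst.comp p he
  have hX : Sm (fun q => (e q).2) p := contDiffAt_snd.comp p he
  have he1 : ∀ᶠ q in 𝓝 p, DifferentiableAt ℝ e q := by
    have h1 : ContDiffAt ℝ 1 e p := he.of_le (by exact_mod_cast le_top)
    exact (h1.eventually (by simp)).mono fun q hq => hq.differentiableAt (by simp)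
  have hh1 := he.continuousAt.eventually hh.eventually_diff
  have hev : dx (fun q => h (e q)) =ᶠ[𝓝 p] fun q =>
      dx (fun q => (e q).1) q * dt h (e q) + dx (fun q => (e q).2) q * dx h (e q) := by
    filter_upwards [he1, hh1] with q h1 h2 using dx_comp h2 h1
  have ht := hh.dt.comp he
  have hx := hh.dx.comp he
  rw [dx_congr hev, dx_add (hT.dx.mul ht).diff (hX.dx.mul hx).diff, dx_mul hT.dx.diff ht.diff,
    dx_mul hX.dx.diff hx.diff, dx_comp hh.dt.diff (he.differentiableAt (by simp)),
    dx_comp hh.dx.diff (he.differentiableAt (by simp)), dt_dx_comm hh]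
  ring

/-- The chain rule for an arbitrary map `e`, sorted by the derivatives of `h` at `e p`. If the
result is to be proportional to an operator of `Lin`, the coefficients of h_tt and h_tx must vanish
and the others must match. -/
theorem Lin_lhs_pullback (k : Coef) {φ h : TX → ℝ} (hφ : Sm φ p) (hh : Sm h (e p))
    (he : ContDiffAt ℝ ∞ e p) (T X : TX → ℝ) (hT : T = fun q => (e q).1)
    (hX : X = fun q => (e q).2) :
    Lin.lhs k (fun q => φ q * h (e q)) p =
      (φ p * dt T p - (k p).1 * (2 * dx φ p * dx T p + φ p * dx (dx T) p)
        - (k p).2.1 * φ p * dx T p) * dt h (e p)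
      - (k p).1 * φ p * dx T p ^ 2 * dt (dt h) (e p)
      - (k p).1 * φ p * (2 * (dx T p * dx X p)) * dx (dt h) (e p)
      - (k p).1 * φ p * dx X p ^ 2 * dx (dx h) (e p)
      - ((k p).1 * (2 * dx φ p * dx X p + φ p * dx (dx X) p) + (k p).2.1 * φ p * dx X p
        - φ p * dt X p) * dx h (e p)
      - ((k p).1 * dx (dx φ) p + (k p).2.1 * dx φ p + (k p).2.2 * φ p - dt φ p) * h (e p) := by
  subst hT hX
  have hd := he.differentiableAt (by simp)
  have hc := hh.comp he
  rw [Lin_lhs, dt_mul hφ.diff hc.diff, dx_mul hφ.diff hc.diff, dxx_mul hφ hc,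
    dt_comp hh.diff hd, dx_comp hh.diff hd, dxx_comp hh he]
  ring

end Maps

/-- The `t`-component of a map. -/
def tc (e : PartialEquiv TX TX) (q : TX) : ℝ := (e q).1
/-- The `x`-component of a map. -/
def xc (e : PartialEquiv TX TX) (q : TX) : ℝ := (e q).2

/-- The linear transformation `u = φ(t,x) ũ`, `(t̃, x̃) = e(t,x)` maps the equation with the
coefficients `k` on `Ω` to the equation with the coefficients `k'` on `Ω'`. -/
structure Inter (Ω Ω' : Set TX) (e : PartialEquiv TX TX) (φ : TX → ℝ) (k k' : Coef) : Prop where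
  op : IsOpen Ω
  op' : IsOpen Ω'
  diffeo : IsDiffeo e Ω Ω'
  smooth : ContDiffOn ℝ ∞ φ Ω
  ne : ∀ p ∈ Ω, φ p ≠ 0
  mem : k ∈ Lin.S Ω
  mem' : k' ∈ Lin.S Ω'
  -- Only proportionality at each point is required. That T depends on t alone and that the factor
  -- equals φ T_t are consequences (`dx_tc`, `maps'`).
  maps : ∀ p ∈ Ω, ∃ κ : ℝ, κ ≠ 0 ∧ ∀ h, Sm h (e p) →
    Lin.lhs k (fun q => φ q * h (e q)) p = κ * Lin.lhs k' h (e p)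

namespace IsDiffeo

variable {Ω Ω' : Set TX} {e : PartialEquiv TX TX}

theorem mapsTo (h : IsDiffeo e Ω Ω') {p : TX} (hp : p ∈ Ω) : e p ∈ Ω' := by
  rw [← h.2.1]; exact e.map_source (h.1 ▸ hp)
theorem symm_mapsTo (h : IsDiffeo e Ω Ω') {p : TX} (hp : p ∈ Ω') : e.symm p ∈ Ω := by
  rw [← h.1]; exact e.map_target (h.2.1 ▸ hp)
theorem left_inv (h : IsDiffeo e Ω Ω') {p : TX} (hp : p ∈ Ω) : e.symm (e p) = p :=
  e.left_inv (h.1 ▸ hp)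
theorem right_inv (h : IsDiffeo e Ω Ω') {p : TX} (hp : p ∈ Ω') : e (e.symm p) = p :=
  e.right_inv (h.2.1 ▸ hp)
theorem contDiffAt (h : IsDiffeo e Ω Ω') (hΩ : IsOpen Ω) {p : TX} (hp : p ∈ Ω) :
    ContDiffAt ℝ ∞ e p := h.2.2.1.contDiffAt (hΩ.mem_nhds hp)
theorem contDiffAt_symm (h : IsDiffeo e Ω Ω') (hΩ : IsOpen Ω') {p : TX} (hp : p ∈ Ω') :
    ContDiffAt ℝ ∞ e.symm p := h.2.2.2.contDiffAt (hΩ.mem_nhds hp)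
theorem symm (h : IsDiffeo e Ω Ω') : IsDiffeo e.symm Ω' Ω := ⟨h.2.1, h.1, h.2.2.2, h.2.2.1⟩

theorem trans {Ω'' : Set TX} {e' : PartialEquiv TX TX} (h : IsDiffeo e Ω Ω')
    (h' : IsDiffeo e' Ω' Ω'') : IsDiffeo (e.trans e') Ω Ω'' := by
  have hs : (e.trans e').source = Ω := by
    ext p; simp only [PartialEquiv.trans_source, Set.mem_inter_iff, Set.mem_preimage, h.1, h'.1]
    exact ⟨fun hp => hp.1, fun hp => ⟨hp, h.mapsTo hp⟩⟩
  have ht : (e.trans e').target = Ω'' := by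
    ext p; simp only [PartialEquiv.trans_target, Set.mem_inter_iff, Set.mem_preimage, h.2.1, h'.2.1]
    exact ⟨fun hp => hp.1, fun hp => ⟨hp, h'.symm_mapsTo hp⟩⟩
  refine ⟨hs, ht, ?_, ?_⟩
  · exact h'.2.2.1.comp h.2.2.1 fun p hp => h.mapsTo hp
  · exact h.2.2.2.comp h'.2.2.2 fun p hp => h'.symm_mapsTo hp

theorem sm_tc (h : IsDiffeo e Ω Ω') (hΩ : IsOpen Ω) {p : TX} (hp : p ∈ Ω) : Sm (tc e) p :=
  contDiffAt_fst.comp p (h.contDiffAt hΩ hp)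
theorem sm_xc (h : IsDiffeo e Ω Ω') (hΩ : IsOpen Ω) {p : TX} (hp : p ∈ Ω) : Sm (xc e) p :=
  contDiffAt_snd.comp p (h.contDiffAt hΩ hp)

end IsDiffeo

namespace Inter

variable {Ω Ω' Ω'' : Set TX} {e e' : PartialEquiv TX TX} {φ φ' : TX → ℝ} {k k' k'' : Coef} {p : TX}

theorem sm (h : Inter Ω Ω' e φ k k') (hp : p ∈ Ω) : Sm φ p := sm_of_contDiffOn h.smooth h.op hp
theorem sm_tc (h : Inter Ω Ω' e φ k k') (hp : p ∈ Ω) : Sm (tc e) p := h.diffeo.sm_tc h.op hp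
theorem sm_xc (h : Inter Ω Ω' e φ k k') (hp : p ∈ Ω) : Sm (xc e) p := h.diffeo.sm_xc h.op hp

/-- A test function whose only nonzero jet coordinate is h_tt is invisible to the target operator,
while the pulled-back operator sees a φ T_x² h_tt. -/
theorem dx_tc (h : Inter Ω Ω' e φ k k') (hp : p ∈ Ω) : dx (tc e) p = 0 := by
  obtain ⟨κ, -, H⟩ := h.maps p hp
  have := H _ (quad_contDiff (e p) 0 0 0 1 0 0).contDiffAt
  rw [Lin_lhs_pullback k (h.sm hp) (quad_contDiff (e p) 0 0 0 1 0 0).contDiffAt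
    (h.diffeo.contDiffAt h.op hp) _ _ rfl rfl, Lin_lhs_quad] at this
  simp only [dt_quad, dx_quad, quad_self] at this
  have h2 : (k p).1 * φ p * dx (tc e) p ^ 2 = 0 := by unfold tc; linarith
  simpa [h.ne p hp, show (k p).1 ≠ 0 from h.mem.2 p hp] using h2

theorem dxx_tc (h : Inter Ω Ω' e φ k k') (hp : p ∈ Ω) : dx (dx (tc e)) p = 0 := by
  rw [dx_congr (eventuallyEq_of_eqOn h.op hp fun q hq => h.dx_tc hq), dx_const]

theorem lhs_eq (H : Inter Ω Ω' e φ k k') (hp : p ∈ Ω) {h : TX → ℝ} (hh : Sm h (e p)) :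
    Lin.lhs k (fun q => φ q * h (e q)) p =
      φ p * dt (tc e) p * dt h (e p) - (k p).1 * φ p * dx (xc e) p ^ 2 * dx (dx h) (e p)
      - ((k p).1 * (2 * dx φ p * dx (xc e) p + φ p * dx (dx (xc e)) p)
        + (k p).2.1 * φ p * dx (xc e) p - φ p * dt (xc e) p) * dx h (e p)
      - ((k p).1 * dx (dx φ) p + (k p).2.1 * dx φ p + (k p).2.2 * φ p - dt φ p) * h (e p) := by
  rw [Lin_lhs_pullback k (H.sm hp) hh (H.diffeo.contDiffAt H.op hp) (tc e) (xc e) rfl rfl,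
    H.dx_tc hp, H.dxx_tc hp]
  ring

/-- The jet with h_t = 1 and all other coordinates zero identifies the factor of proportionality. -/
theorem maps' (H : Inter Ω Ω' e φ k k') (hp : p ∈ Ω) : φ p * dt (tc e) p ≠ 0 ∧ ∀ h, Sm h (e p) →
    Lin.lhs k (fun q => φ q * h (e q)) p = φ p * dt (tc e) p * Lin.lhs k' h (e p) := by
  obtain ⟨κ, hκ, h⟩ := H.maps p hp
  have := h _ (quad_contDiff (e p) 0 1 0 0 0 0).contDiffAt
  rw [H.lhs_eq hp (quad_contDiff (e p) 0 1 0 0 0 0).contDiffAt, Lin_lhs_quad] at this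
  simp only [dt_quad, dx_quad, quad_self] at this
  have h2 : κ = φ p * dt (tc e) p := by linarith
  exact h2 ▸ ⟨hκ, h⟩

theorem dt_tc_ne (h : Inter Ω Ω' e φ k k') (hp : p ∈ Ω) : dt (tc e) p ≠ 0 :=
  right_ne_zero_of_mul (h.maps' hp).1

/-- `rel_a`, `rel_b` and `rel_c` are the transformation laws of the three coefficients, read off the
jets where only h_xx, only h_x or only h is nonzero. -/
theorem rel_a (h : Inter Ω Ω' e φ k k') (hp : p ∈ Ω) :
    (k' (e p)).1 * dt (tc e) p = (k p).1 * dx (xc e) p ^ 2 := by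
  have := (h.maps' hp).2 _ (quad_contDiff (e p) 0 0 0 0 0 1).contDiffAt
  rw [h.lhs_eq hp (quad_contDiff (e p) 0 0 0 0 0 1).contDiffAt, Lin_lhs_quad] at this
  simp only [dt_quad, dx_quad, quad_self] at this
  apply mul_left_cancel₀ (h.ne p hp); linarith

theorem dx_xc_ne (h : Inter Ω Ω' e φ k k') (hp : p ∈ Ω) : dx (xc e) p ≠ 0 := by
  intro h0
  have := h.rel_a hp
  rw [h0] at this
  have h3 : (k' (e p)).1 ≠ 0 := h.mem'.2 _ (h.diffeo.mapsTo hp)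
  simp [h3, h.dt_tc_ne hp] at this

theorem rel_b (h : Inter Ω Ω' e φ k k') (hp : p ∈ Ω) :
    (k' (e p)).2.1 * φ p * dt (tc e) p =
      (k p).1 * (2 * dx φ p * dx (xc e) p + φ p * dx (dx (xc e)) p)
        + (k p).2.1 * φ p * dx (xc e) p - φ p * dt (xc e) p := by
  have := (h.maps' hp).2 _ (quad_contDiff (e p) 0 0 1 0 0 0).contDiffAt
  rw [h.lhs_eq hp (quad_contDiff (e p) 0 0 1 0 0 0).contDiffAt, Lin_lhs_quad] at this
  simp only [dt_quad, dx_quad, quad_self] at this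
  linarith

theorem rel_c (h : Inter Ω Ω' e φ k k') (hp : p ∈ Ω) :
    (k' (e p)).2.2 * φ p * dt (tc e) p =
      (k p).1 * dx (dx φ) p + (k p).2.1 * dx φ p + (k p).2.2 * φ p - dt φ p := by
  have := (h.maps' hp).2 _ (quad_contDiff (e p) 1 0 0 0 0 0).contDiffAt
  rw [h.lhs_eq hp (quad_contDiff (e p) 1 0 0 0 0 0).contDiffAt, Lin_lhs_quad] at this
  simp only [dt_quad, dx_quad, quad_self] at this
  linarith

/-- The converse of the coefficient laws: together with T_x = 0 and T_t ≠ 0 they suffice. Later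
transformations are constructed by checking these relations. -/
theorem of_rel (op : IsOpen Ω) (op' : IsOpen Ω') (diffeo : IsDiffeo e Ω Ω')
    (smooth : ContDiffOn ℝ ∞ φ Ω) (ne : ∀ p ∈ Ω, φ p ≠ 0) (mem : k ∈ Lin.S Ω)
    (mem' : k' ∈ Lin.S Ω') (hT : ∀ p ∈ Ω, dx (tc e) p = 0) (hT' : ∀ p ∈ Ω, dt (tc e) p ≠ 0)
    (ra : ∀ p ∈ Ω, (k' (e p)).1 * dt (tc e) p = (k p).1 * dx (xc e) p ^ 2)
    (rb : ∀ p ∈ Ω, (k' (e p)).2.1 * φ p * dt (tc e) p =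
      (k p).1 * (2 * dx φ p * dx (xc e) p + φ p * dx (dx (xc e)) p)
        + (k p).2.1 * φ p * dx (xc e) p - φ p * dt (xc e) p)
    (rc : ∀ p ∈ Ω, (k' (e p)).2.2 * φ p * dt (tc e) p =
      (k p).1 * dx (dx φ) p + (k p).2.1 * dx φ p + (k p).2.2 * φ p - dt φ p) :
    Inter Ω Ω' e φ k k' := by
  refine ⟨op, op', diffeo, smooth, ne, mem, mem', fun p hp =>
    ⟨φ p * dt (tc e) p, mul_ne_zero (ne p hp) (hT' p hp), fun h hh => ?_⟩⟩
  have h2 : dx (dx (tc e)) p = 0 := by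
    rw [dx_congr (eventuallyEq_of_eqOn op hp fun q hq => hT q hq), dx_const]
  rw [Lin_lhs_pullback k (sm_of_contDiffOn smooth op hp) hh (diffeo.contDiffAt op hp) (tc e) (xc e)
    rfl rfl, hT p hp, h2, Lin_lhs, ← rc p hp, ← rb p hp]
  linear_combination φ p * dx (dx h) (e p) * ra p hp

theorem symm (H : Inter Ω Ω' e φ k k') : Inter Ω' Ω e.symm (fun q => (φ (e.symm q))⁻¹) k' k := by
  refine ⟨H.op', H.op, H.diffeo.symm, ?_, fun p hp => inv_ne_zero (H.ne _ (H.diffeo.symm_mapsTo hp)),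
    H.mem', H.mem, fun p hp => ?_⟩
  · exact (H.smooth.comp H.diffeo.2.2.2 fun p hp => H.diffeo.symm_mapsTo hp).inv
      fun p hp => H.ne _ (H.diffeo.symm_mapsTo hp)
  · have hp' := H.diffeo.symm_mapsTo hp
    obtain ⟨κ, hκ, M⟩ := H.maps _ hp'
    refine ⟨κ⁻¹, inv_ne_zero hκ, fun h hh => ?_⟩
    have e1 := H.diffeo.right_inv hp
    rw [e1] at M
    have sm1 : Sm (fun q => (φ (e.symm q))⁻¹ * h (e.symm q)) p :=
      ContDiffAt.mul (((H.sm hp').comp (H.diffeo.contDiffAt_symm H.op' hp)).inv (H.ne _ hp'))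
        (hh.comp (H.diffeo.contDiffAt_symm H.op' hp))
    have := M _ sm1
    rw [Lin_lhs_congr (g := h)] at this
    · rw [this]; field_simp
    · refine eventuallyEq_of_eqOn H.op hp' fun q hq => ?_
      rw [H.diffeo.left_inv hq, mul_inv_cancel_left₀ (H.ne q hq)]

theorem trans (H : Inter Ω Ω' e φ k k') (H' : Inter Ω' Ω'' e' φ' k' k'') :
    Inter Ω Ω'' (e.trans e') (fun q => φ q * φ' (e q)) k k'' := by
  refine ⟨H.op, H'.op', H.diffeo.trans H'.diffeo, ?_, fun p hp => mul_ne_zero (H.ne p hp)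
    (H'.ne _ (H.diffeo.mapsTo hp)), H.mem, H'.mem', fun p hp => ?_⟩
  · exact H.smooth.mul (H'.smooth.comp H.diffeo.2.2.1 fun p hp => H.diffeo.mapsTo hp)
  · have hp' := H.diffeo.mapsTo hp
    obtain ⟨κ, hκ, M⟩ := H.maps _ hp
    obtain ⟨κ', hκ', M'⟩ := H'.maps _ hp'
    refine ⟨κ * κ', mul_ne_zero hκ hκ', fun h hh => ?_⟩
    have := M (fun q => φ' q * h (e' q)) ((H'.sm hp').mul
      (Sm.comp hh (H'.diffeo.contDiffAt H'.op hp')))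
    rw [M' h hh] at this
    rw [PartialEquiv.coe_trans, Function.comp_apply, mul_assoc, ← this]
    congr 1; ext q; simp [mul_assoc]

theorem congr (H : Inter Ω Ω' e φ k k') {k₁ k₁' : Coef} (hφ : ∀ p ∈ Ω, φ' p = φ p)
    (hk : ∀ p ∈ Ω, k₁ p = k p) (hk' : ∀ p ∈ Ω', k₁' p = k' p) : Inter Ω Ω' e φ' k₁ k₁' := by
  refine ⟨H.op, H.op', H.diffeo, H.smooth.congr hφ, fun p hp => hφ p hp ▸ H.ne p hp,
    ⟨H.mem.1.congr hk, fun p hp => hk p hp ▸ H.mem.2 p hp⟩,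
    ⟨H.mem'.1.congr hk', fun p hp => hk' p hp ▸ H.mem'.2 p hp⟩, fun p hp => ?_⟩
  obtain ⟨κ, hκ, M⟩ := H.maps _ hp
  refine ⟨κ, hκ, fun h hh => ?_⟩
  have h1 : Lin.lhs k₁ (fun q => φ' q * h (e q)) p = Lin.lhs k (fun q => φ q * h (e q)) p := by
    rw [Lin_lhs_congr (g := fun q => φ q * h (e q)), Lin_lhs, Lin_lhs, hk p hp]
    exact eventuallyEq_of_eqOn H.op hp fun q hq => by rw [hφ q hq]
  rw [h1, M h hh, Lin_lhs, Lin_lhs, hk' _ (H.diffeo.mapsTo hp)]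

theorem const_mul (H : Inter Ω Ω' e φ k k') {c : ℝ} (hc : c ≠ 0) :
    Inter Ω Ω' e (fun q => c * φ q) k k' := by
  refine ⟨H.op, H.op', H.diffeo, contDiffOn_const.mul H.smooth, fun p hp =>
    mul_ne_zero hc (H.ne p hp), H.mem, H.mem', fun p hp => ?_⟩
  obtain ⟨κ, hκ, M⟩ := H.maps _ hp
  refine ⟨c * κ, mul_ne_zero hc hκ, fun h hh => ?_⟩
  rw [mul_assoc, ← M h hh, ← Lin_lhs_const_mul c ((H.sm hp).mul
    (Sm.comp hh (H.diffeo.contDiffAt H.op hp)))]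
  simp only [mul_assoc]

/-- Restriction to the preimage of an open subset. -/
theorem restrict (H : Inter Ω Ω' e φ k k') {N' : Set TX} (hN : IsOpen N') (hsub : N' ⊆ Ω') :
    ∃ N ⊆ Ω, ∃ e₁ : PartialEquiv TX TX, N = e.symm '' N' ∧ (∀ p, e₁ p = e p) ∧
      Inter N N' e₁ φ k k' := by
  have hopN : IsOpen (Ω ∩ e ⁻¹' N') := H.diffeo.2.2.1.continuousOn.isOpen_inter_preimage H.op hN
  have himg : Ω ∩ e ⁻¹' N' = e.symm '' N' := by
    ext p; constructor
    · rintro ⟨hp, hp'⟩; exact ⟨e p, hp', H.diffeo.left_inv hp⟩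
    · rintro ⟨q, hq, rfl⟩
      exact ⟨H.diffeo.symm_mapsTo (hsub hq), by
        rw [Set.mem_preimage, H.diffeo.right_inv (hsub hq)]; exact hq⟩
  refine ⟨Ω ∩ e ⁻¹' N', Set.inter_subset_left, e.restr (e ⁻¹' N'), himg, fun p => rfl, ?_⟩
  have hd : IsDiffeo (e.restr (e ⁻¹' N')) (Ω ∩ e ⁻¹' N') N' := by
    refine ⟨by rw [PartialEquiv.restr_source, H.diffeo.1], ?_, ?_, ?_⟩
    · ext q
      simp only [PartialEquiv.restr_target, Set.mem_inter_iff, Set.mem_preimage, H.diffeo.2.1]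
      constructor
      · rintro ⟨h1, h2⟩; rwa [H.diffeo.right_inv h1] at h2
      · intro h; exact ⟨hsub h, by rwa [H.diffeo.right_inv (hsub h)]⟩
    · exact H.diffeo.2.2.1.mono Set.inter_subset_left
    · exact H.diffeo.2.2.2.mono hsub
  exact ⟨hopN, hN, hd, H.smooth.mono Set.inter_subset_left, fun p hp => H.ne p hp.1,
    ⟨H.mem.1.mono Set.inter_subset_left, fun p hp => H.mem.2 p hp.1⟩,
    ⟨H.mem'.1.mono hsub, fun p hp => H.mem'.2 p (hsub hp)⟩, fun p hp => H.maps p hp.1⟩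

end Inter

theorem isDiffeo_refl (Ω : Set TX) : IsDiffeo (PartialEquiv.ofSet Ω) Ω Ω :=
  ⟨rfl, rfl, contDiffOn_id, contDiffOn_id⟩

end

section

/-! ### Adjoint equations -/

/-- The coefficients of the equation that is adjoint to the one with the coefficients `k`. -/
def adj (k : Coef) : Coef := fun p =>
  -- The formal adjoint solved for v_t is v_t = -(a v)_xx + (b v)_x - c v; taking the adjoint of ∂_t
  -- changes all signs, hence the negated leading coefficient.
  (-(k p).1, (k p).2.1 - 2 * dx (fun q => (k q).1) p,
    dx (fun q => (k q).2.1) p - dx (dx fun q => (k q).1) p - (k p).2.2)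

section LinS

variable {k : Coef} {Ω : Set TX} {p : TX}

theorem sm_a (hk : k ∈ Lin.S Ω) (hΩ : IsOpen Ω) (hp : p ∈ Ω) : Sm (fun q => (k q).1) p :=
  sm_of_contDiffOn (contDiff_fst.comp_contDiffOn hk.1) hΩ hp
theorem sm_b (hk : k ∈ Lin.S Ω) (hΩ : IsOpen Ω) (hp : p ∈ Ω) : Sm (fun q => (k q).2.1) p :=
  sm_of_contDiffOn ((contDiff_fst.comp contDiff_snd).comp_contDiffOn hk.1) hΩ hp
theorem sm_c (hk : k ∈ Lin.S Ω) (hΩ : IsOpen Ω) (hp : p ∈ Ω) : Sm (fun q => (k q).2.2) p :=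
  sm_of_contDiffOn ((contDiff_snd.comp contDiff_snd).comp_contDiffOn hk.1) hΩ hp

theorem Lin_mem_S_of_sm {a b c : TX → ℝ}
    (ha : ∀ p ∈ Ω, Sm a p) (hb : ∀ p ∈ Ω, Sm b p) (hc : ∀ p ∈ Ω, Sm c p) (h0 : ∀ p ∈ Ω, a p ≠ 0) :
    (fun p => (a p, b p, c p)) ∈ Lin.S Ω :=
  ⟨fun p hp => (ContDiffAt.prodMk (ha p hp)
    (ContDiffAt.prodMk (hb p hp) (hc p hp))).contDiffWithinAt, h0⟩

theorem adj_mem (hk : k ∈ Lin.S Ω) (hΩ : IsOpen Ω) : adj k ∈ Lin.S Ω := by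
  apply Lin_mem_S_of_sm
  · exact fun p hp => ContDiffAt.neg (sm_a hk hΩ hp)
  · exact fun p hp => (sm_b hk hΩ hp).sub ((Sm.const 2).mul (sm_a hk hΩ hp).dx)
  · exact fun p hp => ((sm_b hk hΩ hp).dx.sub (sm_a hk hΩ hp).dx.dx).sub (sm_c hk hΩ hp)
  · exact fun p hp => neg_ne_zero.2 (hk.2 p hp)

theorem dx_neg {f : TX → ℝ} : dx (fun q => -f q) p = -dx f p := by
  unfold dx; rw [fderiv_fun_neg]; rfl

theorem adj_adj (hk : k ∈ Lin.S Ω) (hΩ : IsOpen Ω) (hp : p ∈ Ω) : adj (adj k) p = k p := by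
  have ha := sm_a hk hΩ hp
  have hb := sm_b hk hΩ hp
  have h1 : dx (fun q => -(k q).1) = fun q => -dx (fun q => (k q).1) q := by ext q; exact dx_neg
  simp only [adj]
  rw [h1, dx_neg, dx_sub hb.diff ((Sm.const 2).mul ha.dx).diff, dx_const_mul 2 ha.dx.diff]
  ext <;> (simp; try ring)

end LinS

namespace Inter

variable {Ω Ω' : Set TX} {e : PartialEquiv TX TX} {φ : TX → ℝ} {k k' : Coef} {p : TX}

theorem dx_comp (H : Inter Ω Ω' e φ k k') (hp : p ∈ Ω) {h : TX → ℝ} (hh : Sm h (e p)) :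
    dx (fun q => h (e q)) p = dx (xc e) p * dx h (e p) := by
  have := KolmogorovFokkerPlanck.dx_comp hh.diff
    ((H.diffeo.contDiffAt H.op hp).differentiableAt (by simp))
  rw [this, show (fun q => (e q).1) = tc e from rfl, H.dx_tc hp]
  show 0 * _ + dx (xc e) p * _ = _
  ring

theorem dx_dt_tc (H : Inter Ω Ω' e φ k k') (hp : p ∈ Ω) : dx (dt (tc e)) p = 0 := by
  rw [← dt_dx_comm (H.sm_tc hp), dt_congr (eventuallyEq_of_eqOn H.op hp fun q hq => H.dx_tc hq),
    dt_const]

theorem sm_comp (H : Inter Ω Ω' e φ k k') (hp : p ∈ Ω) {h : TX → ℝ} (hh : Sm h (e p)) :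
    Sm (fun q => h (e q)) p := Sm.comp hh (H.diffeo.contDiffAt H.op hp)

/-- The x-derivative of `rel_a` divided by X_x. It eliminates the x-derivative of the new leading
coefficient, which enters the adjoint equation. -/
theorem dx_leading_coeff (H : Inter Ω Ω' e φ k k') (hp : p ∈ Ω) :
    dx (fun q => (k' q).1) (e p) * dt (tc e) p =
      dx (fun q => (k q).1) p * dx (xc e) p + 2 * (k p).1 * dx (dx (xc e)) p := by
  have hX := (H.sm_xc hp).dx
  have ha := sm_a H.mem H.op hp
  have ha' := sm_a H.mem' H.op' (H.diffeo.mapsTo hp)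
  have h1 := dx_congr (eventuallyEq_of_eqOn (f := fun q => (k' (e q)).1 * dt (tc e) q)
    (g := fun q => (k q).1 * (dx (xc e) q * dx (xc e) q)) H.op hp fun q hq => by
      rw [H.rel_a hq]; ring)
  rw [dx_mul (H.sm_comp hp ha').diff (H.sm_tc hp).dt.diff, dx_mul ha.diff (hX.mul hX).diff,
    dx_mul hX.diff hX.diff, H.dx_dt_tc hp, H.dx_comp hp ha'] at h1
  apply mul_left_cancel₀ (H.dx_xc_ne hp)
  linear_combination h1

/-- A transformation of linear equations induces a transformation of the adjoint equations. -/
theorem adjoint (H : Inter Ω Ω' e φ k k') :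
    Inter Ω Ω' e (fun q => dx (xc e) q / φ q) (adj k) (adj k') := by
  have hsm : ∀ p ∈ Ω, Sm (fun q => dx (xc e) q / φ q) p := fun p hp =>
    (H.sm_xc hp).dx.div (H.sm hp) (H.ne p hp)
  refine of_rel H.op H.op' H.diffeo (fun p hp => (hsm p hp).contDiffWithinAt)
    (fun p hp => div_ne_zero (H.dx_xc_ne hp) (H.ne p hp)) (adj_mem H.mem H.op)
    (adj_mem H.mem' H.op') (fun p hp => H.dx_tc hp) (fun p hp => H.dt_tc_ne hp)
    (fun p hp => ?_) (fun p hp => ?_) (fun p hp => ?_)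
  all_goals
    have hX := H.sm_xc hp
    have hφ := H.sm hp
    have hψ := hsm p hp
    have ha := sm_a H.mem H.op hp
    have hb := sm_b H.mem H.op hp
    have ha' := sm_a H.mem' H.op' (H.diffeo.mapsTo hp)
    have hb' := sm_b H.mem' H.op' (H.diffeo.mapsTo hp)
    have ra := H.rel_a hp
    have rb := H.rel_b hp
    have rc := H.rel_c hp
    have ra1 := H.dx_leading_coeff hp
    have hne := H.ne p hp
    have hXne := H.dx_xc_ne hp
    simp only [adj]
    -- The dual multiplier ψ satisfies φψ = X_x, so that the density u v dx goes to ũ ṽ dx̃. Writing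
    -- X_x as ψφ makes all relations to be checked polynomial in the derivatives of φ and ψ.
    set ψ : TX → ℝ := fun q => dx (xc e) q / φ q with hψdef
    have hev : dx (xc e) =ᶠ[𝓝 p] fun q => ψ q * φ q :=
      eventuallyEq_of_eqOn H.op hp fun q hq => by
        simp only [hψdef]; rw [div_mul_cancel₀ _ (H.ne q hq)]
    have hψp : dx (xc e) p / φ p = ψ p := rfl
    try simp only [hψp]
    clear_value ψ
    have e0 := hev.eq_of_nhds
    have e1 := dx_congr hev
    rw [dx_mul hψ.diff hφ.diff] at e1
  · linear_combination -ra
  · apply mul_left_cancel₀ hne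
    rw [e1, e0] at rb ra1 ⊢
    linear_combination ψ p * rb - 2 * φ p * ψ p * ra1
  -- The zero-order coefficient of the adjoint contains b_x and a_xx, so its law needs the
  -- x-derivatives of `rel_b` and of `dx_leading_coeff`.
  · have e2 := dx_congr (dx_eventuallyEq hev)
    rw [dxx_mul hψ hφ] at e2
    have e3 := dt_congr hev
    rw [dt_mul hψ.diff hφ.diff, dt_dx_comm hX] at e3
    have ra2 := dx_congr (eventuallyEq_of_eqOn
      (f := fun q => dx (fun q => (k' q).1) (e q) * dt (tc e) q)
      (g := fun q => dx (fun q => (k q).1) q * dx (xc e) q + 2 * ((k q).1 * dx (dx (xc e)) q))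
      H.op hp fun q hq => by rw [H.dx_leading_coeff hq]; ring)
    rw [dx_mul (H.sm_comp hp ha'.dx).diff (H.sm_tc hp).dt.diff, H.dx_comp hp ha'.dx, H.dx_dt_tc hp,
      dx_add (ha.dx.mul hX.dx).diff ((Sm.const 2).mul (ha.mul hX.dx.dx)).diff,
      dx_const_mul 2 (ha.mul hX.dx.dx).diff, dx_mul ha.dx.diff hX.dx.diff,
      dx_mul ha.diff hX.dx.dx.diff] at ra2
    have rb2 := dx_congr (eventuallyEq_of_eqOn
      (f := fun q => (k' (e q)).2.1 * (φ q * dt (tc e) q))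
      (g := fun q => (k q).1 * (2 * (dx φ q * dx (xc e) q) + φ q * dx (dx (xc e)) q)
        + (k q).2.1 * (φ q * dx (xc e) q) - φ q * dt (xc e) q)
      H.op hp fun q hq => by linear_combination H.rel_b hq)
    have s1 := (Sm.const 2).mul (hφ.dx.mul hX.dx)
    have s2 := hφ.mul hX.dx.dx
    rw [dx_mul (H.sm_comp hp hb').diff (hφ.mul (H.sm_tc hp).dt).diff, H.dx_comp hp hb',
      dx_mul hφ.diff (H.sm_tc hp).dt.diff, H.dx_dt_tc hp,
      dx_sub ((ha.mul (s1.add s2)).add (hb.mul (hφ.mul hX.dx))).diff (hφ.mul hX.dt).diff,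
      dx_add (ha.mul (s1.add s2)).diff (hb.mul (hφ.mul hX.dx)).diff,
      dx_mul ha.diff (s1.add s2).diff, dx_add s1.diff s2.diff,
      dx_const_mul 2 (hφ.dx.mul hX.dx).diff, dx_mul hφ.dx.diff hX.dx.diff,
      dx_mul hφ.diff hX.dx.dx.diff, dx_mul hb.diff (hφ.mul hX.dx).diff,
      dx_mul hφ.diff hX.dx.diff, dx_mul hφ.diff hX.dt.diff] at rb2
    apply mul_left_cancel₀ (mul_ne_zero (mul_ne_zero hne hne) hXne)
    rw [e2, e1, e0] at ra2
    rw [e3, e2, e1, e0] at rb2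
    rw [e1, e0] at rb
    rw [e0]
    linear_combination φ p * ψ p * rb2 - ψ p * dx φ p * rb - ψ p * φ p ^ 2 * ra2
      - ψ p * φ p * ψ p * φ p * rc

end Inter

end

section

/-! ### Essential Lie symmetries -/

/-- A function that is smooth near a point coincides near this point with a globally smooth one. -/
theorem exists_contDiff_eventuallyEq {E : Type*} [NormedAddCommGroup E] [NormedSpace ℝ E]
    [HasContDiffBump E] [FiniteDimensional ℝ E] {F : Type*} [NormedAddCommGroup F] [NormedSpace ℝ F]
    {f : E → F} {Ω : Set E} {p : E} (hf : ContDiffOn ℝ ∞ f Ω) (hΩ : IsOpen Ω) (hp : p ∈ Ω) :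
    ∃ g : E → F, ContDiff ℝ ∞ g ∧ g =ᶠ[𝓝 p] f := by
  obtain ⟨r, hr, hsub⟩ := Metric.isOpen_iff.1 hΩ p hp
  let b : ContDiffBump p := ⟨r / 4, r / 2, by positivity, by linarith⟩
  refine ⟨fun q => b q • f q, contDiff_iff_contDiffAt.2 fun q => ?_, ?_⟩
  · by_cases hq : q ∈ Ω
    · exact b.contDiffAt.smul (hf.contDiffAt (hΩ.mem_nhds hq))
    · have hq' : q ∉ tsupport b := by
        rw [b.tsupport_eq]
        intro h
        refine hq (hsub (Metric.mem_ball.2 (lt_of_le_of_lt (Metric.mem_closedBall.1 h) ?_)))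
        show r / 2 < r
        linarith
      have h0 : (fun q => b q • f q) =ᶠ[𝓝 q] fun _ => 0 := by
        filter_upwards [(notMem_tsupport_iff_eventuallyEq.1 hq')] with x hx
        simp [hx]
      exact contDiffAt_const.congr_of_eventuallyEq h0
  · filter_upwards [b.eventuallyEq_one] with q hq
    simp [hq]

variable {Ω Ω' : Set TX} {p : TX}

/-- The characteristic of an essential vector field. -/
theorem toVField_char (Q : EssField) (f : TX → ℝ) : Q.toVField.char f =
    fun q => (Q q).2.2 * f q - (Q q).1 * dt f q - (Q q).2.1 * dx f q := rfl

theorem mem_gEss_iff {Θ : Type} {L : EqClass Θ} {θ : TX → Θ} {Q : EssField} :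
    Q ∈ L.gEss Ω θ ↔ ContDiffOn ℝ ∞ Q Ω ∧ ∀ p ∈ Ω, ∀ f : TX → ℝ, ContDiff ℝ ∞ f →
      L.lhs θ f p = 0 → L.lhs θ (Q.toVField.char f) p + (Q p).1 * dt (L.lhs θ f) p +
        (Q p).2.1 * dx (L.lhs θ f) p = 0 := by
  have hm : Set.MapsTo (fun q : TX => (q, (1 : ℝ))) Ω (Ω ×ˢ Set.univ) := fun q hq => ⟨hq, trivial⟩
  have hc : ContDiffOn ℝ ∞ (fun q : TX => (q, (1 : ℝ))) Ω := contDiffOn_id.prodMk contDiffOn_const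
  constructor
  · rintro ⟨h1, h2, h3, h4⟩
    refine ⟨?_, h4⟩
    have h1' : ContDiffOn ℝ ∞ (fun q => (Q q).1) Ω := h1.comp hc hm
    have h2' : ContDiffOn ℝ ∞ (fun q => (Q q).2.1) Ω := h2.comp hc hm
    have h3' : ContDiffOn ℝ ∞ (fun q => (Q q).2.2 * 1) Ω := h3.comp hc hm
    simp only [mul_one] at h3'
    exact h1'.prodMk (h2'.prodMk h3')
  · rintro ⟨h1, h4⟩
    have hQ : ContDiffOn ℝ ∞ (fun z : TXU => Q z.1) (Ω ×ˢ Set.univ) :=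
      h1.comp contDiffOn_fst fun z hz => hz.1
    refine ⟨contDiff_fst.comp_contDiffOn hQ,
      (contDiff_fst.comp contDiff_snd).comp_contDiffOn hQ, ?_, h4⟩
    exact ((contDiff_snd.comp contDiff_snd).comp_contDiffOn hQ).mul contDiffOn_snd

section EssSm
variable {Q : EssField}

theorem sm_τ (hQ : ContDiffOn ℝ ∞ Q Ω) (hΩ : IsOpen Ω) (hp : p ∈ Ω) : Sm (fun q => (Q q).1) p :=
  sm_of_contDiffOn (contDiff_fst.comp_contDiffOn hQ) hΩ hp
theorem sm_ξ (hQ : ContDiffOn ℝ ∞ Q Ω) (hΩ : IsOpen Ω) (hp : p ∈ Ω) : Sm (fun q => (Q q).2.1) p :=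
  sm_of_contDiffOn ((contDiff_fst.comp contDiff_snd).comp_contDiffOn hQ) hΩ hp
theorem sm_ζ (hQ : ContDiffOn ℝ ∞ Q Ω) (hΩ : IsOpen Ω) (hp : p ∈ Ω) : Sm (fun q => (Q q).2.2) p :=
  sm_of_contDiffOn ((contDiff_snd.comp contDiff_snd).comp_contDiffOn hQ) hΩ hp

end EssSm

theorem Lin_lhs_sm {k : Coef} (hk : k ∈ Lin.S Ω) (hΩ : IsOpen Ω) (hp : p ∈ Ω) {f : TX → ℝ}
    (hf : Sm f p) : Sm (Lin.lhs k f) p :=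
  hf.dt.sub ((((sm_a hk hΩ hp).mul hf.dx.dx).add ((sm_b hk hΩ hp).mul hf.dx)).add
    ((sm_c hk hΩ hp).mul hf))

/-- The image of an essential vector field under the transformation `u = φ ũ`, `(t̃, x̃) = e(t, x)`. -/
def pushField (e : PartialEquiv TX TX) (φ : TX → ℝ) (Q : EssField) : EssField := fun p' =>
  let p := e.symm p'
  ((Q p).1 * dt (tc e) p, (Q p).1 * dt (xc e) p + (Q p).2.1 * dx (xc e) p,
    (Q p).2.2 - ((Q p).1 * dt φ p + (Q p).2.1 * dx φ p) / φ p)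

theorem Inter.dt_comp {e : PartialEquiv TX TX} {φ : TX → ℝ} {k k' : Coef}
    (H : Inter Ω Ω' e φ k k') (hp : p ∈ Ω) {h : TX → ℝ} (hh : Sm h (e p)) :
    dt (fun q => h (e q)) p = dt (tc e) p * dt h (e p) + dt (xc e) p * dx h (e p) :=
  KolmogorovFokkerPlanck.dt_comp hh.diff ((H.diffeo.contDiffAt H.op hp).differentiableAt (by simp))

/-- The invariance criterion is natural: a solution jet of `h` pulls back to a solution jet of φ ·
(h ∘ e), the characteristics are related by the same pullback, and the factor φ T_t does not matter
where the equation holds. -/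
theorem Inter.pushField_mem {e : PartialEquiv TX TX} {φ : TX → ℝ} {k k' : Coef}
    (H : Inter Ω Ω' e φ k k') {Q : EssField} (hQ : Q ∈ Lin.gEss Ω k) :
    pushField e φ Q ∈ Lin.gEss Ω' k' := by
  rw [mem_gEss_iff] at hQ ⊢
  obtain ⟨hs, hQ⟩ := hQ
  have smτ := fun q (hq : q ∈ Ω) => sm_τ hs H.op hq
  have smξ := fun q (hq : q ∈ Ω) => sm_ξ hs H.op hq
  have smζ := fun q (hq : q ∈ Ω) => sm_ζ hs H.op hq
  have smQ' : ContDiffOn ℝ ∞ (pushField e φ Q) Ω' := by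
    have : ContDiffOn ℝ ∞ (fun p => ((Q p).1 * dt (tc e) p,
        (Q p).1 * dt (xc e) p + (Q p).2.1 * dx (xc e) p,
        (Q p).2.2 - ((Q p).1 * dt φ p + (Q p).2.1 * dx φ p) / φ p)) Ω := by
      intro q hq
      refine ContDiffAt.contDiffWithinAt ?_
      refine ContDiffAt.prodMk ((smτ q hq).mul (H.sm_tc hq).dt) (ContDiffAt.prodMk
        (((smτ q hq).mul (H.sm_xc hq).dt).add ((smξ q hq).mul (H.sm_xc hq).dx)) ?_)
      exact (smζ q hq).sub ((((smτ q hq).mul (H.sm hq).dt).add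
        ((smξ q hq).mul (H.sm hq).dx)).div (H.sm hq) (H.ne q hq))
    exact this.comp H.diffeo.2.2.2 fun q hq => H.diffeo.symm_mapsTo hq
  refine ⟨smQ', fun p' hp' h hh h0 => ?_⟩
  obtain ⟨p, hp, rfl⟩ : ∃ p ∈ Ω, e p = p' :=
    ⟨e.symm p', H.diffeo.symm_mapsTo hp', H.diffeo.right_inv hp'⟩
  have hhs : ∀ q, Sm h q := fun q => hh.contDiffAt
  -- The criterion is tested on globally smooth functions, whereas the pullback is smooth only on Ω;
  -- a cutoff leaves its germ at `p` unchanged.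
  obtain ⟨f, hf, hfe⟩ := exists_contDiff_eventuallyEq (f := fun q => φ q * h (e q)) (p := p)
    (H.smooth.mul (hh.comp_contDiffOn H.diffeo.2.2.1)) H.op hp
  obtain ⟨hne, hM⟩ := H.maps' hp
  have hG := Lin_lhs_sm H.mem' H.op' (H.diffeo.mapsTo hp) (hhs (e p))
  have hev : Lin.lhs k f =ᶠ[𝓝 p] fun q => φ q * dt (tc e) q * Lin.lhs k' h (e q) := by
    filter_upwards [hfe.eventuallyEq_nhds, H.op.mem_nhds hp] with q hq hqΩ
    rw [Lin_lhs_congr hq, (H.maps' hqΩ).2 h (hhs _)]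
  have key := hQ p hp f hf (by rw [hev.eq_of_nhds, h0, mul_zero])
  have sφ := (H.sm hp).mul (H.sm_tc hp).dt
  rw [dt_congr hev, dx_congr hev, dt_mul sφ.diff (H.sm_comp hp hG).diff,
    dx_mul sφ.diff (H.sm_comp hp hG).diff, H.dt_comp hp hG, H.dx_comp hp hG, h0] at key
  -- The characteristic of Q on φ · (h ∘ e) is φ times the characteristic of the pushed field on h,
  -- evaluated at `e`.
  have hch : Q.toVField.char f =ᶠ[𝓝 p]
      fun q => φ q * (pushField e φ Q).toVField.char h (e q) := by
    filter_upwards [hfe.eventuallyEq_nhds, H.op.mem_nhds hp] with q hq hqΩ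
    simp only [toVField_char, pushField, H.diffeo.left_inv hqΩ]
    rw [dt_congr hq, dx_congr hq, hq.eq_of_nhds,
      dt_mul (H.sm hqΩ).diff (H.sm_comp hqΩ (hhs _)).diff,
      dx_mul (H.sm hqΩ).diff (H.sm_comp hqΩ (hhs _)).diff, H.dt_comp hqΩ (hhs _),
      H.dx_comp hqΩ (hhs _)]
    have := H.ne q hqΩ
    field_simp
    ring
  have hp2 := H.diffeo.mapsTo hp
  have smc : Sm ((pushField e φ Q).toVField.char h) (e p) :=
    (((sm_ζ smQ' H.op' hp2).mul (hhs _)).sub ((sm_τ smQ' H.op' hp2).mul (hhs _).dt)).sub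
      ((sm_ξ smQ' H.op' hp2).mul (hhs _).dx)
  rw [Lin_lhs_congr hch, hM _ smc] at key
  apply mul_left_cancel₀ hne
  simp only [pushField, H.diffeo.left_inv hp]
  linear_combination key

end

section

/-! ### Unique continuation -/

theorem forall_of_clopen {Ω : Set TX} (hc : IsPreconnected Ω) (hΩ : IsOpen Ω) {P : TX → Prop}
    (hopen : ∀ p ∈ Ω, P p → ∀ᶠ q in 𝓝 p, P q)
    (hclosed : ∀ p ∈ Ω, (∃ᶠ q in 𝓝 p, q ∈ Ω ∧ P q) → P p)
    {p₀ : TX} (hp₀ : p₀ ∈ Ω) (h₀ : P p₀) : ∀ p ∈ Ω, P p := by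
  have hu : IsOpen {p | p ∈ Ω ∧ P p} := by
    refine isOpen_iff_mem_nhds.2 fun p hp => ?_
    filter_upwards [hΩ.mem_nhds hp.1, hopen p hp.1 hp.2] with q h1 h2 using ⟨h1, h2⟩
  have := hc.subset_of_closure_inter_subset hu ⟨p₀, hp₀, hp₀, h₀⟩ fun p hp =>
    ⟨hp.2, hclosed p hp.2 (mem_closure_iff_frequently.1 hp.1)⟩
  exact fun p hp => (this hp).2

/-- A function with vanishing derivatives on a domain is constant. -/
theorem eq_of_dt_dx_eq_zero {Ω : Set TX} (hΩ : IsDom Ω) {f : TX → ℝ}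
    (hf : ∀ p ∈ Ω, Sm f p) (ht : ∀ p ∈ Ω, dt f p = 0) (hx : ∀ p ∈ Ω, dx f p = 0)
    {p q : TX} (hp : p ∈ Ω) (hq : q ∈ Ω) : f p = f q := by
  refine hΩ.1.is_const_of_fderiv_eq_zero hΩ.2.isPreconnected
    (fun r hr => (hf r hr).diff.differentiableWithinAt) (fun r hr => ?_) hp hq
  ext <;> simp [fderiv_apply_eq, ht r hr, hx r hr]

/-- A solution of a linear holonomic system that vanishes at a point of a domain vanishes
identically. -/
theorem eq_zero_of_holonomic {Ω : Set TX} (hΩ : IsDom Ω) {n : ℕ} {f : Fin n → TX → ℝ}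
    {A B : Fin n → Fin n → TX → ℝ} (hf : ∀ i, ∀ p ∈ Ω, Sm (f i) p)
    (hA : ∀ i j, ∀ p ∈ Ω, ContinuousAt (A i j) p) (hB : ∀ i j, ∀ p ∈ Ω, ContinuousAt (B i j) p)
    (ht : ∀ i, ∀ p ∈ Ω, dt (f i) p = ∑ j, A i j p * f j p)
    (hx : ∀ i, ∀ p ∈ Ω, dx (f i) p = ∑ j, B i j p * f j p)
    {p₀ : TX} (hp₀ : p₀ ∈ Ω) (h₀ : ∀ i, f i p₀ = 0) : ∀ p ∈ Ω, ∀ i, f i p = 0 := by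
  refine forall_of_clopen hΩ.2.isPreconnected hΩ.1 (fun p hp h => ?_) (fun p hp h i => ?_) hp₀ h₀
  -- Near `p` the coefficients are bounded by their values at `p` plus 1. On the segment from `p` to
  -- `q` the vector of unknowns then satisfies ‖y'‖ ≤ K‖y‖ and starts at 0, so Grönwall's inequality
  -- forces it to vanish.
  · have hev : ∀ᶠ q in 𝓝 p, q ∈ Ω ∧ ∀ i j, |A i j q| < |A i j p| + 1 ∧ |B i j q| < |B i j p| + 1 := by
      refine Filter.Eventually.and (hΩ.1.mem_nhds hp) ?_
      refine Filter.eventually_all.2 fun i => Filter.eventually_all.2 fun j => ?_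
      exact ((hA i j p hp).abs.eventually (gt_mem_nhds (by linarith))).and
        ((hB i j p hp).abs.eventually (gt_mem_nhds (by linarith)))
    obtain ⟨r, hr, hball⟩ := Metric.eventually_nhds_iff_ball.1 hev
    refine Filter.eventually_of_mem (Metric.ball_mem_nhds p hr) fun q hq => ?_
    set v := q - p with hv
    have hmem : ∀ s ∈ Set.Icc (0 : ℝ) 1, p + s • v ∈ Metric.ball p r := by
      intro s hs
      rw [Metric.mem_ball, dist_eq_norm, add_sub_cancel_left, norm_smul, Real.norm_of_nonneg hs.1]
      have : ‖v‖ < r := by rw [hv, ← dist_eq_norm]; exact hq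
      nlinarith [norm_nonneg v, hs.2]
    let y : ℝ → Fin n → ℝ := fun s i => f i (p + s • v)
    let y' : ℝ → Fin n → ℝ := fun s i =>
      v.1 * dt (f i) (p + s • v) + v.2 * dx (f i) (p + s • v)
    have hy : ∀ s ∈ Set.Icc (0 : ℝ) 1, HasDerivAt y (y' s) s := by
      intro s hs
      refine hasDerivAt_pi.2 fun i => ?_
      have h1 : HasDerivAt (fun s : ℝ => p + s • v) v s := by
        simpa using ((hasDerivAt_id s).smul_const v).const_add p
      have h2 := ((hf i _ (hball _ (hmem s hs)).1).diff.hasFDerivAt).comp_hasDerivAt s h1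
      rw [fderiv_apply_eq] at h2
      exact h2
    let K : ℝ := ∑ i, ∑ j, (|v.1| * (|A i j p| + 1) + |v.2| * (|B i j p| + 1))
    have hb : ∀ s ∈ Set.Icc (0 : ℝ) 1, ‖y' s‖ ≤ K * ‖y s‖ := by
      intro s hs
      have hK : 0 ≤ K := Finset.sum_nonneg fun i _ => Finset.sum_nonneg fun j _ => by positivity
      refine (pi_norm_le_iff_of_nonneg (by positivity)).2 fun i => ?_
      have hm := hball _ (hmem s hs)
      have e1 : y' s i = ∑ j, (v.1 * A i j (p + s • v) + v.2 * B i j (p + s • v)) * y s j := by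
        simp only [y', y]
        rw [ht i _ hm.1, hx i _ hm.1, Finset.mul_sum, Finset.mul_sum, ← Finset.sum_add_distrib]
        exact Finset.sum_congr rfl fun j _ => by ring
      rw [e1]
      calc ‖∑ j, (v.1 * A i j (p + s • v) + v.2 * B i j (p + s • v)) * y s j‖
          ≤ ∑ j, (|v.1| * (|A i j p| + 1) + |v.2| * (|B i j p| + 1)) * ‖y s‖ := by
            refine norm_sum_le_of_le _ fun j _ => ?_
            rw [norm_mul]
            refine mul_le_mul ?_ (norm_le_pi_norm (y s) j) (norm_nonneg _) (by positivity)
            refine (norm_add_le _ _).trans ?_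
            rw [norm_mul, norm_mul]
            exact add_le_add (mul_le_mul_of_nonneg_left (hm.2 i j).1.le (norm_nonneg _))
              (mul_le_mul_of_nonneg_left (hm.2 i j).2.le (norm_nonneg _))
        _ ≤ K * ‖y s‖ := by
            rw [← Finset.sum_mul]
            refine mul_le_mul_of_nonneg_right ?_ (norm_nonneg _)
            exact Finset.single_le_sum (f := fun i => ∑ j, (|v.1| * (|A i j p| + 1) +
              |v.2| * (|B i j p| + 1))) (fun i _ => Finset.sum_nonneg fun j _ => by positivity)
              (Finset.mem_univ i)
    have h1 := eq_zero_of_abs_deriv_le_mul_abs_self_of_eq_zero_right (f := y) (f' := y') (K := K)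
      (a := 0) (b := 1) (fun s hs => (hy s hs).continuousAt.continuousWithinAt)
      (fun s hs => (hy s ⟨hs.1, hs.2.le⟩).hasDerivWithinAt)
      (by ext i; simp [y, h i]) (fun s hs => hb s ⟨hs.1, hs.2.le⟩) 1 (by simp)
    intro i
    have := congrFun h1 i
    simpa [y, hv] using this
  · by_contra hne
    have : ∀ᶠ q in 𝓝 p, f i q ≠ 0 := (hf i p hp).continuousAt.eventually_ne hne
    obtain ⟨q, hq, hq'⟩ := (h.and_eventually this).exists
    exact hq' (hq.2 i)

/-! ### Determining equations -/

/-- The coefficients of the equation `u_t = ε u_xx + C u`. -/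
def Pco (ε : ℝ) (C : TX → ℝ) : Coef := fun p => (ε, 0, C p)

theorem Pco_mem {ε : ℝ} (hε : ε ≠ 0) {Ω : Set TX} {C : TX → ℝ} (hC : ∀ p ∈ Ω, Sm C p) :
    Pco ε C ∈ Lin.S Ω :=
  Lin_mem_S_of_sm (fun _ _ => Sm.const ε) (fun _ _ => Sm.const 0) hC fun _ _ => hε

theorem dtxx_eq {f : TX → ℝ} (hf : ContDiff ℝ ∞ f) (p : TX) :
    dt (dx (dx f)) p = dx (dx (dt f)) p := by
  have h : ∀ q, Sm f q := fun q => hf.contDiffAt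
  rw [dt_dx_comm (h p).dx]
  exact dx_congr (Filter.Eventually.of_forall fun q => dt_dx_comm (h q))

/-- All third-order derivatives of `f` and f_tt cancel between the operator applied to the
characteristic and the total derivatives of the equation. What survives is linear in f, f_t, f_x,
f_tx, f_xx, and its coefficients give the determining equations. -/
theorem lie_identity (ε : ℝ) {C : TX → ℝ} {Q : EssField} {Ω : Set TX} (hΩ : IsOpen Ω)
    (hC : ∀ p ∈ Ω, Sm C p) (hQ : ContDiffOn ℝ ∞ Q Ω) {τ ξ ζ : TX → ℝ} (eτ : τ = fun q => (Q q).1)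
    (eξ : ξ = fun q => (Q q).2.1) (eζ : ζ = fun q => (Q q).2.2) {p : TX} (hp : p ∈ Ω) {f : TX → ℝ}
    (hf : ContDiff ℝ ∞ f) :
    Lin.lhs (Pco ε C) (Q.toVField.char f) p + (Q p).1 * dt (Lin.lhs (Pco ε C) f) p +
        (Q p).2.1 * dx (Lin.lhs (Pco ε C) f) p =
      ζ p * Lin.lhs (Pco ε C) f p
      + (dt ζ p - ε * dx (dx ζ) p - τ p * dt C p - ξ p * dx C p) * f p
      + (ε * dx (dx τ) p - dt τ p) * dt f p + 2 * ε * dx τ p * dx (dt f) p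
      + (ε * dx (dx ξ) p - dt ξ p - 2 * ε * dx ζ p) * dx f p + 2 * ε * dx ξ p * dx (dx f) p := by
  have sf : ∀ q, Sm f q := fun q => hf.contDiffAt
  have sC := hC p hp
  have sτ : Sm τ p := eτ ▸ sm_τ hQ hΩ hp
  have sξ : Sm ξ p := eξ ▸ sm_ξ hQ hΩ hp
  have sζ : Sm ζ p := eζ ▸ sm_ζ hQ hΩ hp
  have hch : Q.toVField.char f = fun q => (ζ q * f q - τ q * dt f q) - ξ q * dx f q := by
    rw [toVField_char, eτ, eξ, eζ]
  have hl : Lin.lhs (Pco ε C) f = fun q => dt f q - (ε * dx (dx f) q + C q * f q) := by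
    ext q; simp [Lin_lhs, Pco]
  have c1 := sC.mul (sf p)
  have c2 := (Sm.const ε).mul (sf p).dx.dx
  have s1 := sζ.mul (sf p)
  have s2 := sτ.mul (sf p).dt
  have s3 := sξ.mul (sf p).dx
  have hdt : dt (Lin.lhs (Pco ε C) f) p =
      dt (dt f) p - (ε * dx (dx (dt f)) p + (C p * dt f p + dt C p * f p)) := by
    rw [hl, dt_sub (sf p).dt.diff (c2.add c1).diff, dt_add c2.diff c1.diff,
      dt_const_mul ε (sf p).dx.dx.diff, dt_mul sC.diff (sf p).diff, dtxx_eq hf]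
  have hdx : dx (Lin.lhs (Pco ε C) f) p =
      dx (dt f) p - (ε * dx (dx (dx f)) p + (C p * dx f p + dx C p * f p)) := by
    rw [hl, dx_sub (sf p).dt.diff (c2.add c1).diff, dx_add c2.diff c1.diff,
      dx_const_mul ε (sf p).dx.dx.diff, dx_mul sC.diff (sf p).diff]
  rw [hdt, hdx, hch]
  simp only [Lin_lhs, Pco]
  rw [dt_sub (s1.sub s2).diff s3.diff, dt_sub s1.diff s2.diff, dt_mul sζ.diff (sf p).diff,
    dt_mul sτ.diff (sf p).dt.diff, dt_mul sξ.diff (sf p).dx.diff, dxx_sub (s1.sub s2) s3,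
    dxx_sub s1 s2, dxx_mul sζ (sf p), dxx_mul sτ (sf p).dt, dxx_mul sξ (sf p).dx,
    dt_dx_comm (sf p), show (Q p).1 = τ p by rw [eτ], show (Q p).2.1 = ξ p by rw [eξ]]
  ring

/-- The determining equations for the essential Lie symmetries of `u_t = ε u_xx + C u`. -/
def DetEqs (ε : ℝ) (C τ ξ ζ : TX → ℝ) (p : TX) : Prop :=
  dx τ p = 0 ∧ 2 * dx ξ p = dt τ p ∧ 2 * ε * dx ζ p = -dt ξ p ∧
    dt ζ p - ε * dx (dx ζ) p = dt τ p * C p + τ p * dt C p + ξ p * dx C p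

section Det

variable {ε : ℝ} {C : TX → ℝ} {Q : EssField} {Ω : Set TX}

theorem dxx_eq_zero_of_det {τ ξ : TX → ℝ} (hΩ : IsOpen Ω) (hτ : ∀ p ∈ Ω, Sm τ p)
    (hξ : ∀ p ∈ Ω, Sm ξ p) (h1 : ∀ p ∈ Ω, dx τ p = 0) (h2 : ∀ p ∈ Ω, 2 * dx ξ p = dt τ p)
    {p : TX} (hp : p ∈ Ω) : dx (dx τ) p = 0 ∧ dx (dt τ) p = 0 ∧ dx (dx ξ) p = 0 := by
  have a1 : dx (dx τ) p = 0 := by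
    rw [dx_congr (eventuallyEq_of_eqOn hΩ hp h1), dx_const]
  have a2 : dx (dt τ) p = 0 := by
    rw [← dt_dx_comm (hτ p hp), dt_congr (eventuallyEq_of_eqOn hΩ hp h1), dt_const]
  have a3 := dx_congr (eventuallyEq_of_eqOn hΩ hp h2)
  rw [dx_const_mul 2 (hξ p hp).dx.diff] at a3
  exact ⟨a1, a2, by linarith⟩

theorem mem_gEss_Pco_iff (hε : ε ≠ 0) (hΩ : IsOpen Ω) (hC : ∀ p ∈ Ω, Sm C p) :
    Q ∈ Lin.gEss Ω (Pco ε C) ↔ ContDiffOn ℝ ∞ Q Ω ∧ ∀ p ∈ Ω,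
      DetEqs ε C (fun q => (Q q).1) (fun q => (Q q).2.1) (fun q => (Q q).2.2) p := by
  rw [mem_gEss_iff]
  refine and_congr_right fun hQ => ?_
  set τ : TX → ℝ := fun q => (Q q).1 with eτ
  set ξ : TX → ℝ := fun q => (Q q).2.1 with eξ
  set ζ : TX → ℝ := fun q => (Q q).2.2 with eζ
  have sτ : ∀ p ∈ Ω, Sm τ p := fun p hp => sm_τ hQ hΩ hp
  have sξ : ∀ p ∈ Ω, Sm ξ p := fun p hp => sm_ξ hQ hΩ hp
  constructor
  · intro H
    -- On jets satisfying the equation, f_t is fixed by f and f_xx, while f, f_x, f_tx and f_xx are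
    -- free. Choosing them as coordinate vectors splits the invariance condition.
    have key : ∀ p ∈ Ω, ∀ c ct cx ctx cxx : ℝ, ct = ε * cxx + C p * c →
        (dt ζ p - ε * dx (dx ζ) p - τ p * dt C p - ξ p * dx C p) * c
        + (ε * dx (dx τ) p - dt τ p) * ct + 2 * ε * dx τ p * ctx
        + (ε * dx (dx ξ) p - dt ξ p - 2 * ε * dx ζ p) * cx + 2 * ε * dx ξ p * cxx = 0 := by
      intro p hp c ct cx ctx cxx h0
      have hl : Lin.lhs (Pco ε C) (quad p c ct cx 0 ctx cxx) p = 0 := by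
        rw [Lin_lhs_quad]; simp only [Pco]; linarith
      have := H p hp _ (quad_contDiff p c ct cx 0 ctx cxx) hl
      rw [lie_identity ε hΩ hC hQ eτ eξ eζ hp (quad_contDiff p c ct cx 0 ctx cxx), hl] at this
      simp only [dt_quad, dx_quad, quad_self] at this
      linarith
    have h1 : ∀ p ∈ Ω, dx τ p = 0 := fun p hp => by
      have := key p hp 0 0 0 1 0 (by ring)
      simpa [hε] using this
    have h1' : ∀ p ∈ Ω, dx (dx τ) p = 0 := fun p hp => by
      rw [dx_congr (eventuallyEq_of_eqOn hΩ hp h1), dx_const]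
    have h2 : ∀ p ∈ Ω, 2 * dx ξ p = dt τ p := fun p hp => by
      have := key p hp 0 ε 0 0 1 (by ring)
      rw [h1' p hp] at this
      apply mul_left_cancel₀ hε; linarith
    intro p hp
    obtain ⟨a1, a2, a3⟩ := dxx_eq_zero_of_det hΩ sτ sξ h1 h2 hp
    have k3 := key p hp 0 0 1 0 0 (by ring)
    have k4 := key p hp 1 (C p) 0 0 0 (by ring)
    rw [a3] at k3
    rw [a1] at k4
    exact ⟨h1 p hp, h2 p hp, by linarith, by linarith⟩
  · intro H p hp f hf h0
    obtain ⟨a1, a2, a3⟩ := dxx_eq_zero_of_det hΩ sτ sξ (fun p hp => (H p hp).1)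
      (fun p hp => (H p hp).2.1) hp
    obtain ⟨b1, b2, b3, b4⟩ := H p hp
    rw [lie_identity ε hΩ hC hQ eτ eξ eζ hp hf, h0, a1, a3, b1]
    rw [Lin_lhs] at h0
    simp only [Pco] at h0
    linear_combination f p * b4 - dx f p * b3 - dt τ p * h0 + ε * dx (dx f) p * b2

end Det

end

section

/-! ### Lie symmetries of heat equations with potentials -/

/-- Components of an essential Lie symmetry of the equation `u_t = ε u_xx + C u` on `Ω`. -/
structure IsSymm (ε : ℝ) (Ω : Set TX) (C τ ξ ζ : TX → ℝ) : Prop where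
  op : IsOpen Ω
  sC : ∀ p ∈ Ω, Sm C p
  sτ : ∀ p ∈ Ω, Sm τ p
  sξ : ∀ p ∈ Ω, Sm ξ p
  sζ : ∀ p ∈ Ω, Sm ζ p
  det : ∀ p ∈ Ω, DetEqs ε C τ ξ ζ p

theorem isSymm_iff {ε : ℝ} (hε : ε ≠ 0) {Ω : Set TX} (hΩ : IsOpen Ω) {C : TX → ℝ}
    (hC : ∀ p ∈ Ω, Sm C p) {Q : EssField} : Q ∈ Lin.gEss Ω (Pco ε C) ↔
      IsSymm ε Ω C (fun q => (Q q).1) (fun q => (Q q).2.1) (fun q => (Q q).2.2) := by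
  rw [mem_gEss_Pco_iff hε hΩ hC]
  constructor
  · rintro ⟨h1, h2⟩
    exact ⟨hΩ, hC, fun p hp => sm_τ h1 hΩ hp, fun p hp => sm_ξ h1 hΩ hp, fun p hp => sm_ζ h1 hΩ hp, h2⟩
  · intro h
    exact ⟨fun p hp => (ContDiffAt.prodMk (h.sτ p hp)
      (ContDiffAt.prodMk (h.sξ p hp) (h.sζ p hp))).contDiffWithinAt, h.det⟩

theorem eps_mul_self {ε : ℝ} (h : ε = 1 ∨ ε = -1) : ε * ε = 1 := by
  rcases h with rfl | rfl <;> norm_num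

theorem eps_ne_zero {ε : ℝ} (h : ε = 1 ∨ ε = -1) : ε ≠ 0 := by
  rcases h with rfl | rfl <;> norm_num

namespace IsSymm

variable {ε : ℝ} {Ω : Set TX} {C τ ξ ζ τ' ξ' ζ' : TX → ℝ} {p p₀ : TX}

theorem sub (h : IsSymm ε Ω C τ ξ ζ) (h' : IsSymm ε Ω C τ' ξ' ζ') :
    IsSymm ε Ω C (fun q => τ q - τ' q) (fun q => ξ q - ξ' q) (fun q => ζ q - ζ' q) := by
  refine ⟨h.op, h.sC, fun p hp => (h.sτ p hp).sub (h'.sτ p hp), fun p hp =>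
    (h.sξ p hp).sub (h'.sξ p hp), fun p hp => (h.sζ p hp).sub (h'.sζ p hp), fun p hp => ?_⟩
  obtain ⟨a1, a2, a3, a4⟩ := h.det p hp
  obtain ⟨b1, b2, b3, b4⟩ := h'.det p hp
  unfold DetEqs
  rw [dx_sub (h.sτ p hp).diff (h'.sτ p hp).diff, dt_sub (h.sτ p hp).diff (h'.sτ p hp).diff,
    dx_sub (h.sξ p hp).diff (h'.sξ p hp).diff, dt_sub (h.sξ p hp).diff (h'.sξ p hp).diff,
    dx_sub (h.sζ p hp).diff (h'.sζ p hp).diff, dt_sub (h.sζ p hp).diff (h'.sζ p hp).diff,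
    dxx_sub (h.sζ p hp) (h'.sζ p hp)]
  exact ⟨by linarith, by linarith, by linarith, by linarith⟩

theorem dx_τ (h : IsSymm ε Ω C τ ξ ζ) (hp : p ∈ Ω) : dx τ p = 0 := (h.det p hp).1

theorem dx_ξ (h : IsSymm ε Ω C τ ξ ζ) (hp : p ∈ Ω) : dx ξ p = 1 / 2 * dt τ p := by
  linarith [(h.det p hp).2.1]

theorem dx_dt_τ (h : IsSymm ε Ω C τ ξ ζ) (hp : p ∈ Ω) : dx (dt τ) p = 0 := by
  rw [← dt_dx_comm (h.sτ p hp), dt_congr (eventuallyEq_of_eqOn h.op hp fun q hq => h.dx_τ hq),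
    dt_const]

theorem dx_dtt_τ (h : IsSymm ε Ω C τ ξ ζ) (hp : p ∈ Ω) : dx (dt (dt τ)) p = 0 := by
  rw [← dt_dx_comm (h.sτ p hp).dt,
    dt_congr (eventuallyEq_of_eqOn h.op hp fun q hq => h.dx_dt_τ hq), dt_const]

theorem dx_dt_ξ (h : IsSymm ε Ω C τ ξ ζ) (hp : p ∈ Ω) :
    dx (dt ξ) p = 1 / 2 * dt (dt τ) p := by
  rw [← dt_dx_comm (h.sξ p hp), dt_congr (eventuallyEq_of_eqOn h.op hp fun q hq => h.dx_ξ hq),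
    dt_const_mul _ (h.sτ p hp).dt.diff]

theorem dx_dtt_ξ (h : IsSymm ε Ω C τ ξ ζ) (hp : p ∈ Ω) :
    dx (dt (dt ξ)) p = 1 / 2 * dt (dt (dt τ)) p := by
  rw [← dt_dx_comm (h.sξ p hp).dt,
    dt_congr (eventuallyEq_of_eqOn h.op hp fun q hq => h.dx_dt_ξ hq),
    dt_const_mul _ (h.sτ p hp).dt.dt.diff]

theorem dx_ζ (hε : ε = 1 ∨ ε = -1) (h : IsSymm ε Ω C τ ξ ζ) (hp : p ∈ Ω) : dx ζ p = -ε / 2 * dt ξ p := by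
  linear_combination ε / 2 * (h.det p hp).2.2.1 - dx ζ p * eps_mul_self hε

theorem dt_ζ (hε : ε = 1 ∨ ε = -1) (h : IsSymm ε Ω C τ ξ ζ) (hp : p ∈ Ω) :
    dt ζ p = dt τ p * C p + τ p * dt C p + ξ p * dx C p - 1 / 4 * dt (dt τ) p := by
  have h1 := dx_congr (eventuallyEq_of_eqOn h.op hp fun q hq => h.dx_ζ hε hq)
  rw [dx_const_mul _ (h.sξ p hp).dt.diff, h.dx_dt_ξ hp] at h1
  have := (h.det p hp).2.2.2
  rw [h1] at this
  linear_combination this - 1 / 4 * dt (dt τ) p * eps_mul_self hε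

/-- Cross-differentiation of `dx_ζ` and `dt_ζ` eliminates ζ. -/
theorem dtt_ξ (hε : ε = 1 ∨ ε = -1) (h : IsSymm ε Ω C τ ξ ζ) (hp : p ∈ Ω) :
    dt (dt ξ) p = -2 * ε * (3 / 2 * dt τ p * dx C p + τ p * dx (dt C) p + ξ p * dx (dx C) p) := by
  have sC := h.sC p hp
  have sτ := h.sτ p hp
  have sξ := h.sξ p hp
  have sζ := h.sζ p hp
  have h1 := dx_congr (eventuallyEq_of_eqOn h.op hp fun q hq => h.dt_ζ hε hq)
  rw [← dt_dx_comm sζ, dt_congr (eventuallyEq_of_eqOn h.op hp fun q hq => h.dx_ζ hε hq),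
    dt_const_mul _ sξ.dt.diff,
    dx_sub (((sτ.dt.mul sC).add (sτ.mul sC.dt)).add (sξ.mul sC.dx)).diff
      ((Sm.const _).mul sτ.dt.dt).diff, dx_const_mul _ sτ.dt.dt.diff,
    dx_add ((sτ.dt.mul sC).add (sτ.mul sC.dt)).diff (sξ.mul sC.dx).diff,
    dx_add (sτ.dt.mul sC).diff (sτ.mul sC.dt).diff,
    dx_mul sτ.dt.diff sC.diff, dx_mul sτ.diff sC.dt.diff, dx_mul sξ.diff sC.dx.diff,
    h.dx_dt_τ hp, h.dx_τ hp, h.dx_ξ hp, h.dx_dtt_τ hp] at h1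
  linear_combination -2 * ε * h1 - dt (dt ξ) p * eps_mul_self hε

/-- Since ξ_x = τ_t/2, the x-derivative of `dtt_ξ` expresses τ_ttt through lower derivatives; this
closes the system. -/
theorem dttt_τ (hε : ε = 1 ∨ ε = -1) (h : IsSymm ε Ω C τ ξ ζ) (hp : p ∈ Ω) :
    dt (dt (dt τ)) p = -4 * ε * (2 * dt τ p * dx (dx C) p + τ p * dx (dx (dt C)) p +
      ξ p * dx (dx (dx C)) p) := by
  have sC := h.sC p hp
  have sτ := h.sτ p hp
  have sξ := h.sξ p hp
  have h1 := dx_congr (eventuallyEq_of_eqOn h.op hp (f := dt (dt ξ)) (g := fun p => -2 * ε *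
    ((3 / 2 * (dt τ p * dx C p) + τ p * dx (dt C) p) + ξ p * dx (dx C) p))
    fun q hq => by rw [h.dtt_ξ hε hq]; ring)
  have s1 := (Sm.const (3 / 2)).mul (sτ.dt.mul sC.dx)
  rw [h.dx_dtt_ξ hp, dx_const_mul _ ((s1.add (sτ.mul sC.dt.dx)).add (sξ.mul sC.dx.dx)).diff,
    dx_add (s1.add (sτ.mul sC.dt.dx)).diff (sξ.mul sC.dx.dx).diff,
    dx_add s1.diff (sτ.mul sC.dt.dx).diff, dx_const_mul _ (sτ.dt.mul sC.dx).diff,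
    dx_mul sτ.dt.diff sC.dx.diff, dx_mul sτ.diff sC.dt.dx.diff, dx_mul sξ.diff sC.dx.dx.diff,
    h.dx_dt_τ hp, h.dx_τ hp, h.dx_ξ hp] at h1
  linear_combination 2 * h1

/-- One more x-derivative annihilates τ_ttt. What is left is the classifying condition: algebraic in
τ_t, τ and ξ, with coefficients built from C_xxx. -/
theorem third_x (hε : ε = 1 ∨ ε = -1) (h : IsSymm ε Ω C τ ξ ζ) (hp : p ∈ Ω) :
    5 / 2 * dt τ p * dx (dx (dx C)) p + τ p * dx (dx (dx (dt C))) p +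
      ξ p * dx (dx (dx (dx C))) p = 0 := by
  have sC := h.sC p hp
  have sτ := h.sτ p hp
  have sξ := h.sξ p hp
  have h1 := dx_congr (eventuallyEq_of_eqOn h.op hp (f := dt (dt (dt τ))) (g := fun p => -4 * ε *
    ((2 * (dt τ p * dx (dx C) p) + τ p * dx (dx (dt C)) p) + ξ p * dx (dx (dx C)) p))
    fun q hq => by rw [h.dttt_τ hε hq]; ring)
  have s1 := (Sm.const 2).mul (sτ.dt.mul sC.dx.dx)
  have h0 : dx (dt (dt (dt τ))) p = 0 := by
    rw [← dt_dx_comm sτ.dt.dt,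
      dt_congr (eventuallyEq_of_eqOn h.op hp fun q hq => h.dx_dtt_τ hq), dt_const]
  rw [h0, dx_const_mul _ ((s1.add (sτ.mul sC.dt.dx.dx)).add (sξ.mul sC.dx.dx.dx)).diff,
    dx_add (s1.add (sτ.mul sC.dt.dx.dx)).diff (sξ.mul sC.dx.dx.dx).diff,
    dx_add s1.diff (sτ.mul sC.dt.dx.dx).diff, dx_const_mul _ (sτ.dt.mul sC.dx.dx).diff,
    dx_mul sτ.dt.diff sC.dx.dx.diff, dx_mul sτ.diff sC.dt.dx.dx.diff,
    dx_mul sξ.diff sC.dx.dx.dx.diff, h.dx_dt_τ hp, h.dx_τ hp, h.dx_ξ hp] at h1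
  linear_combination ε / 4 * h1 - (5 / 2 * dt τ p * dx (dx (dx C)) p +
    τ p * dx (dx (dx (dt C))) p + ξ p * dx (dx (dx (dx C))) p) * eps_mul_self hε

/-- A Lie symmetry is determined, up to a multiple of `u ∂_u`, by its jet at one point. -/
theorem eq_zero (hε : ε = 1 ∨ ε = -1) (hΩ : IsDom Ω) (h : IsSymm ε Ω C τ ξ ζ) (hp₀ : p₀ ∈ Ω) (h1 : τ p₀ = 0)
    (h2 : dt τ p₀ = 0) (h3 : dt (dt τ) p₀ = 0) (h4 : ξ p₀ = 0) (h5 : dt ξ p₀ = 0) :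
    ∀ p ∈ Ω, τ p = 0 ∧ ξ p = 0 := by
  -- By `dttt_τ`, `dtt_ξ` and ξ_x = τ_t/2, all first derivatives of (τ, τ_t, τ_tt, ξ, ξ_t) are
  -- linear combinations of these five functions.
  have key := eq_zero_of_holonomic hΩ (f := ![τ, dt τ, dt (dt τ), ξ, dt ξ])
    (A := ![![0, 1, 0, 0, 0], ![0, 0, 1, 0, 0],
      ![fun p => -4 * ε * dx (dx (dt C)) p, fun p => -4 * ε * (2 * dx (dx C) p), 0,
        fun p => -4 * ε * dx (dx (dx C)) p, 0],
      ![0, 0, 0, 0, 1],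
      ![fun p => -2 * ε * dx (dt C) p, fun p => -2 * ε * (3 / 2 * dx C p), 0,
        fun p => -2 * ε * dx (dx C) p, 0]])
    (B := ![![0, 0, 0, 0, 0], ![0, 0, 0, 0, 0], ![0, 0, 0, 0, 0], ![0, fun _ => 1 / 2, 0, 0, 0],
      ![0, 0, fun _ => 1 / 2, 0, 0]]) ?_ ?_ ?_ ?_ ?_ hp₀ ?_
  · exact fun p hp => ⟨key p hp 0, key p hp 3⟩
  · intro i p hp
    fin_cases i
    · exact h.sτ p hp
    · exact (h.sτ p hp).dt
    · exact (h.sτ p hp).dt.dt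
    · exact h.sξ p hp
    · exact (h.sξ p hp).dt
  · intro i j p hp
    have sC := h.sC p hp
    have c0 : ContinuousAt (0 : TX → ℝ) p := continuousAt_const
    have c1 : ContinuousAt (1 : TX → ℝ) p := continuousAt_const
    have m : ∀ (c : ℝ) {f : TX → ℝ}, Sm f p → ContinuousAt (fun p => c * f p) p :=
      fun c f hf => continuousAt_const.mul hf.continuousAt
    fin_cases i <;> fin_cases j <;> first | exact c0 | exact c1 | skip
    · exact m _ sC.dt.dx.dx
    · exact m _ ((Sm.const 2).mul sC.dx.dx)
    · exact m _ sC.dx.dx.dx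
    · exact m _ sC.dt.dx
    · exact m _ ((Sm.const (3 / 2)).mul sC.dx)
    · exact m _ sC.dx.dx
  · intro i j p hp
    have c0 : ContinuousAt (0 : TX → ℝ) p := continuousAt_const
    fin_cases i <;> fin_cases j <;> first | exact c0 | exact continuousAt_const
  · intro i p hp
    have e1 := h.dttt_τ hε hp
    have e2 := h.dtt_ξ hε hp
    rw [Fin.sum_univ_five]
    fin_cases i <;> simp <;> linarith
  · intro i p hp
    have e1 := h.dx_τ hp
    have e2 := h.dx_dt_τ hp
    have e3 := h.dx_dtt_τ hp
    have e4 := h.dx_ξ hp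
    have e5 := h.dx_dt_ξ hp
    rw [Fin.sum_univ_five]
    fin_cases i <;> simp <;> linarith
  · intro i
    fin_cases i
    exacts [h1, h2, h3, h4, h5]

theorem ζ_const (hε : ε = 1 ∨ ε = -1) (hΩ : IsDom Ω) (h : IsSymm ε Ω C τ ξ ζ) (h0 : ∀ p ∈ Ω, τ p = 0 ∧ ξ p = 0)
    (hp : p ∈ Ω) (hp₀ : p₀ ∈ Ω) : ζ p = ζ p₀ := by
  have a1 : ∀ q ∈ Ω, dt τ q = 0 := fun q hq => by
    rw [dt_congr (eventuallyEq_of_eqOn h.op hq fun r hr => (h0 r hr).1), dt_const]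
  refine eq_of_dt_dx_eq_zero hΩ h.sζ (fun q hq => ?_) (fun q hq => ?_) hp hp₀
  · rw [h.dt_ζ hε hq, (h0 q hq).1, (h0 q hq).2, a1 q hq,
      dt_congr (eventuallyEq_of_eqOn h.op hq a1), dt_const]
    ring
  · rw [h.dx_ζ hε hq, dt_congr (eventuallyEq_of_eqOn h.op hq fun r hr => (h0 r hr).2), dt_const]
    ring

end IsSymm

/-- Polynomial symmetries for `C = 0` and, if `a₄ = a₅ = 0`, for `C = μ x⁻²`. -/
theorem isSymm_poly {ε : ℝ} (hε : ε = 1 ∨ ε = -1) {Ω : Set TX} (hΩ : IsOpen Ω) {C : TX → ℝ}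
    (hC : ∀ p ∈ Ω, Sm C p) (a₀ a₁ a₂ a₃ a₄ a₅ : ℝ) (ht : ∀ p ∈ Ω, dt C p = 0)
    (hx : ∀ p ∈ Ω, 2 * (a₂ + 4 * a₃ * p.1) * C p +
      ((a₂ + 4 * a₃ * p.1) * p.2 + a₄ + 2 * a₅ * p.1) * dx C p = 0) :
    IsSymm ε Ω C (quad 0 a₁ (2 * a₂) 0 (8 * a₃) 0 0) (quad 0 a₄ (2 * a₅) a₂ 0 (4 * a₃) 0)
      (quad 0 a₀ (-(2 * a₃)) (-(ε * a₅)) 0 0 (-(2 * ε * a₃))) := by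
  refine ⟨hΩ, hC, fun p _ => (quad_contDiff ..).contDiffAt, fun p _ => (quad_contDiff ..).contDiffAt,
    fun p _ => (quad_contDiff ..).contDiffAt, fun p hp => ?_⟩
  have h2 := hx p hp
  unfold DetEqs
  simp only [dt_quad, dx_quad, ht p hp]
  simp only [quad, Prod.fst_zero, Prod.snd_zero]
  refine ⟨by ring, by ring, ?_, ?_⟩
  · linear_combination (-(2 * a₅) - 4 * a₃ * p.2) * eps_mul_self hε
  · linear_combination 2 * a₃ * eps_mul_self hε - h2

/-- The five parameters a₁, …, a₅ suffice to match the jet (τ, τ_t, τ_tt, ξ, ξ_t) at one point by a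
polynomial symmetry. The difference is a symmetry with zero jet, so its τ and ξ vanish and its ζ is
the constant absorbed in a₀. -/
theorem exists_poly_of_zero {ε : ℝ} (hε : ε = 1 ∨ ε = -1) {Ω : Set TX} (hΩ : IsDom Ω) {C : TX → ℝ}
    (hC : ∀ p ∈ Ω, C p = 0) {τ ξ ζ : TX → ℝ} (h : IsSymm ε Ω C τ ξ ζ) :
    ∃ a₀ a₁ a₂ a₃ a₄ a₅ : ℝ, ∀ p ∈ Ω, τ p = quad 0 a₁ (2 * a₂) 0 (8 * a₃) 0 0 p ∧
      ξ p = quad 0 a₄ (2 * a₅) a₂ 0 (4 * a₃) 0 p ∧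
      ζ p = quad 0 a₀ (-(2 * a₃)) (-(ε * a₅)) 0 0 (-(2 * ε * a₃)) p := by
  obtain ⟨p₀, hp₀⟩ := hΩ.2.nonempty
  have ht : ∀ p ∈ Ω, dt C p = 0 := fun p hp => by
    rw [dt_congr (eventuallyEq_of_eqOn hΩ.1 hp hC), dt_const]
  have hx : ∀ p ∈ Ω, dx C p = 0 := fun p hp => by
    rw [dx_congr (eventuallyEq_of_eqOn hΩ.1 hp hC), dx_const]
  obtain ⟨a₃, e₃⟩ : ∃ a₃ : ℝ, 8 * a₃ = dt (dt τ) p₀ := ⟨dt (dt τ) p₀ / 8, by ring⟩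
  obtain ⟨a₂, e₂⟩ : ∃ a₂ : ℝ, 2 * a₂ + 8 * a₃ * p₀.1 = dt τ p₀ :=
    ⟨(dt τ p₀ - 8 * a₃ * p₀.1) / 2, by ring⟩
  obtain ⟨a₁, e₁⟩ : ∃ a₁ : ℝ, a₁ + 2 * a₂ * p₀.1 + 4 * a₃ * p₀.1 ^ 2 = τ p₀ :=
    ⟨τ p₀ - 2 * a₂ * p₀.1 - 4 * a₃ * p₀.1 ^ 2, by ring⟩
  obtain ⟨a₅, e₅⟩ : ∃ a₅ : ℝ, 2 * a₅ + 4 * a₃ * p₀.2 = dt ξ p₀ :=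
    ⟨(dt ξ p₀ - 4 * a₃ * p₀.2) / 2, by ring⟩
  obtain ⟨a₄, e₄⟩ : ∃ a₄ : ℝ, a₄ + 2 * a₅ * p₀.1 + a₂ * p₀.2 + 4 * a₃ * (p₀.1 * p₀.2) = ξ p₀ :=
    ⟨ξ p₀ - 2 * a₅ * p₀.1 - a₂ * p₀.2 - 4 * a₃ * (p₀.1 * p₀.2), by ring⟩
  have hs := h.sub (isSymm_poly hε hΩ.1 h.sC 0 a₁ a₂ a₃ a₄ a₅ ht
    fun p hp => by rw [hC p hp, hx p hp]; ring)
  have hd : ∀ (f : TX → ℝ) (hf : ∀ p ∈ Ω, Sm f p) (c ct cx ctt ctx cxx : ℝ), ∀ p ∈ Ω,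
      dt (fun q => f q - quad 0 c ct cx ctt ctx cxx q) p = dt f p - quad 0 ct ctt ctx 0 0 0 p := by
    intro f hf c ct cx ctt ctx cxx p hp
    rw [dt_sub (hf p hp).diff ((quad_contDiff ..).contDiffAt.differentiableAt (by simp)), dt_quad]
  have h0 := hs.eq_zero hε hΩ hp₀ (by simp only [quad, Prod.fst_zero, Prod.snd_zero]; linarith)
    (by rw [hd τ h.sτ _ _ _ _ _ _ _ hp₀]; simp only [quad, Prod.fst_zero, Prod.snd_zero]; linarith)
    (by rw [dt_congr (eventuallyEq_of_eqOn hΩ.1 hp₀ (hd τ h.sτ _ _ _ _ _ _)),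
          hd (dt τ) (fun p hp => (h.sτ p hp).dt) _ _ _ _ _ _ _ hp₀]
        simp only [quad, Prod.fst_zero, Prod.snd_zero]; linarith)
    (by simp only [quad, Prod.fst_zero, Prod.snd_zero]; linarith)
    (by rw [hd ξ h.sξ _ _ _ _ _ _ _ hp₀]; simp only [quad, Prod.fst_zero, Prod.snd_zero]; linarith)
  refine ⟨ζ p₀ - quad 0 0 (-(2 * a₃)) (-(ε * a₅)) 0 0 (-(2 * ε * a₃)) p₀, a₁, a₂, a₃, a₄, a₅,
    fun p hp => ⟨by linarith [(h0 p hp).1], by linarith [(h0 p hp).2], ?_⟩⟩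
  have := hs.ζ_const hε hΩ h0 hp hp₀
  simp only [quad] at this ⊢
  linarith

section OneVariable

variable {F : ℝ → ℝ} {F' : ℝ} {p : TX}

theorem dx_fun_snd (h : HasDerivAt F F' p.2) : dx (fun q => F q.2) p = F' := by
  rw [dx_comp_real (f := fun q : TX => q.2) h.differentiableAt differentiableAt_snd, dx_snd, h.deriv,
    mul_one]
theorem dt_fun_snd (h : DifferentiableAt ℝ F p.2) : dt (fun q => F q.2) p = 0 := by
  rw [dt_comp_real (f := fun q : TX => q.2) h differentiableAt_snd, dt_snd, mul_zero]
theorem dt_fun_fst (h : HasDerivAt F F' p.1) : dt (fun q => F q.1) p = F' := by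
  rw [dt_comp_real (f := fun q : TX => q.1) h.differentiableAt differentiableAt_fst, dt_fst, h.deriv,
    mul_one]
theorem dx_fun_fst (h : DifferentiableAt ℝ F p.1) : dx (fun q => F q.1) p = 0 := by
  rw [dx_comp_real (f := fun q : TX => q.1) h differentiableAt_fst, dx_fst, mul_zero]

theorem hasDerivAt_div_pow (c b : ℝ) (n : ℕ) {x : ℝ} (hx : x + b ≠ 0) :
    HasDerivAt (fun x => c / (x + b) ^ n) (-(n * c) / (x + b) ^ (n + 1)) x := by
  have h1 : HasDerivAt (fun x : ℝ => (x + b) ^ n) (n * (x + b) ^ (n - 1) * 1) x :=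
    ((hasDerivAt_id x).add_const b).pow n
  refine ((hasDerivAt_const x c).div h1 (pow_ne_zero n hx)).congr_deriv ?_
  rcases n with _ | n
  · simp
  · simp only [Nat.add_sub_cancel]
    field_simp
    ring

end OneVariable

theorem sm_div_pow (c b : ℝ) (n : ℕ) {p : TX} (hp : p.2 + b ≠ 0) :
    Sm (fun q => c / (q.2 + b) ^ n) p :=
  (Sm.const c).div (ContDiffAt.pow (contDiffAt_snd.add contDiffAt_const) n) (pow_ne_zero n hp)

theorem dx_div_pow (c b : ℝ) (n : ℕ) {p : TX} (hp : p.2 + b ≠ 0) :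
    dx (fun q => c / (q.2 + b) ^ n) p = -(n * c) / (p.2 + b) ^ (n + 1) :=
  dx_fun_snd (F := fun x => c / (x + b) ^ n) (hasDerivAt_div_pow c b n hp)

theorem dt_div_pow (c b : ℝ) (n : ℕ) {p : TX} (hp : p.2 + b ≠ 0) :
    dt (fun q => c / (q.2 + b) ^ n) p = 0 :=
  dt_fun_snd (F := fun x => c / (x + b) ^ n) (hasDerivAt_div_pow c b n hp).differentiableAt

theorem derivs_invSq {Ω : Set TX} (hΩ : IsOpen Ω) {C : TX → ℝ} {μ : ℝ}
    (hC : ∀ p ∈ Ω, p.2 ≠ 0 ∧ C p = μ / p.2 ^ 2) : (∀ p ∈ Ω, Sm C p) ∧ (∀ p ∈ Ω, dt C p = 0) ∧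
      (∀ p ∈ Ω, dx C p = -2 * μ / p.2 ^ 3) ∧ (∀ p ∈ Ω, dx (dx C) p = 6 * μ / p.2 ^ 4) ∧
      (∀ p ∈ Ω, dx (dx (dx C)) p = -24 * μ / p.2 ^ 5) ∧
      (∀ p ∈ Ω, dx (dx (dx (dx C))) p = 120 * μ / p.2 ^ 6) := by
  have e0 : ∀ p ∈ Ω, C p = μ / (p.2 + 0) ^ 2 := fun p hp => by rw [(hC p hp).2, add_zero]
  have ne : ∀ p ∈ Ω, p.2 + 0 ≠ 0 := fun p hp => by rw [add_zero]; exact (hC p hp).1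
  have step : ∀ (f : TX → ℝ) (c : ℝ) (n : ℕ), (∀ p ∈ Ω, f p = c / (p.2 + 0) ^ n) →
      ∀ p ∈ Ω, dx f p = -(n * c) / (p.2 + 0) ^ (n + 1) := fun f c n h p hp => by
    rw [dx_congr (eventuallyEq_of_eqOn hΩ hp h), dx_div_pow c 0 n (ne p hp)]
  have e1 := step _ _ _ e0
  have e2 := step _ _ _ e1
  have e3 := step _ _ _ e2
  have e4 := step _ _ _ e3
  refine ⟨fun p hp => (sm_div_pow μ 0 2 (ne p hp)).congr (eventuallyEq_of_eqOn hΩ hp e0),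
    fun p hp => ?_, fun p hp => ?_, fun p hp => ?_, fun p hp => ?_, fun p hp => ?_⟩
  · rw [dt_congr (eventuallyEq_of_eqOn hΩ hp e0), dt_div_pow μ 0 2 (ne p hp)]
  · rw [e1 p hp]; norm_num
  · rw [e2 p hp]; norm_num; ring
  · rw [e3 p hp]; norm_num; ring
  · rw [e4 p hp]; norm_num; ring

theorem dx_iterate_dt_eq_zero {Ω : Set TX} (hΩ : IsOpen Ω) {C : TX → ℝ}
    (ht : ∀ p ∈ Ω, dt C p = 0) : ∀ p ∈ Ω,
      dx (dt C) p = 0 ∧ dx (dx (dt C)) p = 0 ∧ dx (dx (dx (dt C))) p = 0 := by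
  have step : ∀ f : TX → ℝ, (∀ p ∈ Ω, f p = 0) → ∀ p ∈ Ω, dx f p = 0 := fun f hf p hp => by
    rw [dx_congr (eventuallyEq_of_eqOn hΩ hp hf), dx_const]
  exact fun p hp => ⟨step _ ht p hp, step _ (step _ ht) p hp, step _ (step _ (step _ ht)) p hp⟩

/-- For μ/x² the condition `third_x` reads ξ = τ_t x/2. Hence ξ carries no data of its own, and it
is enough to match the 2-jet of τ in t at one point. -/
theorem exists_poly_of_invSq {ε : ℝ} (hε : ε = 1 ∨ ε = -1) {Ω : Set TX} (hΩ : IsDom Ω) {C : TX → ℝ}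
    {μ : ℝ} (hμ : μ ≠ 0) (hC : ∀ p ∈ Ω, p.2 ≠ 0 ∧ C p = μ / p.2 ^ 2) {τ ξ ζ : TX → ℝ}
    (h : IsSymm ε Ω C τ ξ ζ) :
    ∃ a₀ a₁ a₂ a₃ : ℝ, ∀ p ∈ Ω, τ p = quad 0 a₁ (2 * a₂) 0 (8 * a₃) 0 0 p ∧
      ξ p = quad 0 0 0 a₂ 0 (4 * a₃) 0 p ∧
      ζ p = quad 0 a₀ (-(2 * a₃)) 0 0 0 (-(2 * ε * a₃)) p := by
  obtain ⟨p₀, hp₀⟩ := hΩ.2.nonempty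
  obtain ⟨sC, ht, h1, h2, h3, h4⟩ := derivs_invSq hΩ.1 hC
  have hξ : ∀ τ ξ ζ : TX → ℝ, IsSymm ε Ω C τ ξ ζ → ∀ p ∈ Ω, ξ p = 1 / 2 * dt τ p * p.2 := by
    intro τ ξ ζ h p hp
    have := h.third_x hε hp
    rw [h3 p hp, h4 p hp, (dx_iterate_dt_eq_zero hΩ.1 ht p hp).2.2] at this
    have hx := (hC p hp).1
    field_simp at this
    have h5 : 120 * μ ≠ 0 := mul_ne_zero (by norm_num) hμ
    apply mul_left_cancel₀ h5
    linear_combination 1 / 2 * this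
  obtain ⟨a₃, e₃⟩ : ∃ a₃ : ℝ, 8 * a₃ = dt (dt τ) p₀ := ⟨dt (dt τ) p₀ / 8, by ring⟩
  obtain ⟨a₂, e₂⟩ : ∃ a₂ : ℝ, 2 * a₂ + 8 * a₃ * p₀.1 = dt τ p₀ :=
    ⟨(dt τ p₀ - 8 * a₃ * p₀.1) / 2, by ring⟩
  obtain ⟨a₁, e₁⟩ : ∃ a₁ : ℝ, a₁ + 2 * a₂ * p₀.1 + 4 * a₃ * p₀.1 ^ 2 = τ p₀ :=
    ⟨τ p₀ - 2 * a₂ * p₀.1 - 4 * a₃ * p₀.1 ^ 2, by ring⟩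
  have hs := h.sub (isSymm_poly hε hΩ.1 h.sC 0 a₁ a₂ a₃ 0 0 ht fun p hp => by
    rw [h1 p hp, (hC p hp).2]
    have hx := (hC p hp).1
    field_simp
    ring)
  have hd : ∀ (f : TX → ℝ) (hf : ∀ p ∈ Ω, Sm f p) (c ct cx ctt ctx cxx : ℝ), ∀ p ∈ Ω,
      dt (fun q => f q - quad 0 c ct cx ctt ctx cxx q) p = dt f p - quad 0 ct ctt ctx 0 0 0 p := by
    intro f hf c ct cx ctt ctx cxx p hp
    rw [dt_sub (hf p hp).diff ((quad_contDiff ..).contDiffAt.differentiableAt (by simp)), dt_quad]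
  set τ' : TX → ℝ := fun q => τ q - quad 0 a₁ (2 * a₂) 0 (8 * a₃) 0 0 q with hτ'
  have k1 : dt τ' p₀ = 0 := by
    rw [hd τ h.sτ _ _ _ _ _ _ _ hp₀]; simp only [quad, Prod.fst_zero, Prod.snd_zero]; linarith
  have k2 : dt (dt τ') p₀ = 0 := by
    rw [dt_congr (eventuallyEq_of_eqOn hΩ.1 hp₀ (hd τ h.sτ _ _ _ _ _ _)),
      hd (dt τ) (fun p hp => (h.sτ p hp).dt) _ _ _ _ _ _ _ hp₀]
    simp only [quad, Prod.fst_zero, Prod.snd_zero]; linarith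
  have hξ' := hξ _ _ _ hs
  have h0 := hs.eq_zero hε hΩ hp₀ (by simp only [hτ', quad, Prod.fst_zero, Prod.snd_zero]; linarith)
    k1 k2 (by rw [hξ' p₀ hp₀, k1]; ring)
    (by rw [dt_congr (eventuallyEq_of_eqOn hΩ.1 hp₀ hξ'),
          dt_mul ((Sm.const _).mul (hs.sτ p₀ hp₀).dt).diff differentiableAt_snd,
          dt_const_mul _ (hs.sτ p₀ hp₀).dt.diff, k1, k2]
        ring)
  refine ⟨ζ p₀ - quad 0 0 (-(2 * a₃)) 0 0 0 (-(2 * ε * a₃)) p₀, a₁, a₂, a₃,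
    fun p hp => ⟨by linarith [(h0 p hp).1], ?_, ?_⟩⟩
  · have := (h0 p hp).2
    simp only [quad, Prod.fst_zero, Prod.snd_zero] at this ⊢; linarith
  · have := hs.ζ_const hε hΩ h0 hp hp₀
    simp only [quad, Prod.fst_zero, Prod.snd_zero] at this ⊢
    linarith

end

section

/-! ### Time-independent potentials with additional Lie symmetries -/

theorem dt_dx_eq_zero {Ω : Set TX} (hΩ : IsOpen Ω) {C : TX → ℝ} (sC : ∀ p ∈ Ω, Sm C p)
    (ht : ∀ p ∈ Ω, dt C p = 0) : ∀ p ∈ Ω, dt (dx C) p = 0 := fun p hp => by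
  rw [dt_dx_comm (sC p hp), dx_congr (eventuallyEq_of_eqOn hΩ hp ht), dx_const]

/-- Only an equality of values is available and `Ω` may have disconnected or complicated slices, so
the derivative is computed along a short segment in the t-direction, where C keeps the value `c
p.2`. -/
theorem dt_eq_zero_of_eq_snd {Ω : Set TX} (hΩ : IsOpen Ω) {C : TX → ℝ} (sC : ∀ p ∈ Ω, Sm C p)
    (hc : ∃ c : ℝ → ℝ, ∀ p ∈ Ω, C p = c p.2) : ∀ p ∈ Ω, dt C p = 0 := fun p hp => by
  obtain ⟨c, hc⟩ := hc
  have h1 : HasDerivAt (fun s : ℝ => ((p.1 + s, p.2) : TX)) (1, 0) 0 :=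
    ((hasDerivAt_id (0 : ℝ)).const_add p.1).prodMk (hasDerivAt_const _ _)
  have h0 : ((p.1 + 0, p.2) : TX) = p := by ext <;> simp
  have h2 := HasFDerivAt.comp_hasDerivAt (0 : ℝ) (l := C)
    (by rw [h0]; exact (sC p hp).diff.hasFDerivAt) h1
  have h3 : (C ∘ fun s : ℝ => ((p.1 + s, p.2) : TX)) =ᶠ[𝓝 0] fun _ => c p.2 := by
    have hm : ∀ᶠ s : ℝ in 𝓝 0, ((p.1 + s, p.2) : TX) ∈ Ω :=
      h1.continuousAt.eventually (by simp only [h0]; exact hΩ.mem_nhds hp)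
    filter_upwards [hm] with s hs
    exact hc _ hs
  exact (h2.congr_of_eventuallyEq h3.symm).unique (hasDerivAt_const _ _)

/-- A potential with vanishing third `x`-derivative that does not depend on `t` is quadratic. -/
theorem exists_quadratic {Ω : Set TX} (hΩ : IsDom Ω) {C : TX → ℝ} (sC : ∀ p ∈ Ω, Sm C p)
    (ht : ∀ p ∈ Ω, dt C p = 0) (h3 : ∀ p ∈ Ω, dx (dx (dx C)) p = 0) :
    ∃ α β γ : ℝ, ∀ p ∈ Ω, C p = α * p.2 ^ 2 + β * p.2 + γ := by
  obtain ⟨p₀, hp₀⟩ := hΩ.2.nonempty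
  have ht1 := dt_dx_eq_zero hΩ.1 sC ht
  have ht2 := dt_dx_eq_zero hΩ.1 (fun p hp => (sC p hp).dx) ht1
  have c2 : ∀ p ∈ Ω, dx (dx C) p = dx (dx C) p₀ := fun p hp =>
    eq_of_dt_dx_eq_zero hΩ (fun p hp => (sC p hp).dx.dx) ht2 h3 hp hp₀
  set a := dx (dx C) p₀
  have s2 : ∀ p : TX, Sm (fun q : TX => q.2) p := fun p => contDiffAt_snd
  have c1 : ∀ p ∈ Ω, dx C p - a * p.2 = dx C p₀ - a * p₀.2 := fun p hp => by
    refine eq_of_dt_dx_eq_zero hΩ (f := fun p => dx C p - a * p.2)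
      (fun p hp => (sC p hp).dx.sub ((Sm.const a).mul (s2 p))) (fun q hq => ?_) (fun q hq => ?_) hp hp₀
    · rw [dt_sub (sC q hq).dx.diff ((Sm.const a).mul (s2 q)).diff, dt_const_mul a (s2 q).diff, dt_snd,
        ht1 q hq]
      ring
    · rw [dx_sub (sC q hq).dx.diff ((Sm.const a).mul (s2 q)).diff, dx_const_mul a (s2 q).diff, dx_snd,
        c2 q hq]
      ring
  set b := dx C p₀ - a * p₀.2
  have c0 : ∀ p ∈ Ω, C p - (a / 2 * (p.2 * p.2) + b * p.2) =
      C p₀ - (a / 2 * (p₀.2 * p₀.2) + b * p₀.2) := fun p hp => by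
    have m1 : ∀ q, Sm (fun p : TX => a / 2 * (p.2 * p.2)) q :=
      fun q => (Sm.const _).mul ((s2 q).mul (s2 q))
    have m2 : ∀ q, Sm (fun p : TX => b * p.2) q := fun q => (Sm.const _).mul (s2 q)
    refine eq_of_dt_dx_eq_zero hΩ (f := fun p => C p - (a / 2 * (p.2 * p.2) + b * p.2))
      (fun p hp => (sC p hp).sub ((m1 p).add (m2 p))) (fun q hq => ?_) (fun q hq => ?_) hp hp₀
    · rw [dt_sub (sC q hq).diff ((m1 q).add (m2 q)).diff, dt_add (m1 q).diff (m2 q).diff,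
        dt_const_mul _ ((s2 q).mul (s2 q)).diff, dt_mul (s2 q).diff (s2 q).diff,
        dt_const_mul b (s2 q).diff, dt_snd, ht q hq]
      ring
    · rw [dx_sub (sC q hq).diff ((m1 q).add (m2 q)).diff, dx_add (m1 q).diff (m2 q).diff,
        dx_const_mul _ ((s2 q).mul (s2 q)).diff, dx_mul (s2 q).diff (s2 q).diff,
        dx_const_mul b (s2 q).diff, dx_snd]
      linarith [c1 q hq]
  exact ⟨a / 2, b, C p₀ - (a / 2 * (p₀.2 * p₀.2) + b * p₀.2), fun p hp => by linarith [c0 p hp]⟩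

/-- Propagation of a first-order linear relation along a domain, together with the constancy of a
function that follows from it. -/
theorem propagate {Ω : Set TX} (hΩ : IsDom Ω) {D G M c : TX → ℝ} {m : ℝ}
    (sD : ∀ p ∈ Ω, Sm D p) (sG : ∀ p ∈ Ω, Sm G p) (sM : ∀ p ∈ Ω, Sm M p)
    (hM : ∀ p ∈ Ω, M p = m → D p ≠ 0) (hc : ∀ p ∈ Ω, D p ≠ 0 → ContinuousAt c p)
    (tG : ∀ p ∈ Ω, dt G p = 0) (tM : ∀ p ∈ Ω, dt M p = 0)
    (xG : ∀ p ∈ Ω, D p ≠ 0 → dx G p = c p * G p) (xM : ∀ p ∈ Ω, G p = 0 → dx M p = 0)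
    {p₀ : TX} (hp₀ : p₀ ∈ Ω) (hG : G p₀ = 0) (hm : M p₀ = m) : ∀ p ∈ Ω, G p = 0 ∧ M p = m := by
  refine forall_of_clopen hΩ.2.isPreconnected hΩ.1 (fun p hp h => ?_) (fun p hp h => ?_) hp₀ ⟨hG, hm⟩
  -- The value of M keeps D away from zero near `p`. There G obeys a homogeneous linear first-order
  -- system and stays 0, and then the derivatives of M vanish too.
  · have hev : ∀ᶠ q in 𝓝 p, q ∈ Ω ∧ D q ≠ 0 :=
      Filter.Eventually.and (hΩ.1.mem_nhds hp) ((sD p hp).continuousAt.eventually_ne (hM p hp h.2))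
    obtain ⟨r, hr, hball⟩ := Metric.eventually_nhds_iff_ball.1 hev
    have hdom : IsDom (Metric.ball p r) :=
      ⟨Metric.isOpen_ball, ⟨p, Metric.mem_ball_self hr⟩, (convex_ball p r).isPreconnected⟩
    have hG0 : ∀ q ∈ Metric.ball p r, G q = 0 := fun q hq =>
      eq_zero_of_holonomic hdom (n := 1) (f := fun _ => G) (A := fun _ _ _ => 0) (B := fun _ _ => c)
        (fun _ q hq => sG q (hball q hq).1) (fun _ _ _ _ => continuousAt_const)
        (fun _ _ q hq => hc q (hball q hq).1 (hball q hq).2)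
        (fun _ q hq => by simp [tG q (hball q hq).1])
        (fun _ q hq => by simp [xG q (hball q hq).1 (hball q hq).2])
        (Metric.mem_ball_self hr) (fun _ => h.1) q hq 0
    refine Filter.eventually_of_mem (Metric.ball_mem_nhds p hr) fun q hq => ⟨hG0 q hq, ?_⟩
    rw [← h.2]
    exact eq_of_dt_dx_eq_zero hdom (fun q hq => sM q (hball q hq).1)
      (fun q hq => tM q (hball q hq).1) (fun q hq => xM q (hball q hq).1 (hG0 q hq)) hq
      (Metric.mem_ball_self hr)
  · constructor
    · by_contra hne
      obtain ⟨q, hq, hq'⟩ := (h.and_eventually ((sG p hp).continuousAt.eventually_ne hne)).exists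
      exact hq' hq.2.1
    · by_contra hne
      obtain ⟨q, hq, hq'⟩ := (h.and_eventually ((sM p hp).continuousAt.eventually_ne hne)).exists
      exact hq' hq.2.2

/-- Put D = C_xxx. The classifying condition is (5/2) τ_t D + ξ D_x = 0, and eliminating τ_t between
it and its x-derivative gives (5 D D_xx - 6 D_x²) ξ = 0. As ξ vanishes on no open set, 5 D D_xx = 6
D_x²; where D ≠ 0, this says that D^(-1/5) is affine in x. Thus D is zero, a nonzero constant, or m
(x+β)^(-5). The first alternative gives a quadratic C, the second contradicts the nontriviality of
the symmetry, and in the third the two expressions for the higher derivatives of ξ and τ give an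
Euler equation that leaves only the terms μ/(x+β)², α(x+β)² and γ. -/
theorem special_of_isSymm {ε : ℝ} (hε : ε = 1 ∨ ε = -1) {Ω : Set TX} (hΩ : IsDom Ω)
    {C τ ξ ζ : TX → ℝ} (h : IsSymm ε Ω C τ ξ ζ) (ht : ∀ p ∈ Ω, dt C p = 0)
    (hne : ∃ p ∈ Ω, ¬ (dt τ p = 0 ∧ ξ p = 0)) :
    (∃ α β γ μ : ℝ, μ ≠ 0 ∧ ∀ p ∈ Ω, C p = μ / (p.2 + β) ^ 2 + α * (p.2 + β) ^ 2 + γ) ∨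
    ∃ α β γ : ℝ, ∀ p ∈ Ω, C p = α * p.2 ^ 2 + β * p.2 + γ := by
  have sC := h.sC
  have ht0 := dx_iterate_dt_eq_zero hΩ.1 ht
  have ht1 := dt_dx_eq_zero hΩ.1 sC ht
  have ht2 := dt_dx_eq_zero hΩ.1 (fun p hp => (sC p hp).dx) ht1
  have ht3 := dt_dx_eq_zero hΩ.1 (fun p hp => (sC p hp).dx.dx) ht2
  have ht4 := dt_dx_eq_zero hΩ.1 (fun p hp => (sC p hp).dx.dx.dx) ht3
  -- no open subset on which the symmetry is trivial
  have hA : ∀ p ∈ Ω, ¬ ∀ᶠ q in 𝓝 p, ξ q = 0 := by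
    intro p hp hev
    have hξ0 : ξ =ᶠ[𝓝 p] fun _ => 0 := hev
    have hτ0 : dt τ =ᶠ[𝓝 p] fun _ => 0 := by
      filter_upwards [dx_eventuallyEq hξ0, hΩ.1.mem_nhds hp] with q hq hqΩ
      rw [h.dx_ξ hqΩ, dx_const] at hq
      linarith
    -- A constant multiple of ∂_t is a symmetry because C is stationary. Subtracting it removes the
    -- one jet coordinate, τ itself, that need not vanish at `p`.
    have hT : IsSymm ε Ω C (fun _ => τ p) (fun _ => 0) (fun _ => 0) :=
      ⟨hΩ.1, sC, fun _ _ => Sm.const _, fun _ _ => Sm.const _, fun _ _ => Sm.const _, fun q hq => by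
        unfold DetEqs
        have : dx (fun _ : TX => (0 : ℝ)) = fun _ => 0 := by ext; exact dx_const 0
        simp only [dt_const, dx_const, ht q hq, this]
        norm_num⟩
    have hs := h.sub hT
    have d1 : dt (fun q => τ q - τ p) =ᶠ[𝓝 p] fun _ => 0 := by
      filter_upwards [hτ0, hΩ.1.mem_nhds hp] with q hq hqΩ
      rw [dt_sub (h.sτ q hqΩ).diff (differentiableAt_const _), dt_const, hq, sub_zero]
    have d2 : (fun q => ξ q - 0) =ᶠ[𝓝 p] fun _ => 0 := by
      filter_upwards [hev] with q hq; simp [hq]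
    have h0 := hs.eq_zero hε hΩ hp (sub_self _) d1.eq_of_nhds
      (by rw [dt_congr d1, dt_const]) d2.eq_of_nhds (by rw [dt_congr d2, dt_const])
    obtain ⟨q, hq, hn⟩ := hne
    refine hn ⟨?_, by simpa using (h0 q hq).2⟩
    have : τ =ᶠ[𝓝 q] fun _ => τ p := eventuallyEq_of_eqOn hΩ.1 hq fun r hr => by
      have := (h0 r hr).1
      linarith
    rw [dt_congr this, dt_const]
  set D := dx (dx (dx C)) with hD
  have sD : ∀ p ∈ Ω, Sm D p := fun p hp => (sC p hp).dx.dx.dx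
  have e7 : ∀ p ∈ Ω, 5 / 2 * (dt τ p * D p) + ξ p * dx D p = 0 := fun p hp => by
    have := h.third_x hε hp
    rw [(ht0 p hp).2.2] at this
    linear_combination this
  have e8 : ∀ p ∈ Ω, 3 * dt τ p * dx D p + ξ p * dx (dx D) p = 0 := fun p hp => by
    have sτ := h.sτ p hp
    have sξ := h.sξ p hp
    have h1 := dx_congr (eventuallyEq_of_eqOn hΩ.1 hp e7)
    rw [dx_const, dx_add ((Sm.const _).mul (sτ.dt.mul (sD p hp))).diff (sξ.mul (sD p hp).dx).diff,
      dx_const_mul _ (sτ.dt.mul (sD p hp)).diff, dx_mul sτ.dt.diff (sD p hp).diff,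
      dx_mul sξ.diff (sD p hp).dx.diff, h.dx_dt_τ hp, h.dx_ξ hp] at h1
    linear_combination h1
  -- If the expression were nonzero at `p`, it would be so nearby, and ξ would vanish on a
  -- neighbourhood, contrary to `hA`.
  have hB : ∀ p ∈ Ω, 5 * D p * dx (dx D) p - 6 * dx D p ^ 2 = 0 := by
    intro p hp
    by_contra hn
    have sm : Sm (fun q => 5 * D q * dx (dx D) q - 6 * (dx D q * dx D q)) p :=
      (((Sm.const 5).mul (sD p hp)).mul (sD p hp).dx.dx).sub
        ((Sm.const 6).mul ((sD p hp).dx.mul (sD p hp).dx))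
    have hn' : 5 * D p * dx (dx D) p - 6 * (dx D p * dx D p) ≠ 0 := by rwa [← sq]
    refine hA p hp ?_
    filter_upwards [sm.continuousAt.eventually_ne hn', hΩ.1.mem_nhds hp] with q hq hqΩ
    have : (5 * D q * dx (dx D) q - 6 * (dx D q * dx D q)) * ξ q = 0 := by
      linear_combination 5 * D q * e8 q hqΩ - 6 * dx D q * e7 q hqΩ
    exact (mul_eq_zero.1 this).resolve_left hq
  by_cases hD0 : ∀ p ∈ Ω, D p = 0
  · exact Or.inr (exists_quadratic hΩ sC ht hD0)
  push Not at hD0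
  obtain ⟨p₁, hp₁, hD₁⟩ := hD0
  have hc : ∀ p ∈ Ω, D p ≠ 0 → ContinuousAt (fun q => 6 * dx D q / (5 * D q)) p := fun p hp hn =>
    (((Sm.const 6).mul (sD p hp).dx).div ((Sm.const 5).mul (sD p hp))
      (mul_ne_zero (by norm_num) hn)).continuousAt
  -- The alternative of constant D ≠ 0. Where D ≠ 0, D_xx = 6 D_x²/(5D) is a linear equation for
  -- D_x, so D_x = 0 spreads over Ω. Then `e7` gives τ_t = 0 and `dttt_τ` gives ξ D = 0, which
  -- contradicts `hA`.
  by_cases hD1 : dx D p₁ = 0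
  · exfalso
    have key := propagate hΩ sD (fun p hp => (sD p hp).dx) sD (m := D p₁)
      (fun p hp e => by rw [e]; exact hD₁) hc ht4 ht3
      (fun p hp hn => by
        have := hB p hp
        field_simp
        linarith)
      (fun p hp e => e) hp₁ hD1 rfl
    have hτ0 : ∀ p ∈ Ω, dt τ p = 0 := fun p hp => by
      have := e7 p hp
      rw [(key p hp).1, (key p hp).2] at this
      have h2 : dt τ p * D p₁ = 0 := by linarith
      exact (mul_eq_zero.1 h2).resolve_right hD₁
    refine hA p₁ hp₁ (Filter.eventually_of_mem (hΩ.1.mem_nhds hp₁) fun p hp => ?_)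
    have e6 := h.dttt_τ hε hp
    have z1 : ∀ q ∈ Ω, dt (dt τ) q = 0 := fun q hq => by
      rw [dt_congr (eventuallyEq_of_eqOn hΩ.1 hq hτ0), dt_const]
    rw [dt_congr (eventuallyEq_of_eqOn hΩ.1 hp z1), dt_const, hτ0 p hp, (ht0 p hp).2.1] at e6
    have h3 : (-4 * ε) * (ξ p * D p) = 0 := by linear_combination -e6
    rw [(key p hp).2] at h3
    have := eps_ne_zero hε
    simpa [this, hD₁] using h3
  -- The value of β for which (x+β) D_x + 5 D vanishes at p₁.
  set β := -5 * D p₁ / dx D p₁ - p₁.2 with hβ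
  have hy1 : p₁.2 + β = -5 * D p₁ / dx D p₁ := by rw [hβ]; ring
  have hy1ne : p₁.2 + β ≠ 0 := by
    rw [hy1]; exact div_ne_zero (mul_ne_zero (by norm_num) hD₁) hD1
  have sy : ∀ p, Sm (fun q : TX => q.2 + β) p := fun p => contDiffAt_snd.add contDiffAt_const
  have ty : ∀ p, dt (fun q : TX => q.2 + β) p = 0 := fun p => by
    rw [dt_add differentiableAt_snd (differentiableAt_const _), dt_snd, dt_const, add_zero]
  have xy : ∀ p, dx (fun q : TX => q.2 + β) p = 1 := fun p => by
    rw [dx_add differentiableAt_snd (differentiableAt_const _), dx_snd, dx_const, add_zero]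
  have sy5 : ∀ p, Sm (fun q : TX => (q.2 + β) ^ 5) p := fun p => ContDiffAt.pow (sy p) 5
  have ty5 : ∀ p, dt (fun q : TX => (q.2 + β) ^ 5) p = 0 := fun p => by
    rw [dt_comp_real (f := fun q : TX => q.2 + β) (F := fun y => y ^ 5) (by fun_prop) (sy p).diff,
      ty, mul_zero]
  have xy5 : ∀ p : TX, dx (fun q : TX => (q.2 + β) ^ 5) p = 5 * (p.2 + β) ^ 4 := fun p => by
    rw [dx_comp_real (f := fun q : TX => q.2 + β) (F := fun y => y ^ 5) (by fun_prop) (sy p).diff, xy]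
    simp
  -- The relation (x+β) D_x + 5 D = 0 spreads from p₁, and with it the constancy of D (x+β)^5; the
  -- nonzero constant keeps D from vanishing.
  have key := propagate hΩ sD (G := fun q => dx D q * (q.2 + β) + 5 * D q)
    (M := fun q => D q * (q.2 + β) ^ 5) (c := fun q => 6 * dx D q / (5 * D q))
    (m := D p₁ * (p₁.2 + β) ^ 5)
    (fun p hp => ((sD p hp).dx.mul (sy p)).add ((Sm.const 5).mul (sD p hp)))
    (fun p hp => (sD p hp).mul (sy5 p))
    (fun p hp e hn => by
      simp only [hn, zero_mul] at e
      exact (mul_ne_zero hD₁ (pow_ne_zero 5 hy1ne)) e.symm) hc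
    (fun p hp => by
      rw [dt_add ((sD p hp).dx.mul (sy p)).diff ((Sm.const 5).mul (sD p hp)).diff,
        dt_mul (sD p hp).dx.diff (sy p).diff, dt_const_mul 5 (sD p hp).diff, ty, ht3 p hp, ht4 p hp]
      ring)
    (fun p hp => by
      rw [dt_mul (sD p hp).diff (sy5 p).diff, ty5, ht3 p hp]; ring)
    (fun p hp hn => by
      rw [dx_add ((sD p hp).dx.mul (sy p)).diff ((Sm.const 5).mul (sD p hp)).diff,
        dx_mul (sD p hp).dx.diff (sy p).diff, dx_const_mul 5 (sD p hp).diff, xy]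
      have := hB p hp
      field_simp
      linear_combination (p.2 + β) * this)
    (fun p hp e => by
      rw [dx_mul (sD p hp).diff (sy5 p).diff, xy5]
      linear_combination (p.2 + β) ^ 4 * e) hp₁
    (by simp only [hy1]; field_simp; ring) rfl
  set m := D p₁ * (p₁.2 + β) ^ 5 with hm
  have hmne : m ≠ 0 := mul_ne_zero hD₁ (pow_ne_zero 5 hy1ne)
  have yne : ∀ p ∈ Ω, p.2 + β ≠ 0 := fun p hp h0 => by
    have := (key p hp).2
    rw [h0] at this
    simp at this
    exact hmne this.symm
  have Dne : ∀ p ∈ Ω, D p ≠ 0 := fun p hp h0 => by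
    have := (key p hp).2
    rw [h0, zero_mul] at this
    exact hmne this.symm
  have eξ : ∀ p ∈ Ω, ξ p = 1 / 2 * (dt τ p * (p.2 + β)) := fun p hp => by
    apply mul_left_cancel₀ (mul_ne_zero (by norm_num : (5 : ℝ) ≠ 0) (Dne p hp))
    linear_combination ξ p * (key p hp).1 - (p.2 + β) * e7 p hp
  -- the Euler-type equation
  have sH : ∀ p ∈ Ω, Sm (fun q => (q.2 + β) * ((q.2 + β) * D q) + 3 * ((q.2 + β) * dx (dx C) q)
      - 3 * dx C q) p := fun p hp =>
    (((sy p).mul ((sy p).mul (sD p hp))).add ((Sm.const 3).mul ((sy p).mul (sC p hp).dx.dx))).sub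
      ((Sm.const 3).mul (sC p hp).dx)
  have hH : ∀ p ∈ Ω, (p.2 + β) * ((p.2 + β) * D p) + 3 * ((p.2 + β) * dx (dx C) p)
      - 3 * dx C p = 0 := by
    -- The Euler expression has zero derivatives on Ω, so it is enough to evaluate it at one point.
    -- A point with τ_t ≠ 0 serves: there ξ = τ_t (x+β)/2 turns `dtt_ξ` and `dttt_τ` into two
    -- expressions for the same quantity.
    obtain ⟨p₂, hp₂, hτ₂⟩ : ∃ p₂ ∈ Ω, dt τ p₂ ≠ 0 := by
      by_contra! hall
      exact hA p₁ hp₁ (Filter.eventually_of_mem (hΩ.1.mem_nhds hp₁) fun p hp => by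
        rw [eξ p hp, hall p hp]; ring)
    have h2 : (p₂.2 + β) * ((p₂.2 + β) * D p₂) + 3 * ((p₂.2 + β) * dx (dx C) p₂)
        - 3 * dx C p₂ = 0 := by
      have e5 := h.dtt_ξ hε hp₂
      have e6 := h.dttt_τ hε hp₂
      have l1 : ∀ q ∈ Ω, dt ξ q = 1 / 2 * (dt (dt τ) q * (q.2 + β)) := fun q hq => by
        rw [dt_congr (eventuallyEq_of_eqOn hΩ.1 hq eξ),
          dt_const_mul _ ((h.sτ q hq).dt.mul (sy q)).diff,
          dt_mul (h.sτ q hq).dt.diff (sy q).diff, ty]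
        ring
      have l2 : dt (dt ξ) p₂ = 1 / 2 * (dt (dt (dt τ)) p₂ * (p₂.2 + β)) := by
        rw [dt_congr (eventuallyEq_of_eqOn hΩ.1 hp₂ l1),
          dt_const_mul _ ((h.sτ p₂ hp₂).dt.dt.mul (sy p₂)).diff,
          dt_mul (h.sτ p₂ hp₂).dt.dt.diff (sy p₂).diff, ty]
        ring
      rw [l2, e6, (ht0 p₂ hp₂).1, (ht0 p₂ hp₂).2.1, eξ p₂ hp₂] at e5
      apply mul_left_cancel₀ (mul_ne_zero (eps_ne_zero hε) hτ₂)
      linear_combination -e5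
    intro p hp
    rw [← h2]
    refine eq_of_dt_dx_eq_zero hΩ sH (fun q hq => ?_) (fun q hq => ?_) hp hp₂
    · have m1 := (sy q).mul ((sy q).mul (sD q hq))
      have m2 := (sy q).mul (sC q hq).dx.dx
      rw [dt_sub (m1.add ((Sm.const 3).mul m2)).diff ((Sm.const 3).mul (sC q hq).dx).diff,
        dt_add m1.diff ((Sm.const 3).mul m2).diff, dt_const_mul 3 m2.diff,
        dt_const_mul 3 (sC q hq).dx.diff, dt_mul (sy q).diff ((sy q).mul (sD q hq)).diff,
        dt_mul (sy q).diff (sD q hq).diff, dt_mul (sy q).diff (sC q hq).dx.dx.diff, ty, ht1 q hq,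
        ht2 q hq, ht3 q hq]
      ring
    · have m1 := (sy q).mul ((sy q).mul (sD q hq))
      have m2 := (sy q).mul (sC q hq).dx.dx
      rw [dx_sub (m1.add ((Sm.const 3).mul m2)).diff ((Sm.const 3).mul (sC q hq).dx).diff,
        dx_add m1.diff ((Sm.const 3).mul m2).diff, dx_const_mul 3 m2.diff,
        dx_const_mul 3 (sC q hq).dx.diff, dx_mul (sy q).diff ((sy q).mul (sD q hq)).diff,
        dx_mul (sy q).diff (sD q hq).diff, dx_mul (sy q).diff (sC q hq).dx.dx.diff, xy]
      linear_combination (q.2 + β) * (key q hq).1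
  -- Because the third derivative of μ/(x+β)² is -24μ/(x+β)^5.
  set μ := -m / 24 with hμ
  have d2 : ∀ p ∈ Ω, dx (dx C) p - 6 * μ / (p.2 + β) ^ 4 =
      dx (dx C) p₁ - 6 * μ / (p₁.2 + β) ^ 4 := fun p hp => by
    refine eq_of_dt_dx_eq_zero hΩ (f := fun p => dx (dx C) p - 6 * μ / (p.2 + β) ^ 4)
      (fun q hq => (sC q hq).dx.dx.sub (sm_div_pow _ _ _ (yne q hq))) (fun q hq => ?_)
      (fun q hq => ?_) hp hp₁
    · rw [dt_sub (sC q hq).dx.dx.diff (sm_div_pow _ _ _ (yne q hq)).diff, ht2 q hq,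
        dt_div_pow _ _ _ (yne q hq), sub_zero]
    · rw [dx_sub (sC q hq).dx.dx.diff (sm_div_pow _ _ _ (yne q hq)).diff,
        dx_div_pow _ _ _ (yne q hq)]
      have := yne q hq
      have k2 := (key q hq).2
      rw [hμ, ← k2, ← hD]
      field_simp
      push_cast
      ring
  obtain ⟨α, hα⟩ : ∃ α : ℝ, 2 * α = dx (dx C) p₁ - 6 * μ / (p₁.2 + β) ^ 4 :=
    ⟨(dx (dx C) p₁ - 6 * μ / (p₁.2 + β) ^ 4) / 2, by ring⟩
  have d1 : ∀ p ∈ Ω, dx C p = -2 * μ / (p.2 + β) ^ 3 + 2 * α * (p.2 + β) := fun p hp => by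
    have a1 := d2 p hp
    have a2 := hH p hp
    have a3 := (key p hp).2
    have hy := yne p hp
    rw [← hα] at a1
    have a4 : dx (dx C) p = 2 * α + 6 * μ / (p.2 + β) ^ 4 := by linarith
    have a5 : D p = -24 * μ / (p.2 + β) ^ 5 := by
      rw [eq_div_iff (pow_ne_zero 5 hy), a3, hμ]; ring
    rw [a4, a5] at a2
    have a6 : 3 * dx C p = (p.2 + β) * ((p.2 + β) * (-24 * μ / (p.2 + β) ^ 5)) +
      3 * ((p.2 + β) * (2 * α + 6 * μ / (p.2 + β) ^ 4)) := by linarith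
    apply mul_left_cancel₀ (by norm_num : (3 : ℝ) ≠ 0)
    rw [a6]
    field_simp
    ring
  refine Or.inl ⟨α, β, C p₁ - (μ / (p₁.2 + β) ^ 2 + α * ((p₁.2 + β) * (p₁.2 + β))), μ,
    div_ne_zero (neg_ne_zero.2 hmne) (by norm_num), fun p hp => ?_⟩
  have m1 : ∀ q, Sm (fun q : TX => α * ((q.2 + β) * (q.2 + β))) q := fun q =>
    (Sm.const _).mul ((sy q).mul (sy q))
  have d0 : C p - (μ / (p.2 + β) ^ 2 + α * ((p.2 + β) * (p.2 + β))) =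
      C p₁ - (μ / (p₁.2 + β) ^ 2 + α * ((p₁.2 + β) * (p₁.2 + β))) := by
    refine eq_of_dt_dx_eq_zero hΩ
      (f := fun p => C p - (μ / (p.2 + β) ^ 2 + α * ((p.2 + β) * (p.2 + β))))
      (fun q hq => (sC q hq).sub ((sm_div_pow _ _ _ (yne q hq)).add (m1 q))) (fun q hq => ?_)
      (fun q hq => ?_) hp hp₁
    · rw [dt_sub (sC q hq).diff ((sm_div_pow _ _ _ (yne q hq)).add (m1 q)).diff,
        dt_add (sm_div_pow _ _ _ (yne q hq)).diff (m1 q).diff, dt_div_pow _ _ _ (yne q hq),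
        dt_const_mul _ ((sy q).mul (sy q)).diff, dt_mul (sy q).diff (sy q).diff, ty, ht q hq]
      ring
    · rw [dx_sub (sC q hq).diff ((sm_div_pow _ _ _ (yne q hq)).add (m1 q)).diff,
        dx_add (sm_div_pow _ _ _ (yne q hq)).diff (m1 q).diff, dx_div_pow _ _ _ (yne q hq),
        dx_const_mul _ ((sy q).mul (sy q)).diff, dx_mul (sy q).diff (sy q).diff, xy, d1 q hq]
      push_cast
      ring
  linarith [d0]

end

section

/-! ### Point transformations between linear equations -/

/-- The derivative in the direction `v`. -/
def dv (v : TX) (f : TX → ℝ) (p : TX) : ℝ := fderiv ℝ f p v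

/-- The derivative of a function of `(t, x, u)` in the direction `v` of the `(t, x)`-plane. -/
def pv (v : TX) (F : TXU → ℝ) (z : TXU) : ℝ := fderiv ℝ F z (v, 0)

/-- The partial derivative of a function of `(t, x, u)` with respect to `u`. -/
def pu (F : TXU → ℝ) (z : TXU) : ℝ := fderiv ℝ F z (0, 1)

section Graph

variable {F : TXU → ℝ} {f : TX → ℝ} {p : TX} {v : TX}

theorem contDiffAt_pv {z : TXU} (hF : ContDiffAt ℝ ∞ F z) (v : TX) : ContDiffAt ℝ ∞ (pv v F) z :=
  (hF.fderiv_right (m := ∞) (by simp)).clm_apply contDiffAt_const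

theorem contDiffAt_pu {z : TXU} (hF : ContDiffAt ℝ ∞ F z) : ContDiffAt ℝ ∞ (pu F) z :=
  (hF.fderiv_right (m := ∞) (by simp)).clm_apply contDiffAt_const

theorem Sm.dv (hf : Sm f p) (v : TX) : Sm (dv v f) p :=
  (hf.fderiv_right (m := ∞) (by simp)).clm_apply contDiffAt_const

theorem sm_graph (hF : ContDiffAt ℝ ∞ F (p, f p)) (hf : Sm f p) : Sm (fun q => F (q, f q)) p :=
  ContDiffAt.comp p (f := fun q => (q, f q)) hF (contDiffAt_id.prodMk hf)

theorem dv_congr {g : TX → ℝ} (h : f =ᶠ[𝓝 p] g) : dv v f p = dv v g p := by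
  unfold dv; rw [h.fderiv_eq]

theorem dv_graph (hF : DifferentiableAt ℝ F (p, f p)) (hf : DifferentiableAt ℝ f p) :
    dv v (fun q => F (q, f q)) p = pv v F (p, f p) + pu F (p, f p) * dv v f p := by
  have h1 := hF.hasFDerivAt.comp p ((hasFDerivAt_id p).prodMk hf.hasFDerivAt)
  unfold dv pv pu
  rw [show (fun q => F (q, f q)) = F ∘ fun q => (id q, f q) from rfl, h1.fderiv,
    ContinuousLinearMap.comp_apply]
  have h2 : ((ContinuousLinearMap.id ℝ TX).prod (fderiv ℝ f p)) v =
      ((v, 0) : TXU) + fderiv ℝ f p v • ((0, 1) : TXU) := by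
    ext <;> simp
  rw [h2, map_add, map_smul, smul_eq_mul, mul_comm]

theorem eventually_dv_graph (hF : ContDiffAt ℝ ∞ F (p, f p)) (hf : Sm f p) :
    dv v (fun q => F (q, f q)) =ᶠ[𝓝 p]
      fun q => pv v F (q, f q) + pu F (q, f q) * dv v f q := by
  have h1 : ContDiffAt ℝ 1 F (p, f p) := hF.of_le (by exact_mod_cast le_top)
  have h2 : ∀ᶠ z in 𝓝 (p, f p), DifferentiableAt ℝ F z :=
    (h1.eventually (by simp)).mono fun z hz => hz.differentiableAt (by simp)
  have h3 : ContinuousAt (fun q => (q, f q)) p := continuousAt_id.prodMk hf.continuousAt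
  filter_upwards [h3.eventually h2, hf.eventually_diff] with q a1 a2 using dv_graph a1 a2

theorem dv_add {g : TX → ℝ} (hf : Sm f p) (hg : Sm g p) :
    dv v (fun q => f q + g q) p = dv v f p + dv v g p := by
  unfold dv; rw [fderiv_fun_add hf.diff hg.diff]; rfl

theorem dv_mul {g : TX → ℝ} (hf : Sm f p) (hg : Sm g p) :
    dv v (fun q => f q * g q) p = f p * dv v g p + dv v f p * g p := by
  unfold dv; rw [fderiv_fun_mul hf.diff hg.diff]; simp [mul_comm]

theorem dvv_graph (hF : ContDiffAt ℝ ∞ F (p, f p)) (hf : Sm f p) :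
    dv v (dv v fun q => F (q, f q)) p = pv v (pv v F) (p, f p) +
      (pu (pv v F) (p, f p) + pv v (pu F) (p, f p)) * dv v f p +
      pu (pu F) (p, f p) * dv v f p ^ 2 + pu F (p, f p) * dv v (dv v f) p := by
  have h1 := contDiffAt_pv hF v
  have h2 := contDiffAt_pu hF
  rw [dv_congr (eventually_dv_graph hF hf),
    dv_add (sm_graph h1 hf) ((sm_graph h2 hf).mul (hf.dv v)),
    dv_mul (sm_graph h2 hf) (hf.dv v), dv_graph (h1.differentiableAt (by simp)) hf.diff,
    dv_graph (h2.differentiableAt (by simp)) hf.diff]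
  ring

theorem dv_comp {d : TX → ℝ} {g : TX → TX} (hd : DifferentiableAt ℝ d (g p))
    (hg : DifferentiableAt ℝ g p) : dv v (fun q => d (g q)) p =
      dv v (fun q => (g q).1) p * dt d (g p) + dv v (fun q => (g q).2) p * dx d (g p) := by
  have := (hd.hasFDerivAt.comp p hg.hasFDerivAt).fderiv
  unfold dv; rw [show (fun q => d (g q)) = d ∘ g from rfl, this, ContinuousLinearMap.comp_apply,
    fderiv_apply_eq, fderiv_pair hg]

/-- At a critical point of `d` the second derivative transforms as a quadratic form, and a direction
that does not move the first coordinate of the image detects only d_xx. -/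
theorem dvv_comp_of_critical {d : TX → ℝ} {g : TX → TX} (hd : Sm d (g p)) (hg : ContDiffAt ℝ ∞ g p)
    (h1 : dt d (g p) = 0) (h2 : dx d (g p) = 0) (h3 : dv v (fun q => (g q).1) p = 0) :
    dv v (dv v fun q => d (g q)) p = dv v (fun q => (g q).2) p ^ 2 * dx (dx d) (g p) := by
  have hg1 : ∀ᶠ q in 𝓝 p, DifferentiableAt ℝ g q := by
    have h1 : ContDiffAt ℝ 1 g p := hg.of_le (by exact_mod_cast le_top)
    exact (h1.eventually (by simp)).mono fun q hq => hq.differentiableAt (by simp)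
  have hev : dv v (fun q => d (g q)) =ᶠ[𝓝 p] fun q =>
      dv v (fun q => (g q).1) q * dt d (g q) + dv v (fun q => (g q).2) q * dx d (g q) := by
    filter_upwards [hg1, hg.continuousAt.eventually hd.eventually_diff] with q a1 a2
      using dv_comp a2 a1
  have hT : Sm (fun q => (g q).1) p := contDiffAt_fst.comp p hg
  have hX : Sm (fun q => (g q).2) p := contDiffAt_snd.comp p hg
  rw [dv_congr hev, dv_add ((hT.dv v).mul (hd.dt.comp hg)) ((hX.dv v).mul (hd.dx.comp hg)),
    dv_mul (hT.dv v) (hd.dt.comp hg), dv_mul (hX.dv v) (hd.dx.comp hg),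
    dv_comp hd.dx.diff (hg.differentiableAt (by simp)), h1, h2, h3]
  ring

end Graph

/-- The determinant of the derivative of a map of the plane. -/
def jacobian (g : TX → TX) (p : TX) : ℝ :=
  dt (fun q => (g q).1) p * dx (fun q => (g q).2) p -
    dx (fun q => (g q).1) p * dt (fun q => (g q).2) p

theorem exists_hasFDerivAt_equiv {g : TX → TX} {p : TX} (hg : DifferentiableAt ℝ g p)
    (hJ : jacobian g p ≠ 0) : ∃ L : TX ≃L[ℝ] TX, HasFDerivAt g (L : TX →L[ℝ] TX) p := by
  have hinj : Function.Injective (fderiv ℝ g p : TX →ₗ[ℝ] TX) := by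
    rw [← LinearMap.ker_eq_bot, LinearMap.ker_eq_bot']
    intro v hv
    have h1 : fderiv ℝ g p v = 0 := hv
    rw [fderiv_pair hg, fderiv_apply_eq, fderiv_apply_eq] at h1
    have a1 := congrArg Prod.fst h1
    have a2 := congrArg Prod.snd h1
    simp only [Prod.fst_zero, Prod.snd_zero] at a1 a2
    unfold jacobian at hJ
    ext
    · apply mul_left_cancel₀ hJ
      simp only [Prod.fst_zero, mul_zero]
      linear_combination dx (fun q => (g q).2) p * a1 - dx (fun q => (g q).1) p * a2
    · apply mul_left_cancel₀ hJ
      simp only [Prod.snd_zero, mul_zero]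
      linear_combination dt (fun q => (g q).1) p * a2 - dt (fun q => (g q).2) p * a1
  refine ⟨(LinearEquiv.ofInjectiveEndo _ hinj).toContinuousLinearEquiv, ?_⟩
  refine hg.hasFDerivAt.congr_fderiv ?_
  ext <;> rfl

/-- The inverse function theorem: where the induced map of the plane is nondegenerate, the image of
a graph is again locally a graph. -/
theorem exists_factor {g : TX → TX} {V : TX → ℝ} {p : TX} (hg : ContDiffAt ℝ ∞ g p) (hV : Sm V p)
    (hJ : jacobian g p ≠ 0) :
    ∃ d : TX → ℝ, Sm d (g p) ∧ ∀ᶠ q in 𝓝 p, V q = d (g q) := by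
  obtain ⟨L, hL⟩ := exists_hasFDerivAt_equiv (hg.differentiableAt (by simp)) hJ
  have hs := hg.hasStrictFDerivAt' hL (by simp)
  refine ⟨fun q => V (hg.localInverse hL (by simp) q), ?_, ?_⟩
  · have h1 := hg.to_localInverse hL (by simp)
    have h2 : hg.localInverse hL (by simp) (g p) = p := hg.localInverse_apply_image hL (by simp)
    exact ContDiffAt.comp (g p) (by rw [h2]; exact hV) h1
  · have := hs.eventually_left_inverse
    filter_upwards [this] with q hq
    show V q = V (hs.localInverse g L p (g q))
    rw [hq]

end

/-! ### Point transformations between linear equations: the new time depends on t alone -/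

section

/-- `Φ` is a point transformation over `Ω` onto that over `Ω'` that maps the equation with the
coefficients `k` to the equation with the coefficients `k'`. -/
structure PointMap (Ω Ω' : Set TX) (Φ : PartialEquiv TXU TXU) (k k' : Coef) : Prop where
  op : IsOpen Ω
  op' : IsOpen Ω'
  diffeo : IsDiffeo Φ (Ω ×ˢ Set.univ) (Ω' ×ˢ Set.univ)
  mem : k ∈ Lin.S Ω
  mem' : k' ∈ Lin.S Ω'
  maps : Lin.MapsEq Ω Φ k k'

namespace PointMap

variable {Ω Ω' : Set TX} {Φ : PartialEquiv TXU TXU} {k k' : Coef} {p : TX} {z : TXU}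

/-- The `t`-component of a point transformation. -/
def ct (Φ : PartialEquiv TXU TXU) (z : TXU) : ℝ := (Φ z).1.1
/-- The `x`-component of a point transformation. -/
def cx (Φ : PartialEquiv TXU TXU) (z : TXU) : ℝ := (Φ z).1.2
/-- The `u`-component of a point transformation. -/
def cu (Φ : PartialEquiv TXU TXU) (z : TXU) : ℝ := (Φ z).2

theorem contDiffAt (H : PointMap Ω Ω' Φ k k') (hp : z.1 ∈ Ω) : ContDiffAt ℝ ∞ Φ z :=
  H.diffeo.2.2.1.contDiffAt ((H.op.prod isOpen_univ).mem_nhds ⟨hp, trivial⟩)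

theorem contDiffAt_ct (H : PointMap Ω Ω' Φ k k') (hp : z.1 ∈ Ω) : ContDiffAt ℝ ∞ (ct Φ) z :=
  (contDiffAt_fst.comp _ contDiffAt_fst).comp z (H.contDiffAt hp)
theorem contDiffAt_cx (H : PointMap Ω Ω' Φ k k') (hp : z.1 ∈ Ω) : ContDiffAt ℝ ∞ (cx Φ) z :=
  (contDiffAt_snd.comp _ contDiffAt_fst).comp z (H.contDiffAt hp)
theorem contDiffAt_cu (H : PointMap Ω Ω' Φ k k') (hp : z.1 ∈ Ω) : ContDiffAt ℝ ∞ (cu Φ) z :=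
  contDiffAt_snd.comp z (H.contDiffAt hp)

theorem mapsTo (H : PointMap Ω Ω' Φ k k') (hp : z.1 ∈ Ω) : (Φ z).1 ∈ Ω' := by
  have : Φ z ∈ Φ.target := Φ.map_source (by rw [H.diffeo.1]; exact ⟨hp, trivial⟩)
  rw [H.diffeo.2.1] at this
  exact this.1

theorem fderiv_eq (F : TXU → ℝ) (z v : TXU) :
    fderiv ℝ F z v = v.1.1 * pv (1, 0) F z + v.1.2 * pv (0, 1) F z + v.2 * pu F z := by
  have : v = v.1.1 • (((1, 0), 0) : TXU) + v.1.2 • (((0, 1), 0) : TXU) + v.2 • ((0, 1) : TXU) := by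
    ext <;> simp
  conv_lhs => rw [this, map_add, map_add, map_smul, map_smul, map_smul]
  rfl

theorem exists_preimage (H : PointMap Ω Ω' Φ k k') (hp : z.1 ∈ Ω) (y : TXU) : ∃ v : TXU,
    fderiv ℝ (ct Φ) z v = y.1.1 ∧ fderiv ℝ (cx Φ) z v = y.1.2 ∧ fderiv ℝ (cu Φ) z v = y.2 := by
  have hz : z ∈ Φ.source := by rw [H.diffeo.1]; exact ⟨hp, trivial⟩
  have hz' : Φ z ∈ Ω' ×ˢ (Set.univ : Set ℝ) := by rw [← H.diffeo.2.1]; exact Φ.map_source hz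
  have hop : (Ω' ×ˢ (Set.univ : Set ℝ)) ∈ 𝓝 (Φ z) := (H.op'.prod isOpen_univ).mem_nhds hz'
  have hs : HasFDerivAt Φ.symm (fderiv ℝ Φ.symm (Φ z)) (Φ z) :=
    ((H.diffeo.2.2.2.contDiffAt hop).differentiableAt (by simp)).hasFDerivAt
  have hd : HasFDerivAt Φ (fderiv ℝ Φ z) z :=
    ((H.contDiffAt hp).differentiableAt (by simp)).hasFDerivAt
  have hd' : HasFDerivAt Φ (fderiv ℝ Φ z) (Φ.symm (Φ z)) := by rwa [Φ.left_inv hz]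
  have hid : HasFDerivAt (Φ ∘ Φ.symm) (ContinuousLinearMap.id ℝ TXU) (Φ z) := by
    refine (hasFDerivAt_id _).congr_of_eventuallyEq ?_
    filter_upwards [hop] with q hq
    exact Φ.right_inv (by rwa [H.diffeo.2.1])
  have key := (hd'.comp _ hs).unique hid
  refine ⟨fderiv ℝ Φ.symm (Φ z) y, ?_⟩
  have h1 : fderiv ℝ Φ z (fderiv ℝ Φ.symm (Φ z) y) = y := by
    have := congrArg (fun A => A y) key
    simpa using this
  have e1 : fderiv ℝ (ct Φ) z = (ContinuousLinearMap.fst ℝ ℝ ℝ).comp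
      ((ContinuousLinearMap.fst ℝ TX ℝ).comp (fderiv ℝ Φ z)) :=
    (hd.fst.fst).fderiv
  have e2 : fderiv ℝ (cx Φ) z = (ContinuousLinearMap.snd ℝ ℝ ℝ).comp
      ((ContinuousLinearMap.fst ℝ TX ℝ).comp (fderiv ℝ Φ z)) :=
    (hd.fst.snd).fderiv
  have e3 : fderiv ℝ (cu Φ) z = (ContinuousLinearMap.snd ℝ TX ℝ).comp (fderiv ℝ Φ z) :=
    (hd.snd).fderiv
  rw [e1, e2, e3]
  simp [h1]

/-- The Jacobian of the map of the `(t, x)`-plane that `Φ` induces along a graph with the gradient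
`(mt, mx)`. -/
def jac (Φ : PartialEquiv TXU TXU) (z : TXU) (mt mx : ℝ) : ℝ :=
  (pv (1, 0) (ct Φ) z + pu (ct Φ) z * mt) * (pv (0, 1) (cx Φ) z + pu (cx Φ) z * mx) -
    (pv (0, 1) (ct Φ) z + pu (ct Φ) z * mx) * (pv (1, 0) (cx Φ) z + pu (cx Φ) z * mt)

theorem sm_image (H : PointMap Ω Ω' Φ k k') (hp : p ∈ Ω) {f : TX → ℝ} (hf : Sm f p) :
    ContDiffAt ℝ ∞ (fun q => (Φ (q, f q)).1) p :=
  contDiffAt_fst.comp p (ContDiffAt.comp p (f := fun q => (q, f q))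
    (H.contDiffAt (z := (p, f p)) hp) (contDiffAt_id.prodMk hf))

theorem exists_image (H : PointMap Ω Ω' Φ k k') (hp : p ∈ Ω) {f : TX → ℝ} (hf : Sm f p)
    (hJ : jac Φ (p, f p) (dt f p) (dx f p) ≠ 0) : ∃ f' : TX → ℝ, Sm f' (Φ (p, f p)).1 ∧
      (∀ᶠ q in 𝓝 p, cu Φ (q, f q) = f' (Φ (q, f q)).1) ∧
      (Lin.lhs k f p = 0 ↔ Lin.lhs k' f' (Φ (p, f p)).1 = 0) := by
  have hT := (H.contDiffAt_ct (z := (p, f p)) hp).differentiableAt (by simp)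
  have hX := (H.contDiffAt_cx (z := (p, f p)) hp).differentiableAt (by simp)
  obtain ⟨f', h1, h2⟩ := exists_factor (g := fun q => (Φ (q, f q)).1)
    (V := fun q => cu Φ (q, f q)) (p := p) (H.sm_image hp hf)
    (sm_graph (H.contDiffAt_cu hp) hf) (by
      have e1 := dv_graph (v := (1, 0)) hT hf.diff
      have e2 := dv_graph (v := (0, 1)) hT hf.diff
      have e3 := dv_graph (v := (1, 0)) hX hf.diff
      have e4 := dv_graph (v := (0, 1)) hX hf.diff
      change dv (1, 0) (fun q => ct Φ (q, f q)) p * dv (0, 1) (fun q => cx Φ (q, f q)) p -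
        dv (0, 1) (fun q => ct Φ (q, f q)) p * dv (1, 0) (fun q => cx Φ (q, f q)) p ≠ 0
      rw [e1, e2, e3, e4]
      exact hJ)
  exact ⟨f', h1, h2, H.maps p hp f f' hf h1 h2⟩

/-- Comparison of two solution jets with a common value. -/
theorem exists_difference (H : PointMap Ω Ω' Φ k k') (hp : p ∈ Ω) {f g : TX → ℝ} (hf : Sm f p)
    (hg : Sm g p) (hfg : g p = f p) (lf : Lin.lhs k f p = 0) (lg : Lin.lhs k g p = 0)
    (hJf : jac Φ (p, f p) (dt f p) (dx f p) ≠ 0) (hJg : jac Φ (p, f p) (dt g p) (dx g p) ≠ 0) :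
    ∃ d h : TX → ℝ, Sm d (Φ (p, f p)).1 ∧ Sm h (Φ (p, f p)).1 ∧
      Lin.lhs k' d (Φ (p, f p)).1 = 0 ∧
      d (Φ (p, f p)).1 = 0 ∧ (∀ᶠ q in 𝓝 p, cu Φ (q, f q) - h (Φ (q, f q)).1 = 0) ∧
      (∀ᶠ q in 𝓝 p, cu Φ (q, g q) - h (Φ (q, g q)).1 = d (Φ (q, g q)).1) ∧
      pu (fun z => cu Φ z - h (Φ z).1) (p, f p) ≠ 0 := by
  obtain ⟨f', sf, ef, mf⟩ := H.exists_image hp hf hJf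
  obtain ⟨g', sg, eg, mg⟩ := H.exists_image hp hg (by rwa [hfg])
  rw [hfg] at sg mg
  refine ⟨fun q => g' q - f' q, f', sg.sub sf, sf, ?_, ?_, ?_, ?_, ?_⟩
  · rw [Lin_lhs_sub sg sf, mf.1 lf, mg.1 lg, sub_zero]
  · have h1 := ef.self_of_nhds
    have h2 := eg.self_of_nhds
    rw [hfg] at h2
    simp only at h1 h2 ⊢
    rw [← h1, ← h2, sub_self]
  · filter_upwards [ef] with q hq; rw [hq, sub_self]
  · filter_upwards [eg] with q hq; rw [hq]
  -- The function F = cu - h∘(base) vanishes along the graph of f, so F_u = 0 would make its whole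
  -- differential vanish at the point. But the differential of Φ is onto, and a vector moving only ũ
  -- changes F.
  · intro h0
    have hG : ContDiffAt ℝ ∞ (fun z => (Φ z).1) (p, f p) :=
      contDiffAt_fst.comp _ (H.contDiffAt (z := (p, f p)) hp)
    have hF : ContDiffAt ℝ ∞ (fun z => cu Φ z - f' (Φ z).1) (p, f p) :=
      (H.contDiffAt_cu hp).sub (ContDiffAt.comp (p, f p) sf hG)
    have hzero : ∀ v, pv v (fun z => cu Φ z - f' (Φ z).1) (p, f p) = 0 := by
      intro v
      have h1 := dv_graph (v := v) (hF.differentiableAt (by simp)) hf.diff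
      rw [h0, zero_mul, add_zero] at h1
      rw [← h1, dv_congr (g := fun _ => 0) (by filter_upwards [ef] with q hq; rw [hq, sub_self])]
      simp [dv]
    obtain ⟨v, v1, v2, v3⟩ := H.exists_preimage (z := (p, f p)) hp ((0, 0), 1)
    have h2 : fderiv ℝ (fun z => cu Φ z - f' (Φ z).1) (p, f p) v = 0 := by
      rw [fderiv_eq, h0, hzero, hzero]; ring
    have hd : HasFDerivAt Φ (fderiv ℝ Φ (p, f p)) (p, f p) :=
      ((H.contDiffAt (z := (p, f p)) hp).differentiableAt (by simp)).hasFDerivAt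
    have h3 : fderiv ℝ (fun z => f' (Φ z).1) (p, f p) v = 0 := by
      have := (sf.diff.hasFDerivAt.comp (p, f p) hd.fst).fderiv
      rw [show (fun z => f' (Φ z).1) = f' ∘ fun z => (Φ z).1 from rfl, this,
        ContinuousLinearMap.comp_apply, fderiv_apply_eq]
      have e1 : fderiv ℝ (ct Φ) (p, f p) = (ContinuousLinearMap.fst ℝ ℝ ℝ).comp
        ((ContinuousLinearMap.fst ℝ TX ℝ).comp (fderiv ℝ Φ (p, f p))) := (hd.fst.fst).fderiv
      have e2 : fderiv ℝ (cx Φ) (p, f p) = (ContinuousLinearMap.snd ℝ ℝ ℝ).comp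
        ((ContinuousLinearMap.fst ℝ TX ℝ).comp (fderiv ℝ Φ (p, f p))) := (hd.fst.snd).fderiv
      rw [e1] at v1
      rw [e2] at v2
      simp only [ContinuousLinearMap.comp_apply, ContinuousLinearMap.coe_fst',
        ContinuousLinearMap.coe_snd'] at v1 v2 ⊢
      rw [v1, v2]; ring
    have hc : ContDiffAt ℝ ∞ (fun z => f' (Φ z).1) (p, f p) := ContDiffAt.comp (p, f p) sf hG
    rw [fderiv_fun_sub ((H.contDiffAt_cu hp).differentiableAt (by simp))
      (hc.differentiableAt (by simp)), sub_apply] at h2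
    rw [h3, v3] at h2
    norm_num at h2

theorem contDiffAt_sub_comp (H : PointMap Ω Ω' Φ k k') (hp : p ∈ Ω) {u : ℝ} {h : TX → ℝ}
    (hh : Sm h (Φ (p, u)).1) : ContDiffAt ℝ ∞ (fun z => cu Φ z - h (Φ z).1) (p, u) :=
  (H.contDiffAt_cu hp).sub (ContDiffAt.comp (p, u) hh
    (contDiffAt_fst.comp _ (H.contDiffAt (z := (p, u)) hp)))

theorem dvv_quad (v : TX) (c ct cx ctt ctx cxx : ℝ) :
    dv v (dv v (quad p c ct cx ctt ctx cxx)) p = v.1 ^ 2 * ctt + 2 * v.1 * v.2 * ctx +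
      v.2 ^ 2 * cxx := by
  have h1 : dv v (quad p c ct cx ctt ctx cxx) = fun q =>
      v.1 * quad p ct ctt ctx 0 0 0 q + v.2 * quad p cx ctx cxx 0 0 0 q := by
    ext q; rw [dv, fderiv_apply_eq, dt_quad, dx_quad]
  have s1 := (quad_contDiff (p := p) (c := ct) (ct := ctt) (cx := ctx) (ctt := 0) (ctx := 0)
    (cxx := 0)).contDiffAt (x := p)
  have s2 := (quad_contDiff (p := p) (c := cx) (ct := ctx) (cx := cxx) (ctt := 0) (ctx := 0)
    (cxx := 0)).contDiffAt (x := p)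
  rw [h1, dv_add ((Sm.const _).mul s1) ((Sm.const _).mul s2), dv_mul (Sm.const _) s1,
    dv_mul (Sm.const _) s2]
  simp only [dv, fderiv_apply_eq, dt_quad, dx_quad, quad_self, dt_const, dx_const]
  ring

/-- Two quadratic solution jets that differ only in f_tt, a coordinate absent from the equation, are
compared. The difference d of their images solves the target equation and has zero 1-jet, hence d_xx
= 0. Differentiating twice along the direction in which the new time is stationary gives F_u · (D_x
T)² = 0, where D_x T is the total derivative. -/
theorem dx_ct_add (H : PointMap Ω Ω' Φ k k') (hp : p ∈ Ω) (u mt mx : ℝ)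
    (hJ : jac Φ (p, u) mt mx ≠ 0) :
    pv (0, 1) (ct Φ) (p, u) + pu (ct Φ) (p, u) * mx = 0 := by
  have hk1 : (k p).1 ≠ 0 := H.mem.2 p hp
  set s := (mt - (k p).2.1 * mx - (k p).2.2 * u) / (k p).1 with hs
  have hs' : (k p).1 * s = mt - (k p).2.1 * mx - (k p).2.2 * u := by rw [hs]; field_simp
  set f := quad p u mt mx 0 0 s with hf
  set g := quad p u mt mx 1 0 s with hg
  have sf : Sm f p := (quad_contDiff ..).contDiffAt
  have sg : Sm g p := (quad_contDiff ..).contDiffAt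
  have fp : f p = u := quad_self ..
  have gp : g p = u := quad_self ..
  have vf : ∀ v : TX, dv v f p = v.1 * mt + v.2 * mx := fun v => by
    rw [dv, fderiv_apply_eq, hf, dt_quad, dx_quad, quad_self, quad_self]
  have vg : ∀ v : TX, dv v g p = v.1 * mt + v.2 * mx := fun v => by
    rw [dv, fderiv_apply_eq, hg, dt_quad, dx_quad, quad_self, quad_self]
  have ft : dt f p = mt := by rw [hf, dt_quad, quad_self]
  have fx : dx f p = mx := by rw [hf, dx_quad, quad_self]
  have gt : dt g p = mt := by rw [hg, dt_quad, quad_self]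
  have gx : dx g p = mx := by rw [hg, dx_quad, quad_self]
  obtain ⟨d, h, sd, sh, ld, d0, ef, eg, hne⟩ := H.exists_difference hp sf sg (gp.trans fp.symm)
    (by rw [hf, Lin_lhs_quad]; linarith) (by rw [hg, Lin_lhs_quad]; linarith)
    (by rw [fp, ft, fx]; exact hJ) (by rw [fp, gt, gx]; exact hJ)
  rw [fp] at sd sh ld d0 hne
  have hF := H.contDiffAt_sub_comp hp sh
  set F := fun z => cu Φ z - h (Φ z).1 with hFdef
  have hFf : ContDiffAt ℝ ∞ F (p, f p) := by rw [fp]; exact hF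
  have hFg : ContDiffAt ℝ ∞ F (p, g p) := by rw [gp]; exact hF
  have sG : ContDiffAt ℝ ∞ (fun q => (Φ (q, g q)).1) p := H.sm_image hp sg
  have z1 : ∀ v, dv v (fun q => F (q, f q)) p = 0 := fun v => by
    rw [dv_congr (g := fun _ => 0) ef]; simp [dv]
  have z2 : ∀ v, dv v (dv v fun q => F (q, f q)) p = 0 := fun v => by
    have : dv v (fun q => F (q, f q)) =ᶠ[𝓝 p] fun _ => 0 := by
      filter_upwards [ef.eventually_nhds] with q hq
      rw [dv_congr (g := fun _ => 0) hq]; simp [dv]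
    rw [dv_congr this]; simp [dv]
  have sd' : Sm d (Φ (p, g p)).1 := by rw [gp]; exact sd
  have hTd := (H.contDiffAt_ct (z := (p, g p)) hp).differentiableAt (by simp)
  have hXd := (H.contDiffAt_cx (z := (p, g p)) hp).differentiableAt (by simp)
  have eT : ∀ v : TX, dv v (fun q => (Φ (q, g q)).1.1) p = v.1 * (pv (1, 0) (ct Φ) (p, u) +
      pu (ct Φ) (p, u) * mt) + v.2 * (pv (0, 1) (ct Φ) (p, u) + pu (ct Φ) (p, u) * mx) := by
    intro v
    have := dv_graph (v := v) hTd sg.diff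
    rw [show (fun q => (Φ (q, g q)).1.1) = fun q => ct Φ (q, g q) from rfl, this, gp, vg]
    have := fderiv_eq (ct Φ) (p, u) (v, 0)
    rw [pv, this]; ring
  have eX : ∀ v : TX, dv v (fun q => (Φ (q, g q)).1.2) p = v.1 * (pv (1, 0) (cx Φ) (p, u) +
      pu (cx Φ) (p, u) * mt) + v.2 * (pv (0, 1) (cx Φ) (p, u) + pu (cx Φ) (p, u) * mx) := by
    intro v
    have := dv_graph (v := v) hXd sg.diff
    rw [show (fun q => (Φ (q, g q)).1.2) = fun q => cx Φ (q, g q) from rfl, this, gp, vg]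
    have := fderiv_eq (cx Φ) (p, u) (v, 0)
    rw [pv, this]; ring
  have first : ∀ v : TX, dv v (fun q => d (Φ (q, g q)).1) p = 0 := by
    intro v
    rw [← dv_congr eg]
    have a1 := dv_graph (v := v) (hFg.differentiableAt (by simp)) sg.diff
    have a2 := dv_graph (v := v) (hFf.differentiableAt (by simp)) sf.diff
    rw [gp, vg] at a1
    rw [fp, vf, z1] at a2
    rw [a1, a2]
  have crit : dt d (Φ (p, u)).1 = 0 ∧ dx d (Φ (p, u)).1 = 0 := by
    have b1 := dv_comp (v := (1, 0)) sd'.diff (sG.differentiableAt (by simp))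
    have b2 := dv_comp (v := (0, 1)) sd'.diff (sG.differentiableAt (by simp))
    rw [first, eT, eX, gp] at b1 b2
    simp only [one_mul, zero_mul, add_zero, zero_add] at b1 b2
    unfold jac at hJ
    constructor
    · apply mul_left_cancel₀ hJ
      linear_combination (-(pv (0, 1) (cx Φ) (p, u) + pu (cx Φ) (p, u) * mx)) * b1 +
        (pv (1, 0) (cx Φ) (p, u) + pu (cx Φ) (p, u) * mt) * b2
    · apply mul_left_cancel₀ hJ
      linear_combination ((pv (0, 1) (ct Φ) (p, u) + pu (ct Φ) (p, u) * mx)) * b1 -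
        (pv (1, 0) (ct Φ) (p, u) + pu (ct Φ) (p, u) * mt) * b2
  have hdxx : dx (dx d) (Φ (p, u)).1 = 0 := by
    rw [Lin_lhs, crit.1, crit.2, d0] at ld
    have : (k' (Φ (p, u)).1).1 ≠ 0 := H.mem'.2 _ (H.mapsTo hp)
    have h3 : (k' (Φ (p, u)).1).1 * dx (dx d) (Φ (p, u)).1 = 0 := by linarith
    exact (mul_eq_zero.1 h3).resolve_left this
  set a := pv (1, 0) (ct Φ) (p, u) + pu (ct Φ) (p, u) * mt
  set b := pv (0, 1) (ct Φ) (p, u) + pu (ct Φ) (p, u) * mx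
  -- The direction along which the total derivative of the new time vanishes; its t-component is
  -- minus the quantity to be shown zero.
  set v : TX := (-b, a) with hv
  have hvT : dv v (fun q => (Φ (q, g q)).1.1) p = 0 := by rw [eT, hv]; ring
  have c1 := dvv_comp_of_critical (v := v) (p := p) (g := fun q => (Φ (q, g q)).1) sd' sG
    (by rw [gp]; exact crit.1) (by rw [gp]; exact crit.2) hvT
  have eg2 : dv v (fun q => F (q, g q)) =ᶠ[𝓝 p] dv v (fun q => d (Φ (q, g q)).1) := by
    filter_upwards [eg.eventually_nhds] with q hq using dv_congr hq
  have c2 := dvv_graph (v := v) hFg sg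
  have c3 := dvv_graph (v := v) hFf sf
  rw [dv_congr eg2, c1, gp, vg, hdxx, hg, dvv_quad] at c2
  rw [z2, fp, vf, hf, dvv_quad] at c3
  have h4 : pu F (p, u) * b ^ 2 = 0 := by
    simp only [hv] at c2 c3
    linear_combination c3 - c2
  simpa using (mul_eq_zero.1 h4).resolve_left hne

/-- The total derivative T_x + T_u m vanishes for all slopes where the Jacobian is nonzero. The
Jacobian is affine in the slopes and not identically zero, so two suitable slopes m separate T_x
from T_u. -/
theorem pv_ct_eq_zero (H : PointMap Ω Ω' Φ k k') (hp : p ∈ Ω) (u : ℝ) :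
    pv (0, 1) (ct Φ) (p, u) = 0 ∧ pu (ct Φ) (p, u) = 0 ∧ pv (1, 0) (ct Φ) (p, u) ≠ 0 := by
  obtain ⟨y, y1, y2, -⟩ := H.exists_preimage (z := (p, u)) hp ((1, 0), 0)
  obtain ⟨w, w1, w2, -⟩ := H.exists_preimage (z := (p, u)) hp ((0, 1), 0)
  rw [fderiv_eq] at y1 y2 w1 w2
  have key := fun mt mx => H.dx_ct_add hp u mt mx
  unfold jac at key
  generalize pv (1, 0) (ct Φ) (p, u) = Tt at *
  generalize pv (0, 1) (ct Φ) (p, u) = Tx at *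
  generalize pu (ct Φ) (p, u) = Tu at *
  generalize pv (1, 0) (cx Φ) (p, u) = Xt at *
  generalize pv (0, 1) (cx Φ) (p, u) = Xx at *
  generalize pu (cx Φ) (p, u) = Xu at *
  simp only at y1 y2 w1 w2
  have h3 : Tx = 0 ∧ Tu = 0 := by
    have k' : ∀ mt mx, (Tt * Xx - Tx * Xt) + mt * (Tu * Xx - Tx * Xu) + mx * (Tt * Xu - Tu * Xt) ≠ 0
        → Tx + Tu * mx = 0 := fun mt mx h => key mt mx fun h0 => h (by linarith)
    -- The Cauchy-Binet formula for the 2×3 matrix of derivatives of (T, X) and a right inverse of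
    -- it: the three minors cannot all vanish.
    have hdet : (Tt * Xx - Tx * Xt) * (y.1.1 * w.1.2 - y.1.2 * w.1.1) +
        (Tu * Xx - Tx * Xu) * (y.2 * w.1.2 - y.1.2 * w.2) +
        (Tt * Xu - Tu * Xt) * (y.1.1 * w.2 - y.2 * w.1.1) = 1 := by
      linear_combination y1 * (w.1.1 * Xt + w.1.2 * Xx + w.2 * Xu) + w2 -
        w1 * (y.1.1 * Xt + y.1.2 * Xx + y.2 * Xu)
    generalize (Tt * Xx - Tx * Xt) = A at *
    generalize (Tu * Xx - Tx * Xu) = B at *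
    generalize (Tt * Xu - Tu * Xt) = D at *
    by_cases hA : A = 0
    · by_cases hB : B = 0
      · have hD : D ≠ 0 := by rintro rfl; simp [hA, hB] at hdet
        have h1 := k' 0 1 (by simpa [hA] using hD)
        have h2 := k' 0 2 (by simpa [hA] using hD)
        constructor <;> linarith
      · have h1 := k' 1 0 (by simpa [hA] using hB)
        by_cases h5 : B + D = 0
        · have h2 := k' (-1) 1 (by rw [hA]; intro h6; apply hB; linarith)
          constructor <;> linarith
        · have h2 := k' 1 1 (by rw [hA]; intro h6; apply h5; linarith)
          constructor <;> linarith
    · have h1 := k' 0 0 (by simpa using hA)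
      by_cases h5 : A + D = 0
      · have h2 := k' 0 (-1) (by intro h6; apply hA; linarith)
        constructor <;> linarith
      · have h2 := k' 0 1 (by intro h6; apply h5; linarith)
        constructor <;> linarith
  refine ⟨h3.1, h3.2, ?_⟩
  rintro rfl
  rw [h3.1, h3.2] at y1
  norm_num at y1

end PointMap

end

/-! ### Point transformations between linear equations: projectability to (t, x) and affinity in u
-/

section

namespace PointMap

variable {Ω Ω' : Set TX} {Φ : PartialEquiv TXU TXU} {k k' : Coef} {p : TX} {z : TXU}

theorem jac_eq (H : PointMap Ω Ω' Φ k k') (hp : p ∈ Ω) (u mt mx : ℝ) :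
    jac Φ (p, u) mt mx = pv (1, 0) (ct Φ) (p, u) *
      (pv (0, 1) (cx Φ) (p, u) + pu (cx Φ) (p, u) * mx) := by
  obtain ⟨h1, h2, -⟩ := H.pv_ct_eq_zero hp u
  rw [jac, h1, h2]; ring

theorem dx_ct_graph (H : PointMap Ω Ω' Φ k k') (hp : p ∈ Ω) {g : TX → ℝ} (hg : Sm g p) :
    dx (fun q => (Φ (q, g q)).1.1) p = 0 := by
  have := dv_graph (v := (0, 1)) ((H.contDiffAt_ct (z := (p, g p)) hp).differentiableAt (by simp))
    hg.diff
  obtain ⟨h1, h2, -⟩ := H.pv_ct_eq_zero hp (g p)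
  rw [h1, h2, zero_mul, add_zero] at this
  exact this

/-- Comparison of two solution jets whose images differ in second order in `x`. -/
theorem sq_eq (H : PointMap Ω Ω' Φ k k') (hp : p ∈ Ω) (u mx : ℝ)
    (hJ : pv (0, 1) (cx Φ) (p, u) + pu (cx Φ) (p, u) * mx ≠ 0) :
    (k p).1 * (pv (0, 1) (cx Φ) (p, u) + pu (cx Φ) (p, u) * mx) ^ 2 =
      (k' (Φ (p, u)).1).1 * pv (1, 0) (ct Φ) (p, u) := by
  set f := quad p u ((k p).2.1 * mx + (k p).2.2 * u) mx 0 0 0 with hf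
  -- The second jet raises f_xx by 1 and f_t by the leading coefficient, so both jets solve the
  -- equation. Comparing their images determines d_t and d_xx, and the target equation for d relates
  -- them.
  set g := quad p u ((k p).2.1 * mx + (k p).2.2 * u + (k p).1) mx 0 0 1 with hg
  have sf : Sm f p := (quad_contDiff ..).contDiffAt
  have sg : Sm g p := (quad_contDiff ..).contDiffAt
  have sg' : ∀ q, Sm g q := fun q => (quad_contDiff ..).contDiffAt
  have fp : f p = u := quad_self ..
  have gp : g p = u := quad_self ..
  have hTt := (H.pv_ct_eq_zero hp u).2.2
  have fx : dx f p = mx := by rw [hf, dx_quad, quad_self]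
  have gx : dx g p = mx := by rw [hg, dx_quad, quad_self]
  have ft : dt f p = (k p).2.1 * mx + (k p).2.2 * u := by rw [hf, dt_quad, quad_self]
  have gt : dt g p = (k p).2.1 * mx + (k p).2.2 * u + (k p).1 := by rw [hg, dt_quad, quad_self]
  have fxx : dx (dx f) p = 0 := by rw [hf, dx_quad, dx_quad, quad_self]
  have gxx : dx (dx g) p = 1 := by rw [hg, dx_quad, dx_quad, quad_self]
  obtain ⟨d, h, sd, sh, ld, d0, ef, eg, hne⟩ := H.exists_difference hp sf sg (gp.trans fp.symm)
    (by rw [hf, Lin_lhs_quad]; ring) (by rw [hg, Lin_lhs_quad]; ring)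
    (by rw [fp, fx, H.jac_eq hp]; exact mul_ne_zero hTt hJ)
    (by rw [fp, gx, H.jac_eq hp]; exact mul_ne_zero hTt hJ)
  rw [fp] at sd sh ld d0 hne
  have hF := H.contDiffAt_sub_comp hp sh
  set F := fun z => cu Φ z - h (Φ z).1 with hFdef
  have hFf : ContDiffAt ℝ ∞ F (p, f p) := by rw [fp]; exact hF
  have hFg : ContDiffAt ℝ ∞ F (p, g p) := by rw [gp]; exact hF
  have sG : ContDiffAt ℝ ∞ (fun q => (Φ (q, g q)).1) p := H.sm_image hp sg
  have z1 : ∀ v, dv v (fun q => F (q, f q)) p = 0 := fun v => by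
    rw [dv_congr (g := fun _ => 0) ef]; simp [dv]
  have z2 : ∀ v, dv v (dv v fun q => F (q, f q)) p = 0 := fun v => by
    have : dv v (fun q => F (q, f q)) =ᶠ[𝓝 p] fun _ => 0 := by
      filter_upwards [ef.eventually_nhds] with q hq
      rw [dv_congr (g := fun _ => 0) hq]; simp [dv]
    rw [dv_congr this]; simp [dv]
  have sd' : Sm d (Φ (p, g p)).1 := by rw [gp]; exact sd
  have hTd := (H.contDiffAt_ct (z := (p, g p)) hp).differentiableAt (by simp)
  have hXd := (H.contDiffAt_cx (z := (p, g p)) hp).differentiableAt (by simp)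
  have Tx : dx (fun q => (Φ (q, g q)).1.1) p = 0 := H.dx_ct_graph hp sg
  have Txx : dx (dx fun q => (Φ (q, g q)).1.1) p = 0 := by
    rw [dx_congr (eventuallyEq_of_eqOn H.op hp fun q hq => H.dx_ct_graph hq (sg' q)), dx_const]
  have Tt : dt (fun q => (Φ (q, g q)).1.1) p = pv (1, 0) (ct Φ) (p, u) := by
    have := dv_graph (v := (1, 0)) hTd sg.diff
    rw [gp, (H.pv_ct_eq_zero hp u).2.1, zero_mul, add_zero] at this
    exact this
  have Xx : dx (fun q => (Φ (q, g q)).1.2) p =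
      pv (0, 1) (cx Φ) (p, u) + pu (cx Φ) (p, u) * mx := by
    have := dv_graph (v := (0, 1)) hXd sg.diff
    rw [gp, show dv (0, 1) g p = mx from gx] at this
    exact this
  have first : ∀ v : TX, dv v (fun q => d (Φ (q, g q)).1) p =
      pu F (p, u) * (dv v g p - dv v f p) := by
    intro v
    rw [← dv_congr eg]
    have a1 := dv_graph (v := v) (hFg.differentiableAt (by simp)) sg.diff
    have a2 := dv_graph (v := v) (hFf.differentiableAt (by simp)) sf.diff
    rw [gp] at a1
    rw [fp, z1] at a2
    rw [a1]; linear_combination -a2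
  have ddx : dx d (Φ (p, u)).1 = 0 := by
    have b2 := dx_comp sd'.diff (sG.differentiableAt (by simp))
    have b3 := first (0, 1)
    change dx (fun q => d (Φ (q, g q)).1) p = pu F (p, u) * (dx g p - dx f p) at b3
    rw [b3, Tx, Xx, gp, fx, gx, sub_self, mul_zero, zero_mul, zero_add] at b2
    exact (mul_eq_zero.1 b2.symm).resolve_left hJ
  have ddt : pv (1, 0) (ct Φ) (p, u) * dt d (Φ (p, u)).1 = pu F (p, u) * (k p).1 := by
    have b2 := dt_comp sd'.diff (sG.differentiableAt (by simp))
    have b3 := first (1, 0)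
    change dt (fun q => d (Φ (q, g q)).1) p = pu F (p, u) * (dt g p - dt f p) at b3
    rw [b3, Tt, gp, ft, gt, ddx] at b2
    linarith
  have ddxx : (pv (0, 1) (cx Φ) (p, u) + pu (cx Φ) (p, u) * mx) ^ 2 * dx (dx d) (Φ (p, u)).1 =
      pu F (p, u) := by
    have b2 := dxx_comp sd' sG
    rw [Tx, Txx, Xx, gp, ddx] at b2
    have eg2 : dv (0, 1) (fun q => F (q, g q)) =ᶠ[𝓝 p] dv (0, 1) (fun q => d (Φ (q, g q)).1) := by
      filter_upwards [eg.eventually_nhds] with q hq using dv_congr hq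
    have c2 := dvv_graph (v := (0, 1)) hFg sg
    have c3 := dvv_graph (v := (0, 1)) hFf sf
    rw [dv_congr eg2, gp] at c2
    rw [z2, fp] at c3
    change dx (dx (fun q => d (Φ (q, g q)).1)) p = _ + _ * dx g p + _ * dx g p ^ 2 +
      _ * dx (dx g) p at c2
    change 0 = _ + _ * dx f p + _ * dx f p ^ 2 + _ * dx (dx f) p at c3
    rw [gx, gxx, b2] at c2
    rw [fx, fxx] at c3
    linear_combination c2 - c3
  rw [Lin_lhs, ddx, d0] at ld
  apply mul_left_cancel₀ hne
  set D := pv (0, 1) (cx Φ) (p, u) + pu (cx Φ) (p, u) * mx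
  linear_combination (- D ^ 2) * ddt + (k' (Φ (p, u)).1).1 * pv (1, 0) (ct Φ) (p, u) * ddxx +
     D ^ 2 * pv (1, 0) (ct Φ) (p, u) * ld

/-- In `sq_eq` the square of X_x + X_u m equals an expression free of the slope m. If X_u were
nonzero, m could be chosen to make this sum 1 or 2, and the leading coefficient would have to
vanish. -/
theorem pu_cx_eq_zero (H : PointMap Ω Ω' Φ k k') (hp : p ∈ Ω) (u : ℝ) :
    pu (cx Φ) (p, u) = 0 ∧ pv (0, 1) (cx Φ) (p, u) ≠ 0 := by
  have h0 : pu (cx Φ) (p, u) = 0 := by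
    by_contra hX
    have e1 : pv (0, 1) (cx Φ) (p, u) + pu (cx Φ) (p, u) *
        ((1 - pv (0, 1) (cx Φ) (p, u)) / pu (cx Φ) (p, u)) = 1 := by field_simp; ring
    have e2 : pv (0, 1) (cx Φ) (p, u) + pu (cx Φ) (p, u) *
        ((2 - pv (0, 1) (cx Φ) (p, u)) / pu (cx Φ) (p, u)) = 2 := by field_simp; ring
    have h1 := H.sq_eq hp u _ (by rw [e1]; norm_num)
    have h2 := H.sq_eq hp u _ (by rw [e2]; norm_num)
    rw [e1] at h1
    rw [e2, ← h1] at h2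
    have : (k p).1 ≠ 0 := H.mem.2 p hp
    apply this; linarith
  refine ⟨h0, fun h1 => ?_⟩
  obtain ⟨w, w1, w2, -⟩ := H.exists_preimage (z := (p, u)) hp ((0, 1), 0)
  obtain ⟨h3, h4, h5⟩ := H.pv_ct_eq_zero hp u
  rw [fderiv_eq, h3, h4] at w1
  rw [fderiv_eq, h0, h1] at w2
  simp [h5] at w1 w2
  simp [w1] at w2

theorem fst_eq (H : PointMap Ω Ω' Φ k k') (hp : p ∈ Ω) (u : ℝ) : (Φ (p, u)).1 = (Φ (p, 0)).1 := by
  have aux : ∀ F : TXU → ℝ, (∀ u, DifferentiableAt ℝ F (p, u)) → (∀ u, pu F (p, u) = 0) →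
      F (p, u) = F (p, 0) := by
    intro F hF h0
    have hd : ∀ u : ℝ, HasDerivAt (fun s : ℝ => F (p, s)) 0 u := by
      intro u
      have := (hF u).hasFDerivAt.comp_hasDerivAt u ((hasDerivAt_const u p).prodMk (hasDerivAt_id u))
      have h1 := h0 u
      unfold pu at h1
      rw [h1] at this
      exact this
    exact is_const_of_deriv_eq_zero (fun u => (hd u).differentiableAt) (fun u => (hd u).deriv) u 0
  ext
  · exact aux (ct Φ) (fun u => (H.contDiffAt_ct hp).differentiableAt (by simp))
      fun u => (H.pv_ct_eq_zero hp u).2.1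
  · exact aux (cx Φ) (fun u => (H.contDiffAt_cx hp).differentiableAt (by simp))
      fun u => (H.pu_cx_eq_zero hp u).1

/-- The restriction of a point transformation to the plane `u = 0`. -/
theorem sm_base (H : PointMap Ω Ω' Φ k k') (hp : p ∈ Ω) :
    ContDiffAt ℝ ∞ (fun q => (Φ (q, 0)).1) p := H.sm_image hp (f := fun _ => 0) (Sm.const 0)

/-- Solution jets with the same value u, slopes 0 and s, and zero f_xx are compared. The jet of the
difference of their images obeys relations linear in s, except for the term with V_uu in the last
one, where V is the u-component. -/
theorem exists_jet (H : PointMap Ω Ω' Φ k k') (hp : p ∈ Ω) (u s : ℝ) : ∃ jt jx jxx : ℝ,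
    jt = (k' (Φ (p, 0)).1).1 * jxx + (k' (Φ (p, 0)).1).2.1 * jx ∧
    pv (0, 1) (cx Φ) (p, 0) * jx = pu (cu Φ) (p, u) * s ∧
    pv (1, 0) (ct Φ) (p, 0) * jt + dt (fun q => (Φ (q, 0)).1.2) p * jx =
      pu (cu Φ) (p, u) * s * (k p).2.1 ∧
    dx (dx fun q => (Φ (q, 0)).1.2) p * jx + pv (0, 1) (cx Φ) (p, 0) ^ 2 * jxx =
      (pu (pv (0, 1) (cu Φ)) (p, u) + pv (0, 1) (pu (cu Φ)) (p, u)) * s +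
        pu (pu (cu Φ)) (p, u) * s ^ 2 := by
  set f := quad p u ((k p).2.2 * u) 0 0 0 0 with hf
  set g := quad p u ((k p).2.2 * u + s * (k p).2.1) s 0 0 0 with hg
  have sf : Sm f p := (quad_contDiff ..).contDiffAt
  have sg : Sm g p := (quad_contDiff ..).contDiffAt
  have fp : f p = u := quad_self ..
  have gp : g p = u := quad_self ..
  have fx : dv (0, 1) f p = 0 := by change dx f p = _; rw [hf, dx_quad, quad_self]
  have gx : dv (0, 1) g p = s := by change dx g p = _; rw [hg, dx_quad, quad_self]
  have ft : dv (1, 0) f p = (k p).2.2 * u := by change dt f p = _; rw [hf, dt_quad, quad_self]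
  have gt : dv (1, 0) g p = (k p).2.2 * u + s * (k p).2.1 := by
    change dt g p = _; rw [hg, dt_quad, quad_self]
  have fxx : dv (0, 1) (dv (0, 1) f) p = 0 := by
    change dx (dx f) p = _; rw [hf, dx_quad, dx_quad, quad_self]
  have gxx : dv (0, 1) (dv (0, 1) g) p = 0 := by
    change dx (dx g) p = _; rw [hg, dx_quad, dx_quad, quad_self]
  have hTt := (H.pv_ct_eq_zero hp u).2.2
  have hX := H.pu_cx_eq_zero hp u
  obtain ⟨d, h, sd, sh, ld, d0, ef, eg, -⟩ := H.exists_difference hp sf sg (gp.trans fp.symm)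
    (by rw [hf, Lin_lhs_quad]; ring) (by rw [hg, Lin_lhs_quad]; ring)
    (by rw [fp, H.jac_eq hp, hX.1, zero_mul, add_zero]; exact mul_ne_zero hTt hX.2)
    (by rw [fp, H.jac_eq hp, hX.1, zero_mul, add_zero]; exact mul_ne_zero hTt hX.2)
  rw [H.fst_eq hp] at sd ld d0
  have ev : (fun q => d (Φ (q, 0)).1) =ᶠ[𝓝 p]
      fun q => cu Φ (q, g q) + (-1) * cu Φ (q, f q) := by
    filter_upwards [ef, eg, H.op.mem_nhds hp] with q h1 h2 h3
    rw [H.fst_eq h3] at h1 h2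
    linarith
  have hVf : ContDiffAt ℝ ∞ (cu Φ) (p, f p) := H.contDiffAt_cu hp
  have hVg : ContDiffAt ℝ ∞ (cu Φ) (p, g p) := H.contDiffAt_cu hp
  have hm1 := (Sm.const (p := p) (-1)).mul (sm_graph hVf sf)
  have first : ∀ v : TX, dv v (fun q => d (Φ (q, 0)).1) p =
      pu (cu Φ) (p, u) * (dv v g p - dv v f p) := by
    intro v
    rw [dv_congr ev, dv_add (sm_graph hVg sg) hm1, dv_mul (Sm.const _) (sm_graph hVf sf),
      dv_graph (hVg.differentiableAt (by simp)) sg.diff,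
      dv_graph (hVf.differentiableAt (by simp)) sf.diff, fp, gp]
    simp [dv]; ring
  have second : dx (dx (fun q => d (Φ (q, 0)).1)) p =
      (pu (pv (0, 1) (cu Φ)) (p, u) + pv (0, 1) (pu (cu Φ)) (p, u)) * s +
        pu (pu (cu Φ)) (p, u) * s ^ 2 := by
    have c2 := dvv_graph (v := (0, 1)) hVg sg
    have c3 := dvv_graph (v := (0, 1)) hVf sf
    rw [gp, gx, gxx] at c2
    rw [fp, fx, fxx] at c3
    rw [dx_congr (dx_eventuallyEq ev), dxx_add (sm_graph hVg sg) hm1,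
      dxx_const_mul _ (sm_graph hVf sf)]
    change dv (0, 1) (dv (0, 1) _) p + -1 * dv (0, 1) (dv (0, 1) _) p = _
    rw [c2, c3]; ring
  have sb := H.sm_base hp
  have Tx : dx (fun q => (Φ (q, 0)).1.1) p = 0 := H.dx_ct_graph hp (Sm.const 0)
  have Txx : dx (dx fun q => (Φ (q, 0)).1.1) p = 0 := by
    rw [dx_congr (eventuallyEq_of_eqOn H.op hp fun q hq => H.dx_ct_graph hq (Sm.const 0)), dx_const]
  have Tt : dt (fun q => (Φ (q, 0)).1.1) p = pv (1, 0) (ct Φ) (p, 0) := by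
    have := dv_graph (v := (1, 0)) (p := p) (f := fun _ => 0)
      ((H.contDiffAt_ct (z := (p, 0)) hp).differentiableAt (by simp)) (Sm.const 0).diff
    rw [(H.pv_ct_eq_zero hp _).2.1, zero_mul, add_zero] at this
    exact this
  have Xx : dx (fun q => (Φ (q, 0)).1.2) p = pv (0, 1) (cx Φ) (p, 0) := by
    have := dv_graph (v := (0, 1)) (p := p) (f := fun _ => 0)
      ((H.contDiffAt_cx (z := (p, 0)) hp).differentiableAt (by simp)) (Sm.const 0).diff
    rw [(H.pu_cx_eq_zero hp _).1, zero_mul, add_zero] at this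
    exact this
  refine ⟨dt d (Φ (p, 0)).1, dx d (Φ (p, 0)).1, dx (dx d) (Φ (p, 0)).1, ?_, ?_, ?_, ?_⟩
  · rw [Lin_lhs, d0] at ld; linarith
  · have b2 := dx_comp sd.diff (sb.differentiableAt (by simp))
    rw [show dx (fun q => d (Φ (q, 0)).1) p = _ from first (0, 1), Tx, Xx, gx, fx] at b2
    linarith
  · have b2 := dt_comp sd.diff (sb.differentiableAt (by simp))
    rw [show dt (fun q => d (Φ (q, 0)).1) p = _ from first (1, 0), Tt, gt, ft] at b2
    linarith
  · rw [← second, dxx_comp sd sb, Tx, Txx, Xx]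
    ring

/-- In the sum of the relations for s = 1 and s = -1 everything odd in s cancels, and only V_uu is
left. -/
theorem pu_pu_cu (H : PointMap Ω Ω' Φ k k') (hp : p ∈ Ω) (u : ℝ) : pu (pu (cu Φ)) (p, u) = 0 := by
  obtain ⟨jt, jx, jxx, h1, h2, h3, h4⟩ := H.exists_jet hp u 1
  obtain ⟨it, ix, ixx, i1, i2, i3, i4⟩ := H.exists_jet hp u (-1)
  have hX := (H.pu_cx_eq_zero hp 0).2
  have hT := (H.pv_ct_eq_zero hp 0).2.2
  have ex : jx + ix = 0 := by
    apply (mul_eq_zero.1 (show pv (0, 1) (cx Φ) (p, 0) * (jx + ix) = 0 by linarith)).resolve_left hX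
  have et : jt + it = 0 := by
    apply (mul_eq_zero.1 (show pv (1, 0) (ct Φ) (p, 0) * (jt + it) = 0 by
      linear_combination h3 + i3 - dt (fun q => (Φ (q, 0)).1.2) p * ex)).resolve_left hT
  have ha : (k' (Φ (p, 0)).1).1 ≠ 0 := H.mem'.2 _ (H.mapsTo (z := (p, 0)) hp)
  have exx : jxx + ixx = 0 := by
    apply (mul_eq_zero.1 (show (k' (Φ (p, 0)).1).1 * (jxx + ixx) = 0 by
      linear_combination et - h1 - i1 - (k' (Φ (p, 0)).1).2.1 * ex)).resolve_left ha
  linear_combination (-1 / 2) * h4 - 1 / 2 * i4 + 1 / 2 * pv (0, 1) (cx Φ) (p, 0) ^ 2 * exx +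
    1 / 2 * dx (dx fun q => (Φ (q, 0)).1.2) p * ex

theorem snd_eq (H : PointMap Ω Ω' Φ k k') (hp : p ∈ Ω) (u : ℝ) :
    (Φ (p, u)).2 = ((Φ (p, 1)).2 - (Φ (p, 0)).2) * u + (Φ (p, 0)).2 := by
  have aux : ∀ F : TXU → ℝ, ∀ u, DifferentiableAt ℝ F (p, u) →
      HasDerivAt (fun s : ℝ => F (p, s)) (pu F (p, u)) u := fun F u hF =>
    hF.hasFDerivAt.comp_hasDerivAt u ((hasDerivAt_const u p).prodMk (hasDerivAt_id u))
  have hV : ∀ u, HasDerivAt (fun s : ℝ => cu Φ (p, s)) (pu (cu Φ) (p, u)) u := fun u =>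
    aux _ u ((H.contDiffAt_cu hp).differentiableAt (by simp))
  have hV' : ∀ u, HasDerivAt (fun s : ℝ => pu (cu Φ) (p, s)) 0 u := fun u => by
    have := aux _ u ((contDiffAt_pu (H.contDiffAt_cu (z := (p, u)) hp)).differentiableAt (by simp))
    rwa [H.pu_pu_cu hp] at this
  have hc : ∀ u, pu (cu Φ) (p, u) = pu (cu Φ) (p, 0) := fun u =>
    is_const_of_deriv_eq_zero (fun u => (hV' u).differentiableAt) (fun u => (hV' u).deriv) u 0
  have hL : ∀ u, HasDerivAt (fun s : ℝ => cu Φ (p, s) - pu (cu Φ) (p, 0) * s) 0 u := fun u => by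
    have := (hV u).sub ((hasDerivAt_id u).const_mul (pu (cu Φ) (p, 0)))
    rw [hc u, mul_one, sub_self] at this
    exact this
  have hl : ∀ u, cu Φ (p, u) - pu (cu Φ) (p, 0) * u = cu Φ (p, 0) - pu (cu Φ) (p, 0) * 0 :=
    fun u => is_const_of_deriv_eq_zero (fun u => (hL u).differentiableAt)
      (fun u => (hL u).deriv) u 0
  have h1 := hl 1
  have h2 := hl u
  simp only [cu] at h1 h2 ⊢
  linear_combination h2 - u * h1

/-- A point transformation between linear equations is an affine bundle map whose linear part maps
the first equation to the second one and whose shift is a solution of the second one. -/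
theorem exists_inter (H : PointMap Ω Ω' Φ k k') : ∃ (e : PartialEquiv TX TX) (φ v : TX → ℝ),
    Inter Ω Ω' e φ k k' ∧ (∀ p ∈ Ω, ∀ u, Φ (p, u) = (e p, u / φ p + v (e p))) ∧
    ContDiffOn ℝ ∞ v Ω' ∧ ∀ p ∈ Ω', Lin.lhs k' v p = 0 := by
  set ψ : TX → ℝ := fun p => (Φ (p, 1)).2 - (Φ (p, 0)).2 with hψ
  have hsrc : ∀ p ∈ Ω, ∀ u, (p, u) ∈ Φ.source := fun p hp u => by
    rw [H.diffeo.1]; exact ⟨hp, trivial⟩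
  have htgt : ∀ p ∈ Ω', ∀ u, (p, u) ∈ Φ.target := fun p hp u => by
    rw [H.diffeo.2.1]; exact ⟨hp, trivial⟩
  have hψ0 : ∀ p ∈ Ω, ψ p ≠ 0 := by
    intro p hp h0
    have h1 : Φ (p, 1) = Φ (p, 0) := Prod.ext (H.fst_eq hp 1) (sub_eq_zero.1 h0)
    have := Φ.injOn (hsrc p hp 1) (hsrc p hp 0) h1
    simp at this
  have hΦ : ∀ p ∈ Ω, ∀ u, Φ (p, u) = ((Φ (p, 0)).1, ψ p * u + (Φ (p, 0)).2) := fun p hp u =>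
    Prod.ext (H.fst_eq hp u) (H.snd_eq hp u)
  have hsy : ∀ p ∈ Ω', (Φ.symm (p, 0)).1 ∈ Ω := fun p hp => by
    have := Φ.map_target (htgt p hp 0)
    rw [H.diffeo.1] at this
    exact this.1
  -- The base map is the restriction to u = 0. It is invertible because the fibre over each point is
  -- mapped onto a whole fibre: the point with ũ = 0 has the explicit preimage -V(p,0)/ψ used in
  -- `left_inv'`.
  let e : PartialEquiv TX TX :=
    { toFun := fun p => (Φ (p, 0)).1
      invFun := fun p => (Φ.symm (p, 0)).1
      source := Ω
      target := Ω'
      map_source' := fun p hp => H.mapsTo (z := (p, 0)) hp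
      map_target' := hsy
      left_inv' := fun p hp => by
        have h1 := hΦ p hp (-(Φ (p, 0)).2 / ψ p)
        rw [mul_div_cancel₀ _ (hψ0 p hp), neg_add_cancel] at h1
        change (Φ.symm ((Φ (p, 0)).1, 0)).1 = p
        rw [← h1, Φ.left_inv (hsrc p hp _)]
      right_inv' := fun p hp => by
        rw [← H.fst_eq (hsy p hp) (Φ.symm (p, 0)).2, Prod.mk.eta, Φ.right_inv (htgt p hp 0)] }
  have hde : IsDiffeo e Ω Ω' := by
    refine ⟨rfl, rfl, ?_, ?_⟩
    · exact contDiff_fst.comp_contDiffOn (H.diffeo.2.2.1.comp (f := fun p => (p, (0 : ℝ)))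
        (contDiffOn_id.prodMk contDiffOn_const) fun p hp => ⟨hp, trivial⟩)
    · exact contDiff_fst.comp_contDiffOn (H.diffeo.2.2.2.comp (f := fun p => (p, (0 : ℝ)))
        (contDiffOn_id.prodMk contDiffOn_const) fun p hp => ⟨hp, trivial⟩)
  have hsl : ∀ c : ℝ, ContDiffOn ℝ ∞ (fun p => (Φ (p, c)).2) Ω := fun c =>
    contDiff_snd.comp_contDiffOn (H.diffeo.2.2.1.comp (f := fun p => (p, c))
        (contDiffOn_id.prodMk contDiffOn_const) fun p hp => ⟨hp, trivial⟩)
  have hψs : ContDiffOn ℝ ∞ ψ Ω := (hsl 1).sub (hsl 0)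
  set φ : TX → ℝ := fun p => (ψ p)⁻¹ with hφ
  have hφs : ContDiffOn ℝ ∞ φ Ω := hψs.inv hψ0
  set v : TX → ℝ := fun p => (Φ (e.symm p, 0)).2 with hv
  have hvs : ContDiffOn ℝ ∞ v Ω' := (hsl 0).comp hde.2.2.2 fun p hp => hsy p hp
  have hform : ∀ p ∈ Ω, ∀ u, Φ (p, u) = (e p, u / φ p + v (e p)) := by
    intro p hp u
    rw [hΦ p hp u, hv]
    simp only [hde.left_inv hp]
    rw [hφ, div_inv_eq_mul, mul_comm]
  have hmaps : ∀ p ∈ Ω, ∀ h, Sm h (e p) →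
      (Lin.lhs k (fun q => φ q * h (e q)) p = 0 ↔ Lin.lhs k' (fun q => h q + v q) (e p) = 0) := by
    intro p hp h hh
    have hv' : Sm v (e p) := sm_of_contDiffOn hvs H.op' (hde.mapsTo hp)
    have := H.maps p hp (fun q => φ q * h (e q)) (fun q => h q + v q)
      ((sm_of_contDiffOn hφs H.op hp).mul (hh.comp (hde.contDiffAt H.op hp)))
    rw [hform p hp] at this
    refine this (hh.add hv') ?_
    filter_upwards [H.op.mem_nhds hp] with q hq
    rw [hform q hq, mul_div_cancel_left₀ _ (inv_ne_zero (hψ0 q hq))]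
  have hvsol : ∀ p ∈ Ω, Lin.lhs k' v (e p) = 0 := by
    intro p hp
    have := (hmaps p hp (fun _ => 0) (Sm.const 0)).1 (by
      simp only [mul_zero, Lin_lhs, dt_const]
      have : dx (fun _ : TX => (0 : ℝ)) = fun _ => 0 := by ext; rw [dx_const]
      rw [this, dx_const]; ring)
    simpa only [zero_add] using this
  refine ⟨e, φ, v, ⟨H.op, H.op', hde, hφs, fun p hp => inv_ne_zero (hψ0 p hp), H.mem, H.mem',
    fun p hp => ?_⟩, hform, hvs, fun p hp => ?_⟩
  · have hv' : Sm v (e p) := sm_of_contDiffOn hvs H.op' (hde.mapsTo hp)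
    have key : ∀ h, Sm h (e p) →
        (Lin.lhs k (fun q => φ q * h (e q)) p = 0 ↔ Lin.lhs k' h (e p) = 0) := by
      intro h hh
      rw [hmaps p hp h hh, Lin_lhs_add hh hv', hvsol p hp, add_zero]
    -- The maps h ↦ (source operator on φ·(h∘e) at p) and h ↦ (target operator on h at e p) are
    -- linear with the same kernel, hence proportional; a function normalized to value 1 under the
    -- second gives the factor.
    set h0 := quad (e p) 0 1 0 0 0 0 with hh0
    have s0 : Sm h0 (e p) := (quad_contDiff ..).contDiffAt
    have l0 : Lin.lhs k' h0 (e p) = 1 := by rw [hh0, Lin_lhs_quad]; ring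
    refine ⟨Lin.lhs k (fun q => φ q * h0 (e q)) p, fun h => ?_, fun h hh => ?_⟩
    · rw [(key h0 s0).1 h] at l0; norm_num at l0
    · have sφ := sm_of_contDiffOn hφs H.op hp
      have se := hde.contDiffAt H.op hp
      set c := Lin.lhs k' h (e p) with hc
      have h1 := (key (fun q => h q - c * h0 q) (hh.sub ((Sm.const c).mul s0))).2 (by
        rw [Lin_lhs_sub hh ((Sm.const c).mul s0), Lin_lhs_const_mul _ s0, l0]; ring)
      have h2 : (fun q => φ q * (h (e q) - c * h0 (e q))) =
          fun q => φ q * h (e q) - c * (φ q * h0 (e q)) := by ext q; ring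
      rw [h2, Lin_lhs_sub (sφ.mul (hh.comp se)) ((Sm.const c).mul (sφ.mul (s0.comp se))),
        Lin_lhs_const_mul _ (sφ.mul (s0.comp se))] at h1
      linarith
  · have := hvsol _ (hsy p hp)
    rwa [show e (Φ.symm (p, 0)).1 = p from hde.right_inv hp] at this

end PointMap

end

section

/-! ### Classes of linear equations and their equivalence transformations -/

/-- The equations of the class `L` are linear equations with the coefficients `C θ`. -/
structure Rep {Θ : Type} [NormedAddCommGroup Θ] [NormedSpace ℝ Θ] (L : EqClass Θ)
    (C : (TX → Θ) → Coef) : Prop where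
  mem : ∀ {Ω θ}, IsOpen Ω → θ ∈ L.S Ω → C θ ∈ Lin.S Ω
  lhs : ∀ {Ω θ p f}, IsOpen Ω → θ ∈ L.S Ω → p ∈ Ω → Sm f p → L.lhs θ f p = Lin.lhs (C θ) f p
  congr : ∀ {Ω θ θ'}, IsOpen Ω → (∀ p ∈ Ω, θ p = θ' p) → ∀ p ∈ Ω, C θ p = C θ' p

theorem mapsEq_of_inter {Ω Ω' : Set TX} {e : PartialEquiv TX TX} {φ : TX → ℝ} {k k' : Coef}
    (H : Inter Ω Ω' e φ k k') {Φ : PartialEquiv TXU TXU}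
    (hΦ : ∀ p ∈ Ω, ∀ u, Φ (p, u) = (e p, u / φ p)) : Lin.MapsEq Ω Φ k k' := by
  intro p hp f f' hf hf' hev
  rw [hΦ p hp] at hf' ⊢
  have : f =ᶠ[𝓝 p] fun q => φ q * f' (e q) := by
    filter_upwards [hev, H.op.mem_nhds hp] with q hq hqΩ
    rw [hΦ q hqΩ] at hq
    simp only at hq
    rw [← hq, mul_div_cancel₀ _ (H.ne q hqΩ)]
  obtain ⟨κ, hκ, h⟩ := H.maps p hp
  rw [Lin_lhs_congr this, h f' hf', mul_eq_zero, or_iff_right hκ]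

namespace Rep

variable {Θ : Type} [NormedAddCommGroup Θ] [NormedSpace ℝ Θ] {L : EqClass Θ}
  {C : (TX → Θ) → Coef} {Ω Ω' : Set TX} {θ θ' : TX → Θ}

theorem gEss_eq (R : Rep L C) (hΩ : IsOpen Ω) (hθ : θ ∈ L.S Ω) :
    L.gEss Ω θ = Lin.gEss Ω (C θ) := by
  ext Q
  rw [mem_gEss_iff, mem_gEss_iff]
  refine and_congr_right fun hQ => forall_congr' fun p => forall_congr' fun hp =>
    forall_congr' fun f => forall_congr' fun hf => ?_
  have hs : ∀ q, Sm f q := fun q => hf.contDiffAt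
  have hev : L.lhs θ f =ᶠ[𝓝 p] Lin.lhs (C θ) f :=
    eventuallyEq_of_eqOn hΩ hp fun q hq => R.lhs hΩ hθ hq (hs q)
  have hch : Sm (Q.toVField.char f) p := by
    rw [toVField_char]
    exact (((sm_ζ hQ hΩ hp).mul (hs p)).sub ((sm_τ hQ hΩ hp).mul (hs p).dt)).sub
      ((sm_ξ hQ hΩ hp).mul (hs p).dx)
  rw [R.lhs hΩ hθ hp (hs p), R.lhs hΩ hθ hp hch, dt_congr hev, dx_congr hev]

theorem mapsEq_iff (R : Rep L C) (hΩ : IsOpen Ω) (hΩ' : IsOpen Ω') (hθ : θ ∈ L.S Ω)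
    (hθ' : θ' ∈ L.S Ω') {Φ : PartialEquiv TXU TXU}
    (hΦ : IsDiffeo Φ (Ω ×ˢ Set.univ) (Ω' ×ˢ Set.univ)) :
    L.MapsEq Ω Φ θ θ' ↔ Lin.MapsEq Ω Φ (C θ) (C θ') := by
  have hm : ∀ p ∈ Ω, ∀ u, (Φ (p, u)).1 ∈ Ω' := fun p hp u => by
    have : Φ (p, u) ∈ Φ.target := Φ.map_source (by rw [hΦ.1]; exact ⟨hp, trivial⟩)
    rw [hΦ.2.1] at this
    exact this.1
  unfold EqClass.MapsEq
  refine forall_congr' fun p => forall_congr' fun hp => forall_congr' fun f =>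
    forall_congr' fun f' => forall_congr' fun hf => forall_congr' fun hf' => ?_
  rw [R.lhs hΩ hθ hp hf, R.lhs hΩ' hθ' (hm p hp _) hf']

theorem pushes_unique {Φ : PartialEquiv TXU TXU} {T : PartialEquiv (TXU × Θ) (TXU × Θ)}
    (hT : L.IsEquivTransf Ω Ω' Φ T) (hθ : θ ∈ L.S Ω) {θ'' : TX → Θ}
    (h1 : EqClass.Pushes Ω T θ θ') (h2 : EqClass.Pushes Ω T θ θ'') : ∀ p ∈ Ω', θ' p = θ'' p := by
  intro p' hp'
  have hz : Φ.symm (p', 0) ∈ Ω ×ˢ (Set.univ : Set ℝ) := by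
    rw [← hT.1.1]; exact Φ.map_target (by rw [hT.1.2.1]; exact ⟨hp', trivial⟩)
  have h3 := hT.2.2.1 (Φ.symm (p', 0), θ (Φ.symm (p', 0)).1) ⟨hz, hθ.2 _ hz.1⟩
  have h4 := (h1 _ hz.1 (Φ.symm (p', 0)).2).symm.trans (h2 _ hz.1 (Φ.symm (p', 0)).2)
  simp only [Prod.mk.eta] at h4
  rw [h3, Φ.right_inv (by rw [hT.1.2.1]; exact ⟨hp', trivial⟩)] at h4
  exact h4

/-- An equivalence transformation acts on all equations of the class by the same linear
transformation. -/
theorem exists_inter (R : Rep L C) (hΩ : IsOpen Ω) (hΩ' : IsOpen Ω') (hne : (L.S Ω).Nonempty)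
    {Φ : PartialEquiv TXU TXU} {T : PartialEquiv (TXU × Θ) (TXU × Θ)}
    (hT : L.IsEquivTransf Ω Ω' Φ T) : ∃ (e : PartialEquiv TX TX) (φ v : TX → ℝ),
      (∀ p ∈ Ω, ∀ u, Φ (p, u) = (e p, u / φ p + v (e p))) ∧
      (∀ θ ∈ L.S Ω, ∀ θ' ∈ L.S Ω', EqClass.Pushes Ω T θ θ' → Inter Ω Ω' e φ (C θ) (C θ')) ∧
      ContDiffOn ℝ ∞ v Ω' ∧ ∀ θ' ∈ L.S Ω', ∀ p ∈ Ω', L.lhs θ' v p = 0 := by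
  have key : ∀ θ ∈ L.S Ω, ∀ θ' ∈ L.S Ω', EqClass.Pushes Ω T θ θ' →
      PointMap Ω Ω' Φ (C θ) (C θ') := by
    intro θ hθ θ' hθ' hp
    obtain ⟨θ'', hθ'', hp'', hm⟩ := hT.2.2.2.1 θ hθ
    have heq := pushes_unique hT hθ hp hp''
    have hm' := (R.mapsEq_iff hΩ hΩ' hθ hθ'' hT.1).1 hm
    refine ⟨hΩ, hΩ', hT.1, R.mem hΩ hθ, R.mem hΩ' hθ', ?_⟩
    intro p hpΩ f f' hf hf' hev
    rw [hm' p hpΩ f f' hf hf' hev, Lin_lhs, Lin_lhs, R.congr hΩ' heq]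
    have : Φ (p, f p) ∈ Φ.target := Φ.map_source (by rw [hT.1.1]; exact ⟨hpΩ, trivial⟩)
    rw [hT.1.2.1] at this
    exact this.1
  obtain ⟨θ₀, hθ₀⟩ := hne
  obtain ⟨θ₀', hθ₀', hp₀, -⟩ := hT.2.2.2.1 θ₀ hθ₀
  obtain ⟨e, φ, v, hI, hΦ, hv, hvs⟩ := (key θ₀ hθ₀ θ₀' hθ₀' hp₀).exists_inter
  -- The point map Φ alone determines e, φ and v, so those found for one value θ₀ serve all values;
  -- in particular v solves every equation of the class over Ω'.
  have agree : ∀ θ ∈ L.S Ω, ∀ θ' ∈ L.S Ω', EqClass.Pushes Ω T θ θ' →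
      Inter Ω Ω' e φ (C θ) (C θ') ∧ ∀ p ∈ Ω', Lin.lhs (C θ') v p = 0 := by
    intro θ hθ θ' hθ' hp
    obtain ⟨e₁, φ₁, v₁, hI₁, hΦ₁, hv₁, hvs₁⟩ := (key θ hθ θ' hθ' hp).exists_inter
    have he : ∀ p ∈ Ω, e₁ p = e p := fun p hp => by
      have := (hΦ₁ p hp 0).symm.trans (hΦ p hp 0)
      exact congrArg Prod.fst this
    have hvv : ∀ p ∈ Ω, v₁ (e p) = v (e p) := fun p hp => by
      have := congrArg Prod.snd ((hΦ₁ p hp 0).symm.trans (hΦ p hp 0))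
      simpa [he p hp] using this
    have hφ : ∀ p ∈ Ω, φ p = φ₁ p := fun p hp => by
      have := congrArg Prod.snd ((hΦ₁ p hp 1).symm.trans (hΦ p hp 1))
      simp only [he p hp, hvv p hp, one_div, add_left_inj, inv_inj] at this
      exact this.symm
    have hv' : ∀ p ∈ Ω', v p = v₁ p := fun p hp => by
      have := hvv _ (hI.diffeo.symm_mapsTo hp)
      rw [hI.diffeo.right_inv hp] at this
      exact this.symm
    refine ⟨⟨hΩ, hΩ', hI.diffeo, hI.smooth, hI.ne, hI₁.mem, hI₁.mem', fun p hp => ?_⟩,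
      fun p hp => ?_⟩
    · obtain ⟨κ, hκ, M⟩ := hI₁.maps p hp
      refine ⟨κ, hκ, fun h hh => ?_⟩
      rw [he p hp] at M
      rw [← M h hh]
      refine Lin_lhs_congr (eventuallyEq_of_eqOn hΩ hp fun q hq => ?_)
      rw [hφ q hq, he q hq]
    · rw [← hvs₁ p hp]
      exact Lin_lhs_congr (eventuallyEq_of_eqOn hΩ' hp hv')
  refine ⟨e, φ, v, hΦ, fun θ hθ θ' hθ' hp => (agree θ hθ θ' hθ' hp).1, hv, fun θ' hθ' p hp => ?_⟩
  obtain ⟨θ, hθ, hpu, -⟩ := hT.2.2.2.2 θ' hθ'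
  rw [R.lhs hΩ' hθ' hp (sm_of_contDiffOn hv hΩ' hp)]
  exact (agree θ hθ θ' hθ' hpu).2 p hp

/-- Equivalence transformations that are defined by linear transformations of `(t, x, u)` and by
transformations of the values of the arbitrary-element tuple. -/
theorem exists_isEquivTransf (R : Rep L C) (hΩ : IsOpen Ω) (hΩ' : IsOpen Ω')
    {e : PartialEquiv TX TX} {φ : TX → ℝ} (he : IsDiffeo e Ω Ω') (hφ : ContDiffOn ℝ ∞ φ Ω)
    (hφ0 : ∀ p ∈ Ω, φ p ≠ 0) {α β : TX → Θ → Θ}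
    (hα : ContDiffOn ℝ ∞ (fun z : TX × Θ => α z.1 z.2) (Ω ×ˢ Set.univ))
    (hβ : ContDiffOn ℝ ∞ (fun z : TX × Θ => β z.1 z.2) (Ω' ×ˢ Set.univ))
    (mα : ∀ p ∈ Ω, ∀ ϑ ∈ L.values, α p ϑ ∈ L.values)
    (mβ : ∀ p ∈ Ω', ∀ ϑ ∈ L.values, β p ϑ ∈ L.values)
    (hβα : ∀ p ∈ Ω, ∀ ϑ, β (e p) (α p ϑ) = ϑ)
    (hαβ : ∀ p ∈ Ω', ∀ ϑ, α (e.symm p) (β p ϑ) = ϑ)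
    (hI : ∀ θ ∈ L.S Ω, ∀ θ' ∈ L.S Ω', (∀ p ∈ Ω, θ' (e p) = α p (θ p)) →
      Inter Ω Ω' e φ (C θ) (C θ')) :
    ∃ Φ T, L.IsEquivTransf Ω Ω' Φ T ∧ (∀ p ∈ Ω, ∀ u, Φ (p, u) = (e p, u / φ p)) ∧
      ∀ θ θ', (∀ p ∈ Ω, θ' (e p) = α p (θ p)) → EqClass.Pushes Ω T θ θ' := by
  let Φ : PartialEquiv TXU TXU :=
    { toFun := fun z => (e z.1, z.2 / φ z.1)
      invFun := fun z => (e.symm z.1, z.2 * φ (e.symm z.1))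
      source := Ω ×ˢ Set.univ
      target := Ω' ×ˢ Set.univ
      map_source' := fun z hz => ⟨he.mapsTo hz.1, trivial⟩
      map_target' := fun z hz => ⟨he.symm_mapsTo hz.1, trivial⟩
      left_inv' := fun z hz => by
        simp only [he.left_inv hz.1, div_mul_cancel₀ _ (hφ0 _ hz.1)]
      right_inv' := fun z hz => by
        simp only [he.right_inv hz.1, mul_div_cancel_right₀ _ (hφ0 _ (he.symm_mapsTo hz.1))] }
  let T : PartialEquiv (TXU × Θ) (TXU × Θ) :=
    { toFun := fun z => (Φ z.1, α z.1.1 z.2)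
      invFun := fun z => (Φ.symm z.1, β z.1.1 z.2)
      source := (Ω ×ˢ Set.univ) ×ˢ L.values
      target := (Ω' ×ˢ Set.univ) ×ˢ L.values
      map_source' := fun z hz => ⟨Φ.map_source hz.1, mα _ hz.1.1 _ hz.2⟩
      map_target' := fun z hz => ⟨Φ.map_target hz.1, mβ _ hz.1.1 _ hz.2⟩
      left_inv' := fun z hz => Prod.ext (Φ.left_inv hz.1) (hβα _ hz.1.1 _)
      right_inv' := fun z hz => Prod.ext (Φ.right_inv hz.1) (hαβ _ hz.1.1 _) }
  have f1 : ∀ {s : Set TX}, ContDiffOn ℝ ∞ (fun z : TXU => z.1) (s ×ˢ Set.univ) :=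
    contDiffOn_fst
  have hes := fun z (hz : z ∈ Ω' ×ˢ (Set.univ : Set ℝ)) => he.symm_mapsTo hz.1
  have hΦd : IsDiffeo Φ (Ω ×ˢ Set.univ) (Ω' ×ˢ Set.univ) := by
    refine ⟨rfl, rfl, ?_, ?_⟩
    · exact (he.2.2.1.comp f1 fun z hz => hz.1).prodMk
        (contDiffOn_snd.div (hφ.comp f1 fun z hz => hz.1) fun z hz => hφ0 _ hz.1)
    · have h1 : ContDiffOn ℝ ∞ (fun z : TXU => e.symm z.1) (Ω' ×ˢ Set.univ) :=
        he.2.2.2.comp f1 fun z hz => hz.1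
      exact h1.prodMk (contDiffOn_snd.mul (hφ.comp h1 hes))
  have hTd : IsDiffeo T ((Ω ×ˢ Set.univ) ×ˢ L.values) ((Ω' ×ˢ Set.univ) ×ˢ L.values) := by
    refine ⟨rfl, rfl, ?_, ?_⟩
    · refine (hΦd.2.2.1.comp contDiffOn_fst fun z hz => hz.1).prodMk ?_
      exact hα.comp (f := fun z : TXU × Θ => (z.1.1, z.2))
        (contDiff_fst.fst.prodMk contDiff_snd).contDiffOn fun z hz => ⟨hz.1.1, trivial⟩
    · refine (hΦd.2.2.2.comp contDiffOn_fst fun z hz => hz.1).prodMk ?_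
      exact hβ.comp (f := fun z : TXU × Θ => (z.1.1, z.2))
        (contDiff_fst.fst.prodMk contDiff_snd).contDiffOn fun z hz => ⟨hz.1.1, trivial⟩
  have hpush : ∀ θ θ', (∀ p ∈ Ω, θ' (e p) = α p (θ p)) → EqClass.Pushes Ω T θ θ' :=
    fun θ θ' h p hp u => (h p hp).symm
  have hmaps : ∀ θ ∈ L.S Ω, ∀ θ' ∈ L.S Ω', (∀ p ∈ Ω, θ' (e p) = α p (θ p)) →
      L.MapsEq Ω Φ θ θ' := fun θ hθ θ' hθ' h =>
    (R.mapsEq_iff hΩ hΩ' hθ hθ' hΦd).2 (mapsEq_of_inter (hI θ hθ θ' hθ' h) fun p _ u => rfl)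
  refine ⟨Φ, T, ⟨hΦd, hTd, fun z _ => rfl, fun θ hθ => ?_, fun θ' hθ' => ?_⟩, fun p _ u => rfl,
    hpush⟩
  · have h2 : (fun p => α (e.symm p) (θ (e.symm p))) ∈ L.S Ω' := by
      refine ⟨?_, fun p hp => mα _ (he.symm_mapsTo hp) _ (hθ.2 _ (he.symm_mapsTo hp))⟩
      exact hα.comp (f := fun p => (e.symm p, θ (e.symm p)))
        (he.2.2.2.prodMk (hθ.1.comp he.2.2.2 fun p hp => he.symm_mapsTo hp))
        fun p hp => ⟨he.symm_mapsTo hp, trivial⟩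
    have h3 : ∀ p ∈ Ω, (fun p => α (e.symm p) (θ (e.symm p))) (e p) = α p (θ p) := fun p hp => by
      simp only [he.left_inv hp]
    exact ⟨_, h2, hpush _ _ h3, hmaps _ hθ _ h2 h3⟩
  · have h2 : (fun p => β (e p) (θ' (e p))) ∈ L.S Ω := by
      refine ⟨?_, fun p hp => mβ _ (he.mapsTo hp) _ (hθ'.2 _ (he.mapsTo hp))⟩
      exact hβ.comp (f := fun p => (e p, θ' (e p)))
        (he.2.2.1.prodMk (hθ'.1.comp he.2.2.1 fun p hp => he.mapsTo hp))
        fun p hp => ⟨he.mapsTo hp, trivial⟩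
    have h3 : ∀ p ∈ Ω, θ' (e p) = α p ((fun p => β (e p) (θ' (e p))) p) := fun p hp => by
      have := hαβ _ (he.mapsTo hp) (θ' (e p))
      rw [he.left_inv hp] at this
      exact this.symm
    exact ⟨_, h2, hpush _ _ h3, hmaps _ h2 _ hθ' h3⟩

end Rep

end

/-! ### The four classes as Kolmogorov equations or their adjoints -/

section

/-- Either the equation with the coefficients `k` or its adjoint, depending on the sign `σ`. -/
def co (σ : ℝ) (k : Coef) : Coef := if σ = 1 then k else adj k

/-- The multiplier of a linear transformation, dualized if `σ = -1`. -/
def com (σ : ℝ) (e : PartialEquiv TX TX) (φ : TX → ℝ) : TX → ℝ :=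
  if σ = 1 then φ else fun q => dx (xc e) q / φ q

section Co

variable {Ω Ω' : Set TX} {e : PartialEquiv TX TX} {φ : TX → ℝ} {k k' : Coef} {σ : ℝ} {p : TX}

theorem co_mem (hk : k ∈ Lin.S Ω) (hΩ : IsOpen Ω) : co σ k ∈ Lin.S Ω := by
  unfold co; split_ifs
  exacts [hk, adj_mem hk hΩ]

theorem adj_congr (hΩ : IsOpen Ω) (h : ∀ p ∈ Ω, k p = k' p) (hp : p ∈ Ω) : adj k p = adj k' p := by
  have h1 := eventuallyEq_of_eqOn (f := fun q => (k q).1) (g := fun q => (k' q).1) hΩ hp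
    fun q hq => by rw [h q hq]
  have h2 := eventuallyEq_of_eqOn (f := fun q => (k q).2.1) (g := fun q => (k' q).2.1) hΩ hp
    fun q hq => by rw [h q hq]
  rw [adj, adj, h p hp, dx_congr h1, dx_congr h2, dx_congr (dx_eventuallyEq h1)]

theorem co_congr (hΩ : IsOpen Ω) (h : ∀ p ∈ Ω, k p = k' p) (hp : p ∈ Ω) :
    co σ k p = co σ k' p := by
  unfold co; split_ifs
  exacts [h p hp, adj_congr hΩ h hp]

theorem co_co (hk : k ∈ Lin.S Ω) (hΩ : IsOpen Ω) (hp : p ∈ Ω) : co σ (co σ k) p = k p := by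
  unfold co; split_ifs
  exacts [rfl, adj_adj hk hΩ hp]

theorem Inter.co (H : Inter Ω Ω' e φ k k') (σ : ℝ) :
    Inter Ω Ω' e (com σ e φ) (co σ k) (co σ k') := by
  unfold com KolmogorovFokkerPlanck.co; split_ifs
  exacts [H, H.adjoint]

theorem Inter.of_co (H : Inter Ω Ω' e φ (KolmogorovFokkerPlanck.co σ k)
    (KolmogorovFokkerPlanck.co σ k')) (hk : k ∈ Lin.S Ω) (hk' : k' ∈ Lin.S Ω') :
    Inter Ω Ω' e (com σ e φ) k k' :=
  (H.co σ).congr (fun _ _ => rfl) (fun _ hp => (co_co hk H.op hp).symm)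
    fun _ hp => (co_co hk' H.op' hp).symm

end Co

/-- Classes whose equations are Kolmogorov equations, or their adjoints if `σ = -1`. -/
structure KClass {Θ : Type} [NormedAddCommGroup Θ] [NormedSpace ℝ Θ] (L : EqClass Θ)
    (ε σ : ℝ) (el : (TX → ℝ) → TX → Θ) (κ : (TX → Θ) → Coef) : Prop where
  rep : Rep L fun θ => co σ (κ θ)
  κ_mem : ∀ {Ω θ}, IsOpen Ω → θ ∈ L.S Ω → κ θ ∈ Lin.S Ω
  κ_c : ∀ θ p, (κ θ p).2.2 = 0
  κ_el : ∀ B p, κ (el B) p = (σ * ε, B p, 0)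
  el_mem : ∀ {Ω B}, (∀ p ∈ Ω, Sm B p) → el B ∈ L.S Ω
  realize : ∀ {Ω Ω' e θ θ'}, θ ∈ L.S Ω → θ' ∈ L.S Ω' →
    Inter Ω Ω' e (fun _ => 1) (κ θ) (κ θ') → L.GEquiv Ω θ Ω' θ'

theorem rep_Peps {ε : ℝ} (hε : ε ≠ 0) : Rep (Peps ε) (Pco ε) where
  mem hΩ hθ := Pco_mem hε fun p hp => sm_of_contDiffOn hθ.1 hΩ hp
  lhs hΩ hθ hp hf := by
    simp only [EqClass.lhs, Peps, Lin, Pco]; ring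
  congr hΩ h p hp := by simp only [Pco, h p hp]

theorem exists_isEquivTransf_real {L : EqClass ℝ} {C : (TX → ℝ) → Coef} (R : Rep L C)
    (hL : L.values = Set.univ) {Ω Ω' : Set TX} (hΩ : IsOpen Ω) (hΩ' : IsOpen Ω')
    {e : PartialEquiv TX TX} {φ : TX → ℝ} (he : IsDiffeo e Ω Ω') (hφ : ContDiffOn ℝ ∞ φ Ω)
    (hφ0 : ∀ p ∈ Ω, φ p ≠ 0) {m n : TX → ℝ} (hm : ∀ p ∈ Ω, Sm m p)
    (hn : ∀ p ∈ Ω, Sm n p) (hm0 : ∀ p ∈ Ω, m p ≠ 0)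
    (hI : ∀ θ ∈ L.S Ω, ∀ θ' ∈ L.S Ω', (∀ p ∈ Ω, θ' (e p) = m p * θ p + n p) →
      Inter Ω Ω' e φ (C θ) (C θ')) :
    ∃ Φ T, L.IsEquivTransf Ω Ω' Φ T ∧ (∀ p ∈ Ω, ∀ u, Φ (p, u) = (e p, u / φ p)) ∧
      ∀ θ θ', (∀ p ∈ Ω, θ' (e p) = m p * θ p + n p) → EqClass.Pushes Ω T θ θ' := by
  have hm' : ContDiffOn ℝ ∞ m Ω := fun p hp => (hm p hp).contDiffWithinAt
  have hn' : ContDiffOn ℝ ∞ n Ω := fun p hp => (hn p hp).contDiffWithinAt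
  have f1 : ∀ {s : Set TX}, ContDiffOn ℝ ∞ (fun z : TX × ℝ => z.1) (s ×ˢ Set.univ) :=
    contDiffOn_fst
  have h1 : ContDiffOn ℝ ∞ (fun z : TXU => e.symm z.1) (Ω' ×ˢ Set.univ) :=
    he.2.2.2.comp f1 fun z hz => hz.1
  have hes := fun z (hz : z ∈ Ω' ×ˢ (Set.univ : Set ℝ)) => he.symm_mapsTo hz.1
  refine R.exists_isEquivTransf hΩ hΩ' he hφ hφ0 (α := fun p ϑ => m p * ϑ + n p)
    (β := fun p ϑ => (ϑ - n (e.symm p)) / m (e.symm p)) ?_ ?_ (fun _ _ _ _ => hL ▸ trivial)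
    (fun _ _ _ _ => hL ▸ trivial) (fun p hp ϑ => ?_) (fun p hp ϑ => ?_) hI
  · exact ((hm'.comp f1 fun z hz => hz.1).mul contDiffOn_snd).add
      (hn'.comp f1 fun z hz => hz.1)
  · exact (contDiffOn_snd.sub (hn'.comp h1 hes)).div (hm'.comp h1 hes)
      fun z hz => hm0 _ (hes z hz)
  · rw [he.left_inv hp, add_sub_cancel_right, mul_div_cancel_left₀ _ (hm0 p hp)]
  · rw [mul_div_cancel₀ _ (hm0 _ (he.symm_mapsTo hp)), sub_add_cancel]

/-- The equivalence transformations of the class of heat equations with potentials that are defined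
by linear transformations between two of its equations. -/
theorem exists_isEquivTransf_Peps {ε : ℝ} (hε : ε ≠ 0) {Ω Ω' : Set TX} {e : PartialEquiv TX TX}
    {φ C C' : TX → ℝ} (H : Inter Ω Ω' e φ (Pco ε C) (Pco ε C')) :
    ∃ Φ T, (Peps ε).IsEquivTransf Ω Ω' Φ T ∧ (∀ p ∈ Ω, ∀ u, Φ (p, u) = (e p, u / φ p)) ∧
      EqClass.Pushes Ω T C C' := by
  -- By `rel_c` the potential changes as C' = C/T_t + n. This affine law depends only on e and φ, so
  -- it acts on all potentials at once.
  set n : TX → ℝ := fun p => (ε * dx (dx φ) p - dt φ p) / (φ p * dt (tc e) p) with hn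
  have hne : ∀ p ∈ Ω, φ p * dt (tc e) p ≠ 0 := fun p hp =>
    mul_ne_zero (H.ne p hp) (H.dt_tc_ne hp)
  obtain ⟨Φ, T, h1, h2, h3⟩ := exists_isEquivTransf_real (rep_Peps hε) rfl H.op H.op' H.diffeo
    H.smooth H.ne (m := fun p => (dt (tc e) p)⁻¹) (n := n)
    (fun p hp => (H.sm_tc hp).dt.inv (H.dt_tc_ne hp))
    (fun p hp => (((Sm.const ε).mul (H.sm hp).dx.dx).sub (H.sm hp).dt).div
      ((H.sm hp).mul (H.sm_tc hp).dt) (hne p hp))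
    (fun p hp => inv_ne_zero (H.dt_tc_ne hp))
    (fun θ hθ θ' hθ' h => by
      refine Inter.of_rel H.op H.op' H.diffeo H.smooth H.ne ((rep_Peps hε).mem H.op hθ)
        ((rep_Peps hε).mem H.op' hθ') (fun p hp => H.dx_tc hp) (fun p hp => H.dt_tc_ne hp)
        (fun p hp => H.rel_a hp) (fun p hp => H.rel_b hp) fun p hp => ?_
      simp only [Pco]
      rw [h p hp, hn]
      have := H.ne p hp
      have := H.dt_tc_ne hp
      field_simp
      ring)
  refine ⟨Φ, T, h1, h2, h3 _ _ fun p hp => ?_⟩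
  have h4 := H.rel_c hp
  simp only [Pco] at h4
  have := H.ne p hp
  have := H.dt_tc_ne hp
  rw [hn]
  field_simp
  linear_combination h4

/-- The coefficients of a reduced Kolmogorov equation. -/
def κred (ε σ : ℝ) (B : TX → ℝ) : Coef := fun p => (σ * ε, B p, 0)

/-- The coefficients of a Kolmogorov equation. -/
def κbar (σ : ℝ) (θ : TX → ℝ × ℝ) : Coef := fun p => (σ * (θ p).1, (θ p).2, 0)

/-- With the multiplier 1 the law for the zero-order coefficient is void, `rel_a` concerns only the
fixed leading coefficient, and `rel_b` is an affine law for B whose coefficients depend on e alone.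
Hence a map between two equations extends to an equivalence transformation of the whole class. -/
theorem realize_red {ε σ : ℝ} (hσε : σ * ε ≠ 0) {L : EqClass ℝ}
    (R : Rep L fun θ => co σ (κred ε σ θ)) (hL : L.values = Set.univ)
    {Ω Ω' e θ θ'} (_hθ : θ ∈ L.S Ω) (_hθ' : θ' ∈ L.S Ω')
    (H : Inter Ω Ω' e (fun _ => 1) (κred ε σ θ) (κred ε σ θ')) : L.GEquiv Ω θ Ω' θ' := by
  have hne : ∀ p ∈ Ω, dt (tc e) p ≠ 0 := fun p hp => H.dt_tc_ne hp
  have hone : ∀ p : TX, dx (fun _ : TX => (1 : ℝ)) p = 0 := fun p => dx_const _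
  have hone' : dx (fun _ : TX => (1 : ℝ)) = fun _ => 0 := by ext; exact dx_const _
  have hm : ∀ θ ∈ L.S Ω, κred ε σ θ ∈ Lin.S Ω := fun θ hθ =>
    Lin_mem_S_of_sm (fun _ _ => Sm.const _) (fun p hp => sm_of_contDiffOn hθ.1 H.op hp)
      (fun _ _ => Sm.const _) fun _ _ => hσε
  have hm' : ∀ θ ∈ L.S Ω', κred ε σ θ ∈ Lin.S Ω' := fun θ hθ =>
    Lin_mem_S_of_sm (fun _ _ => Sm.const _) (fun p hp => sm_of_contDiffOn hθ.1 H.op' hp)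
      (fun _ _ => Sm.const _) fun _ _ => hσε
  obtain ⟨Φ, T, h1, -, h3⟩ := exists_isEquivTransf_real R hL H.op H.op' H.diffeo
    (H.co σ).smooth (H.co σ).ne (m := fun p => dx (xc e) p / dt (tc e) p)
    (n := fun p => (σ * ε * dx (dx (xc e)) p - dt (xc e) p) / dt (tc e) p)
    (fun p hp => (H.sm_xc hp).dx.div (H.sm_tc hp).dt (H.dt_tc_ne hp))
    (fun p hp => (((Sm.const _).mul (H.sm_xc hp).dx.dx).sub (H.sm_xc hp).dt).div
      (H.sm_tc hp).dt (H.dt_tc_ne hp))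
    (fun p hp => div_ne_zero (H.dx_xc_ne hp) (H.dt_tc_ne hp))
    (fun θ hθ θ' hθ' h => by
      refine Inter.co (Inter.of_rel H.op H.op' H.diffeo H.smooth H.ne (hm θ hθ)
        (hm' θ' hθ') (fun p hp => H.dx_tc hp) (fun p hp => H.dt_tc_ne hp)
        (fun p hp => H.rel_a hp) (fun p hp => ?_) fun p hp => ?_) σ
      · simp only [κred, hone]
        rw [h p hp]
        have := H.dt_tc_ne hp
        field_simp
        ring
      · simp only [κred, hone', dx_const, dt_const]; ring)
  refine ⟨Φ, T, h1, h3 _ _ fun p hp => ?_⟩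
  have h4 := H.rel_b hp
  simp only [κred, hone] at h4
  have := H.dt_tc_ne hp
  field_simp
  linear_combination h4

/-- As for the reduced classes, but A is also transformed: `rel_a` gives the factor X_x²/T_t, and
`rel_b` mixes A into the new drift through X_xx. -/
theorem realize_bar {σ : ℝ} (hσ : σ ≠ 0) {L : EqClass (ℝ × ℝ)}
    (R : Rep L fun θ => co σ (κbar σ θ)) (hL : L.values = {v | v.1 ≠ 0})
    {Ω Ω' e θ θ'} (_hθ : θ ∈ L.S Ω) (_hθ' : θ' ∈ L.S Ω')
    (H : Inter Ω Ω' e (fun _ => 1) (κbar σ θ) (κbar σ θ')) : L.GEquiv Ω θ Ω' θ' := by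
  have hone : ∀ p : TX, dx (fun _ : TX => (1 : ℝ)) p = 0 := fun p => dx_const _
  have hone' : dx (fun _ : TX => (1 : ℝ)) = fun _ => 0 := by ext; exact dx_const _
  have hm : ∀ {Ω}, IsOpen Ω → ∀ θ ∈ L.S Ω, κbar σ θ ∈ Lin.S Ω := fun {Ω} hΩ θ hθ => by
    have hv := hθ.2
    rw [hL] at hv
    exact Lin_mem_S_of_sm (fun p hp => (Sm.const σ).mul
      (sm_of_contDiffOn (contDiff_fst.comp_contDiffOn hθ.1) hΩ hp))
      (fun p hp => sm_of_contDiffOn (contDiff_snd.comp_contDiffOn hθ.1) hΩ hp)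
      (fun _ _ => Sm.const _) fun p hp => mul_ne_zero hσ (hv p hp)
  set m₁ : TX → ℝ := fun p => dx (xc e) p ^ 2 / dt (tc e) p with hm₁
  set m₂ : TX → ℝ := fun p => σ * dx (dx (xc e)) p / dt (tc e) p with hm₂
  set m₃ : TX → ℝ := fun p => dx (xc e) p / dt (tc e) p with hm₃
  set n : TX → ℝ := fun p => -(dt (xc e) p / dt (tc e) p) with hn
  have m₁0 : ∀ p ∈ Ω, m₁ p ≠ 0 := fun p hp =>
    div_ne_zero (pow_ne_zero 2 (H.dx_xc_ne hp)) (H.dt_tc_ne hp)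
  have m₃0 : ∀ p ∈ Ω, m₃ p ≠ 0 := fun p hp => div_ne_zero (H.dx_xc_ne hp) (H.dt_tc_ne hp)
  have s₁ : ContDiffOn ℝ ∞ m₁ Ω := fun p hp => ContDiffAt.contDiffWithinAt
    (Sm.div (ContDiffAt.pow (H.sm_xc hp).dx 2) (H.sm_tc hp).dt (H.dt_tc_ne hp))
  have s₂ : ContDiffOn ℝ ∞ m₂ Ω := fun p hp => ContDiffAt.contDiffWithinAt
    (((Sm.const σ).mul (H.sm_xc hp).dx.dx).div (H.sm_tc hp).dt (H.dt_tc_ne hp))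
  have s₃ : ContDiffOn ℝ ∞ m₃ Ω := fun p hp => ContDiffAt.contDiffWithinAt
    ((H.sm_xc hp).dx.div (H.sm_tc hp).dt (H.dt_tc_ne hp))
  have sn : ContDiffOn ℝ ∞ n Ω := fun p hp => ContDiffAt.contDiffWithinAt
    (ContDiffAt.neg ((H.sm_xc hp).dt.div (H.sm_tc hp).dt (H.dt_tc_ne hp)))
  have f1 : ∀ {s : Set TX}, ContDiffOn ℝ ∞ (fun z : TX × (ℝ × ℝ) => z.1) (s ×ˢ Set.univ) :=
    contDiffOn_fst
  have f2 : ∀ {s : Set (TX × (ℝ × ℝ))}, ContDiffOn ℝ ∞ (fun z : TX × (ℝ × ℝ) => z.2.1) s :=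
    contDiff_snd.fst.contDiffOn
  have f3 : ∀ {s : Set (TX × (ℝ × ℝ))}, ContDiffOn ℝ ∞ (fun z : TX × (ℝ × ℝ) => z.2.2) s :=
    contDiff_snd.snd.contDiffOn
  have g1 : ContDiffOn ℝ ∞ (fun z : TX × (ℝ × ℝ) => e.symm z.1) (Ω' ×ˢ Set.univ) :=
    H.diffeo.2.2.2.comp f1 fun z hz => hz.1
  have hes := fun z (hz : z ∈ Ω' ×ˢ (Set.univ : Set (ℝ × ℝ))) => H.diffeo.symm_mapsTo hz.1
  have hes' := fun z (hz : z ∈ Ω ×ˢ (Set.univ : Set (ℝ × ℝ))) => hz.1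
  have k1 : ∀ p ∈ Ω, (θ' (e p)).1 = m₁ p * (θ p).1 := fun p hp => by
    have h4 := H.rel_a hp
    simp only [κbar] at h4
    have := H.dt_tc_ne hp
    rw [hm₁]; field_simp
    apply mul_left_cancel₀ hσ; linear_combination h4
  have k2 : ∀ p ∈ Ω, (θ' (e p)).2 = m₂ p * (θ p).1 + m₃ p * (θ p).2 + n p := fun p hp => by
    have h4 := H.rel_b hp
    simp only [κbar, hone] at h4
    have := H.dt_tc_ne hp
    rw [hm₂, hm₃, hn]; field_simp
    linear_combination h4
  obtain ⟨Φ, T, h1, -, h3⟩ := R.exists_isEquivTransf H.op H.op' H.diffeo (H.co σ).smooth (H.co σ).ne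
    (α := fun p ϑ => (m₁ p * ϑ.1, m₂ p * ϑ.1 + m₃ p * ϑ.2 + n p))
    (β := fun p ϑ => (ϑ.1 / m₁ (e.symm p),
      (ϑ.2 - m₂ (e.symm p) * (ϑ.1 / m₁ (e.symm p)) - n (e.symm p)) / m₃ (e.symm p)))
    (((s₁.comp f1 hes').mul f2).prodMk
      ((((s₂.comp f1 hes').mul f2).add ((s₃.comp f1 hes').mul f3)).add (sn.comp f1 hes')))
    ((f2.div (s₁.comp g1 hes) fun z hz => m₁0 _ (hes z hz)).prodMk
      (((f3.sub ((s₂.comp g1 hes).mul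
        (f2.div (s₁.comp g1 hes) fun z hz => m₁0 _ (hes z hz)))).sub (sn.comp g1 hes)).div
          (s₃.comp g1 hes) fun z hz => m₃0 _ (hes z hz)))
    (fun p hp ϑ hϑ => by rw [hL] at hϑ ⊢; exact mul_ne_zero (m₁0 p hp) hϑ)
    (fun p hp ϑ hϑ => by
      rw [hL] at hϑ ⊢; exact div_ne_zero hϑ (m₁0 _ (H.diffeo.symm_mapsTo hp)))
    (fun p hp ϑ => by
      have := m₁0 p hp
      have := m₃0 p hp
      rw [H.diffeo.left_inv hp]
      ext
      · simp only; field_simp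
      · simp only; field_simp; ring)
    (fun p hp ϑ => by
      have := m₁0 _ (H.diffeo.symm_mapsTo hp)
      have := m₃0 _ (H.diffeo.symm_mapsTo hp)
      ext
      · simp only; field_simp
      · simp only; field_simp; ring)
    (fun θ hθ θ' hθ' h => by
      refine Inter.co (Inter.of_rel H.op H.op' H.diffeo H.smooth H.ne (hm H.op θ hθ)
        (hm H.op' θ' hθ') (fun p hp => H.dx_tc hp) (fun p hp => H.dt_tc_ne hp)
        (fun p hp => ?_) (fun p hp => ?_) fun p hp => ?_) σ
      · simp only [κbar]
        rw [h p hp, hm₁]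
        have := H.dt_tc_ne hp
        field_simp
      · simp only [κbar, hone]
        rw [h p hp, hm₂, hm₃, hn]
        have := H.dt_tc_ne hp
        field_simp
        ring
      · simp only [κbar, hone', dx_const, dt_const]; ring)
  exact ⟨Φ, T, h1, h3 _ _ fun p hp => Prod.ext (k1 p hp) (k2 p hp)⟩

theorem co_one (k : Coef) : co 1 k = k := if_pos rfl
theorem co_neg_one (k : Coef) : co (-1) k = adj k := if_neg (by norm_num)

theorem κred_mem {ε σ : ℝ} (hσε : σ * ε ≠ 0) {Ω : Set TX} (hΩ : IsOpen Ω) {B : TX → ℝ}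
    (hB : ContDiffOn ℝ ∞ B Ω) : κred ε σ B ∈ Lin.S Ω :=
  Lin_mem_S_of_sm (fun _ _ => Sm.const _) (fun _ hp => sm_of_contDiffOn hB hΩ hp)
    (fun _ _ => Sm.const _) fun _ _ => hσε

theorem κbar_mem {σ : ℝ} (hσ : σ ≠ 0) {Ω : Set TX} (hΩ : IsOpen Ω) {θ : TX → ℝ × ℝ}
    (hθ : ContDiffOn ℝ ∞ θ Ω) (h0 : ∀ p ∈ Ω, (θ p).1 ≠ 0) : κbar σ θ ∈ Lin.S Ω :=
  Lin_mem_S_of_sm (fun _ hp => (Sm.const σ).mul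
    (sm_of_contDiffOn (contDiff_fst.comp_contDiffOn hθ) hΩ hp))
    (fun _ hp => sm_of_contDiffOn (contDiff_snd.comp_contDiffOn hθ) hΩ hp)
    (fun _ _ => Sm.const _) fun p hp => mul_ne_zero hσ (h0 p hp)

variable {ε : ℝ}

theorem kClass_Keps (hε : ε ≠ 0) : KClass (Keps ε) ε 1 (fun B => B) (κred ε 1) := by
  have hne : (1 : ℝ) * ε ≠ 0 := by simpa using hε
  have R : Rep (Keps ε) fun θ => co 1 (κred ε 1 θ) :=
    { mem := fun hΩ hθ => co_mem (κred_mem hne hΩ hθ.1) hΩ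
      lhs := fun hΩ hθ hp hf => by
        rw [co_one]; simp only [EqClass.lhs, Keps, Lin, κred]; ring
      congr := fun hΩ h p hp => co_congr hΩ (fun q hq => by simp only [κred, h q hq]) hp }
  exact ⟨R, fun hΩ hθ => κred_mem hne hΩ hθ.1, fun _ _ => rfl, fun _ _ => rfl,
    fun h => ⟨fun p hp => (h p hp).contDiffWithinAt, fun _ _ => trivial⟩,
    fun hθ hθ' H => realize_red hne R rfl hθ hθ' H⟩

theorem kClass_Kbar (hε : ε ≠ 0) : KClass Kbar ε 1 (fun B p => (ε, B p)) (κbar 1) := by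
  have R : Rep Kbar fun θ => co 1 (κbar 1 θ) :=
    { mem := fun hΩ hθ => co_mem (κbar_mem one_ne_zero hΩ hθ.1 hθ.2) hΩ
      lhs := fun hΩ hθ hp hf => by
        rw [co_one]; simp only [EqClass.lhs, Kbar, Lin, κbar]; ring
      congr := fun hΩ h p hp => co_congr hΩ (fun q hq => by simp only [κbar, h q hq]) hp }
  exact ⟨R, fun hΩ hθ => κbar_mem one_ne_zero hΩ hθ.1 hθ.2, fun _ _ => rfl, fun _ _ => rfl,
    fun h => ⟨fun p hp => (contDiffAt_const.prodMk (h p hp)).contDiffWithinAt, fun _ _ => hε⟩,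
    fun hθ hθ' H => realize_bar one_ne_zero R rfl hθ hθ' H⟩

/-- The equation u_t = ε u_xx + (B u)_x is the adjoint of u_t = -ε u_xx + B u_x; this is the reason
for the leading coefficient σε in `κred`. -/
theorem kClass_Feps (hε : ε ≠ 0) : KClass (Feps ε) ε (-1) (fun B => B) (κred ε (-1)) := by
  have hne : (-1 : ℝ) * ε ≠ 0 := by simpa using hε
  have R : Rep (Feps ε) fun θ => co (-1) (κred ε (-1) θ) :=
    { mem := fun hΩ hθ => co_mem (κred_mem hne hΩ hθ.1) hΩ
      lhs := fun {Ω θ p f} hΩ hθ hp hf => by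
        have hB : Sm θ p := sm_of_contDiffOn hθ.1 hΩ hp
        have hc : dx (fun _ : TX => -1 * ε) = fun _ => 0 := by ext; exact dx_const _
        rw [co_neg_one]; simp only [EqClass.lhs, Feps, Lin, κred, adj]
        rw [dx_mul hB.diff hf.diff, hc, dx_const]; ring
      congr := fun hΩ h p hp => co_congr hΩ (fun q hq => by simp only [κred, h q hq]) hp }
  exact ⟨R, fun hΩ hθ => κred_mem hne hΩ hθ.1, fun _ _ => rfl, fun _ _ => rfl,
    fun h => ⟨fun p hp => (h p hp).contDiffWithinAt, fun _ _ => trivial⟩,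
    fun hθ hθ' H => realize_red hne R rfl hθ hθ' H⟩

theorem kClass_Fbar (hε : ε ≠ 0) : KClass Fbar ε (-1) (fun B p => (ε, B p)) (κbar (-1)) := by
  have hne : (-1 : ℝ) ≠ 0 := by norm_num
  have R : Rep Fbar fun θ => co (-1) (κbar (-1) θ) :=
    { mem := fun hΩ hθ => co_mem (κbar_mem hne hΩ hθ.1 hθ.2) hΩ
      lhs := fun {Ω θ p f} hΩ hθ hp hf => by
        have hA : ∀ q ∈ Ω, Sm (fun q => (θ q).1) q := fun q hq =>
          sm_of_contDiffOn (contDiff_fst.comp_contDiffOn hθ.1) hΩ hq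
        have hB : Sm (fun q => (θ q).2) p :=
          sm_of_contDiffOn (contDiff_snd.comp_contDiffOn hθ.1) hΩ hp
        rw [co_neg_one]; simp only [EqClass.lhs, Fbar, Lin, κbar, adj]
        rw [dx_mul hB.diff hf.diff, dxx_mul (hA p hp) hf, dx_const_mul _ (hA p hp).diff,
          dxx_const_mul _ (hA p hp)]; ring
      congr := fun hΩ h p hp => co_congr hΩ (fun q hq => by simp only [κbar, h q hq]) hp }
  exact ⟨R, fun hΩ hθ => κbar_mem hne hΩ hθ.1 hθ.2, fun _ _ => rfl, fun _ _ => rfl,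
    fun h => ⟨fun p hp => (contDiffAt_const.prodMk (h p hp)).contDiffWithinAt, fun _ _ => hε⟩,
    fun hθ hθ' H => realize_bar hne R rfl hθ hθ' H⟩

end

section

/-! ### Local reduction to heat equations with potentials -/

open MeasureTheory in
/-- A smooth function has, locally, a smooth antiderivative with respect to `x`. -/
theorem exists_dx_eq {g : TX → ℝ} {W : Set TX} (hW : IsOpen W) (hg : ContDiffOn ℝ ∞ g W) {p : TX}
    (hp : p ∈ W) : ∃ G : TX → ℝ, ContDiff ℝ ∞ G ∧ ∀ᶠ q in 𝓝 p, dx G q = g q := by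
  obtain ⟨g₁, hg₁, heq⟩ := exists_contDiff_eventuallyEq hg hW hp
  let b : ContDiffBump p := ⟨1, 2, by norm_num, by norm_num⟩
  set g₂ : ℝ → ℝ → ℝ := fun t x => b (t, x) * g₁ (t, x) with hg₂
  have hs₂ : ContDiff ℝ ∞ (fun q : TX => g₂ q.1 q.2) := by
    simpa [hg₂] using b.contDiff.mul hg₁
  set k : Set ℝ := Metric.closedBall p.2 2
  have hgs : ∀ t, ∀ x, t ∈ (Set.univ : Set ℝ) → x ∉ k → g₂ t x = 0 := by
    intro t x _ hx
    have : b (t, x) = 0 := by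
      apply b.zero_of_le_dist
      have h1 : 2 < dist x p.2 := by simpa [k] using hx
      have h2 : dist x p.2 ≤ dist (t, x) p := by
        rw [Prod.dist_eq]; exact le_max_right _ _
      exact (h1.trans_le h2).le
    simp [hg₂, this]
  -- After a cutoff, the integral of g from -∞ to x is the convolution with the Heaviside function,
  -- and convolution with compactly supported functions is jointly smooth in x and the parameter t.
  set f : ℝ → ℝ := (Set.Ici 0).indicator fun _ => 1 with hf
  have hfl : LocallyIntegrable f volume :=
    (locallyIntegrable_const 1).indicator measurableSet_Ici
  have key := contDiffOn_convolution_right_with_param (𝕜 := ℝ) (μ := volume) (n := ⊤)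
    (ContinuousLinearMap.mul ℝ ℝ) (g := g₂) isOpen_univ (isCompact_closedBall p.2 2) hgs hfl
    hs₂.contDiffOn
  set G : TX → ℝ := fun q => convolution f (g₂ q.1) (ContinuousLinearMap.mul ℝ ℝ) volume q.2
  have hG : ContDiff ℝ ∞ G := by
    rw [Set.univ_prod_univ, contDiffOn_univ] at key
    exact key
  have hcont : ∀ t, Continuous (g₂ t) := fun t =>
    hs₂.continuous.comp (continuous_const.prodMk continuous_id)
  have hint : ∀ t, Integrable (g₂ t) := fun t => by
    refine (hcont t).integrable_of_hasCompactSupport ?_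
    exact HasCompactSupport.intro (isCompact_closedBall p.2 2) fun x hx => hgs t x trivial hx
  have hGI : ∀ q : TX, G q = ∫ y in Set.Iic q.2, g₂ q.1 y := by
    intro q
    have h1 := integral_sub_left_eq_self (fun y => f (q.2 - y) * g₂ q.1 y) volume q.2
    have h2 : G q = ∫ y, f y * g₂ q.1 (q.2 - y) := rfl
    rw [h2]
    simp only [sub_sub_cancel] at h1
    rw [h1, ← integral_indicator measurableSet_Iic]
    congr 1
    ext y
    by_cases hy : y ≤ q.2
    · simp [hf, Set.indicator, hy]
    · simp [hf, Set.indicator, hy]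
  refine ⟨G, hG, ?_⟩
  filter_upwards [heq, b.eventuallyEq_one] with q h1 h2
  have hder : HasDerivAt (fun x => G (q.1, x)) (g₂ q.1 q.2) q.2 := by
    have h3 : (fun x => G (q.1, x)) = fun x => (∫ y in Set.Iic (0 : ℝ), g₂ q.1 y) +
        ∫ y in (0 : ℝ)..x, g₂ q.1 y := by
      ext x
      rw [hGI, ← intervalIntegral.integral_Iic_sub_Iic (hint q.1).integrableOn
        (hint q.1).integrableOn]
      ring
    rw [h3]
    exact ((hcont q.1).integral_hasStrictDerivAt 0 q.2).hasDerivAt.const_add _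
  have h4 : HasDerivAt (fun x => G (q.1, x)) (dx G q) q.2 := by
    have := (hG.contDiffAt (x := (q.1, q.2))).differentiableAt (by simp) |>.hasFDerivAt
      |>.comp_hasDerivAt q.2 ((hasDerivAt_const q.2 q.1).prodMk (hasDerivAt_id q.2))
    exact this
  rw [h4.unique hder]
  simp only [hg₂, Prod.mk.eta]
  rw [h2, h1, Pi.one_apply, one_mul]

theorem exists_hasDerivAt_eq {g : ℝ → ℝ} {I : Set ℝ} (hI : IsOpen I) (hg : ContDiffOn ℝ ∞ g I)
    {t : ℝ} (ht : t ∈ I) : ∃ G : ℝ → ℝ, ContDiff ℝ ∞ G ∧ ∀ᶠ s in 𝓝 t, HasDerivAt G (g s) s := by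
  obtain ⟨G, hG, h⟩ := exists_dx_eq (hI.preimage continuous_snd)
    (hg.comp contDiffOn_snd fun q hq => hq) (p := ((0 : ℝ), t)) ht
  refine ⟨fun s => G (0, s), hG.comp (contDiff_const.prodMk contDiff_id), ?_⟩
  have h1 : ContinuousAt (fun s : ℝ => ((0 : ℝ), s)) t := by fun_prop
  filter_upwards [h1.eventually h] with s hs
  have := (hG.contDiffAt (x := (0, s))).differentiableAt (by simp) |>.hasFDerivAt
      |>.comp_hasDerivAt s ((hasDerivAt_const s (0 : ℝ)).prodMk (hasDerivAt_id s))
  have h2 : HasDerivAt (fun s => G (0, s)) (dx G (0, s)) s := this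
  rwa [hs] at h2

/-- Balls of the plane are domains. -/
theorem isDom_ball (p : TX) {r : ℝ} (hr : 0 < r) : IsDom (Metric.ball p r) :=
  ⟨Metric.isOpen_ball, ⟨p, Metric.mem_ball_self hr⟩, (convex_ball p r).isPreconnected⟩

theorem IsDiffeo.isDom {Ω Ω' : Set TX} {e : PartialEquiv TX TX} (h : IsDiffeo e Ω Ω')
    (hΩ : IsDom Ω) (hΩ' : IsOpen Ω') : IsDom Ω' := by
  refine ⟨hΩ', ?_⟩
  have : e '' Ω = Ω' := by rw [← h.1, ← h.2.1]; exact e.image_source_eq_target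
  rw [← this]
  exact hΩ.2.image e h.2.2.1.continuousOn

/-- The inverse function theorem, restricted to a ball so that the source is a domain and the
Jacobian is nonzero throughout, which makes the inverse smooth on all of the image. -/
theorem exists_isDiffeo {E : TX → TX} {W : Set TX} (hW : IsOpen W) (hE : ContDiffOn ℝ ∞ E W) {p : TX}
    (hp : p ∈ W) (hJ : jacobian E p ≠ 0) : ∃ (N N' : Set TX) (e : PartialEquiv TX TX), IsDom N ∧
      p ∈ N ∧ N ⊆ W ∧ IsOpen N' ∧ IsDiffeo e N N' ∧ ∀ q, e q = E q := by
  have hEa : ∀ q ∈ W, ContDiffAt ℝ ∞ E q := fun q hq => hE.contDiffAt (hW.mem_nhds hq)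
  have s1 : ∀ q ∈ W, Sm (fun q => (E q).1) q := fun q hq => contDiffAt_fst.comp q (hEa q hq)
  have s2 : ∀ q ∈ W, Sm (fun q => (E q).2) q := fun q hq => contDiffAt_snd.comp q (hEa q hq)
  have hJs : Sm (jacobian E) p :=
    ((s1 p hp).dt.mul (s2 p hp).dx).sub ((s1 p hp).dx.mul (s2 p hp).dt)
  obtain ⟨L, hL⟩ := exists_hasFDerivAt_equiv ((hEa p hp).differentiableAt (by simp)) hJ
  set h := (hEa p hp).toOpenPartialHomeomorph E hL (by simp) with hh
  have hcoe : ∀ q, h q = E q := fun q => rfl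
  have hsrc : h.source ∈ 𝓝 p :=
    h.open_source.mem_nhds ((hEa p hp).mem_toOpenPartialHomeomorph_source hL (by simp))
  have hev : ∀ᶠ q in 𝓝 p, q ∈ h.source ∧ q ∈ W ∧ jacobian E q ≠ 0 :=
    by
      filter_upwards [hsrc, hW.mem_nhds hp, hJs.continuousAt.eventually_ne hJ] with q a b c
      using ⟨a, b, c⟩
  obtain ⟨r, hr, hb⟩ := Metric.eventually_nhds_iff_ball.1 hev
  set N := Metric.ball p r
  have hN : N ⊆ h.source := fun q hq => (hb q hq).1
  refine ⟨N, h '' N, h.toPartialEquiv.restr N, isDom_ball p hr, Metric.mem_ball_self hr,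
    fun q hq => (hb q hq).2.1, h.isOpen_image_of_subset_source Metric.isOpen_ball hN,
    ⟨?_, ?_, ?_, ?_⟩, fun q => rfl⟩
  · rw [PartialEquiv.restr_source, Set.inter_eq_right]; exact hN
  · rw [PartialEquiv.restr_target]
    ext y; constructor
    · rintro ⟨h1, h2⟩; exact ⟨h.symm y, h2, h.right_inv h1⟩
    · rintro ⟨q, hq, rfl⟩
      exact ⟨h.map_source (hN hq), by
        change h.symm (h q) ∈ N; rw [h.left_inv (hN hq)]; exact hq⟩
  · exact hE.mono fun q hq => (hb q hq).2.1
  · rintro _ ⟨q, hq, rfl⟩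
    obtain ⟨L', hL'⟩ := exists_hasFDerivAt_equiv ((hEa q (hb q hq).2.1).differentiableAt (by simp))
      (hb q hq).2.2
    have h1 := h.left_inv (hN hq)
    exact (h.contDiffAt_symm (f₀' := L') (h.map_source (hN hq)) (by rw [h1]; exact hL')
      (by rw [h1]; exact hEa q (hb q hq).2.1)).contDiffWithinAt

/-- A linear transformation maps, locally, any linear evolution equation to some other one. -/
theorem exists_inter_push {k : Coef} {W : Set TX} (hW : IsOpen W) (hk : k ∈ Lin.S W) {E : TX → TX}
    {φ : TX → ℝ} (hE : ContDiffOn ℝ ∞ E W) (hφ : ContDiffOn ℝ ∞ φ W) (hφ0 : ∀ q ∈ W, φ q ≠ 0)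
    (hTx : ∀ q ∈ W, dx (fun q => (E q).1) q = 0) (hTt : ∀ q ∈ W, dt (fun q => (E q).1) q ≠ 0)
    (hXx : ∀ q ∈ W, dx (fun q => (E q).2) q ≠ 0) {p : TX} (hp : p ∈ W) :
    ∃ (N N' : Set TX) (e : PartialEquiv TX TX) (k' : Coef), IsDom N ∧ p ∈ N ∧ N ⊆ W ∧ IsDom N' ∧
      (∀ q, e q = E q) ∧ Inter N N' e φ k k' := by
  obtain ⟨N, N', e, hN, hpN, hNW, hN', he, heE⟩ := exists_isDiffeo hW hE hp (by
    rw [jacobian, hTx p hp, zero_mul, sub_zero]; exact mul_ne_zero (hTt p hp) (hXx p hp))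
  have htc : tc e = fun q => (E q).1 := by ext q; rw [tc, heE]
  have hxc : xc e = fun q => (E q).2 := by ext q; rw [xc, heE]
  have hkN : k ∈ Lin.S N := ⟨hk.1.mono hNW, fun q hq => hk.2 q (hNW hq)⟩
  have sT : ∀ q ∈ N, Sm (tc e) q := fun q hq => he.sm_tc hN.1 hq
  have sX : ∀ q ∈ N, Sm (xc e) q := fun q hq => he.sm_xc hN.1 hq
  have sφ : ∀ q ∈ N, Sm φ q := fun q hq => sm_of_contDiffOn hφ hW (hNW hq)
  have hT0 : ∀ q ∈ N, dt (tc e) q ≠ 0 := fun q hq => by rw [htc]; exact hTt q (hNW hq)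
  have hX0 : ∀ q ∈ N, dx (xc e) q ≠ 0 := fun q hq => by rw [hxc]; exact hXx q (hNW hq)
  have hφ' : ∀ q ∈ N, φ q ≠ 0 := fun q hq => hφ0 q (hNW hq)
  set a : TX → ℝ := fun q => (k q).1 * dx (xc e) q ^ 2 / dt (tc e) q with ha
  set b : TX → ℝ := fun q => ((k q).1 * (2 * dx φ q * dx (xc e) q + φ q * dx (dx (xc e)) q)
        + (k q).2.1 * φ q * dx (xc e) q - φ q * dt (xc e) q) / (φ q * dt (tc e) q) with hb
  set c : TX → ℝ := fun q => ((k q).1 * dx (dx φ) q + (k q).2.1 * dx φ q + (k q).2.2 * φ q - dt φ q)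
    / (φ q * dt (tc e) q) with hc
  have hne : ∀ q ∈ N, φ q * dt (tc e) q ≠ 0 := fun q hq => mul_ne_zero (hφ' q hq) (hT0 q hq)
  have sa : ∀ q ∈ N, Sm a q := fun q hq =>
    ((sm_a hkN hN.1 hq).mul (ContDiffAt.pow (sX q hq).dx 2)).div (sT q hq).dt (hT0 q hq)
  have sb : ∀ q ∈ N, Sm b q := fun q hq =>
    ((((sm_a hkN hN.1 hq).mul ((((Sm.const 2).mul (sφ q hq).dx).mul (sX q hq).dx).add
      ((sφ q hq).mul (sX q hq).dx.dx))).add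
      (((sm_b hkN hN.1 hq).mul (sφ q hq)).mul (sX q hq).dx)).sub
        ((sφ q hq).mul (sX q hq).dt)).div ((sφ q hq).mul (sT q hq).dt) (hne q hq)
  have sc : ∀ q ∈ N, Sm c q := fun q hq =>
    (((((sm_a hkN hN.1 hq).mul (sφ q hq).dx.dx).add ((sm_b hkN hN.1 hq).mul (sφ q hq).dx)).add
      ((sm_c hkN hN.1 hq).mul (sφ q hq))).sub (sφ q hq).dt).div ((sφ q hq).mul (sT q hq).dt)
        (hne q hq)
  refine ⟨N, N', e, fun q => (a (e.symm q), b (e.symm q), c (e.symm q)), hN, hpN, hNW,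
    he.isDom hN hN', heE, ?_⟩
  refine Inter.of_rel hN.1 hN' he (hφ.mono hNW) hφ' hkN ?_
    (fun q hq => by rw [htc]; exact hTx q (hNW hq)) hT0 (fun q hq => ?_) (fun q hq => ?_)
    fun q hq => ?_
  · have hs := fun q (hq : q ∈ N') => he.symm_mapsTo hq
    have hd := fun q (hq : q ∈ N') => he.contDiffAt_symm hN' hq
    exact Lin_mem_S_of_sm (fun q hq => (sa _ (hs q hq)).comp (hd q hq))
      (fun q hq => (sb _ (hs q hq)).comp (hd q hq)) (fun q hq => (sc _ (hs q hq)).comp (hd q hq))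
      fun q hq => div_ne_zero (mul_ne_zero (hkN.2 _ (hs q hq)) (pow_ne_zero 2 (hX0 _ (hs q hq))))
        (hT0 _ (hs q hq))
  · simp only [he.left_inv hq, ha]
    rw [div_mul_cancel₀ _ (hT0 q hq)]
  · simp only [he.left_inv hq, hb]
    rw [mul_assoc, div_mul_cancel₀ _ (hne q hq)]
  · simp only [he.left_inv hq, hc]
    rw [mul_assoc, div_mul_cancel₀ _ (hne q hq)]

/-- If the transformed equation has the leading coefficient `ε` and no first-order term, then it is
a heat equation with potential. -/
theorem Inter.to_Pco {Ω Ω' : Set TX} {e : PartialEquiv TX TX} {φ : TX → ℝ} {k k' : Coef} {ε : ℝ}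
    (H : Inter Ω Ω' e φ k k')
    (ha : ∀ p ∈ Ω, (k p).1 * dx (xc e) p ^ 2 = ε * dt (tc e) p)
    (hb : ∀ p ∈ Ω, (k p).1 * (2 * dx φ p * dx (xc e) p + φ p * dx (dx (xc e)) p)
        + (k p).2.1 * φ p * dx (xc e) p - φ p * dt (xc e) p = 0) :
    Inter Ω Ω' e φ k (Pco ε fun p => (k' p).2.2) := by
  refine H.congr (fun _ _ => rfl) (fun _ _ => rfl) fun p hp => ?_
  have hq := H.diffeo.symm_mapsTo hp
  have h1 := H.rel_a hq
  have h2 := H.rel_b hq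
  rw [ha _ hq, H.diffeo.right_inv hp] at h1
  rw [hb _ hq, H.diffeo.right_inv hp, mul_assoc] at h2
  have h3 := mul_right_cancel₀ (H.dt_tc_ne hq) h1
  have h4 := (mul_eq_zero.1 h2).resolve_right (mul_ne_zero (H.ne _ hq) (H.dt_tc_ne hq))
  ext
  · exact h3.symm
  · exact h4.symm
  · rfl

/-- Any linear evolution equation is locally equivalent to a heat equation with potential. -/
theorem exists_inter_Pco {ε : ℝ} (hε : ε = 1 ∨ ε = -1) {k : Coef} {W : Set TX} (hW : IsOpen W)
    (hk : k ∈ Lin.S W) {p : TX} (hp : p ∈ W) :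
    ∃ (N N' : Set TX) (e : PartialEquiv TX TX) (φ C : TX → ℝ), IsDom N ∧ p ∈ N ∧ N ⊆ W ∧ IsDom N' ∧
      Inter N N' e φ k (Pco ε C) := by
  have hε0 := eps_ne_zero hε
  have ha0 : (k p).1 ≠ 0 := hk.2 p hp
  -- The new time is s t. Its sign must be that of ε times the leading coefficient, since the other
  -- coefficient laws cannot change the sign; time is reversed when necessary.
  obtain ⟨s, hs, hpos⟩ : ∃ s : ℝ, s ≠ 0 ∧ 0 < ε * s / (k p).1 := by
    refine ⟨ε * (k p).1, mul_ne_zero hε0 ha0, ?_⟩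
    rw [← mul_assoc, eps_mul_self hε, one_mul, div_self ha0]; exact one_pos
  set W₁ := W ∩ {q | 0 < ε * s / (k q).1} with hW₁
  have hca : ContinuousOn (fun q => ε * s / (k q).1) W := fun q hq =>
    (ContinuousAt.div continuousAt_const (sm_a hk hW hq).continuousAt (hk.2 q hq)).continuousWithinAt
  have hW₁o : IsOpen W₁ := hca.isOpen_inter_preimage hW isOpen_Ioi
  have sw : ∀ q ∈ W₁, Sm (fun q => Real.sqrt (ε * s / (k q).1)) q := fun q hq =>
    ContDiffAt.sqrt ((Sm.const _).div (sm_a hk hW hq.1) (hk.2 q hq.1)) hq.2.ne'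
  -- The new x is an x-antiderivative of the square root of εs/a, so that a X_x² = ε T_t.
  obtain ⟨X, hX, hXw⟩ := exists_dx_eq hW₁o (fun q hq => (sw q hq).contDiffWithinAt) ⟨hp, hpos⟩
  obtain ⟨W₂, hW₂s, hW₂o, hpW₂⟩ := eventually_nhds_iff.1
    (hXw.and (hW₁o.mem_nhds (show p ∈ W₁ from ⟨hp, hpos⟩)))
  have hXs : ∀ q, Sm X q := fun q => hX.contDiffAt
  have hXx0 : ∀ q ∈ W₂, dx X q ≠ 0 := fun q hq => by
    rw [(hW₂s q hq).1]; exact (Real.sqrt_pos.2 (hW₂s q hq).2.2).ne'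
  have hXsq : ∀ q ∈ W₂, (k q).1 * dx X q ^ 2 = ε * s := fun q hq => by
    rw [(hW₂s q hq).1, Real.sq_sqrt (hW₂s q hq).2.2.le]
    have : (k q).1 ≠ 0 := hk.2 q (hW₂s q hq).2.1
    field_simp
  -- The value of φ_x/φ for which `rel_b` gives zero new drift; then φ = exp f with f_x = g.
  set g : TX → ℝ := fun q => (dt X q - (k q).2.1 * dx X q - (k q).1 * dx (dx X) q) /
    (2 * (k q).1 * dx X q) with hg
  have sg : ∀ q ∈ W₂, Sm g q := fun q hq => by
    have hqW := (hW₂s q hq).2.1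
    exact (((hXs q).dt.sub ((sm_b hk hW hqW).mul (hXs q).dx)).sub
      ((sm_a hk hW hqW).mul (hXs q).dx.dx)).div (((Sm.const 2).mul (sm_a hk hW hqW)).mul (hXs q).dx)
      (mul_ne_zero (mul_ne_zero two_ne_zero (hk.2 q hqW)) (hXx0 q hq))
  obtain ⟨f, hf, hfg⟩ := exists_dx_eq hW₂o (fun q hq => (sg q hq).contDiffWithinAt) hpW₂
  obtain ⟨W₃, hW₃s, hW₃o, hpW₃⟩ := eventually_nhds_iff.1 (hfg.and (hW₂o.mem_nhds hpW₂))
  have hsub : W₃ ⊆ W := fun q hq => (hW₂s q (hW₃s q hq).2).2.1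
  have hE : ContDiff ℝ ∞ (fun q : TX => (s * q.1, X q)) := (contDiff_const.mul contDiff_fst).prodMk hX
  have hT : ∀ q : TX, dt (fun q : TX => s * q.1) q = s ∧ dx (fun q : TX => s * q.1) q = 0 := fun q => by
    rw [dt_const_mul _ differentiableAt_fst, dx_const_mul _ differentiableAt_fst, dt_fst, dx_fst]
    simp
  obtain ⟨N, N', e, k', hN, hpN, hNW, hN', he, H⟩ := exists_inter_push hW₃o
    (k := k) ⟨hk.1.mono hsub, fun q hq => hk.2 q (hsub hq)⟩ (E := fun q => (s * q.1, X q))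
    (φ := fun q => Real.exp (f q)) hE.contDiffOn hf.exp.contDiffOn (fun q _ => Real.exp_ne_zero _)
    (fun q _ => (hT q).2) (fun q _ => by rw [(hT q).1]; exact hs)
    (fun q hq => hXx0 q (hW₃s q hq).2) hpW₃
  have htc : tc e = fun q => s * q.1 := by ext q; rw [tc, he]
  have hxc : xc e = X := by ext q; rw [xc, he]
  refine ⟨N, N', e, _, _, hN, hpN, hNW.trans hsub, hN', H.to_Pco (ε := ε) (fun q hq => ?_)
    fun q hq => ?_⟩
  · rw [htc, hxc, (hT q).1, hXsq q (hW₃s q (hNW hq)).2]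
  · have hqW₂ := (hW₃s q (hNW hq)).2
    have h1 : dx (fun q => Real.exp (f q)) q = Real.exp (f q) * g q := by
      rw [dx_comp_real (F := Real.exp) Real.differentiable_exp.differentiableAt
        (hf.contDiffAt.differentiableAt (by simp)), Real.deriv_exp, (hW₃s q (hNW hq)).1]
    rw [hxc, h1, hg]
    have := hXx0 q hqW₂
    have : (k q).1 ≠ 0 := hk.2 q (hsub (hNW hq))
    field_simp
    ring

end

section

/-! ### Unique continuation of essential symmetries -/

theorem gEss_mono {k : Coef} {Ω N : Set TX} {Q : EssField} (hQ : Q ∈ Lin.gEss Ω k) (h : N ⊆ Ω) :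
    Q ∈ Lin.gEss N k := by
  rw [mem_gEss_iff] at hQ ⊢
  exact ⟨hQ.1.mono h, fun p hp => hQ.2 p (h hp)⟩

section UniqueContinuation

variable {k : Coef} {Ω : Set TX} {Q : EssField} {p : TX}

theorem Inter.pushField_fst {Ω' e φ} {k' : Coef} (H : Inter Ω Ω' e φ k k') (hp : p ∈ Ω) :
    pushField e φ Q (e p) = ((Q p).1 * dt (tc e) p, (Q p).1 * dt (xc e) p + (Q p).2.1 * dx (xc e) p,
      (Q p).2.2 - ((Q p).1 * dt φ p + (Q p).2.1 * dx φ p) / φ p) := by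
  simp only [pushField, H.diffeo.left_inv hp]

theorem Inter.isSymm {Ω' e φ} {ε : ℝ} (hε : ε ≠ 0) {C : TX → ℝ} (H : Inter Ω Ω' e φ k (Pco ε C))
    (hQ : Q ∈ Lin.gEss Ω k) : IsSymm ε Ω' C (fun q => (pushField e φ Q q).1)
      (fun q => (pushField e φ Q q).2.1) (fun q => (pushField e φ Q q).2.2) :=
  (isSymm_iff hε H.op' fun _ hq => sm_c H.mem' H.op' hq).1 (H.pushField_mem hQ)

theorem eventually_symm_image {Ω' e φ} {k' : Coef} (H : Inter Ω Ω' e φ k k') (hp : p ∈ Ω)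
    {P : TX → Prop} (h : ∀ᶠ q in 𝓝 p, P q) : ∀ᶠ q' in 𝓝 (e p), P (e.symm q') := by
  have := (H.diffeo.contDiffAt_symm H.op' (H.diffeo.mapsTo hp)).continuousAt
  rw [ContinuousAt, H.diffeo.left_inv hp] at this
  exact this.eventually h

/-- Near any point the equation reduces to a heat equation with potential, where vanishing of τ and
ξ on an open set propagates by `IsSymm.eq_zero`. The set of points with vanishing germ is therefore
open and closed in the domain. -/
theorem gEss_unique (hΩ : IsDom Ω) (hk : k ∈ Lin.S Ω) (hQ : Q ∈ Lin.gEss Ω k) (hp : p ∈ Ω)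
    (h0 : ∀ᶠ q in 𝓝 p, (Q q).1 = 0 ∧ (Q q).2.1 = 0) : ∀ q ∈ Ω, (Q q).1 = 0 ∧ (Q q).2.1 = 0 := by
  have key := forall_of_clopen hΩ.2.isPreconnected hΩ.1
    (P := fun p => ∀ᶠ q in 𝓝 p, (Q q).1 = 0 ∧ (Q q).2.1 = 0)
    (fun p _ h => h.eventually_nhds) (fun p hp h => ?_) hp h0
  · exact fun q hq => (key q hq).self_of_nhds
  have hε : (1 : ℝ) = 1 ∨ (1 : ℝ) = -1 := Or.inl rfl
  obtain ⟨N, N', e, φ, C, hN, hpN, hNW, hN', H⟩ := exists_inter_Pco hε hΩ.1 hk hp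
  have hS := H.isSymm one_ne_zero (gEss_mono hQ hNW)
  obtain ⟨q, ⟨-, hq⟩, hqN⟩ := (h.and_eventually (hN.1.mem_nhds hpN)).exists
  have hq' := H.diffeo.mapsTo hqN
  have ev : ∀ᶠ r in 𝓝 (e q), (pushField e φ Q r).1 = 0 ∧ (pushField e φ Q r).2.1 = 0 := by
    filter_upwards [eventually_symm_image H hqN hq] with r hr
    simp only [pushField, hr.1, hr.2, zero_mul, add_zero, and_self]
  have e1 : (fun q => (pushField e φ Q q).1) =ᶠ[𝓝 (e q)] fun _ => 0 := ev.mono fun r hr => hr.1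
  have e2 : (fun q => (pushField e φ Q q).2.1) =ᶠ[𝓝 (e q)] fun _ => 0 := ev.mono fun r hr => hr.2
  have e3 : dt (fun q => (pushField e φ Q q).1) =ᶠ[𝓝 (e q)] fun _ => 0 :=
    (dt_eventuallyEq e1).trans (Filter.Eventually.of_forall fun r => dt_const 0)
  have hz := hS.eq_zero hε hN' hq' e1.self_of_nhds e3.self_of_nhds
    (by rw [dt_congr e3, dt_const]) e2.self_of_nhds (by rw [dt_congr e2, dt_const])
  filter_upwards [hN.1.mem_nhds hpN] with r hr
  have h1 := hz (e r) (H.diffeo.mapsTo hr)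
  simp only [H.pushField_fst hr] at h1
  have h2 := (mul_eq_zero.1 h1.1).resolve_right (H.dt_tc_ne hr)
  have h3 := h1.2
  rw [h2, zero_mul, zero_add] at h3
  exact ⟨h2, (mul_eq_zero.1 h3).resolve_right (H.dx_xc_ne hr)⟩

/-- Under local reduction to a heat equation with potential, a field with τ = ξ = 0 keeps its ζ, and
there ζ is constant by `IsSymm.ζ_const`. -/
theorem gEss_const (hΩ : IsDom Ω) (hk : k ∈ Lin.S Ω) (hQ : Q ∈ Lin.gEss Ω k)
    (h0 : ∀ q ∈ Ω, (Q q).1 = 0 ∧ (Q q).2.1 = 0) : ∃ a : ℝ, ∀ q ∈ Ω, Q q = (0, 0, a) := by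
  have hε : (1 : ℝ) = 1 ∨ (1 : ℝ) = -1 := Or.inl rfl
  have hs := (mem_gEss_iff.1 hQ).1
  have loc : ∀ p ∈ Ω, (fun q => (Q q).2.2) =ᶠ[𝓝 p] fun _ => (Q p).2.2 := by
    intro p hp
    obtain ⟨N, N', e, φ, C, hN, hpN, hNW, hN', H⟩ := exists_inter_Pco hε hΩ.1 hk hp
    have hS := H.isSymm one_ne_zero (gEss_mono hQ hNW)
    have hz : ∀ q ∈ N', (pushField e φ Q q).1 = 0 ∧ (pushField e φ Q q).2.1 = 0 := fun q hq => by
      have := h0 _ (hNW (H.diffeo.symm_mapsTo hq))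
      simp only [pushField, this.1, this.2, zero_mul, add_zero, and_self]
    have hζ : ∀ q ∈ N, (pushField e φ Q (e q)).2.2 = (Q q).2.2 := fun q hq => by
      rw [H.pushField_fst hq]
      simp only [(h0 q (hNW hq)).1, (h0 q (hNW hq)).2, zero_mul, add_zero, zero_div, sub_zero]
    filter_upwards [hN.1.mem_nhds hpN] with q hq
    rw [← hζ q hq, ← hζ p hpN]
    exact hS.ζ_const (p := e q) (p₀ := e p) hε hN' hz (H.diffeo.mapsTo hq) (H.diffeo.mapsTo hpN)
  obtain ⟨p₀, hp₀⟩ := hΩ.2.nonempty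
  refine ⟨(Q p₀).2.2, fun q hq => Prod.ext (h0 q hq).1 (Prod.ext (h0 q hq).2 ?_)⟩
  exact eq_of_dt_dx_eq_zero hΩ (fun r hr => sm_ζ hs hΩ.1 hr)
    (fun r hr => by rw [dt_congr (loc r hr), dt_const])
    (fun r hr => by rw [dx_congr (loc r hr), dx_const]) hq hp₀

end UniqueContinuation

/-! ### Equivalence transformations of heat equations with potentials -/

/-- Polynomials of the second degree in `x`. -/
def pol (a b c : ℝ → ℝ) (q : TX) : ℝ := a q.1 * q.2 ^ 2 + b q.1 * q.2 + c q.1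

section Pol

variable {a b c : ℝ → ℝ} {a' b' c' : ℝ} {q : TX}

theorem hasFDerivAt_pol (ha : HasDerivAt a a' q.1) (hb : HasDerivAt b b' q.1)
    (hc : HasDerivAt c c' q.1) : HasFDerivAt (pol a b c)
      ((a' * q.2 ^ 2 + b' * q.2 + c') • ContinuousLinearMap.fst ℝ ℝ ℝ +
        (2 * a q.1 * q.2 + b q.1) • ContinuousLinearMap.snd ℝ ℝ ℝ) q := by
  have f1 : HasFDerivAt (fun q : TX => q.1) (ContinuousLinearMap.fst ℝ ℝ ℝ) q := hasFDerivAt_fst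
  have f2 : HasFDerivAt (fun q : TX => q.2) (ContinuousLinearMap.snd ℝ ℝ ℝ) q := hasFDerivAt_snd
  have hA := ha.comp_hasFDerivAt q f1
  have hB := hb.comp_hasFDerivAt q f1
  have hC := hc.comp_hasFDerivAt q f1
  have := ((hA.mul (f2.pow 2)).add (hB.mul f2)).add hC
  refine this.congr_fderiv ?_
  ext <;> simp <;> ring

theorem dt_pol (ha : HasDerivAt a a' q.1) (hb : HasDerivAt b b' q.1)
    (hc : HasDerivAt c c' q.1) : dt (pol a b c) q = a' * q.2 ^ 2 + b' * q.2 + c' := by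
  rw [dt, (hasFDerivAt_pol ha hb hc).fderiv]; simp

theorem dx_pol (ha : DifferentiableAt ℝ a q.1) (hb : DifferentiableAt ℝ b q.1)
    (hc : DifferentiableAt ℝ c q.1) : dx (pol a b c) q = pol 0 (fun t => 2 * a t) b q := by
  rw [dx, (hasFDerivAt_pol ha.hasDerivAt hb.hasDerivAt hc.hasDerivAt).fderiv]; simp [pol]

theorem sm_pol (ha : ContDiffAt ℝ ∞ a q.1) (hb : ContDiffAt ℝ ∞ b q.1)
    (hc : ContDiffAt ℝ ∞ c q.1) : Sm (pol a b c) q := by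
  have f1 : ContDiffAt ℝ ∞ (fun q : TX => q.1) q := contDiffAt_fst
  have f2 : ContDiffAt ℝ ∞ (fun q : TX => q.2) q := contDiffAt_snd
  exact (((ha.comp q f1).mul (f2.pow 2)).add ((hb.comp q f1).mul f2)).add (hc.comp q f1)

end Pol

/-- Data of the transformation `t̃ = T(t)`, `x̃ = x / y(t) + X(t)`,
`u = exp(ε P(t) x² / 4 + ε Q(t) x / 2 + r(t)) ũ`. -/
structure TransData (y T X P Q r : ℝ → ℝ) (t : ℝ) : Prop where
  ne : y t ≠ 0
  sy : ContDiffAt ℝ ∞ y t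
  sT : ContDiffAt ℝ ∞ T t
  sX : ContDiffAt ℝ ∞ X t
  sP : ContDiffAt ℝ ∞ P t
  sQ : ContDiffAt ℝ ∞ Q t
  sr : ContDiffAt ℝ ∞ r t
  hT : HasDerivAt T (1 / y t ^ 2) t
  hy : HasDerivAt y (-P t * y t) t
  hX : HasDerivAt X (Q t / y t) t

/-- The choice T' = y^(-2) gives T_t = X_x², as the fixed leading coefficient requires, and the
exponent with x-derivative ε(Px + Q)/2 cancels the drift that the motion of x̃ creates. The
potential is multiplied by y² after the addition of a quadratic polynomial in x; choosing y, Q and r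
controls its coefficients of x², x and 1. -/
theorem exists_inter_trans {ε : ℝ} (hε : ε = 1 ∨ ε = -1) {C : TX → ℝ} {W : Set TX} (hW : IsOpen W)
    (hC : ∀ q ∈ W, Sm C q) {p : TX} (hp : p ∈ W) {y T X P Q r : ℝ → ℝ}
    (h : ∀ᶠ t in 𝓝 p.1, TransData y T X P Q r t) :
    ∃ (N N' : Set TX) (e : PartialEquiv TX TX) (φ C' : TX → ℝ), IsDom N ∧ p ∈ N ∧ N ⊆ W ∧ IsDom N' ∧
      (∀ q, e q = (T q.1, q.2 / y q.1 + X q.1)) ∧ Inter N N' e φ (Pco ε C) (Pco ε C') ∧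
      (∀ q ∈ N, dt (tc e) q = 1 / y q.1 ^ 2 ∧ dx (xc e) q = 1 / y q.1 ∧
        dt (xc e) q = (P q.1 * q.2 + Q q.1) / y q.1) ∧
      ∀ q ∈ N, C' (e q) = y q.1 ^ 2 * (C q + P q.1 / 2 + ε / 4 * (P q.1 * q.2 + Q q.1) ^ 2 -
        ε / 4 * deriv P q.1 * q.2 ^ 2 - ε / 2 * deriv Q q.1 * q.2 - deriv r q.1) := by
  have hε0 := eps_ne_zero hε
  have hεε := eps_mul_self hε
  obtain ⟨I, hIs, hIo, hpI⟩ := eventually_nhds_iff.1 h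
  set W₁ := W ∩ {q | q.1 ∈ I} with hW₁
  have hW₁o : IsOpen W₁ := hW.inter (hIo.preimage continuous_fst)
  have D : ∀ q ∈ W₁, TransData y T X P Q r q.1 := fun q hq => hIs _ hq.2
  have syi : ∀ q ∈ W₁, ContDiffAt ℝ ∞ (fun t => (y t)⁻¹) q.1 := fun q hq =>
    (D q hq).sy.inv (D q hq).ne
  have hyi : ∀ q ∈ W₁, HasDerivAt (fun t => (y t)⁻¹) (P q.1 / y q.1) q.1 := fun q hq => by
    have := (D q hq).hy.inv (D q hq).ne
    have h0 := (D q hq).ne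
    rw [neg_mul, neg_neg, pow_two, mul_div_mul_right _ _ h0] at this
    exact this
  set E : TX → TX := fun q => (T q.1, pol 0 (fun t => (y t)⁻¹) X q) with hE
  set f : TX → ℝ := pol (fun t => ε / 4 * P t) (fun t => ε / 2 * Q t) r with hf
  have c0 : ∀ t : ℝ, ContDiffAt ℝ ∞ (0 : ℝ → ℝ) t := fun t => contDiffAt_const
  have d0 : ∀ t : ℝ, HasDerivAt (0 : ℝ → ℝ) 0 t := fun t => hasDerivAt_const t 0
  have sX : ∀ q ∈ W₁, Sm (fun q => (E q).2) q := fun q hq =>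
    sm_pol (c0 _) (syi q hq) (D q hq).sX
  have sT : ∀ q ∈ W₁, Sm (fun q => (E q).1) q := fun q hq =>
    (D q hq).sT.comp q contDiffAt_fst
  have sf : ∀ q ∈ W₁, Sm f q := fun q hq =>
    sm_pol (contDiffAt_const.mul (D q hq).sP) (contDiffAt_const.mul (D q hq).sQ) (D q hq).sr
  have tT : ∀ q ∈ W₁, dt (fun q => (E q).1) q = 1 / y q.1 ^ 2 := fun q hq => dt_fun_fst (D q hq).hT
  have xT : ∀ q ∈ W₁, dx (fun q => (E q).1) q = 0 := fun q hq =>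
    dx_fun_fst (D q hq).hT.differentiableAt
  have xX : ∀ q ∈ W₁, dx (fun q => (E q).2) q = 1 / y q.1 := fun q hq => by
    have := dx_pol (q := q) (d0 _).differentiableAt (hyi q hq).differentiableAt
      (D q hq).hX.differentiableAt
    rw [show (fun q => (E q).2) = pol 0 (fun t => (y t)⁻¹) X from rfl, this]
    simp [pol]
  have tX : ∀ q ∈ W₁, dt (fun q => (E q).2) q = (P q.1 * q.2 + Q q.1) / y q.1 := fun q hq => by
    have := dt_pol (q := q) (d0 _) (hyi q hq) (D q hq).hX
    rw [show (fun q => (E q).2) = pol 0 (fun t => (y t)⁻¹) X from rfl, this]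
    ring
  have xxX : ∀ q ∈ W₁, dx (dx (fun q => (E q).2)) q = 0 := fun q hq => by
    rw [dx_congr (eventuallyEq_of_eqOn hW₁o hq xX)]
    exact dx_fun_fst (F := fun t => 1 / y t) ((hyi q hq).differentiableAt.congr_of_eventuallyEq
      (Filter.Eventually.of_forall fun t => by simp))
  have dP : ∀ q ∈ W₁, HasDerivAt (fun t => ε / 4 * P t) (ε / 4 * deriv P q.1) q.1 := fun q hq =>
    ((D q hq).sP.differentiableAt (by simp)).hasDerivAt.const_mul _
  have dQ : ∀ q ∈ W₁, HasDerivAt (fun t => ε / 2 * Q t) (ε / 2 * deriv Q q.1) q.1 := fun q hq =>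
    ((D q hq).sQ.differentiableAt (by simp)).hasDerivAt.const_mul _
  have tf : ∀ q ∈ W₁, dt f q = ε / 4 * deriv P q.1 * q.2 ^ 2 + ε / 2 * deriv Q q.1 * q.2 +
      deriv r q.1 := fun q hq =>
    dt_pol (dP q hq) (dQ q hq) ((D q hq).sr.differentiableAt (by simp)).hasDerivAt
  have xf' : ∀ q ∈ W₁, dx f q = pol 0 (fun t => 2 * (ε / 4 * P t)) (fun t => ε / 2 * Q t) q :=
    fun q hq => dx_pol (dP q hq).differentiableAt (dQ q hq).differentiableAt
      ((D q hq).sr.differentiableAt (by simp))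
  have xf : ∀ q ∈ W₁, dx f q = ε / 2 * (P q.1 * q.2 + Q q.1) := fun q hq => by
    rw [xf' q hq]; simp [pol]; ring
  have xxf : ∀ q ∈ W₁, dx (dx f) q = ε / 2 * P q.1 := fun q hq => by
    rw [dx_congr (eventuallyEq_of_eqOn hW₁o hq xf'), dx_pol (d0 _).differentiableAt
      ((dP q hq).differentiableAt.const_mul _) (dQ q hq).differentiableAt]
    simp [pol]; ring
  have tφ : ∀ q ∈ W₁, dt (fun q => Real.exp (f q)) q = Real.exp (f q) * dt f q := fun q hq => by
    rw [dt_comp_real (F := Real.exp) Real.differentiable_exp.differentiableAt (sf q hq).diff,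
      Real.deriv_exp]
  have xφ : ∀ q ∈ W₁, dx (fun q => Real.exp (f q)) q = Real.exp (f q) * dx f q := fun q hq => by
    rw [dx_comp_real (F := Real.exp) Real.differentiable_exp.differentiableAt (sf q hq).diff,
      Real.deriv_exp]
  have sφ : ∀ q ∈ W₁, Sm (fun q => Real.exp (f q)) q := fun q hq => (sf q hq).exp
  have xxφ : ∀ q ∈ W₁, dx (dx (fun q => Real.exp (f q))) q =
      Real.exp (f q) * (dx (dx f) q + dx f q ^ 2) := fun q hq => by
    rw [dx_congr (eventuallyEq_of_eqOn hW₁o hq xφ), dx_mul (sφ q hq).diff (sf q hq).dx.diff,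
      xφ q hq]
    ring
  obtain ⟨N, N', e, k', hN, hpN, hNW, hN', he, H⟩ := exists_inter_push hW₁o
    (k := Pco ε C) (Pco_mem hε0 fun q hq => hC q hq.1) (E := E) (φ := fun q => Real.exp (f q))
    (fun q hq => (ContDiffAt.prodMk (sT q hq) (sX q hq)).contDiffWithinAt)
    (fun q hq => (sφ q hq).contDiffWithinAt) (fun q _ => Real.exp_ne_zero _) xT
    (fun q hq => by rw [tT q hq]; exact one_div_ne_zero (pow_ne_zero 2 (D q hq).ne))
    (fun q hq => by rw [xX q hq]; exact one_div_ne_zero (D q hq).ne) ⟨hp, hpI⟩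
  have htc : tc e = fun q => (E q).1 := by ext q; rw [tc, he]
  have hxc : xc e = fun q => (E q).2 := by ext q; rw [xc, he]
  have H' := H.to_Pco (ε := ε) (fun q hq => by
      rw [htc, hxc, tT q (hNW hq), xX q (hNW hq)]; simp [Pco]) (fun q hq => by
      rw [hxc, xX q (hNW hq), tX q (hNW hq), xxX q (hNW hq), xφ q (hNW hq), xf q (hNW hq)]
      have h0 := (D q (hNW hq)).ne
      simp only [Pco]
      field_simp
      linear_combination Real.exp (f q) * (P q.1 * q.2 + Q q.1) * hεε)
  refine ⟨N, N', e, _, _, hN, hpN, hNW.trans Set.inter_subset_left, hN', fun q => ?_, H',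
    fun q hq => ⟨by rw [htc, tT q (hNW hq)], by rw [hxc, xX q (hNW hq)],
      by rw [hxc, tX q (hNW hq)]⟩, fun q hq => ?_⟩
  · rw [he, hE]; simp only [pol, Pi.zero_apply, zero_mul, zero_add]; rw [div_eq_inv_mul]
  · have h1 := H'.rel_c hq
    have h0 := (D q (hNW hq)).ne
    rw [htc, tT q (hNW hq), xxφ q (hNW hq), xφ q (hNW hq), tφ q (hNW hq), xxf q (hNW hq),
      xf q (hNW hq), tf q (hNW hq)] at h1
    simp only [Pco] at h1 ⊢
    field_simp at h1
    linear_combination 1 / 16 * h1 + y q.1 ^ 2 *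
      (P q.1 / 2 + ε / 4 * (P q.1 * q.2 + Q q.1) ^ 2) * hεε

end

section

/-! ### Reduction to canonical potentials -/

theorem Inter.refl {Ω : Set TX} (hΩ : IsOpen Ω) {k : Coef} (hk : k ∈ Lin.S Ω) :
    Inter Ω Ω (PartialEquiv.ofSet Ω) (fun _ => 1) k k :=
  ⟨hΩ, hΩ, isDiffeo_refl Ω, contDiffOn_const, fun _ _ => one_ne_zero, hk, hk,
    fun p _ => ⟨1, one_ne_zero, fun h _ => by simp only [one_mul]; rfl⟩⟩

/-- The equation with the coefficients `k` is, on some subdomain of `W`, equivalent to a heat equation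
with a canonical potential. -/
def Reduces (ε : ℝ) (W : Set TX) (k : Coef) : Prop :=
  ∃ (N N' : Set TX) (e : PartialEquiv TX TX) (φ C : TX → ℝ) (l : PotCase), IsDom N ∧ N ⊆ W ∧
    IsDom N' ∧ Inter N N' e φ k (Pco ε C) ∧ IsCanonical N' C l

namespace Reduces

variable {ε : ℝ} {W : Set TX} {k : Coef}

theorem mono {W' : Set TX} (h : Reduces ε W k) (hW : W ⊆ W') : Reduces ε W' k := by
  obtain ⟨N, N', e, φ, C, l, h1, h2, h3⟩ := h
  exact ⟨N, N', e, φ, C, l, h1, h2.trans hW, h3⟩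

theorem of_inter {Ω Ω' : Set TX} {e : PartialEquiv TX TX} {φ : TX → ℝ} {k' : Coef}
    (H : Inter Ω Ω' e φ k k') (h : Reduces ε Ω' k') : Reduces ε Ω k := by
  obtain ⟨N₁, N', e₁, φ₁, C, l, h1, h2, h3, h4, h5⟩ := h
  obtain ⟨N, hN, e₂, himg, -, H₂⟩ := H.restrict h1.1 h2
  refine ⟨N, N', e₂.trans e₁, _, C, l, ⟨H₂.op, ?_⟩, hN, h3, H₂.trans h4, h5⟩
  rw [himg]
  exact h1.2.image _ (H.diffeo.2.2.2.continuousOn.mono h2)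

theorem of_canonical (hε : ε ≠ 0) {C : TX → ℝ} {l : PotCase} (hW : IsDom W)
    (hC : ∀ q ∈ W, Sm C q) (h : IsCanonical W C l) : Reduces ε W (Pco ε C) :=
  ⟨W, W, _, _, C, l, hW, subset_rfl, hW, Inter.refl hW.1 (Pco_mem hε hC), h⟩

end Reduces

/-- It supplies the scaling of x: for y'' = c y the function P = -y'/y solves the Riccati equation
P' = P² - c, which is used with c = -4εα to remove the term αx². -/
theorem exists_ode_solution (c t₀ : ℝ) : ∃ y y' : ℝ → ℝ, ContDiff ℝ ∞ y ∧ ContDiff ℝ ∞ y' ∧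
    (∀ t, HasDerivAt y (y' t) t) ∧ (∀ t, HasDerivAt y' (c * y t) t) ∧ y t₀ ≠ 0 := by
  rcases le_or_gt 0 c with hc | hc
  · set w := Real.sqrt c
    have hw : w * w = c := Real.mul_self_sqrt hc
    have hd : ∀ t, HasDerivAt (fun t => Real.exp (w * t)) (w * Real.exp (w * t)) t := fun t => by
      have := ((hasDerivAt_id t).const_mul w).exp
      rw [mul_one, mul_comm] at this
      exact this
    refine ⟨fun t => Real.exp (w * t), fun t => w * Real.exp (w * t),
      (contDiff_const.mul contDiff_id).exp, contDiff_const.mul (contDiff_const.mul contDiff_id).exp,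
      hd, fun t => ?_, Real.exp_ne_zero _⟩
    have := (hd t).const_mul w
    rwa [← mul_assoc, hw] at this
  · set w := Real.sqrt (-c)
    have hw : w * w = -c := Real.mul_self_sqrt (by linarith)
    have hl : ∀ t, HasDerivAt (fun t => w * (t - t₀)) w t := fun t => by
      have := ((hasDerivAt_id t).sub_const t₀).const_mul w
      rw [mul_one] at this
      exact this
    have hls : ContDiff ℝ ∞ fun t => w * (t - t₀) := contDiff_const.mul (contDiff_id.sub contDiff_const)
    refine ⟨fun t => Real.cos (w * (t - t₀)), fun t => -Real.sin (w * (t - t₀)) * w,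
      hls.cos, hls.sin.neg.mul contDiff_const, fun t => (hl t).cos, fun t => ?_, by simp⟩
    have := ((hl t).sin.neg).mul_const w
    refine this.congr_deriv ?_
    linear_combination (-Real.cos (w * (t - t₀))) * hw

theorem contDiffAt_slice {f : TX → ℝ} {t x : ℝ} (hf : Sm f (t, x)) :
    ContDiffAt ℝ ∞ (fun s => f (s, x)) t :=
  ContDiffAt.comp t (f := fun s : ℝ => (s, x)) hf (contDiffAt_id.prodMk contDiffAt_const)

theorem hasDerivAt_slice {f : TX → ℝ} {t x : ℝ} (hf : DifferentiableAt ℝ f (t, x)) :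
    HasDerivAt (fun s => f (s, x)) (dt f (t, x)) t :=
  hf.hasFDerivAt.comp_hasDerivAt t ((hasDerivAt_id t).prodMk (hasDerivAt_const t x))

/-- Balls of the plane are rectangles in the product metric, so every slice is an interval that
contains the coordinate of the centre. -/
theorem eq_of_dx_eq_zero {f : TX → ℝ} {p : TX} {r : ℝ} (hf : ∀ q ∈ Metric.ball p r, Sm f q)
    (h : ∀ q ∈ Metric.ball p r, dx f q = 0) {q : TX} (hq : q ∈ Metric.ball p r) :
    f q = f (q.1, p.2) := by
  rw [Metric.mem_ball, Prod.dist_eq, max_lt_iff] at hq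
  have hmem : ∀ x ∈ Metric.ball p.2 r, (q.1, x) ∈ Metric.ball p r := fun x hx => by
    rw [Metric.mem_ball, Prod.dist_eq, max_lt_iff]; exact ⟨hq.1, hx⟩
  have hd : ∀ x ∈ Metric.ball p.2 r, HasDerivAt (fun x => f (q.1, x)) 0 x := fun x hx => by
    have := (hf _ (hmem x hx)).diff.hasFDerivAt.comp_hasDerivAt x
      ((hasDerivAt_const x q.1).prodMk (hasDerivAt_id x))
    have h2 : HasDerivAt (fun x => f (q.1, x)) (dx f (q.1, x)) x := this
    rwa [h _ (hmem x hx)] at h2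
  have := Metric.isOpen_ball.is_const_of_deriv_eq_zero (convex_ball p.2 r).isPreconnected
    (fun x hx => (hd x hx).differentiableAt.differentiableWithinAt) (fun x hx => (hd x hx).deriv)
    (x := q.2) (y := p.2) hq.2 (Metric.mem_ball_self (dist_nonneg.trans_lt hq.1))
  exact this

theorem eq_of_dt_eq_zero {f : TX → ℝ} {p : TX} {r : ℝ} (hf : ∀ q ∈ Metric.ball p r, Sm f q)
    (h : ∀ q ∈ Metric.ball p r, dt f q = 0) {q : TX} (hq : q ∈ Metric.ball p r) :
    f q = f (p.1, q.2) := by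
  rw [Metric.mem_ball, Prod.dist_eq, max_lt_iff] at hq
  have hmem : ∀ t ∈ Metric.ball p.1 r, (t, q.2) ∈ Metric.ball p r := fun x hx => by
    rw [Metric.mem_ball, Prod.dist_eq, max_lt_iff]; exact ⟨hx, hq.2⟩
  have hd : ∀ t ∈ Metric.ball p.1 r, HasDerivAt (fun t => f (t, q.2)) 0 t := fun t ht => by
    have h2 := hasDerivAt_slice (hf _ (hmem t ht)).diff
    rwa [h _ (hmem t ht)] at h2
  have := Metric.isOpen_ball.is_const_of_deriv_eq_zero (convex_ball p.1 r).isPreconnected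
    (fun x hx => (hd x hx).differentiableAt.differentiableWithinAt) (fun x hx => (hd x hx).deriv)
    (x := q.1) (y := p.1) hq.1 (Metric.mem_ball_self (dist_nonneg.trans_lt hq.1))
  exact this

section Normal

variable {ε : ℝ} {W : Set TX} {C : TX → ℝ}

theorem Inter.sm_potential {Ω Ω' : Set TX} {e : PartialEquiv TX TX} {φ : TX → ℝ} {k : Coef}
    (H : Inter Ω Ω' e φ k (Pco ε C)) {q : TX} (hq : q ∈ Ω') : Sm C q := sm_c H.mem' H.op' hq

theorem eventually_nhds_mem {I : Set ℝ} (hI : IsOpen I) {t : ℝ} (ht : t ∈ I) : ∀ᶠ s in 𝓝 t, s ∈ I :=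
  hI.mem_nhds ht

/-- All three coefficients are removed by `exists_inter_trans`: that of x² by P' = 4εα + P², which
y'' = -4εαy ensures; that of x by Q' = 2εβ + PQ, solved as Q = G/y with G' = 2εβy; the constant one
by r' = γ + P/2 + εQ²/4. -/
theorem reduces_of_quadratic (hε : ε = 1 ∨ ε = -1) (hW : IsOpen W) (hC : ∀ q ∈ W, Sm C q)
    {α : ℝ} {β γ : ℝ → ℝ} {p : TX} (hp : p ∈ W)
    (hβ : ∀ᶠ t in 𝓝 p.1, ContDiffAt ℝ ∞ β t) (hγ : ∀ᶠ t in 𝓝 p.1, ContDiffAt ℝ ∞ γ t)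
    (h : ∀ q ∈ W, C q = α * q.2 ^ 2 + β q.1 * q.2 + γ q.1) : Reduces ε W (Pco ε C) := by
  have hεε := eps_mul_self hε
  obtain ⟨y, y', sy, sy', dy, dy', hy0⟩ := exists_ode_solution (-4 * ε * α) p.1
  obtain ⟨I, hI, hIo, hpI⟩ := eventually_nhds_iff.1
    (hβ.and (hγ.and (sy.continuous.continuousAt.eventually_ne hy0)))
  have sβ : ContDiffOn ℝ ∞ β I := fun t ht => (hI t ht).1.contDiffWithinAt
  have sγ : ContDiffOn ℝ ∞ γ I := fun t ht => (hI t ht).2.1.contDiffWithinAt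
  have ny : ∀ t ∈ I, y t ≠ 0 := fun t ht => (hI t ht).2.2
  obtain ⟨G, sG, hG⟩ := exists_hasDerivAt_eq hIo
    ((contDiffOn_const.mul sβ).mul sy.contDiffOn : ContDiffOn ℝ ∞ (fun t => 2 * ε * β t * y t) I) hpI
  set P : ℝ → ℝ := fun t => -(y' t / y t) with hP
  set Q : ℝ → ℝ := fun t => G t / y t with hQ
  have sP : ContDiffOn ℝ ∞ P I := (sy'.contDiffOn.div sy.contDiffOn ny).neg
  have sQ : ContDiffOn ℝ ∞ Q I := sG.contDiffOn.div sy.contDiffOn ny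
  obtain ⟨X, sX, hX⟩ := exists_hasDerivAt_eq hIo (sQ.div sy.contDiffOn ny) hpI
  obtain ⟨T, sT, hT⟩ := exists_hasDerivAt_eq hIo
    ((contDiffOn_const.div (sy.contDiffOn.pow 2) fun t ht => pow_ne_zero 2 (ny t ht)) :
      ContDiffOn ℝ ∞ (fun t => 1 / y t ^ 2) I) hpI
  obtain ⟨r, sr, hr⟩ := exists_hasDerivAt_eq hIo
    ((sγ.add (sP.div_const 2)).add (contDiffOn_const.mul (sQ.pow 2)) :
      ContDiffOn ℝ ∞ (fun t => γ t + P t / 2 + ε / 4 * Q t ^ 2) I) hpI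
  obtain ⟨J, hJ, hJo, hpJ⟩ := eventually_nhds_iff.1
    (hG.and (hX.and (hT.and (hr.and (eventually_nhds_mem hIo hpI)))))
  set W₁ := W ∩ {q | q.1 ∈ J} with hW₁
  have hW₁o : IsOpen W₁ := hW.inter (hJo.preimage continuous_fst)
  have atI : ∀ {f : ℝ → ℝ}, ContDiffOn ℝ ∞ f I → ∀ t ∈ J, ContDiffAt ℝ ∞ f t := fun hf t ht =>
    hf.contDiffAt (hIo.mem_nhds (hJ t ht).2.2.2.2)
  obtain ⟨N, N', e, φ, C', hN, hpN, hNW, hN', he, H, -, hC'⟩ := exists_inter_trans hε hW₁o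
    (fun q hq => hC q hq.1) (p := p) ⟨hp, hpJ⟩ (y := y) (T := T) (X := X) (P := P) (Q := Q) (r := r) (by
      filter_upwards [eventually_nhds_mem hJo hpJ] with t ht
      refine ⟨ny t (hJ t ht).2.2.2.2, sy.contDiffAt, sT.contDiffAt, sX.contDiffAt, atI sP t ht,
        atI sQ t ht, sr.contDiffAt, (hJ t ht).2.2.1, ?_, (hJ t ht).2.1⟩
      have h0 := ny t (hJ t ht).2.2.2.2
      have := dy t
      rwa [show -P t * y t = y' t by simp only [hP]; field_simp])
  have hz : ∀ q ∈ N', C' q = 0 := by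
    intro q' hq'
    have hq := H.diffeo.symm_mapsTo hq'
    set q := e.symm q' with hqd
    have ht := (hNW hq).2
    have h0 := ny q.1 (hJ _ ht).2.2.2.2
    have hPd : deriv P q.1 = 4 * ε * α + P q.1 ^ 2 := by
      have : HasDerivAt P _ q.1 := ((dy' q.1).div (dy q.1) h0).neg
      rw [this.deriv]
      simp only [hP]; field_simp; ring
    have hQd : deriv Q q.1 = 2 * ε * β q.1 + P q.1 * Q q.1 := by
      have : HasDerivAt Q _ q.1 := (hJ _ ht).1.div (dy q.1) h0
      rw [this.deriv]
      simp only [hP, hQ]; field_simp; ring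
    have := hC' q hq
    rw [H.diffeo.right_inv hq'] at this
    rw [this, hPd, hQd, (hJ _ ht).2.2.2.1.deriv, h q (hNW hq).1]
    linear_combination (-y q.1 ^ 2) * (α * q.2 ^ 2 + β q.1 * q.2) * hεε
  refine Reduces.mono (Reduces.of_inter H (Reduces.of_canonical (eps_ne_zero hε) (l := .zero) hN'
    (fun q hq => H.sm_potential hq) hz)) (hNW.trans Set.inter_subset_left)

/-- With Q = βP and X = β/y the new coordinate is (x+β)/y. The term μ/(x+β)² has exactly the
homogeneity that absorbs the factor y², while α(x+β)² and γ are removed as in the quadratic case. -/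
theorem reduces_of_special (hε : ε = 1 ∨ ε = -1) (hW : IsOpen W) (hne : W.Nonempty)
    (hC : ∀ q ∈ W, Sm C q) {α β γ μ : ℝ} (hμ : μ ≠ 0)
    (h : ∀ q ∈ W, C q = μ / (q.2 + β) ^ 2 + α * (q.2 + β) ^ 2 + γ) : Reduces ε W (Pco ε C) := by
  have hεε := eps_mul_self hε
  -- The hypothesis is an equality of values in which division by zero is permitted, so a point off
  -- the line x = -β is selected explicitly.
  obtain ⟨p, hp, hpβ⟩ : ∃ p ∈ W, p.2 + β ≠ 0 := by
    obtain ⟨p, hp⟩ := hne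
    by_cases h0 : p.2 + β = 0
    · obtain ⟨r, hr, hb⟩ := Metric.isOpen_iff.1 hW p hp
      refine ⟨(p.1, p.2 + r / 2), hb ?_, ?_⟩
      · rw [Metric.mem_ball, Prod.dist_eq]
        simp [abs_of_pos hr, hr]
      · simp only; intro h1; linarith
    · exact ⟨p, hp, h0⟩
  obtain ⟨y, y', sy, sy', dy, dy', hy0⟩ := exists_ode_solution (-4 * ε * α) p.1
  obtain ⟨I, hI, hIo, hpI⟩ := eventually_nhds_iff.1
    (sy.continuous.continuousAt.eventually_ne hy0)
  have ny : ∀ t ∈ I, y t ≠ 0 := fun t ht => hI t ht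
  set P : ℝ → ℝ := fun t => -(y' t / y t) with hP
  have sP : ContDiffOn ℝ ∞ P I := (sy'.contDiffOn.div sy.contDiffOn ny).neg
  obtain ⟨T, sT, hT⟩ := exists_hasDerivAt_eq hIo
    ((contDiffOn_const.div (sy.contDiffOn.pow 2) fun t ht => pow_ne_zero 2 (ny t ht)) :
      ContDiffOn ℝ ∞ (fun t => 1 / y t ^ 2) I) hpI
  obtain ⟨r, sr, hr⟩ := exists_hasDerivAt_eq hIo
    ((contDiffOn_const.add (sP.div_const 2)).add
      (contDiffOn_const.mul (contDiffOn_const.add (sP.pow 2))) :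
      ContDiffOn ℝ ∞ (fun t => γ + P t / 2 + ε / 4 * β ^ 2 * (4 * ε * α + P t ^ 2)) I) hpI
  obtain ⟨J, hJ, hJo, hpJ⟩ := eventually_nhds_iff.1
    (hT.and (hr.and (eventually_nhds_mem hIo hpI)))
  set W₁ := W ∩ ({q | q.1 ∈ J} ∩ {q | q.2 + β ≠ 0}) with hW₁
  have hW₁o : IsOpen W₁ := hW.inter ((hJo.preimage continuous_fst).inter
    (isOpen_ne.preimage (continuous_snd.add continuous_const)))
  have atI : ∀ {f : ℝ → ℝ}, ContDiffOn ℝ ∞ f I → ∀ t ∈ J, ContDiffAt ℝ ∞ f t := fun hf t ht =>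
    hf.contDiffAt (hIo.mem_nhds (hJ t ht).2.2)
  have dP : ∀ t ∈ J, HasDerivAt P (4 * ε * α + P t ^ 2) t := fun t ht => by
    have h0 := ny t (hJ t ht).2.2
    have := ((dy' t).div (dy t) h0).neg
    refine this.congr_deriv ?_
    simp only [hP]; field_simp; ring
  obtain ⟨N, N', e, φ, C', hN, hpN, hNW, hN', he, H, -, hC'⟩ := exists_inter_trans hε hW₁o
    (fun q hq => hC q hq.1) (p := p) ⟨hp, hpJ, hpβ⟩ (y := y) (T := T) (X := fun t => β / y t)
    (P := P) (Q := fun t => β * P t) (r := r) (by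
      filter_upwards [eventually_nhds_mem hJo hpJ] with t ht
      have h0 := ny t (hJ t ht).2.2
      refine ⟨h0, sy.contDiffAt, sT.contDiffAt, contDiffAt_const.div sy.contDiffAt h0, atI sP t ht,
        contDiffAt_const.mul (atI sP t ht), sr.contDiffAt, (hJ t ht).1, ?_, ?_⟩
      · have := dy t
        rwa [show -P t * y t = y' t by simp only [hP]; field_simp]
      · refine ((hasDerivAt_const t β).div (dy t) h0).congr_deriv ?_
        simp only [hP]; field_simp; ring)
  have hz : ∀ q ∈ N', q.2 ≠ 0 ∧ C' q = μ / q.2 ^ 2 := by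
    intro q' hq'
    have hq := H.diffeo.symm_mapsTo hq'
    set q := e.symm q' with hqd
    have ht := (hNW hq).2.1
    have hx : q.2 + β ≠ 0 := (hNW hq).2.2
    have h0 := ny q.1 (hJ _ ht).2.2
    have hq2 : q'.2 = (q.2 + β) / y q.1 := by
      have := congrArg Prod.snd (he q)
      rw [H.diffeo.right_inv hq'] at this
      rw [this]; ring
    have h3 := hC' q hq
    rw [H.diffeo.right_inv hq'] at h3
    have hQd : deriv (fun t => β * P t) q.1 = β * (4 * ε * α + P q.1 ^ 2) :=
      ((dP _ ht).const_mul β).deriv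
    rw [hQd, (dP _ ht).deriv, (hJ _ ht).2.1.deriv, h q (hNW hq).1] at h3
    refine ⟨by rw [hq2]; exact div_ne_zero hx h0, ?_⟩
    rw [h3, hq2]
    have : y q.1 ^ 2 * (μ / (q.2 + β) ^ 2) = μ / ((q.2 + β) / y q.1) ^ 2 := by field_simp
    rw [← this]
    linear_combination (-y q.1 ^ 2) * α * (q.2 + β) ^ 2 * hεε
  exact Reduces.mono (Reduces.of_inter H (Reduces.of_canonical (eps_ne_zero hε) (l := .invSq μ) hN'
    (fun q hq => H.sm_potential hq) ⟨hμ, hz⟩)) (hNW.trans Set.inter_subset_left)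

theorem reduces_of_stationary (hε : ε = 1 ∨ ε = -1) (hW : IsOpen W) (hne : W.Nonempty)
    (hC : ∀ q ∈ W, Sm C q) (h : ∀ q ∈ W, dt C q = 0) : Reduces ε W (Pco ε C) := by
  obtain ⟨p, hp⟩ := hne
  obtain ⟨r, hr, hb⟩ := Metric.isOpen_iff.1 hW p hp
  have hC' : ∀ q ∈ Metric.ball p r, Sm C q := fun q hq => hC q (hb hq)
  refine Reduces.mono ?_ hb
  by_cases h1 : ∃ α β γ μ : ℝ, μ ≠ 0 ∧
        ∀ q ∈ Metric.ball p r, C q = μ / (q.2 + β) ^ 2 + α * (q.2 + β) ^ 2 + γ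
  · obtain ⟨α, β, γ, μ, hμ, h1⟩ := h1
    exact reduces_of_special hε Metric.isOpen_ball ⟨p, Metric.mem_ball_self hr⟩ hC' hμ h1
  by_cases h2 : ∃ α β γ : ℝ, ∀ q ∈ Metric.ball p r, C q = α * q.2 ^ 2 + β * q.2 + γ
  · obtain ⟨α, β, γ, h2⟩ := h2
    exact reduces_of_quadratic hε Metric.isOpen_ball hC' (β := fun _ => β) (γ := fun _ => γ)
      (Metric.mem_ball_self hr) (Filter.Eventually.of_forall fun _ => contDiffAt_const)
      (Filter.Eventually.of_forall fun _ => contDiffAt_const) h2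
  · exact Reduces.of_canonical (eps_ne_zero hε) (l := .general) (isDom_ball p hr) hC'
      ⟨⟨fun x => C (p.1, x), fun q hq => eq_of_dt_eq_zero hC' (fun q hq => h q (hb hq)) hq⟩, h1, h2⟩

end Normal

end

/-! ### Straightening a symmetry of a heat equation with potential -/

section

section Symm

variable {ε : ℝ} {Ω : Set TX} {C τ ξ ζ : TX → ℝ}

theorem IsSymm.mono {N : Set TX} (h : IsSymm ε Ω C τ ξ ζ) (hN : IsOpen N) (hs : N ⊆ Ω) :
    IsSymm ε N C τ ξ ζ :=
  ⟨hN, fun p hp => h.sC p (hs hp), fun p hp => h.sτ p (hs hp), fun p hp => h.sξ p (hs hp),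
    fun p hp => h.sζ p (hs hp), fun p hp => h.det p (hs hp)⟩

theorem IsSymm.mem_gEss (hε : ε ≠ 0) (h : IsSymm ε Ω C τ ξ ζ) :
    (fun q => (τ q, ξ q, ζ q)) ∈ Lin.gEss Ω (Pco ε C) :=
  (isSymm_iff hε h.op h.sC).2 h

theorem slice_mem_ball {p : TX} {r : ℝ} (hr : 0 < r) {t : ℝ} (ht : t ∈ Metric.ball p.1 r) :
    (t, p.2) ∈ Metric.ball p r := by
  rw [Metric.mem_ball, Prod.dist_eq, max_lt_iff]
  exact ⟨ht, by simpa using hr⟩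

theorem fst_mem_ball {p q : TX} {r : ℝ} (hq : q ∈ Metric.ball p r) : q.1 ∈ Metric.ball p.1 r := by
  rw [Metric.mem_ball, Prod.dist_eq, max_lt_iff] at hq
  exact hq.1

/-- A potential that admits the symmetry `s ∂_t + ζ u ∂_u`, `s ≠ 0`, is reducible. -/
theorem reduces_of_dt (hε : ε = 1 ∨ ε = -1) {s : ℝ} (hs : s ≠ 0)
    (h : IsSymm ε Ω C τ ξ ζ) (hτ : ∀ q ∈ Ω, τ q = s) (hξ : ∀ q ∈ Ω, ξ q = 0) (hne : Ω.Nonempty) :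
    Reduces ε Ω (Pco ε C) := by
  obtain ⟨p, hp⟩ := hne
  have tτ : ∀ q ∈ Ω, dt τ q = 0 := fun q hq => by
    rw [dt_congr (eventuallyEq_of_eqOn h.op hq hτ), dt_const]
  have tξ : ∀ q ∈ Ω, dt ξ q = 0 := fun q hq => by
    rw [dt_congr (eventuallyEq_of_eqOn h.op hq hξ), dt_const]
  have xζ : ∀ q ∈ Ω, dx ζ q = 0 := fun q hq => by rw [h.dx_ζ hε hq, tξ q hq, mul_zero]
  have tζ : ∀ q ∈ Ω, dt ζ q = s * dt C q := fun q hq => by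
    have h1 := (h.det q hq).2.2.2
    rw [dx_congr (eventuallyEq_of_eqOn h.op hq xζ), dx_const, tτ q hq, hτ q hq, hξ q hq] at h1
    linarith
  obtain ⟨ρ, hρ, hb⟩ := Metric.isOpen_iff.1 h.op p hp
  -- The multiplier exp r with r' = ζ/s replaces C by C - ζ/s, which is stationary because the
  -- determining equations give ζ_x = 0 and ζ_t = s C_t.
  have sζ : ContDiffOn ℝ ∞ (fun t => ζ (t, p.2) / s) (Metric.ball p.1 ρ) := fun t ht =>
    ((contDiffAt_slice (h.sζ _ (hb (slice_mem_ball hρ ht)))).div_const s).contDiffWithinAt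
  obtain ⟨r, sr, hr⟩ := exists_hasDerivAt_eq Metric.isOpen_ball sζ (Metric.mem_ball_self hρ)
  obtain ⟨J, hJ, hJo, hpJ⟩ := eventually_nhds_iff.1 hr
  set W := Metric.ball p ρ ∩ {q | q.1 ∈ J} with hW
  have hWo : IsOpen W := Metric.isOpen_ball.inter (hJo.preimage continuous_fst)
  obtain ⟨N, N', e, φ, C', hN, hpN, hNW, hN', he, H, -, hC'⟩ := exists_inter_trans hε hWo
    (fun q hq => h.sC q (hb hq.1)) (p := p) ⟨Metric.mem_ball_self hρ, hpJ⟩ (y := fun _ => 1)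
    (T := fun t => t) (X := fun _ => 0) (P := fun _ => 0) (Q := fun _ => 0) (r := r)
    (Filter.Eventually.of_forall fun t => ⟨one_ne_zero, contDiffAt_const, contDiffAt_id,
      contDiffAt_const, contDiffAt_const, contDiffAt_const, sr.contDiffAt,
      by simpa using (hasDerivAt_id' t), by simpa using hasDerivAt_const t (1 : ℝ),
      by simpa using hasDerivAt_const t (0 : ℝ)⟩)
  have hid : ∀ q, e q = q := fun q => by rw [he]; simp
  have hNN : N' ⊆ N := fun q hq => by
    have h1 := H.diffeo.symm_mapsTo hq
    have h2 := H.diffeo.right_inv hq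
    rw [hid] at h2
    rwa [h2] at h1
  have key : ∀ q ∈ N', C' q = C q - ζ q / s := fun q hq => by
    have h1 := hC' q (hNN hq)
    rw [hid, (hJ _ (hNW (hNN hq)).2).deriv, ← eq_of_dx_eq_zero (fun q hq => h.sζ q (hb hq))
      (fun q hq => xζ q (hb hq)) (hNW (hNN hq)).1] at h1
    rw [h1]; simp
  have hsub : N' ⊆ Ω := fun q hq => hb (hNW (hNN hq)).1
  refine Reduces.mono (Reduces.of_inter H (reduces_of_stationary hε hN'.1 hN'.2.nonempty
    (fun q hq => H.sm_potential hq) fun q hq => ?_)) fun q hq => hb (hNW hq).1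
  have h1 := eventuallyEq_of_eqOn (f := C') (g := fun q => C q - s⁻¹ * ζ q) hN'.1 hq fun q hq => by
    rw [key q hq]; ring
  rw [dt_congr h1, dt_sub (h.sC q (hsub hq)).diff ((Sm.const _).mul (h.sζ q (hsub hq))).diff,
    dt_const_mul _ (h.sζ q (hsub hq)).diff, tζ q (hsub hq)]
  field_simp
  ring

/-- A potential that admits the symmetry `∂_x + ζ u ∂_u` is reducible. -/
theorem reduces_of_dx (hε : ε = 1 ∨ ε = -1)
    (h : IsSymm ε Ω C τ ξ ζ) (hτ : ∀ q ∈ Ω, τ q = 0) (hξ : ∀ q ∈ Ω, ξ q = 1) (hne : Ω.Nonempty) :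
    Reduces ε Ω (Pco ε C) := by
  obtain ⟨p, hp⟩ := hne
  have tτ : ∀ q ∈ Ω, dt τ q = 0 := fun q hq => by
    rw [dt_congr (eventuallyEq_of_eqOn h.op hq hτ), dt_const]
  have tξ : ∀ q ∈ Ω, dt ξ q = 0 := fun q hq => by
    rw [dt_congr (eventuallyEq_of_eqOn h.op hq hξ), dt_const]
  have xζ : ∀ q ∈ Ω, dx ζ q = 0 := fun q hq => by rw [h.dx_ζ hε hq, tξ q hq, mul_zero]
  have xC : ∀ q ∈ Ω, dx C q = dt ζ q := fun q hq => by
    have h1 := (h.det q hq).2.2.2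
    rw [dx_congr (eventuallyEq_of_eqOn h.op hq xζ), dx_const, tτ q hq, hτ q hq, hξ q hq] at h1
    linarith
  have xtζ : ∀ q ∈ Ω, dx (dt ζ) q = 0 := fun q hq => by
    rw [← dt_dx_comm (h.sζ q hq), dt_congr (eventuallyEq_of_eqOn h.op hq xζ), dt_const]
  obtain ⟨ρ, hρ, hb⟩ := Metric.isOpen_iff.1 h.op p hp
  -- The determining equations give C_x = ζ_t, which does not depend on x; hence C is affine in x
  -- with coefficients depending on t.
  set β : ℝ → ℝ := fun t => dt ζ (t, p.2) with hβ
  set γ : ℝ → ℝ := fun t => C (t, p.2) - β t * p.2 with hγ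
  have sβ : ∀ t ∈ Metric.ball p.1 ρ, ContDiffAt ℝ ∞ β t := fun t ht =>
    contDiffAt_slice (h.sζ _ (hb (slice_mem_ball hρ ht))).dt
  have sγ : ∀ t ∈ Metric.ball p.1 ρ, ContDiffAt ℝ ∞ γ t := fun t ht =>
    (contDiffAt_slice (h.sC _ (hb (slice_mem_ball hρ ht)))).sub ((sβ t ht).mul contDiffAt_const)
  have hβζ : ∀ q ∈ Metric.ball p ρ, dt ζ q = β q.1 := fun q hq =>
    eq_of_dx_eq_zero (fun q hq => (h.sζ q (hb hq)).dt) (fun q hq => xtζ q (hb hq)) hq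
  have sβx : ∀ q ∈ Metric.ball p ρ, Sm (fun q : TX => β q.1 * q.2) q := fun q hq =>
    ((sβ _ (fst_mem_ball hq)).comp q contDiffAt_fst).mul contDiffAt_snd
  have hlin : ∀ q ∈ Metric.ball p ρ, C q - β q.1 * q.2 = γ q.1 := fun q hq => by
    refine eq_of_dx_eq_zero (f := fun q => C q - β q.1 * q.2)
      (fun q hq => (h.sC q (hb hq)).sub (sβx q hq)) (fun q hq => ?_) hq
    have hβs : Sm (fun q : TX => β q.1) q := (sβ _ (fst_mem_ball hq)).comp q contDiffAt_fst
    rw [dx_sub (h.sC q (hb hq)).diff (sβx q hq).diff, dx_mul hβs.diff differentiableAt_snd, dx_snd,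
      dx_fun_fst ((sβ _ (fst_mem_ball hq)).differentiableAt (by simp)), xC q (hb hq), hβζ q hq]
    ring
  have hballp := Metric.ball_mem_nhds p.1 hρ
  refine Reduces.mono (reduces_of_quadratic hε Metric.isOpen_ball (fun q hq => h.sC q (hb hq))
    (α := 0) (β := β) (γ := γ) (Metric.mem_ball_self hρ)
    (by filter_upwards [hballp] with t ht using sβ t ht)
    (by filter_upwards [hballp] with t ht using sγ t ht) fun q hq => ?_) hb
  rw [← hlin q hq]; ring

/-- The time change with y² = τ/s makes τ equal to the constant s = τ(p); normalizing to s rather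
than to 1 keeps the root real. Since ξ = τ_t x/2 + c(t), the choice P = -τ_t/(2τ), Q = -c/τ makes ξ
vanish, and `reduces_of_dt` applies. -/
theorem reduces_of_τ_ne (hε : ε = 1 ∨ ε = -1) (h : IsSymm ε Ω C τ ξ ζ) {p : TX} (hp : p ∈ Ω)
    (hτ : τ p ≠ 0) : Reduces ε Ω (Pco ε C) := by
  set s := τ p with hs
  have hev : ∀ᶠ q in 𝓝 p, q ∈ Ω ∧ 0 < τ q / s := by
    have hc : ContinuousAt (fun q => τ q / s) p := (h.sτ p hp).continuousAt.div_const s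
    have : 0 < τ p / s := by rw [← hs, div_self hτ]; exact one_pos
    filter_upwards [h.op.mem_nhds hp, hc.eventually (lt_mem_nhds this)] with q a b using ⟨a, b⟩
  obtain ⟨ρ, hρ, hb⟩ := Metric.eventually_nhds_iff_ball.1 hev
  set I := Metric.ball p.1 ρ with hI
  have hIo : IsOpen I := Metric.isOpen_ball
  have hpI : p.1 ∈ I := Metric.mem_ball_self hρ
  have hsl : ∀ t ∈ I, (t, p.2) ∈ Metric.ball p ρ := fun t ht => slice_mem_ball hρ ht
  set a : ℝ → ℝ := fun t => τ (t, p.2) with ha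
  set a' : ℝ → ℝ := fun t => dt τ (t, p.2) with ha'
  have sa : ∀ t ∈ I, ContDiffAt ℝ ∞ a t := fun t ht => contDiffAt_slice (h.sτ _ (hb _ (hsl t ht)).1)
  have sa' : ∀ t ∈ I, ContDiffAt ℝ ∞ a' t := fun t ht =>
    contDiffAt_slice (h.sτ _ (hb _ (hsl t ht)).1).dt
  have da : ∀ t ∈ I, HasDerivAt a (a' t) t := fun t ht =>
    hasDerivAt_slice (h.sτ _ (hb _ (hsl t ht)).1).diff
  have pa : ∀ t ∈ I, 0 < a t / s := fun t ht => (hb _ (hsl t ht)).2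
  have a0 : ∀ t ∈ I, a t ≠ 0 := fun t ht h0 => by
    have := pa t ht; rw [h0, zero_div] at this; exact lt_irrefl _ this
  set y : ℝ → ℝ := fun t => Real.sqrt (a t / s) with hy
  have y2 : ∀ t ∈ I, y t ^ 2 = a t / s := fun t ht => Real.sq_sqrt (pa t ht).le
  have y0 : ∀ t ∈ I, y t ≠ 0 := fun t ht => (Real.sqrt_pos.2 (pa t ht)).ne'
  have sy : ∀ t ∈ I, ContDiffAt ℝ ∞ y t := fun t ht =>
    ContDiffAt.sqrt ((sa t ht).div_const s) (pa t ht).ne'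
  set P : ℝ → ℝ := fun t => -(a' t / (2 * a t)) with hP
  set c : ℝ → ℝ := fun t => ξ (t, p.2) - 1 / 2 * (a' t * p.2) with hc
  set Q : ℝ → ℝ := fun t => -(c t / a t) with hQ
  have sP : ∀ t ∈ I, ContDiffAt ℝ ∞ P t := fun t ht =>
    ((sa' t ht).div (contDiffAt_const.mul (sa t ht)) (mul_ne_zero two_ne_zero (a0 t ht))).neg
  have sc : ∀ t ∈ I, ContDiffAt ℝ ∞ c t := fun t ht =>
    (contDiffAt_slice (h.sξ _ (hb _ (hsl t ht)).1)).sub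
      (contDiffAt_const.mul ((sa' t ht).mul contDiffAt_const))
  have sQ : ∀ t ∈ I, ContDiffAt ℝ ∞ Q t := fun t ht => ((sc t ht).div (sa t ht) (a0 t ht)).neg
  obtain ⟨X, sX, hX⟩ := exists_hasDerivAt_eq hIo (g := fun t => Q t / y t)
    (fun t ht => ((sQ t ht).div (sy t ht) (y0 t ht)).contDiffWithinAt) hpI
  obtain ⟨T, sT, hT⟩ := exists_hasDerivAt_eq hIo (g := fun t => 1 / y t ^ 2)
    (fun t ht => (contDiffAt_const.div ((sy t ht).pow 2)
      (pow_ne_zero 2 (y0 t ht))).contDiffWithinAt) hpI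
  have dy : ∀ t ∈ I, HasDerivAt y (-P t * y t) t := fun t ht => by
    refine (((da t ht).div_const s).sqrt (pa t ht).ne').congr_deriv ?_
    have h1 := y0 t ht
    have h2 := a0 t ht
    have h3 := y2 t ht
    change a' t / s / (2 * y t) = -P t * y t
    simp only [hP]
    field_simp at h3 ⊢
    linear_combination (-a' t) * h3
  obtain ⟨N, N', e, φ, C', hN, hpN, hNW, hN', he, H, hder, -⟩ := exists_inter_trans hε
    Metric.isOpen_ball (fun q hq => h.sC q (hb q hq).1) (p := p) (Metric.mem_ball_self hρ) (y := y)
    (T := T) (X := X) (P := P) (Q := Q) (r := fun _ => 0) (by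
      filter_upwards [eventually_nhds_mem hIo hpI, hX, hT] with t ht h1 h2
      exact ⟨y0 t ht, sy t ht, sT.contDiffAt, sX.contDiffAt, sP t ht, sQ t ht, contDiffAt_const,
        h2, dy t ht, h1⟩)
  have hNΩ : N ⊆ Ω := fun q hq => (hb q (hNW hq)).1
  have eqτ : ∀ q ∈ Metric.ball p ρ, τ q = a q.1 := fun q hq =>
    eq_of_dx_eq_zero (fun q hq => h.sτ q (hb q hq).1) (fun q hq => h.dx_τ (hb q hq).1) hq
  have eqτt : ∀ q ∈ Metric.ball p ρ, dt τ q = a' q.1 := fun q hq =>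
    eq_of_dx_eq_zero (fun q hq => (h.sτ q (hb q hq).1).dt) (fun q hq => h.dx_dt_τ (hb q hq).1) hq
  have eqξ : ∀ q ∈ Metric.ball p ρ, ξ q = 1 / 2 * (a' q.1 * q.2) + c q.1 := fun q hq => by
    have h1 : ∀ q ∈ Metric.ball p ρ, Sm (fun q => ξ q - 1 / 2 * (dt τ q * q.2)) q := fun q hq =>
      (h.sξ q (hb q hq).1).sub ((Sm.const _).mul ((h.sτ q (hb q hq).1).dt.mul contDiffAt_snd))
    have h2 := eq_of_dx_eq_zero h1 (fun q hq => by
      have hq' := (hb q hq).1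
      have m1 : Sm (fun q => dt τ q * q.2) q := (h.sτ q hq').dt.mul contDiffAt_snd
      rw [dx_sub (h.sξ q hq').diff ((Sm.const _).mul m1).diff, dx_const_mul _ m1.diff,
        dx_mul (h.sτ q hq').dt.diff differentiableAt_snd, dx_snd, h.dx_dt_τ hq', h.dx_ξ hq']
      ring) hq
    rw [eqτt q hq] at h2
    simp only [hc, ha']
    linear_combination h2
  have hS := H.isSymm (eps_ne_zero hε) ((h.mono hN.1 hNΩ).mem_gEss (eps_ne_zero hε))
  have vals : ∀ q ∈ N', (pushField e φ (fun q => (τ q, ξ q, ζ q)) q).1 = s ∧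
      (pushField e φ (fun q => (τ q, ξ q, ζ q)) q).2.1 = 0 := fun q' hq' => by
    have hq := H.diffeo.symm_mapsTo hq'
    have hqb := hNW hq
    have ht := fst_mem_ball hqb
    have h1 := y0 _ ht
    have h2 := a0 _ ht
    obtain ⟨d1, d2, d3⟩ := hder _ hq
    simp only [pushField]
    rw [d1, d2, d3, eqτ _ hqb, eqξ _ hqb]
    constructor
    · rw [y2 _ ht]; field_simp
    · simp only [hP, hQ]; field_simp; ring
  exact Reduces.mono (Reduces.of_inter H (reduces_of_dt hε hτ hS (fun q hq => (vals q hq).1)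
    (fun q hq => (vals q hq).2) hN'.2.nonempty)) hNΩ

/-- If τ = 0, then ξ depends on t only, and the scaling x̃ = x/ξ turns the symmetry into ∂_x plus a
multiple of u∂_u. -/
theorem reduces_of_ξ_ne (hε : ε = 1 ∨ ε = -1) (h : IsSymm ε Ω C τ ξ ζ) (hτ : ∀ q ∈ Ω, τ q = 0)
    {p : TX} (hp : p ∈ Ω) (hξ : ξ p ≠ 0) : Reduces ε Ω (Pco ε C) := by
  have hev : ∀ᶠ q in 𝓝 p, q ∈ Ω ∧ ξ q ≠ 0 := by
    filter_upwards [h.op.mem_nhds hp, (h.sξ p hp).continuousAt.eventually_ne hξ] with q a b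
      using ⟨a, b⟩
  obtain ⟨ρ, hρ, hb⟩ := Metric.eventually_nhds_iff_ball.1 hev
  set I := Metric.ball p.1 ρ with hI
  have hIo : IsOpen I := Metric.isOpen_ball
  have hpI : p.1 ∈ I := Metric.mem_ball_self hρ
  have hsl : ∀ t ∈ I, (t, p.2) ∈ Metric.ball p ρ := fun t ht => slice_mem_ball hρ ht
  set y : ℝ → ℝ := fun t => ξ (t, p.2) with hy
  set y' : ℝ → ℝ := fun t => dt ξ (t, p.2) with hy'
  have sy : ∀ t ∈ I, ContDiffAt ℝ ∞ y t := fun t ht => contDiffAt_slice (h.sξ _ (hb _ (hsl t ht)).1)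
  have sy' : ∀ t ∈ I, ContDiffAt ℝ ∞ y' t := fun t ht =>
    contDiffAt_slice (h.sξ _ (hb _ (hsl t ht)).1).dt
  have dy : ∀ t ∈ I, HasDerivAt y (y' t) t := fun t ht =>
    hasDerivAt_slice (h.sξ _ (hb _ (hsl t ht)).1).diff
  have y0 : ∀ t ∈ I, y t ≠ 0 := fun t ht => (hb _ (hsl t ht)).2
  obtain ⟨T, sT, hT⟩ := exists_hasDerivAt_eq hIo (g := fun t => 1 / y t ^ 2)
    (fun t ht => (contDiffAt_const.div ((sy t ht).pow 2)
      (pow_ne_zero 2 (y0 t ht))).contDiffWithinAt) hpI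
  obtain ⟨N, N', e, φ, C', hN, hpN, hNW, hN', he, H, hder, -⟩ := exists_inter_trans hε
    Metric.isOpen_ball (fun q hq => h.sC q (hb q hq).1) (p := p) (Metric.mem_ball_self hρ) (y := y)
    (T := T) (X := fun _ => 0) (P := fun t => -(y' t / y t)) (Q := fun _ => 0) (r := fun _ => 0) (by
      filter_upwards [eventually_nhds_mem hIo hpI, hT] with t ht h2
      refine ⟨y0 t ht, sy t ht, sT.contDiffAt, contDiffAt_const,
        ((sy' t ht).div (sy t ht) (y0 t ht)).neg, contDiffAt_const, contDiffAt_const, h2, ?_, ?_⟩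
      · rw [neg_neg, div_mul_cancel₀ _ (y0 t ht)]; exact dy t ht
      · rw [zero_div]; exact hasDerivAt_const t 0)
  have hNΩ : N ⊆ Ω := fun q hq => (hb q (hNW hq)).1
  have eqξ : ∀ q ∈ Metric.ball p ρ, ξ q = y q.1 := fun q hq =>
    eq_of_dx_eq_zero (fun q hq => h.sξ q (hb q hq).1) (fun q hq => by
      rw [h.dx_ξ (hb q hq).1, dt_congr (eventuallyEq_of_eqOn h.op (hb q hq).1 hτ), dt_const,
        mul_zero]) hq
  have hS := H.isSymm (eps_ne_zero hε) ((h.mono hN.1 hNΩ).mem_gEss (eps_ne_zero hε))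
  have vals : ∀ q ∈ N', (pushField e φ (fun q => (τ q, ξ q, ζ q)) q).1 = 0 ∧
      (pushField e φ (fun q => (τ q, ξ q, ζ q)) q).2.1 = 1 := fun q' hq' => by
    have hq := H.diffeo.symm_mapsTo hq'
    have hqb := hNW hq
    have h1 := y0 _ (fst_mem_ball hqb)
    obtain ⟨d1, d2, d3⟩ := hder _ hq
    simp only [pushField]
    rw [d1, d2, d3, hτ _ (hNΩ hq), eqξ _ hqb]
    constructor
    · ring
    · field_simp; ring
  exact Reduces.mono (Reduces.of_inter H (reduces_of_dx hε hS (fun q hq => (vals q hq).1)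
    (fun q hq => (vals q hq).2) hN'.2.nonempty)) hNΩ

/-- A linear evolution equation with a nontrivial essential symmetry is locally equivalent to a heat
equation with a canonical potential. -/
theorem reduces_of_mem_gEss (hε : ε = 1 ∨ ε = -1) {k : Coef} (hΩ : IsOpen Ω) (hk : k ∈ Lin.S Ω)
    {Q : EssField} (hQ : Q ∈ Lin.gEss Ω k) {p : TX} (hp : p ∈ Ω)
    (h : ¬ ((Q p).1 = 0 ∧ (Q p).2.1 = 0)) : Reduces ε Ω k := by
  obtain ⟨N, N', e, φ, C, hN, hpN, hNW, hN', H⟩ := exists_inter_Pco hε hΩ hk hp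
  have hS := H.isSymm (eps_ne_zero hε) (gEss_mono hQ hNW)
  refine Reduces.mono (Reduces.of_inter H ?_) hNW
  by_cases h0 : ∀ q ∈ N', (pushField e φ Q q).1 = 0
  · refine reduces_of_ξ_ne hε hS h0 (H.diffeo.mapsTo hpN) fun h1 => h ?_
    have h2 := h0 _ (H.diffeo.mapsTo hpN)
    simp only [H.pushField_fst hpN] at h1 h2
    have h3 := (mul_eq_zero.1 h2).resolve_right (H.dt_tc_ne hpN)
    rw [h3, zero_mul, zero_add] at h1
    exact ⟨h3, (mul_eq_zero.1 h1).resolve_right (H.dx_xc_ne hpN)⟩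
  · push Not at h0
    obtain ⟨q, hq, h1⟩ := h0
    exact reduces_of_τ_ne hε hS hq h1

end Symm

end

section

/-! ### Gauging by solutions -/

/-- The equation with ε, C and the one with εσ, σC coincide for σ = 1 and are mutually adjoint for σ
= -1. Thus U may solve the second equation while the symmetries are computed for the first. -/
theorem co_Pco {ε σ : ℝ} (hσ : σ = 1 ∨ σ = -1) (C : TX → ℝ) (p : TX) :
    co σ (Pco (ε * σ) fun p => σ * C p) p = Pco ε C p := by
  rcases hσ with rfl | rfl
  · simp [co_one, Pco]
  · have h : ∀ c : ℝ, dx (fun _ : TX => c) = fun _ => 0 := fun c => by ext; exact dx_const _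
    simp [co_neg_one, Pco, adj, h]

theorem sm_of_nonzeroSol {ε : ℝ} {Ω : Set TX} (hΩ : IsOpen Ω) {C U : TX → ℝ}
    (hU : U ∈ (Peps ε).nonzeroSol Ω C) {p : TX} (hp : p ∈ Ω) : Sm U p :=
  sm_of_contDiffOn hU.1 hΩ hp

theorem sm_drift {ε σ : ℝ} {Ω : Set TX} {U : TX → ℝ} (sU : ∀ p ∈ Ω, Sm U p)
    (hU : ∀ p ∈ Ω, U p ≠ 0) {p : TX} (hp : p ∈ Ω) : Sm (drift ε σ U) p :=
  ((Sm.const (2 * ε * σ)).mul (sU p hp).dx).div (sU p hp) (hU p hp)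

/-- With the identity on (t, x), the law for the zero-order coefficient says that it vanishes
exactly when the multiplier U solves the initial equation, and the law for the drift yields 2εσ
U_x/U. -/
theorem inter_drift {ε σ : ℝ} (h0 : ε * σ ≠ 0) {Ω : Set TX} (hΩ : IsOpen Ω) {C U : TX → ℝ}
    (hC : ∀ p ∈ Ω, Sm C p) (hU : U ∈ (Peps (ε * σ)).nonzeroSol Ω fun p => σ * C p) :
    Inter Ω Ω (PartialEquiv.ofSet Ω) U (Pco (ε * σ) fun p => σ * C p)
      (fun p => (σ * ε, drift ε σ U p, 0)) := by
  have sU : ∀ p ∈ Ω, Sm U p := fun p hp => sm_of_nonzeroSol hΩ hU hp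
  have h1 : dx (xc (PartialEquiv.ofSet Ω)) = fun _ => 1 := by ext p; exact dx_snd
  have h2 : ∀ p, dt (tc (PartialEquiv.ofSet Ω)) p = 1 := fun p => dt_fst
  have h3 : ∀ p, dx (tc (PartialEquiv.ofSet Ω)) p = 0 := fun p => dx_fst
  have h4 : ∀ p, dt (xc (PartialEquiv.ofSet Ω)) p = 0 := fun p => dt_snd
  refine Inter.of_rel hΩ hΩ (isDiffeo_refl Ω) hU.1 hU.2.1
    (Pco_mem h0 fun p hp => (Sm.const σ).mul (hC p hp))
    (Lin_mem_S_of_sm (fun _ _ => Sm.const _) (fun p hp => sm_drift sU hU.2.1 hp)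
      (fun _ _ => Sm.const _) fun _ _ => by rwa [mul_comm]) (fun p _ => h3 p)
    (fun p _ => by rw [h2]; exact one_ne_zero) (fun p _ => ?_) (fun p hp => ?_) fun p hp => ?_
  · simp only [h1, h2, Pco]; ring
  · have := hU.2.1 p hp
    simp only [h1, h2, h4, Pco, dx_const, PartialEquiv.ofSet_coe, id, drift]
    field_simp
    ring
  · have := hU.2.2 p hp
    simp only [EqClass.lhs, Peps] at this
    simp only [Pco]
    linarith

/-- The ratios of the derivatives of the dualized multiplier `U`. -/
theorem com_drift {ε σ : ℝ} (hε : ε = 1 ∨ ε = -1) (hσ : σ = 1 ∨ σ = -1) {Ω : Set TX}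
    {U : TX → ℝ} {p : TX} (sU : Sm U p) (hU : U p ≠ 0) :
    com σ (PartialEquiv.ofSet Ω) U p ≠ 0 ∧
    dt (com σ (PartialEquiv.ofSet Ω) U) p =
      com σ (PartialEquiv.ofSet Ω) U p * Rfun σ U p ∧
    dx (com σ (PartialEquiv.ofSet Ω) U) p =
      com σ (PartialEquiv.ofSet Ω) U p * (1 / 2 * ε * drift ε σ U p) := by
  have he := eps_mul_self hε
  have h1 : dx (xc (PartialEquiv.ofSet Ω)) = fun _ => 1 := by ext p; exact dx_snd
  rcases hσ with rfl | rfl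
  · have hc : com 1 (PartialEquiv.ofSet Ω) U = U := if_pos rfl
    rw [hc]
    refine ⟨hU, ?_, ?_⟩
    · simp only [Rfun]; field_simp
    · simp only [drift]; field_simp; linear_combination -dx U p * he
  · have hc : com (-1) (PartialEquiv.ofSet Ω) U = fun q => (U q)⁻¹ := by
      unfold com
      rw [if_neg (by norm_num), h1]
      ext q
      rw [one_div]
    have hd : DifferentiableAt ℝ (fun x : ℝ => x⁻¹) (U p) := differentiableAt_inv hU
    rw [hc]
    refine ⟨inv_ne_zero hU, ?_, ?_⟩
    · rw [dt_comp_real hd sU.diff, deriv_inv]; simp only [Rfun]; field_simp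
    · rw [dx_comp_real hd sU.diff, deriv_inv]; simp only [drift]; field_simp
      linear_combination dx U p * he

theorem gauge_mem {Ω : Set TX} {ψ : TX → ℝ} {k k' : Coef}
    (H : Inter Ω Ω (PartialEquiv.ofSet Ω) ψ k k') {Q : EssField} (hQ : Q ∈ Lin.gEss Ω k) :
    (fun p => ((Q p).1, (Q p).2.1, (Q p).2.2 - ((Q p).1 * dt ψ p + (Q p).2.1 * dx ψ p) / ψ p)) ∈
      Lin.gEss Ω k' := by
  have h1 : ∀ p, dx (xc (PartialEquiv.ofSet Ω)) p = 1 := fun p => dx_snd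
  have h2 : ∀ p, dt (tc (PartialEquiv.ofSet Ω)) p = 1 := fun p => dt_fst
  have h4 : ∀ p, dt (xc (PartialEquiv.ofSet Ω)) p = 0 := fun p => dt_snd
  convert H.pushField_mem hQ using 1
  ext p <;> simp [pushField, h1, h2, h4]

theorem IsSymm.congr {ε : ℝ} {Ω : Set TX} {C τ ξ ζ τ' ξ' ζ' : TX → ℝ} (h : IsSymm ε Ω C τ ξ ζ)
    (h1 : ∀ p ∈ Ω, τ' p = τ p) (h2 : ∀ p ∈ Ω, ξ' p = ξ p) (h3 : ∀ p ∈ Ω, ζ' p = ζ p) :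
    IsSymm ε Ω C τ' ξ' ζ' := by
  have e1 : ∀ p ∈ Ω, τ' =ᶠ[𝓝 p] τ := fun p hp => eventuallyEq_of_eqOn h.op hp h1
  have e2 : ∀ p ∈ Ω, ξ' =ᶠ[𝓝 p] ξ := fun p hp => eventuallyEq_of_eqOn h.op hp h2
  have e3 : ∀ p ∈ Ω, ζ' =ᶠ[𝓝 p] ζ := fun p hp => eventuallyEq_of_eqOn h.op hp h3
  refine ⟨h.op, h.sC, fun p hp => (h.sτ p hp).congr (e1 p hp), fun p hp =>
    (h.sξ p hp).congr (e2 p hp), fun p hp => (h.sζ p hp).congr (e3 p hp), fun p hp => ?_⟩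
  have := h.det p hp
  unfold DetEqs at this ⊢
  rwa [dx_congr (e1 p hp), dt_congr (e1 p hp), dx_congr (e2 p hp), dt_congr (e2 p hp),
    dx_congr (e3 p hp), dt_congr (e3 p hp), dx_congr (dx_eventuallyEq (e3 p hp)), h1 p hp, h2 p hp]

theorem const_mem_gEss {Ω : Set TX} (hΩ : IsOpen Ω) {k : Coef} {Q : EssField} {a : ℝ}
    (h : ∀ q ∈ Ω, Q q = (0, 0, a)) : Q ∈ Lin.gEss Ω k := by
  refine mem_gEss_iff.2 ⟨contDiffOn_const.congr h, fun p hp f hf h0 => ?_⟩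
  have h1 : Q.toVField.char f =ᶠ[𝓝 p] fun q => a * f q :=
    eventuallyEq_of_eqOn hΩ hp fun q hq => by rw [toVField_char]; simp [h q hq]
  rw [Lin_lhs_congr h1, Lin_lhs_const_mul a hf.contDiffAt, h0, h p hp]
  simp

section KClass

variable {Θ : Type} [NormedAddCommGroup Θ] [NormedSpace ℝ Θ] {L : EqClass Θ} {ε σ : ℝ}
  {el : (TX → ℝ) → TX → Θ} {κ : (TX → Θ) → Coef} {Ω : Set TX} {C U : TX → ℝ}

namespace KClass

theorem el_drift_mem (K : KClass L ε σ el κ) (hΩ : IsOpen Ω)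
    (hU : U ∈ (Peps (ε * σ)).nonzeroSol Ω fun p => σ * C p) : el (drift ε σ U) ∈ L.S Ω :=
  K.el_mem fun _ hp => sm_drift (fun _ hp => sm_of_nonzeroSol hΩ hU hp) hU.2.1 hp

theorem inter_el (K : KClass L ε σ el κ) (h0 : ε * σ ≠ 0) (hΩ : IsOpen Ω)
    (hC : ∀ p ∈ Ω, Sm C p) (hU : U ∈ (Peps (ε * σ)).nonzeroSol Ω fun p => σ * C p) :
    Inter Ω Ω (PartialEquiv.ofSet Ω) U (Pco (ε * σ) fun p => σ * C p) (κ (el (drift ε σ U))) :=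
  (inter_drift h0 hΩ hC hU).congr (fun _ _ => rfl) (fun _ _ => rfl) fun _ _ => K.κ_el _ _

/-- The essential Lie symmetries of a gauged equation. -/
theorem mem_gEss_el (K : KClass L ε σ el κ) (hε : ε = 1 ∨ ε = -1) (hσ : σ = 1 ∨ σ = -1)
    (hΩ : IsOpen Ω) (hC : ∀ p ∈ Ω, Sm C p)
    (hU : U ∈ (Peps (ε * σ)).nonzeroSol Ω fun p => σ * C p) {Q : EssField} :
    Q ∈ L.gEss Ω (el (drift ε σ U)) ↔
      IsSymm ε Ω C (fun p => (Q p).1) (fun p => (Q p).2.1) (fun p => (Q p).2.2 +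
        ((Q p).1 * Rfun σ U p + (Q p).2.1 * (1 / 2 * ε * drift ε σ U p))) := by
  have hε0 := eps_ne_zero hε
  have h0 := mul_ne_zero hε0 (eps_ne_zero hσ)
  have sU : ∀ p ∈ Ω, Sm U p := fun p hp => sm_of_nonzeroSol hΩ hU hp
  set ψ := com σ (PartialEquiv.ofSet Ω) U with hψ
  have hd : ∀ p ∈ Ω, ψ p ≠ 0 ∧ dt ψ p = ψ p * Rfun σ U p ∧
      dx ψ p = ψ p * (1 / 2 * ε * drift ε σ U p) := fun p hp =>
    com_drift hε hσ (sU p hp) (hU.2.1 p hp)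
  -- Dualizing the gauge by U gives a gauge by ψ = U or ψ = 1/U from the heat equation with
  -- potential C to the equation itself. In both cases the logarithmic derivatives of ψ are R and
  -- εB/2, so the formulas do not distinguish the signs of σ.
  have H : Inter Ω Ω (PartialEquiv.ofSet Ω) ψ (Pco ε C) (co σ (κ (el (drift ε σ U)))) :=
    ((K.inter_el h0 hΩ hC hU).co σ).congr (fun _ _ => rfl) (fun p _ => (co_Pco hσ C p).symm)
      fun _ _ => rfl
  have Hs : Inter Ω Ω (PartialEquiv.ofSet Ω) (fun q => (ψ q)⁻¹) (co σ (κ (el (drift ε σ U))))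
    (Pco ε C) := H.symm
  have sψ : ∀ p ∈ Ω, Sm ψ p := fun p hp => H.sm hp
  have hd' : ∀ p ∈ Ω, dt (fun q => (ψ q)⁻¹) p = -((ψ p)⁻¹ * Rfun σ U p) ∧
      dx (fun q => (ψ q)⁻¹) p = -((ψ p)⁻¹ * (1 / 2 * ε * drift ε σ U p)) := fun p hp => by
    obtain ⟨h1, h2, h3⟩ := hd p hp
    have hi : DifferentiableAt ℝ (fun x : ℝ => x⁻¹) (ψ p) := differentiableAt_inv h1
    rw [dt_comp_real hi (sψ p hp).diff, dx_comp_real hi (sψ p hp).diff, deriv_inv, h2, h3]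
    constructor <;> field_simp
  rw [K.rep.gEss_eq hΩ (K.el_drift_mem hΩ hU)]
  constructor
  · intro hQ
    have h1 := (isSymm_iff hε0 hΩ hC).1 (gauge_mem Hs hQ)
    refine h1.congr (fun _ _ => rfl) (fun _ _ => rfl) fun p hp => ?_
    have := (hd p hp).1
    simp only [(hd' p hp).1, (hd' p hp).2]
    field_simp
    ring
  · intro hS
    have h1 := hS.congr (ζ' := fun p => (Q p).2.2 + ((Q p).1 * dt ψ p + (Q p).2.1 * dx ψ p) / ψ p)
      (fun _ _ => rfl) (fun _ _ => rfl) fun p hp => by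
        have := (hd p hp).1
        simp only [(hd p hp).2.1, (hd p hp).2.2]
        field_simp
    have h2 := gauge_mem H (h1.mem_gEss hε0)
    simpa only [add_sub_cancel_right, Prod.mk.eta] using h2

end KClass

end KClass

end

section

/-! ### Kernel algebra and bases -/

theorem quad_eq_zero {Ω : Set TX} (hΩ : IsOpen Ω) (hne : Ω.Nonempty) {c ct cx ctt ctx cxx : ℝ}
    (h : ∀ p ∈ Ω, quad 0 c ct cx ctt ctx cxx p = 0) :
    c = 0 ∧ ct = 0 ∧ cx = 0 ∧ ctt = 0 ∧ ctx = 0 ∧ cxx = 0 := by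
  have ht : ∀ {f : TX → ℝ}, (∀ p ∈ Ω, f p = 0) → ∀ p ∈ Ω, dt f p = 0 := fun hf p hp => by
    rw [dt_congr (eventuallyEq_of_eqOn (g := fun _ => 0) hΩ hp hf), dt_const]
  have hx : ∀ {f : TX → ℝ}, (∀ p ∈ Ω, f p = 0) → ∀ p ∈ Ω, dx f p = 0 := fun hf p hp => by
    rw [dx_congr (eventuallyEq_of_eqOn (g := fun _ => 0) hΩ hp hf), dx_const]
  obtain ⟨p, hp⟩ := hne
  have h1 := ht h
  have h2 := hx h
  have h3 := ht h1 p hp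
  have h4 := hx h1 p hp
  have h5 := hx h2 p hp
  rw [dt_quad] at h1 h3 h4
  rw [dx_quad] at h2 h5
  rw [dt_quad] at h3
  rw [dx_quad] at h4 h5
  have h0 := h p hp
  have h1 := h1 p hp
  have h2 := h2 p hp
  simp only [quad, Prod.fst_zero, Prod.snd_zero, sub_zero, zero_mul, zero_div, add_zero] at *
  subst h3 h4 h5
  simp only [zero_mul, add_zero] at h1 h2
  subst h1 h2
  simpa using h0

/-- The excluded forms of a general canonical potential are exactly those that `special_of_isSymm`
would produce from a symmetry with τ_t or ξ not identically zero. -/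
theorem exists_const_of_general {ε : ℝ} (hε : ε = 1 ∨ ε = -1) {Ω : Set TX} (hΩ : IsDom Ω)
    {C : TX → ℝ} (hC : IsCanonical Ω C .general) {τ ξ ζ : TX → ℝ} (h : IsSymm ε Ω C τ ξ ζ) :
    ∃ a₀ a₁ : ℝ, ∀ p ∈ Ω, τ p = a₁ ∧ ξ p = 0 ∧ ζ p = a₀ := by
  have tC := dt_eq_zero_of_eq_snd hΩ.1 h.sC hC.1
  have key : ∀ p ∈ Ω, dt τ p = 0 ∧ ξ p = 0 := by
    by_contra hne
    push Not at hne
    obtain ⟨p, hp, hne⟩ := hne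
    rcases special_of_isSymm hε hΩ h tC ⟨p, hp, fun h => hne h.1 h.2⟩ with h1 | h1
    exacts [hC.2.1 h1, hC.2.2 h1]
  have tτ : ∀ p ∈ Ω, dt (dt τ) p = 0 := fun p hp => by
    rw [dt_congr (eventuallyEq_of_eqOn (g := fun _ => 0) hΩ.1 hp fun q hq => (key q hq).1),
      dt_const]
  have tξ : ∀ p ∈ Ω, dt ξ p = 0 := fun p hp => by
    rw [dt_congr (eventuallyEq_of_eqOn (g := fun _ => 0) hΩ.1 hp fun q hq => (key q hq).2),
      dt_const]
  obtain ⟨p₀, hp₀⟩ := hΩ.2.nonempty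
  refine ⟨ζ p₀, τ p₀, fun p hp => ⟨?_, (key p hp).2, ?_⟩⟩
  · exact eq_of_dt_dx_eq_zero hΩ h.sτ (fun q hq => (key q hq).1) (fun q hq => h.dx_τ hq) hp hp₀
  · refine eq_of_dt_dx_eq_zero hΩ h.sζ (fun q hq => ?_) (fun q hq => ?_) hp hp₀
    · rw [h.dt_ζ hε hq, (key q hq).1, (key q hq).2, tC q hq, tτ q hq]; ring
    · rw [h.dx_ζ hε hq, tξ q hq, mul_zero]

theorem dt_eq_zero_of_canonical {Ω : Set TX} (hΩ : IsOpen Ω) {C : TX → ℝ}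
    (hC : ∀ p ∈ Ω, Sm C p) {l : PotCase} (hl : IsCanonical Ω C l) : ∀ p ∈ Ω, dt C p = 0 := by
  cases l with
  | general => exact dt_eq_zero_of_eq_snd hΩ hC hl.1
  | invSq μ => exact (derivs_invSq hΩ hl.2).2.1
  | zero =>
    intro p hp
    rw [dt_congr (eventuallyEq_of_eqOn (g := fun _ => 0) hΩ hp hl), dt_const]

/-- The linear combinations of the listed vector fields. -/
def listedField (ε σ : ℝ) (U : TX → ℝ) (a₀ a₁ a₂ a₃ a₄ a₅ : ℝ) : EssField := fun p =>
  (quad 0 a₁ (2 * a₂) 0 (8 * a₃) 0 0 p, quad 0 a₄ (2 * a₅) a₂ 0 (4 * a₃) 0 p,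
    quad 0 a₀ (-(2 * a₃)) (-(ε * a₅)) 0 0 (-(2 * ε * a₃)) p -
      (quad 0 a₁ (2 * a₂) 0 (8 * a₃) 0 0 p * Rfun σ U p +
        quad 0 a₄ (2 * a₅) a₂ 0 (4 * a₃) 0 p * (1 / 2 * ε * drift ε σ U p)))

theorem listedField_eq_zero {ε σ : ℝ} {U : TX → ℝ} {Ω : Set TX} (hΩ : IsOpen Ω)
    (hne : Ω.Nonempty) {a₀ a₁ a₂ a₃ a₄ a₅ : ℝ}
    (h : ∀ p ∈ Ω, listedField ε σ U a₀ a₁ a₂ a₃ a₄ a₅ p = 0) :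
    a₀ = 0 ∧ a₁ = 0 ∧ a₂ = 0 ∧ a₃ = 0 ∧ a₄ = 0 ∧ a₅ = 0 := by
  have h1 : ∀ p ∈ Ω, quad 0 a₁ (2 * a₂) 0 (8 * a₃) 0 0 p = 0 := fun p hp =>
    congrArg Prod.fst (h p hp)
  have h2 : ∀ p ∈ Ω, quad 0 a₄ (2 * a₅) a₂ 0 (4 * a₃) 0 p = 0 := fun p hp =>
    congrArg (fun z => z.2.1) (h p hp)
  have h3 : ∀ p ∈ Ω, quad 0 a₀ (-(2 * a₃)) (-(ε * a₅)) 0 0 (-(2 * ε * a₃)) p = 0 := fun p hp => by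
    have := congrArg (fun z => z.2.2) (h p hp)
    simp only [listedField, h1 p hp, h2 p hp] at this
    simpa using this
  obtain ⟨b1, b2, -, b3, -⟩ := quad_eq_zero hΩ hne h1
  obtain ⟨b4, b5, b6, -⟩ := quad_eq_zero hΩ hne h2
  obtain ⟨b7, -⟩ := quad_eq_zero hΩ hne h3
  exact ⟨b7, b1, b6, by linarith, b4, by linarith⟩

section KClass

variable {Θ : Type} [NormedAddCommGroup Θ] [NormedSpace ℝ Θ] {L : EqClass Θ} {ε σ : ℝ}
  {el : (TX → ℝ) → TX → Θ} {κ : (TX → Θ) → Coef} {Ω : Set TX} {C U : TX → ℝ}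

theorem eq_listedField {Q : EssField} {a₀ a₁ a₂ a₃ a₄ a₅ : ℝ} {p : TX}
    (h1 : (Q p).1 = quad 0 a₁ (2 * a₂) 0 (8 * a₃) 0 0 p)
    (h2 : (Q p).2.1 = quad 0 a₄ (2 * a₅) a₂ 0 (4 * a₃) 0 p)
    (h3 : (Q p).2.2 + ((Q p).1 * Rfun σ U p + (Q p).2.1 * (1 / 2 * ε * drift ε σ U p)) =
      quad 0 a₀ (-(2 * a₃)) (-(ε * a₅)) 0 0 (-(2 * ε * a₃)) p) :
    Q p = listedField ε σ U a₀ a₁ a₂ a₃ a₄ a₅ p := by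
  rw [h1, h2] at h3
  exact Prod.ext h1 (Prod.ext h2 (eq_sub_of_add_eq h3))

namespace KClass

theorem listed_mem (K : KClass L ε σ el κ) (hε : ε = 1 ∨ ε = -1) (hσ : σ = 1 ∨ σ = -1)
    (hΩ : IsOpen Ω) (hC : ∀ p ∈ Ω, Sm C p)
    (hU : U ∈ (Peps (ε * σ)).nonzeroSol Ω fun p => σ * C p) {Q : EssField}
    {a₀ a₁ a₂ a₃ a₄ a₅ : ℝ} (ht : ∀ p ∈ Ω, dt C p = 0)
    (hx : ∀ p ∈ Ω, 2 * (a₂ + 4 * a₃ * p.1) * C p +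
      ((a₂ + 4 * a₃ * p.1) * p.2 + a₄ + 2 * a₅ * p.1) * dx C p = 0)
    (hQ : ∀ p ∈ Ω, Q p = listedField ε σ U a₀ a₁ a₂ a₃ a₄ a₅ p) :
    Q ∈ L.gEss Ω (el (drift ε σ U)) := by
  refine (K.mem_gEss_el hε hσ hΩ hC hU).2 ((isSymm_poly hε hΩ hC a₀ a₁ a₂ a₃ a₄ a₅ ht hx).congr
    (fun p hp => by rw [hQ p hp]; rfl) (fun p hp => by rw [hQ p hp]; rfl) fun p hp => ?_)
  rw [hQ p hp]
  simp only [listedField]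
  ring

theorem hasListedBasis (K : KClass L ε σ el κ) (hε : ε = 1 ∨ ε = -1) (hσ : σ = 1 ∨ σ = -1)
    (hΩ : IsDom Ω) (hC : ∀ p ∈ Ω, Sm C p)
    (hU : U ∈ (Peps (ε * σ)).nonzeroSol Ω fun p => σ * C p) {l : PotCase}
    (hl : IsCanonical Ω C l) : HasListedBasis ε σ Ω U (L.gEss Ω (el (drift ε σ U))) l := by
  cases l with
  | general =>
    have tC := dt_eq_zero_of_eq_snd hΩ.1 hC hl.1
    have hsum : ∀ (a : Fin 2 → ℝ) (p : TX), ∑ i, a i • ![fieldI, fieldPt σ U] i p =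
        listedField ε σ U (a 0) (a 1) 0 0 0 0 p := fun a p => by
      simp only [Fin.sum_univ_two, Matrix.cons_val_zero, Matrix.cons_val_one]
      ext <;> simp [fieldI, fieldPt, listedField, quad]
      ring
    refine ⟨fun Q => ⟨fun hQ => ?_, fun ⟨a, hQ⟩ => ?_⟩, fun a ha => ?_⟩
    · have hS := (K.mem_gEss_el hε hσ hΩ.1 hC hU).1 hQ
      obtain ⟨a₀, a₁, h⟩ := exists_const_of_general hε hΩ hl hS
      refine ⟨![a₀, a₁], fun p hp => ?_⟩
      obtain ⟨h1, h2, h3⟩ := h p hp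
      rw [hsum]
      exact eq_listedField (h1.trans (by simp [quad])) (h2.trans (by simp [quad]))
        (h3.trans (by simp [quad]))
    · exact K.listed_mem hε hσ hΩ.1 hC hU tC (fun p _ => by ring)
        fun p hp => (hQ p hp).trans (hsum a p)
    · obtain ⟨h0, h1, -⟩ := listedField_eq_zero hΩ.1 hΩ.2.nonempty
        fun p hp => (hsum a p).symm.trans (ha p hp)
      ext i; fin_cases i; exacts [h0, h1]
  | invSq μ =>
    obtain ⟨-, tC, xC, -⟩ := derivs_invSq hΩ.1 hl.2
    have hsum : ∀ (a : Fin 4 → ℝ) (p : TX),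
        ∑ i, a i • ![fieldI, fieldPt σ U, fieldD ε σ U, fieldPi ε σ U] i p =
        listedField ε σ U (a 0) (a 1) (a 2) (a 3) 0 0 p := fun a p => by
      simp only [Fin.sum_univ_four, Matrix.cons_val]
      ext <;> simp [fieldI, fieldPt, fieldD, fieldPi, listedField, quad] <;> ring
    refine ⟨fun Q => ⟨fun hQ => ?_, fun ⟨a, hQ⟩ => ?_⟩, fun a ha => ?_⟩
    · have hS := (K.mem_gEss_el hε hσ hΩ.1 hC hU).1 hQ
      obtain ⟨a₀, a₁, a₂, a₃, h⟩ := exists_poly_of_invSq hε hΩ hl.1 hl.2 hS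
      refine ⟨![a₀, a₁, a₂, a₃], fun p hp => ?_⟩
      obtain ⟨h1, h2, h3⟩ := h p hp
      rw [hsum]
      exact eq_listedField h1 (h2.trans (by simp)) (h3.trans (by simp))
    · refine K.listed_mem hε hσ hΩ.1 hC hU tC (fun p hp => ?_)
        fun p hp => (hQ p hp).trans (hsum a p)
      have := (hl.2 p hp).1
      rw [xC p hp, (hl.2 p hp).2]
      field_simp
      ring
    · obtain ⟨h0, h1, h2, h3, -⟩ := listedField_eq_zero hΩ.1 hΩ.2.nonempty
        fun p hp => (hsum a p).symm.trans (ha p hp)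
      ext i; fin_cases i; exacts [h0, h1, h2, h3]
  | zero =>
    have tC : ∀ p ∈ Ω, dt C p = 0 := fun p hp => by
      rw [dt_congr (eventuallyEq_of_eqOn (g := fun _ => 0) hΩ.1 hp hl), dt_const]
    have xC : ∀ p ∈ Ω, dx C p = 0 := fun p hp => by
      rw [dx_congr (eventuallyEq_of_eqOn (g := fun _ => 0) hΩ.1 hp hl), dx_const]
    have hsum : ∀ (a : Fin 6 → ℝ) (p : TX),
        ∑ i, a i • ![fieldI, fieldPt σ U, fieldD ε σ U, fieldPi ε σ U, fieldPx ε σ U,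
          fieldG ε σ U] i p =
        listedField ε σ U (a 0) (a 1) (a 2) (a 3) (a 4) (a 5) p := fun a p => by
      simp only [Fin.sum_univ_six, Matrix.cons_val]
      ext <;> simp [fieldI, fieldPt, fieldD, fieldPi, fieldPx, fieldG, listedField, quad] <;> ring
    refine ⟨fun Q => ⟨fun hQ => ?_, fun ⟨a, hQ⟩ => ?_⟩, fun a ha => ?_⟩
    · have hS := (K.mem_gEss_el hε hσ hΩ.1 hC hU).1 hQ
      obtain ⟨a₀, a₁, a₂, a₃, a₄, a₅, h⟩ := exists_poly_of_zero hε hΩ hl hS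
      refine ⟨![a₀, a₁, a₂, a₃, a₄, a₅], fun p hp => ?_⟩
      obtain ⟨h1, h2, h3⟩ := h p hp
      rw [hsum]
      exact eq_listedField h1 h2 h3
    · refine K.listed_mem hε hσ hΩ.1 hC hU tC (fun p hp => ?_)
        fun p hp => (hQ p hp).trans (hsum a p)
      rw [xC p hp, hl p hp]
      ring
    · obtain ⟨h0, h1, h2, h3, h4, h5⟩ := listedField_eq_zero hΩ.1 hΩ.2.nonempty
        fun p hp => (hsum a p).symm.trans (ha p hp)
      ext i; fin_cases i; exacts [h0, h1, h2, h3, h4, h5]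

/-- Any positive function exp l is a solution for the potential defined by it, so every drift that
is an x-derivative is available for testing a common symmetry. -/
theorem exp_mem_nonzeroSol (hσ : σ = 1 ∨ σ = -1) {l : TX → ℝ} (sl : ∀ p, Sm l p) :
    (fun p => Real.exp (l p)) ∈ (Peps (ε * σ)).nonzeroSol Ω fun p => σ * (σ *
      ((dt (fun p => Real.exp (l p)) p - ε * σ * dx (dx fun p => Real.exp (l p)) p) /
        Real.exp (l p))) := by
  have hs := eps_mul_self hσ
  refine ⟨fun p _ => (Real.contDiff_exp.contDiffAt.comp p (sl p)).contDiffWithinAt,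
    fun p _ => Real.exp_ne_zero _, fun p _ => ?_⟩
  simp only [EqClass.lhs, Peps]
  rw [← mul_assoc, hs, one_mul, div_mul_cancel₀ _ (Real.exp_ne_zero _)]
  ring

/-- A common essential symmetry is, in particular, compatible with the drift of `exp l`. -/
theorem dx_ζ_of_exp (K : KClass L ε σ el κ) (hε : ε = 1 ∨ ε = -1) (hσ : σ = 1 ∨ σ = -1)
    (hΩ : IsOpen Ω) {Q : EssField} (hQ : Q ∈ L.kernelEss Ω) {l : TX → ℝ} (sl : ∀ p, Sm l p) :
    (∀ p ∈ Ω, 2 * dx (fun q => (Q q).2.1) p = dt (fun q => (Q q).1) p) ∧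
    (∀ p ∈ Ω, dx (fun q => (Q q).1) p = 0) ∧ ∀ p ∈ Ω,
    dx (fun q => (Q q).2.2 + ((Q q).1 * (σ * dt l q) + (Q q).2.1 * (σ * dx l q))) p =
      -ε / 2 * dt (fun q => (Q q).2.1) p := by
  have he := eps_mul_self hε
  have sE : ∀ p, Sm (fun p => Real.exp (l p)) p := fun p =>
    Real.contDiff_exp.contDiffAt.comp p (sl p)
  have hU := exp_mem_nonzeroSol (ε := ε) (Ω := Ω) hσ sl
  have hR : ∀ p, Rfun σ (fun p => Real.exp (l p)) p = σ * dt l p := fun p => by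
    rw [Rfun, dt_comp_real Real.differentiableAt_exp (sl p).diff, Real.deriv_exp]
    field_simp
  have hB : ∀ p, 1 / 2 * ε * drift ε σ (fun p => Real.exp (l p)) p = σ * dx l p := fun p => by
    rw [drift, dx_comp_real Real.differentiableAt_exp (sl p).diff, Real.deriv_exp]
    field_simp
    linear_combination σ * dx l p * he
  have hS := (K.mem_gEss_el hε hσ hΩ (fun p _ => (Sm.const σ).mul
    (((sE p).dt.sub ((Sm.const (ε * σ)).mul (sE p).dx.dx)).div (sE p) (Real.exp_ne_zero _)))
    hU).1 (hQ _ (K.el_drift_mem hΩ hU))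
  simp only [hR, hB] at hS
  exact ⟨fun p hp => (hS.det p hp).2.1, fun p hp => hS.dx_τ hp, fun p hp => hS.dx_ζ hε hp⟩

/-- A common symmetry must be compatible with the drift of exp l for every l. Comparing l = bx + atx
+ cx²/2 with l = 0 gives the x-derivative of τ l_t + ξ l_x equal to 0 for all a, b, c, which forces
τ = ξ = 0. -/
theorem isBasisOn_kernelEss (K : KClass L ε σ el κ) (hε : ε = 1 ∨ ε = -1) (hσ : σ = 1 ∨ σ = -1)
    (hΩ : IsDom Ω) : IsBasisOn Ω (L.kernelEss Ω) ![fieldI] := by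
  have hsum : ∀ (a : Fin 1 → ℝ) (p : TX), ∑ i, a i • ![fieldI] i p = (0, 0, a 0) := fun a p => by
    simp [fieldI]
  have hσ0 := eps_ne_zero hσ
  refine ⟨fun Q => ⟨fun hQ => ?_, fun ⟨a, h⟩ θ hθ => ?_⟩, fun a ha => ?_⟩
  · have sm0 : el (fun _ => 0) ∈ L.S Ω := K.el_mem fun _ _ => Sm.const 0
    have hQ0 := hQ _ sm0
    have hs := (mem_gEss_iff.1 hQ0).1
    have sq : ∀ a b c d e f (p : TX), Sm (quad 0 a b c d e f) p := fun _ _ _ _ _ _ p =>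
      (quad_contDiff _ _ _ _ _ _ _).contDiffAt
    obtain ⟨eξ, eτ, e0⟩ := K.dx_ζ_of_exp hε hσ hΩ.1 hQ fun p => Sm.const (p := p) 0
    have rel : ∀ a b c, ∀ p ∈ Ω, (Q p).1 * a + (dx (fun q => (Q q).2.1) p * (b + a * p.1 + c * p.2)
        + (Q p).2.1 * c) = 0 := by
      intro a b c p hp
      have h1 := (K.dx_ζ_of_exp hε hσ hΩ.1 hQ (sq 0 0 b 0 a c)).2.2 p hp
      have h2 := e0 p hp
      have c1 : dx (fun _ : TX => (0 : ℝ)) = fun _ => 0 := by ext; exact dx_const _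
      have c2 : dt (fun _ : TX => (0 : ℝ)) = fun _ => 0 := by ext; exact dt_const _
      simp only [c1, c2, mul_zero, add_zero] at h2
      have s1 := sm_τ hs hΩ.1 hp
      have s2 := sm_ξ hs hΩ.1 hp
      have s3 := sm_ζ hs hΩ.1 hp
      rw [dt_quad, dx_quad] at h1
      have q1 := sq 0 0 a 0 0 0 p
      have q2 := sq b a c 0 0 0 p
      rw [dx_add s3.diff ((s1.mul ((Sm.const σ).mul q1)).add (s2.mul ((Sm.const σ).mul q2))).diff,
        dx_add (s1.mul ((Sm.const σ).mul q1)).diff (s2.mul ((Sm.const σ).mul q2)).diff,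
        dx_mul s1.diff ((Sm.const σ).mul q1).diff, dx_mul s2.diff ((Sm.const σ).mul q2).diff,
        dx_const_mul σ q1.diff, dx_const_mul σ q2.diff, dx_quad, dx_quad, h2, eτ p hp] at h1
      simp only [quad, Prod.fst_zero, Prod.snd_zero, sub_zero] at h1
      apply mul_left_cancel₀ hσ0
      linear_combination h1
    have h0 : ∀ q ∈ Ω, (Q q).1 = 0 ∧ (Q q).2.1 = 0 := fun q hq => by
      have r1 := rel 0 1 0 q hq
      have r2 := rel 0 0 1 q hq
      have r3 := rel 1 0 0 q hq
      have hx : dx (fun q => (Q q).2.1) q = 0 := by linarith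
      rw [hx] at r2 r3
      exact ⟨by linarith, by linarith⟩
    rw [K.rep.gEss_eq hΩ.1 sm0] at hQ0
    obtain ⟨a, ha⟩ := gEss_const hΩ (K.rep.mem hΩ.1 sm0) hQ0 h0
    exact ⟨fun _ => a, fun p hp => by rw [hsum, ha p hp]⟩
  · rw [K.rep.gEss_eq hΩ.1 hθ]
    exact const_mem_gEss hΩ.1 fun q hq => (h q hq).trans (hsum a q)
  · obtain ⟨p, hp⟩ := hΩ.2.nonempty
    have h1 := (hsum a p).symm.trans (ha p hp)
    ext i
    rw [Subsingleton.elim i 0]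
    exact congrArg (fun z => z.2.2) h1

theorem kernelEss_ssubset (K : KClass L ε σ el κ) (hε : ε = 1 ∨ ε = -1) (hσ : σ = 1 ∨ σ = -1)
    (hΩ : IsDom Ω) (hC : ∀ p ∈ Ω, Sm C p)
    (hU : U ∈ (Peps (ε * σ)).nonzeroSol Ω fun p => σ * C p) {l : PotCase}
    (hl : IsCanonical Ω C l) : L.kernelEss Ω ⊂ L.gEss Ω (el (drift ε σ U)) := by
  have tC := dt_eq_zero_of_canonical hΩ.1 hC hl
  refine ⟨fun Q hQ => hQ _ (K.el_drift_mem hΩ.1 hU), fun h => ?_⟩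
  have h1 : listedField ε σ U 0 1 0 0 0 0 ∈ L.gEss Ω (el (drift ε σ U)) :=
    K.listed_mem hε hσ hΩ.1 hC hU tC (fun p _ => by ring) fun _ _ => rfl
  obtain ⟨a, ha⟩ := ((K.isBasisOn_kernelEss hε hσ hΩ).1 _).1 (h h1)
  obtain ⟨p, hp⟩ := hΩ.2.nonempty
  have := congrArg Prod.fst (ha p hp)
  simp [listedField, quad, fieldI] at this

end KClass

end KClass

end

section

/-! ### Inequivalence of canonical potentials -/

section Label

variable {ε : ℝ} {Ω Ω' : Set TX} {e : PartialEquiv TX TX} {φ C C' : TX → ℝ} {p : TX}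

theorem dx_eq_of_eqOn {f g : TX → ℝ} (hΩ : IsOpen Ω) (h : ∀ q ∈ Ω, f q = g q) (hp : p ∈ Ω) :
    dx f p = dx g p := dx_congr (eventuallyEq_of_eqOn hΩ hp h)

theorem dt_eq_of_eqOn {f g : TX → ℝ} (hΩ : IsOpen Ω) (h : ∀ q ∈ Ω, f q = g q) (hp : p ∈ Ω) :
    dt f p = dt g p := dt_congr (eventuallyEq_of_eqOn hΩ hp h)

/-- Transformations between heat equations with potentials change the potentials, up to a factor, by
functions that are quadratic in `x`. -/
theorem Inter.third_deriv (hε : ε = 1 ∨ ε = -1) (H : Inter Ω Ω' e φ (Pco ε C) (Pco ε C'))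
    (hp : p ∈ Ω) :
    dx (dx (dx C')) (e p) * dx (xc e) p ^ 5 = dx (dx (dx C)) p := by
  have he := eps_mul_self hε
  have hε0 := eps_ne_zero hε
  have hΩ := H.op
  set T := dt (tc e) with hT
  set s := dx (xc e) with hs
  have sX : ∀ q ∈ Ω, Sm (xc e) q := fun q hq => H.sm_xc hq
  have ss : ∀ q ∈ Ω, Sm s q := fun q hq => (sX q hq).dx
  have sT : ∀ q ∈ Ω, Sm T q := fun q hq => (H.sm_tc hq).dt
  have sφ : ∀ q ∈ Ω, Sm φ q := fun q hq => H.sm hq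
  have sC : ∀ q ∈ Ω, Sm C q := fun q hq => sm_c H.mem hΩ hq
  have sC' : ∀ q ∈ Ω, Sm C' (e q) := fun q hq => H.sm_potential (H.diffeo.mapsTo hq)
  have s0 : ∀ q ∈ Ω, s q ≠ 0 := fun q hq => H.dx_xc_ne hq
  have φ0 : ∀ q ∈ Ω, φ q ≠ 0 := H.ne
  have Ts : ∀ q ∈ Ω, T q = s q * s q := fun q hq => by
    have := H.rel_a hq
    simp only [Pco] at this
    rw [← sq]
    exact mul_left_cancel₀ hε0 this
  have xT : ∀ q ∈ Ω, dx T q = 0 := fun q hq => H.dx_dt_tc hq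
  have xs : ∀ q ∈ Ω, dx s q = 0 := fun q hq => by
    have := xT q hq
    rw [dx_eq_of_eqOn hΩ Ts hq, dx_mul (ss q hq).diff (ss q hq).diff] at this
    have h2 : s q * dx s q = 0 := by linarith
    exact (mul_eq_zero.1 h2).resolve_left (s0 q hq)
  -- The value of φ_x/φ prescribed by `rel_b`. Since X_x does not depend on x, w is affine in x.
  set w : TX → ℝ := fun q => ε / 2 * dt (xc e) q / s q with hw
  have sw : ∀ q ∈ Ω, Sm w q := fun q hq =>
    ((Sm.const _).mul (sX q hq).dt).div (ss q hq) (s0 q hq)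
  have ws : ∀ q ∈ Ω, w q * s q = ε / 2 * dt (xc e) q := fun q hq =>
    div_mul_cancel₀ _ (s0 q hq)
  have wxs : ∀ q ∈ Ω, dx w q * s q = ε / 2 * dt s q := fun q hq => by
    have := dx_eq_of_eqOn hΩ ws hq
    rw [dx_mul (sw q hq).diff (ss q hq).diff, dx_const_mul _ (sX q hq).dt.diff, xs q hq,
      ← dt_dx_comm (sX q hq)] at this
    linarith
  have wxx : ∀ q ∈ Ω, dx (dx w) q = 0 := fun q hq => by
    have := dx_eq_of_eqOn hΩ wxs hq
    rw [dx_mul (sw q hq).dx.diff (ss q hq).diff, dx_const_mul _ (ss q hq).dt.diff, xs q hq,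
      ← dt_dx_comm (ss q hq), dt_eq_of_eqOn (g := fun _ => 0) hΩ xs hq, dt_const, mul_zero,
      mul_zero, zero_add] at this
    exact (mul_eq_zero.1 this).resolve_right (s0 q hq)
  have wtxx : ∀ q ∈ Ω, dx (dx (dt w)) q = 0 := fun q hq => by
    rw [dx_eq_of_eqOn hΩ (fun r hr => (dt_dx_comm (sw r hr)).symm) hq, ← dt_dx_comm (sw q hq).dx,
      dt_eq_of_eqOn (g := fun _ => 0) hΩ wxx hq, dt_const]
  have xφ : ∀ q ∈ Ω, dx φ q = w q * φ q := fun q hq => by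
    have := H.rel_b hq
    simp only [Pco] at this
    rw [← hs, xs q hq] at this
    rw [hw]
    have := s0 q hq
    field_simp
    linear_combination (-ε * ‹0 * φ q * dt (tc e) q = _›) - 2 * dx φ q * s q * he
  have xxφ : ∀ q ∈ Ω, dx (dx φ) q = (dx w q + w q * w q) * φ q := fun q hq => by
    rw [dx_eq_of_eqOn hΩ xφ hq, dx_mul (sw q hq).diff (sφ q hq).diff, xφ q hq]
    ring
  -- By `rel_c`, G - ε(w_x + w²) equals -φ_t/φ, whose x-derivative is -w_t. As w is affine in x, G
  -- is quadratic in x, and its third derivative compares C'_xxx with C_xxx.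
  set G : TX → ℝ := fun q => C' (e q) * T q - C q with hG
  set g : TX → ℝ := fun q => G q - ε * (dx w q + w q * w q) with hg
  have sCe : ∀ q ∈ Ω, Sm (fun q => C' (e q)) q := fun q hq => H.sm_comp hq (sC' q hq)
  have sG : ∀ q ∈ Ω, Sm G q := fun q hq => ((sCe q hq).mul (sT q hq)).sub (sC q hq)
  have sww : ∀ q ∈ Ω, Sm (fun q => dx w q + w q * w q) q := fun q hq =>
    (sw q hq).dx.add ((sw q hq).mul (sw q hq))
  have sg : ∀ q ∈ Ω, Sm g q := fun q hq => (sG q hq).sub ((Sm.const ε).mul (sww q hq))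
  have gφ : ∀ q ∈ Ω, g q * φ q = -1 * dt φ q := fun q hq => by
    have := H.rel_c hq
    simp only [Pco] at this
    rw [xxφ q hq] at this
    simp only [hg, hG]
    linear_combination this
  have xg : ∀ q ∈ Ω, dx g q = -1 * dt w q := fun q hq => by
    have h1 := dx_eq_of_eqOn hΩ gφ hq
    rw [dx_mul (sg q hq).diff (sφ q hq).diff, dx_const_mul _ (sφ q hq).dt.diff,
      ← dt_dx_comm (sφ q hq), dt_eq_of_eqOn hΩ xφ hq, dt_mul (sw q hq).diff (sφ q hq).diff,
      xφ q hq] at h1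
    apply mul_right_cancel₀ (φ0 q hq)
    linear_combination h1 - w q * gφ q hq
  have xG : ∀ q ∈ Ω, dx G q = -1 * dt w q + 2 * ε * (w q * dx w q) := fun q hq => by
    have h1 := xg q hq
    rw [hg, dx_sub (sG q hq).diff ((Sm.const ε).mul (sww q hq)).diff,
      dx_const_mul _ (sww q hq).diff, dx_add (sw q hq).dx.diff ((sw q hq).mul (sw q hq)).diff,
      dx_mul (sw q hq).diff (sw q hq).diff, wxx q hq] at h1
    linear_combination h1
  have xxG : ∀ q ∈ Ω, dx (dx G) q = -1 * dx (dt w) q + 2 * ε * (dx w q * dx w q) :=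
    fun q hq => by
    rw [dx_eq_of_eqOn hΩ xG hq, dx_add ((Sm.const (-1)).mul (sw q hq).dt).diff
      ((Sm.const (2 * ε)).mul ((sw q hq).mul (sw q hq).dx)).diff, dx_const_mul _ (sw q hq).dt.diff,
      dx_const_mul _ ((sw q hq).mul (sw q hq).dx).diff, dx_mul (sw q hq).diff (sw q hq).dx.diff,
      wxx q hq]
    ring
  have xxxG : dx (dx (dx G)) p = 0 := by
    rw [dx_eq_of_eqOn hΩ xxG hp, dx_add ((Sm.const (-1)).mul (sw p hp).dt.dx).diff
      ((Sm.const (2 * ε)).mul ((sw p hp).dx.mul (sw p hp).dx)).diff,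
      dx_const_mul _ (sw p hp).dt.dx.diff, dx_const_mul _ ((sw p hp).dx.mul (sw p hp).dx).diff,
      dx_mul (sw p hp).dx.diff (sw p hp).dx.diff, wxx p hp, wtxx p hp]
    ring
  have pull : ∀ {f : TX → ℝ}, (∀ q ∈ Ω, Sm f (e q)) → ∀ {m : TX → ℝ}, (∀ q ∈ Ω, Sm m q) →
      (∀ q ∈ Ω, dx m q = 0) → ∀ q ∈ Ω, dx (fun q => f (e q) * m q) q =
        dx f (e q) * (m q * s q) := fun hf m sm hm q hq => by
    rw [dx_mul (H.sm_comp hq (hf q hq)).diff (sm q hq).diff, hm q hq, H.dx_comp hq (hf q hq)]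
    ring
  have xm : ∀ {m : TX → ℝ}, (∀ q ∈ Ω, Sm m q) → (∀ q ∈ Ω, dx m q = 0) →
      ∀ q ∈ Ω, dx (fun q => m q * s q) q = 0 := fun sm hm q hq => by
    rw [dx_mul (sm q hq).diff (ss q hq).diff, hm q hq, xs q hq]; ring
  have sT1 : ∀ q ∈ Ω, Sm (fun q => T q * s q) q := fun q hq => (sT q hq).mul (ss q hq)
  have sT2 : ∀ q ∈ Ω, Sm (fun q => T q * s q * s q) q := fun q hq => (sT1 q hq).mul (ss q hq)
  have d1 : ∀ q ∈ Ω, dx G q = dx C' (e q) * (T q * s q) - dx C q := fun q hq => by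
    rw [hG, dx_sub ((sCe q hq).mul (sT q hq)).diff (sC q hq).diff, pull sC' sT xT q hq]
  have d2 : ∀ q ∈ Ω, dx (dx G) q = dx (dx C') (e q) * (T q * s q * s q) - dx (dx C) q :=
    fun q hq => by
    rw [dx_eq_of_eqOn hΩ d1 hq, dx_sub ((H.sm_comp hq (sC' q hq).dx).mul (sT1 q hq)).diff
      (sC q hq).dx.diff, pull (fun r hr => (sC' r hr).dx) sT1 (xm sT xT) q hq]
  have d3 : dx (dx (dx G)) p = dx (dx (dx C')) (e p) * (T p * s p * s p * s p) -
      dx (dx (dx C)) p := by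
    rw [dx_eq_of_eqOn hΩ d2 hp, dx_sub ((H.sm_comp hp (sC' p hp).dx.dx).mul (sT2 p hp)).diff
      (sC p hp).dx.dx.diff, pull (fun r hr => (sC' r hr).dx.dx) sT2 (xm sT1 (xm sT xT)) p hp]
  rw [d3, Ts p hp] at xxxG
  linear_combination xxxG

/-- The relation for C_xxx becomes μ'(X_x x)^5 = μ X^5. As X_xx = 0, its x-derivative is the same
relation with fourth powers; dividing gives X = X_x x and then μ = μ'. -/
theorem invSq_unique (hε : ε = 1 ∨ ε = -1) (H : Inter Ω Ω' e φ (Pco ε C) (Pco ε C'))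
    (hne : Ω.Nonempty) {μ μ' : ℝ} (h : IsCanonical Ω C (.invSq μ))
    (h' : IsCanonical Ω' C' (.invSq μ')) : μ = μ' := by
  obtain ⟨-, -, -, -, d3, -⟩ := derivs_invSq H.op h.2
  obtain ⟨-, -, -, -, d3', -⟩ := derivs_invSq H.op' h'.2
  have xs : ∀ q ∈ Ω, dx (dx (xc e)) q = 0 := fun q hq => by
    have h1 : ∀ r ∈ Ω, dt (tc e) r = dx (xc e) r * dx (xc e) r := fun r hr => by
      have := H.rel_a hr
      simp only [Pco] at this
      rw [← sq]
      exact mul_left_cancel₀ (eps_ne_zero hε) this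
    have := H.dx_dt_tc hq
    rw [dx_eq_of_eqOn H.op h1 hq, dx_mul (H.sm_xc hq).dx.diff (H.sm_xc hq).dx.diff] at this
    have h2 : dx (xc e) q * dx (dx (xc e)) q = 0 := by linarith
    exact (mul_eq_zero.1 h2).resolve_left (H.dx_xc_ne hq)
  have X0 : ∀ q ∈ Ω, xc e q ≠ 0 := fun q hq => (h'.2 _ (H.diffeo.mapsTo hq)).1
  have key : ∀ q ∈ Ω, μ' * (dx (xc e) q * q.2) ^ 5 = μ * xc e q ^ 5 := fun q hq => by
    have h1 := H.third_deriv hε hq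
    rw [d3 q hq, d3' _ (H.diffeo.mapsTo hq)] at h1
    have h2 := X0 q hq
    have h3 := (h.2 q hq).1
    change _ / xc e q ^ 5 * _ = _ at h1
    field_simp at h1
    linear_combination -h1
  obtain ⟨p, hp⟩ := hne
  have hd : ∀ (c y : ℝ), HasDerivAt (fun y : ℝ => c * y ^ 5) (c * (5 * y ^ 4)) y := fun c y => by
    simpa using (hasDerivAt_pow 5 y).const_mul c
  have ssnd : Sm (fun q : TX => q.2) p := contDiffAt_snd
  have sz : Sm (fun q => dx (xc e) q * q.2) p := (H.sm_xc hp).dx.mul ssnd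
  have h1 := dx_eq_of_eqOn H.op key hp
  rw [dx_comp_real (F := fun y => μ' * y ^ 5) (hd μ' _).differentiableAt sz.diff,
    dx_comp_real (F := fun y => μ * y ^ 5) (hd μ _).differentiableAt (H.sm_xc hp).diff,
    (hd _ _).deriv, (hd _ _).deriv, dx_mul (H.sm_xc hp).dx.diff ssnd.diff, xs p hp, dx_snd] at h1
  have h2 := key p hp
  have hs := H.dx_xc_ne hp
  have h3 : μ' * (dx (xc e) p * p.2) ^ 4 = μ * xc e p ^ 4 := by
    apply mul_right_cancel₀ (mul_ne_zero (by norm_num : (5 : ℝ) ≠ 0) hs)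
    linear_combination h1
  have h4 : xc e p = dx (xc e) p * p.2 := by
    apply mul_left_cancel₀ (mul_ne_zero h.1 (pow_ne_zero 4 (X0 p hp)))
    linear_combination -h2 + (dx (xc e) p * p.2) * h3
  rw [← h4] at h3
  exact (mul_right_cancel₀ (pow_ne_zero 4 (X0 p hp)) h3).symm

theorem dx_eq_zero_of_zero (hΩ : IsOpen Ω) (h : IsCanonical Ω C .zero) : ∀ p ∈ Ω, dx C p = 0 :=
  fun p hp => by rw [dx_eq_of_eqOn (g := fun _ => 0) hΩ h hp, dx_const]

/-- Otherwise the second potential admits both ∂_t and 2t∂_t + x∂_x. Their pullbacks to the general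
potential would have constant t-components, whereas the ratio of these components is twice the new
time, which is not constant on an open set. -/
theorem general_unique (hε : ε = 1 ∨ ε = -1) (hΩ : IsDom Ω)
    (H : Inter Ω Ω' e φ (Pco ε C) (Pco ε C')) (h : IsCanonical Ω C .general) {l : PotCase}
    (h' : IsCanonical Ω' C' l) : l = .general := by
  by_contra hl
  have hε0 := eps_ne_zero hε
  have sC' : ∀ p ∈ Ω', Sm C' p := fun p hp => H.sm_potential hp
  have tC' := dt_eq_zero_of_canonical H.op' sC' h'
  have hx : ∀ p ∈ Ω', 2 * C' p + p.2 * dx C' p = 0 := fun p hp => by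
    cases l with
    | general => exact absurd rfl hl
    | invSq μ =>
      rw [(h'.2 p hp).2, (derivs_invSq H.op' h'.2).2.2.1 p hp]
      have := (h'.2 p hp).1
      field_simp
      ring
    | zero => rw [h' p hp, dx_eq_zero_of_zero H.op' h' p hp]; ring
  have S1 := isSymm_poly hε H.op' sC' 0 1 0 0 0 0 tC' fun p hp => by ring
  have S2 := isSymm_poly hε H.op' sC' 0 0 1 0 0 0 tC' fun p hp => by
    linear_combination hx p hp
  obtain ⟨_, c₁, h1⟩ := exists_const_of_general hε hΩ h (H.symm.isSymm hε0 (S1.mem_gEss hε0))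
  obtain ⟨_, c₂, h2⟩ := exists_const_of_general hε hΩ h (H.symm.isSymm hε0 (S2.mem_gEss hε0))
  have key : ∀ q ∈ Ω', q.1 = c₂ / (2 * c₁) := fun q hq => by
    have a1 := (h1 _ (H.diffeo.symm_mapsTo hq)).1
    have a2 := (h2 _ (H.diffeo.symm_mapsTo hq)).1
    have a3 := H.symm.dt_tc_ne hq
    rw [H.symm.pushField_fst hq] at a1 a2
    simp only [quad, Prod.fst_zero, Prod.snd_zero] at a1 a2
    rw [← a1, ← a2]
    field_simp
    ring
  obtain ⟨p, hp⟩ := hΩ.2.nonempty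
  have := dt_eq_of_eqOn H.op' key (H.diffeo.mapsTo hp)
  rw [dt_fst, dt_const] at this
  exact one_ne_zero this

/-- The translation ∂_x of the free equation pulls back to a symmetry with τ = 0. For μ/x² such a
symmetry has ξ = 0, but a diffeomorphism cannot annihilate ∂_x. -/
theorem zero_ne_invSq (hε : ε = 1 ∨ ε = -1) (hΩ : IsDom Ω)
    (H : Inter Ω Ω' e φ (Pco ε C) (Pco ε C')) {μ : ℝ} (h : IsCanonical Ω C (.invSq μ))
    (h' : IsCanonical Ω' C' .zero) : False := by
  have hε0 := eps_ne_zero hε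
  have sC' : ∀ p ∈ Ω', Sm C' p := fun p hp => H.sm_potential hp
  have S := isSymm_poly hε H.op' sC' 0 0 0 0 1 0 (dt_eq_zero_of_canonical H.op' sC' h')
    fun p hp => by rw [h' p hp, dx_eq_zero_of_zero H.op' h' p hp]; ring
  obtain ⟨a₀, a₁, a₂, a₃, h1⟩ := exists_poly_of_invSq hε hΩ h.1 h.2
    (H.symm.isSymm hε0 (S.mem_gEss hε0))
  have push : ∀ p ∈ Ω, (0 : ℝ) = quad 0 a₁ (2 * a₂) 0 (8 * a₃) 0 0 p ∧
      dx (xc e.symm) (e p) = quad 0 0 0 a₂ 0 (4 * a₃) 0 p := fun p hp => by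
    have h2 := h1 p hp
    rw [← H.diffeo.left_inv hp, H.symm.pushField_fst (H.diffeo.mapsTo hp),
      H.diffeo.left_inv hp] at h2
    have h3 := h2.1
    have h4 := h2.2.1
    constructor
    · rw [← h3]; simp [quad]
    · rw [← h4]; simp [quad]
  obtain ⟨-, b2, -, b3, -⟩ := quad_eq_zero hΩ.1 hΩ.2.nonempty fun p hp => (push p hp).1.symm
  obtain ⟨p, hp⟩ := hΩ.2.nonempty
  refine H.symm.dx_xc_ne (H.diffeo.mapsTo hp) ?_
  rw [(push p hp).2, show a₂ = 0 by linarith, show a₃ = 0 by linarith]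
  simp [quad]

/-- Equivalent canonical potentials have the same label. -/
theorem label_unique (hε : ε = 1 ∨ ε = -1) (hΩ : IsDom Ω) (hΩ' : IsDom Ω')
    (H : Inter Ω Ω' e φ (Pco ε C) (Pco ε C')) {l l' : PotCase} (h : IsCanonical Ω C l)
    (h' : IsCanonical Ω' C' l') : l = l' := by
  cases l with
  | general => exact (general_unique hε hΩ H h h').symm
  | invSq μ =>
    cases l' with
    | general => exact general_unique hε hΩ' H.symm h' h
    | invSq μ' => rw [invSq_unique hε H hΩ.2.nonempty h h']
    | zero => exact (zero_ne_invSq hε hΩ H h h').elim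
  | zero =>
    cases l' with
    | general => exact general_unique hε hΩ' H.symm h' h
    | invSq μ' => exact (zero_ne_invSq hε hΩ' H.symm h' h).elim
    | zero => rfl

end Label

end

section

/-! ### The classification -/

theorem const_mem_S {ε : ℝ} {Ω : Set TX} (c : ℝ) : (fun _ => c) ∈ (Peps ε).S Ω :=
  ⟨contDiffOn_const, fun _ _ => trivial⟩

theorem mem_S_Peps {ε : ℝ} {Ω : Set TX} {C : TX → ℝ} (h : ∀ p ∈ Ω, Sm C p) : C ∈ (Peps ε).S Ω :=
  ⟨fun p hp => (h p hp).contDiffWithinAt, fun _ _ => trivial⟩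

theorem S_mono {Θ : Type} [NormedAddCommGroup Θ] [NormedSpace ℝ Θ] {L : EqClass Θ} {Ω N : Set TX}
    {θ : TX → Θ} (h : θ ∈ L.S Ω) (hN : N ⊆ Ω) : θ ∈ L.S N :=
  ⟨h.1.mono hN, fun p hp => h.2 p (hN hp)⟩

theorem inter_of_gEquiv_Peps {ε : ℝ} (hε : ε ≠ 0) {Ω Ω' : Set TX} (hΩ : IsOpen Ω)
    (hΩ' : IsOpen Ω') {C C' : TX → ℝ} (hC : C ∈ (Peps ε).S Ω) (hC' : C' ∈ (Peps ε).S Ω')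
    (h : (Peps ε).GEquiv Ω C Ω' C') : ∃ e φ, Inter Ω Ω' e φ (Pco ε C) (Pco ε C') := by
  obtain ⟨Φ, T, hT, hp⟩ := h
  obtain ⟨e, φ, v, -, hI, -⟩ := (rep_Peps hε).exists_inter hΩ hΩ' ⟨_, hC⟩ hT
  exact ⟨e, φ, hI _ hC _ hC' hp⟩

/-- Essential point symmetries of heat equations with potentials are linear in `u`. -/
theorem inter_of_mem_GEss {ε : ℝ} (hε : ε ≠ 0) {Ω : Set TX} (hΩ : IsOpen Ω) {C : TX → ℝ}
    (hC : C ∈ (Peps ε).S Ω) {Φ : PartialEquiv TXU TXU} (h : Φ ∈ (Peps ε).GEss Ω C) :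
    ∃ e φ, Inter Ω Ω e φ (Pco ε C) (Pco ε C) ∧ ∀ p ∈ Ω, ∀ u, Φ (p, u) = (e p, u / φ p) := by
  obtain ⟨hm, T, hT⟩ := h
  obtain ⟨e₁, φ₁, v₁, hΦ₁, -, -, hv₁⟩ := (rep_Peps hε).exists_inter hΩ hΩ ⟨_, hC⟩ hT
  -- The shift solves the equations with all potentials over Ω; the potentials 0 and 1 alone show
  -- that it vanishes.
  have v0 : ∀ p ∈ Ω, v₁ p = 0 := fun p hp => by
    have h0 := hv₁ _ (const_mem_S 0) p hp
    have h1 := hv₁ _ (const_mem_S 1) p hp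
    simp only [EqClass.lhs, Peps] at h0 h1
    linarith
  have hP : PointMap Ω Ω Φ (Pco ε C) (Pco ε C) := ⟨hΩ, hΩ, hT.1, (rep_Peps hε).mem hΩ hC,
    (rep_Peps hε).mem hΩ hC, ((rep_Peps hε).mapsEq_iff hΩ hΩ hC hC hT.1).1 hm⟩
  obtain ⟨e, φ, v, H, hΦ, -⟩ := hP.exists_inter
  refine ⟨e, φ, H, fun p hp u => ?_⟩
  have h0 := (hΦ p hp 0).symm.trans (hΦ₁ p hp 0)
  have h1 := congrArg Prod.fst h0
  have h2 := congrArg Prod.snd h0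
  simp only [zero_div, zero_add] at h1 h2
  rw [← h1, v0 _ (H.diffeo.mapsTo hp)] at h2
  rw [hΦ p hp u, h2, add_zero]

theorem mem_GEss_of_inter {ε : ℝ} (hε : ε ≠ 0) {Ω : Set TX} {C : TX → ℝ}
    (hC : C ∈ (Peps ε).S Ω) {e : PartialEquiv TX TX} {φ : TX → ℝ}
    (H : Inter Ω Ω e φ (Pco ε C) (Pco ε C)) :
    ∃ Φ ∈ (Peps ε).GEss Ω C, ∀ p ∈ Ω, ∀ u, Φ (p, u) = (e p, u / φ p) := by
  obtain ⟨Φ, T, hT, hΦ, -⟩ := exists_isEquivTransf_Peps hε H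
  exact ⟨Φ, ⟨((rep_Peps hε).mapsEq_iff H.op H.op hC hC hT.1).2 (mapsEq_of_inter H hΦ), T, hT⟩, hΦ⟩

namespace KClass

variable {Θ : Type} [NormedAddCommGroup Θ] [NormedSpace ℝ Θ] {L : EqClass Θ} {ε σ : ℝ}
  {el : (TX → ℝ) → TX → Θ} {κ : (TX → Θ) → Coef} {Ω Ω' : Set TX}

/-- Equivalence transformations of the class have constant multipliers. -/
theorem inter_of_gEquiv (K : KClass L ε σ el κ) (hΩ : IsDom Ω) (hΩ' : IsDom Ω') {θ θ' : TX → Θ}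
    (hθ : θ ∈ L.S Ω) (hθ' : θ' ∈ L.S Ω') (h : L.GEquiv Ω θ Ω' θ') :
    ∃ e, Inter Ω Ω' e (fun _ => 1) (κ θ) (κ θ') := by
  obtain ⟨Φ, T, hT, hp⟩ := h
  obtain ⟨e, φ, v, -, hI, -⟩ := K.rep.exists_inter hΩ.1 hΩ'.1 ⟨_, hθ⟩ hT
  have hI' : ∀ θ ∈ L.S Ω, ∀ θ' ∈ L.S Ω', EqClass.Pushes Ω T θ θ' →
      Inter Ω Ω' e (com σ e φ) (κ θ) (κ θ') := fun θ hθ θ' hθ' hp =>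
    (hI θ hθ θ' hθ' hp).of_co (K.κ_mem hΩ.1 hθ) (K.κ_mem hΩ'.1 hθ')
  set ψ := com σ e φ with hψ
  have H := hI' θ hθ θ' hθ' hp
  -- The same multiplier serves every constant drift b, and the zero-order coefficient remains 0.
  -- Varying b separates ψ_x = 0 from ψ_t = 0.
  have rel : ∀ b : ℝ, ∀ p ∈ Ω, 0 = σ * ε * dx (dx ψ) p + b * dx ψ p - dt ψ p := fun b p hp => by
    have hb : el (fun _ => b) ∈ L.S Ω := K.el_mem fun _ _ => Sm.const b
    obtain ⟨θ₁, hθ₁, hp₁, -⟩ := hT.2.2.2.1 _ hb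
    have := (hI' _ hb θ₁ hθ₁ hp₁).rel_c hp
    rw [K.κ_c, K.κ_el] at this
    simpa using this
  have xψ : ∀ p ∈ Ω, dx ψ p = 0 := fun p hp => by linarith [rel 0 p hp, rel 1 p hp]
  have tψ : ∀ p ∈ Ω, dt ψ p = 0 := fun p hp => by
    have := rel 0 p hp
    rw [dx_eq_of_eqOn (g := fun _ => 0) hΩ.1 xψ hp, dx_const] at this
    linarith
  obtain ⟨p₀, hp₀⟩ := hΩ.2.nonempty
  refine ⟨e, (H.const_mul (inv_ne_zero (H.ne p₀ hp₀))).congr (fun p hp => ?_) (fun _ _ => rfl)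
    fun _ _ => rfl⟩
  rw [eq_of_dt_dx_eq_zero hΩ (fun q hq => H.sm hq) tψ xψ hp hp₀, inv_mul_cancel₀ (H.ne p₀ hp₀)]

/-- An equivalence of gauged equations, conjugated by the gauges, maps one heat equation with
potential to the other. So the labels agree, the selection makes the potentials equal, and the
conjugated map becomes an essential symmetry that sends U to U'. -/
theorem inequivalent (K : KClass L ε σ el κ) (hε : ε = 1 ∨ ε = -1) (hσ : σ = 1 ∨ σ = -1)
    {𝒞 : Set Pot} (h𝒞 : IsPotSelection ε 𝒞) {𝒰 : Pot → Set (TX → ℝ)}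
    (h𝒰 : ∀ P ∈ 𝒞, (Peps (ε * σ)).IsSolSelection P.1 (fun p => σ * P.2 p) (𝒰 P))
    {P : Pot} (hP : P ∈ 𝒞) {U : TX → ℝ} (hU : U ∈ 𝒰 P) {P' : Pot} (hP' : P' ∈ 𝒞) {U' : TX → ℝ}
    (hU' : U' ∈ 𝒰 P') (h : L.GEquiv P.1 (el (drift ε σ U)) P'.1 (el (drift ε σ U'))) :
    P = P' ∧ U = U' := by
  have hε0 := eps_ne_zero hε
  have h0 := mul_ne_zero hε0 (eps_ne_zero hσ)
  obtain ⟨l, hl⟩ := h𝒞.1 P hP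
  obtain ⟨l', hl'⟩ := h𝒞.1 P' hP'
  have sC : ∀ {P : Pot} {l}, P ∈ canonicalPot ε l → ∀ p ∈ P.1, Sm P.2 p := fun h p hp =>
    sm_of_contDiffOn h.2.1.1 h.1.1 hp
  have sU := (h𝒰 P hP).1 hU
  have sU' := (h𝒰 P' hP').1 hU'
  obtain ⟨e, H⟩ := K.inter_of_gEquiv hl.1 hl'.1 (K.el_drift_mem hl.1.1 sU)
    (K.el_drift_mem hl'.1.1 sU') h
  -- The composition of the gauge by U, the given map with multiplier 1, and the inverse gauge by
  -- U'.
  obtain ⟨e₁, he₁, H₁⟩ : ∃ e₁ : PartialEquiv TX TX, (∀ p, e₁ p = e p) ∧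
      Inter P.1 P'.1 e₁ (fun p => U p * (U' (e p))⁻¹) (Pco (ε * σ) fun p => σ * P.2 p)
        (Pco (ε * σ) fun p => σ * P'.2 p) :=
    ⟨((PartialEquiv.ofSet P.1).trans e).trans (PartialEquiv.ofSet P'.1).symm, fun _ => rfl,
      (((K.inter_el h0 hl.1.1 (sC hl) sU).trans H).trans
      (K.inter_el h0 hl'.1.1 (sC hl') sU').symm).congr
        (fun p _ => by rw [mul_one]; rfl) (fun _ _ => rfl) fun _ _ => rfl⟩
  have H₂ : Inter P.1 P'.1 e₁ _ (Pco ε P.2) (Pco ε P'.2) := (H₁.co σ).congr (fun _ _ => rfl)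
    (fun p _ => (co_Pco hσ P.2 p).symm) fun p _ => (co_Pco hσ P'.2 p).symm
  obtain rfl := label_unique hε hl.1 hl'.1 H₂ hl.2.2 hl'.2.2
  obtain ⟨Φ, T, hT, -, hpush⟩ := exists_isEquivTransf_Peps hε0 H₂
  obtain rfl := (h𝒞.2 l).2 P ⟨hP, hl⟩ P' ⟨hP', hl'⟩ ⟨Φ, T, hT, hpush⟩
  refine ⟨rfl, (h𝒰 P hP).2.2 U hU U' hU' ?_⟩
  obtain ⟨Ψ, hΨ, hf⟩ := mem_GEss_of_inter h0
    (mem_S_Peps fun p hp => (Sm.const σ).mul (sC hl p hp)) H₁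
  refine ⟨Ψ, hΨ, fun p hp => ?_⟩
  have h1 := sU.2.1 p hp
  have h2 := sU'.2.1 _ (H.diffeo.mapsTo hp)
  rw [hf p hp, he₁]
  field_simp

/-- A field with τ = ξ = 0 on an open subset would have τ = ξ = 0 on the whole domain and constant
ζ, and hence would lie in the kernel. So every open subset contains a point where the extra symmetry
is nontrivial. -/
theorem exists_ne_zero_of_ssubset (K : KClass L ε σ el κ) (hε : ε = 1 ∨ ε = -1)
    (hσ : σ = 1 ∨ σ = -1) (hΩ : IsDom Ω) {θ : TX → Θ} (hθ : θ ∈ L.S Ω)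
    (h : L.kernelEss Ω ⊂ L.gEss Ω θ) {W : Set TX} (hW : W ⊆ Ω) (hWo : IsOpen W)
    (hne : W.Nonempty) : ∃ Q ∈ Lin.gEss Ω (co σ (κ θ)), ∃ p ∈ W,
      ¬ ((Q p).1 = 0 ∧ (Q p).2.1 = 0) := by
  obtain ⟨Q, hQ, hQk⟩ := Set.exists_of_ssubset h
  rw [K.rep.gEss_eq hΩ.1 hθ] at hQ
  refine ⟨Q, hQ, ?_⟩
  by_contra hcon
  push Not at hcon
  obtain ⟨p, hp⟩ := hne
  have hk := K.rep.mem hΩ.1 hθ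
  have hz := gEss_unique hΩ hk hQ (hW hp) (by
    filter_upwards [hWo.mem_nhds hp] with q hq using hcon q hq)
  obtain ⟨a, ha⟩ := gEss_const hΩ hk hQ hz
  exact hQk (((K.isBasisOn_kernelEss hε hσ hΩ).1 Q).2 ⟨fun _ => a, fun q hq => by
    rw [ha q hq]; simp [fieldI]⟩)

/-- The extra symmetry reduces the equation, or its adjoint, to a heat equation with a selected
canonical potential. Dualizing back gives a map of the underlying Kolmogorov equation, whose
solution 1 is carried to a nonvanishing solution; replacing that by the selected U costs an
essential symmetry. -/
theorem complete (K : KClass L ε σ el κ) (hε : ε = 1 ∨ ε = -1) (hσ : σ = 1 ∨ σ = -1)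
    {𝒞 : Set Pot} (h𝒞 : IsPotSelection ε 𝒞) {𝒰 : Pot → Set (TX → ℝ)}
    (h𝒰 : ∀ P ∈ 𝒞, (Peps (ε * σ)).IsSolSelection P.1 (fun p => σ * P.2 p) (𝒰 P))
    (hΩ : IsDom Ω) {θ : TX → Θ} (hθ : θ ∈ L.S Ω) (h : L.kernelEss Ω ⊂ L.gEss Ω θ)
    {W : Set TX} (hW : W ⊆ Ω) (hWo : IsOpen W) (hne : W.Nonempty) :
    ∃ Ω' ⊆ W, IsDom Ω' ∧ ∃ P ∈ 𝒞, ∃ U ∈ 𝒰 P, L.GEquiv Ω' θ P.1 (el (drift ε σ U)) := by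
  have hε0 := eps_ne_zero hε
  have h0 := mul_ne_zero hε0 (eps_ne_zero hσ)
  obtain ⟨Q, hQ, p, hp, hQp⟩ := K.exists_ne_zero_of_ssubset hε hσ hΩ hθ h hW hWo hne
  obtain ⟨N, N', e, φ, C, l, hN, hNW, hN', H, hl⟩ := reduces_of_mem_gEss hε hWo
    (K.rep.mem hWo (S_mono hθ hW)) (gEss_mono hQ hW) hp hQp
  have hCS : C ∈ (Peps ε).S N' := mem_S_Peps fun q hq => H.sm_potential hq
  obtain ⟨P, ⟨hP, hPl⟩, hPC⟩ := (h𝒞.2 l).1 (N', C) ⟨hN', hCS, hl⟩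
  obtain ⟨e₁, φ₁, H₁⟩ := inter_of_gEquiv_Peps hε0 hN'.1 hPl.1.1 hCS hPl.2.1 hPC
  have sC : ∀ p ∈ P.1, Sm P.2 p := fun p hp => sm_of_contDiffOn hPl.2.1.1 hPl.1.1 hp
  have sσC : ∀ p ∈ P.1, Sm (fun p => σ * P.2 p) p := fun p hp => (Sm.const σ).mul (sC p hp)
  have H₂ := ((H.trans H₁).congr (k₁' := co σ (Pco (ε * σ) fun p => σ * P.2 p)) (fun _ _ => rfl)
    (fun _ _ => rfl) fun q _ => co_Pco hσ P.2 q).of_co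
    (K.κ_mem hN.1 (S_mono hθ (hNW.trans hW))) (Pco_mem h0 sσC)
  set e₂ := e.trans e₁
  set χ := com σ e₂ fun q => φ q * φ₁ (e q)
  -- The image of the constant solution 1, which exists because Kolmogorov equations have no
  -- zero-order term.
  have hU₁ : (fun q => (χ (e₂.symm q))⁻¹) ∈ (Peps (ε * σ)).nonzeroSol P.1 fun p => σ * P.2 p := by
    refine ⟨H₂.symm.smooth, H₂.symm.ne, fun q hq => ?_⟩
    have := H₂.symm.rel_c hq
    rw [K.κ_c] at this
    simp only [Pco] at this
    simp only [EqClass.lhs, Peps]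
    linarith
  obtain ⟨U, hU, Φ, hΦ, hΦU⟩ := (h𝒰 P hP).2.1 _ hU₁
  have sU := (h𝒰 P hP).1 hU
  obtain ⟨e₃, φ₃, H₃, hf⟩ := inter_of_mem_GEss h0 hPl.1.1 (mem_S_Peps sσC) hΦ
  -- The composition of the reduction, the essential symmetry and the gauge by U carries 1 to 1; its
  -- multiplier is therefore 1, which is what `realize` requires.
  refine ⟨N, hNW, hN, P, hP, U, hU, K.realize (S_mono hθ (hNW.trans hW))
    (K.el_drift_mem hPl.1.1 sU) (((H₂.trans H₃).trans (K.inter_el h0 hPl.1.1 sC sU)).congr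
      (fun q hq => ?_) (fun _ _ => rfl) fun _ _ => rfl)⟩
  have h1 := hΦU _ (H₂.diffeo.mapsTo hq)
  rw [hf _ (H₂.diffeo.mapsTo hq)] at h1
  simp only [H₂.diffeo.left_inv hq] at h1
  change 1 = χ q * φ₃ (e₂ q) * U (e₃ (e₂ q))
  rw [← h1]
  have := H₂.ne q hq
  have := H₃.ne _ (H₂.diffeo.mapsTo hq)
  field_simp

theorem groupClassification (K : KClass L ε σ el κ) (hε : ε = 1 ∨ ε = -1)
    (hσ : σ = 1 ∨ σ = -1) : GroupClassification L ε σ el where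
  kernel _ hΩ := K.isBasisOn_kernelEss hε hσ hΩ
  bases _ _ hP _ hU :=
    have hC := fun _ hp => sm_of_contDiffOn hP.2.1.1 hP.1.1 hp
    ⟨K.el_drift_mem hP.1.1 hU, K.kernelEss_ssubset hε hσ hP.1 hC hU hP.2.2,
      K.hasListedBasis hε hσ hP.1 hC hU hP.2.2⟩
  inequivalent _ h𝒞 _ h𝒰 _ hP _ hU _ hP' _ hU' h :=
    K.inequivalent hε hσ h𝒞 h𝒰 hP hU hP' hU' h
  complete _ h𝒞 _ h𝒰 _ hΩ _ hθ h _ hW hWo hne := K.complete hε hσ h𝒞 h𝒰 hΩ hθ h hW hWo hne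

end KClass

end

end

end KolmogorovFokkerPlanck

theorem mainTheorem1 (ε : ℝ) (hε : ε = 1 ∨ ε = -1) :
    KolmogorovFokkerPlanck.GroupClassification KolmogorovFokkerPlanck.Kbar ε 1 (fun B p => (ε, B p)) ∧
    KolmogorovFokkerPlanck.GroupClassification (KolmogorovFokkerPlanck.Keps ε) ε 1 (fun B => B) ∧
    KolmogorovFokkerPlanck.GroupClassification KolmogorovFokkerPlanck.Fbar ε (-1) (fun B p => (ε, B p)) ∧
    KolmogorovFokkerPlanck.GroupClassification (KolmogorovFokkerPlanck.Feps ε) ε (-1) (fun B => B) := by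
  have h0 := KolmogorovFokkerPlanck.eps_ne_zero hε
  exact ⟨(KolmogorovFokkerPlanck.kClass_Kbar h0).groupClassification hε (Or.inl rfl),
    (KolmogorovFokkerPlanck.kClass_Keps h0).groupClassification hε (Or.inl rfl),
    (KolmogorovFokkerPlanck.kClass_Fbar h0).groupClassification hε (Or.inr rfl),
    (KolmogorovFokkerPlanck.kClass_Feps h0).groupClassification hε (Or.inr rfl)⟩
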